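/- For real $a$, $k>0$, $0<\varepsilon<1/4$ and $m=\pm\sqrt\varepsilon$ consider the planar piecewise linear system \[ x'=y-f(x),\qquad y'=\varepsilon(a-x), \] \[ f(x)=\begin{cases} x+1-k(\sqrt\varepsilon-1)-m(\sqrt\varepsilon+a), & x\le -1,\\ -k(x+\sqrt\varepsilon)-m(\sqrt\varepsilon+a), & -1\le x\le-\sqrt\varepsilon,\\ m(x-a), & |x|\le\sqrt\varepsilon,\\ x-\sqrt\varepsilon+m(\sqrt\varepsilon-a), & x\ge\sqrt\varepsilon. \end{cases} \] A limit cycle (isolated periodic orbit) has width $x_0$ if $(x_0,f(x_0))$ is its unique point on the graph of $f$ with abscissa less than $a$. If $k^2>4\varepsilon$, put $\lambda_L=\frac{k-\sqrt{k^2-4\varepsilon}}2$, $\lambda_{LL}=\frac{-1+\sqrt{1-4\varepsilon}}2$ and \[ x_r=-(1+k)+k\sqrt\varepsilon-\lambda_L(\sqrt\varepsilon+a),\quad x_s=-\sqrt\varepsilon-\lambda_L(\sqrt\varepsilon+a),\quad x_u=-1+\lambda_{LL}(1+a). \] A canard limit cycle is a limit cycle whose width lies in $(x_r,x_s)$; it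 is headless if its width is greater than $-1$, and has a head if its width is less than $-1$. When there is exactly one $a\in(-\sqrt\varepsilon,\sqrt\varepsilon)$ for which the system has a canard limit cycle of width $x_0$, this value is denoted by $\hat a(k,\varepsilon,x_0;m)$. A canard limit cycle that exists for the parameter value $a=a_0$ is a saddle-node canard cycle if it meets the half-line $\{(\sqrt\varepsilon,y): y<f(\sqrt\varepsilon)\}$ at a point $(\sqrt\varepsilon,y_0)$ such that the first return map $\Pi(y,a)$ to this half-line is defined near $(y_0,a_0)$, is $C^2$ at $(y_0,a_0)$, and satisfies there \[ \Pi=y_0,\qquad \frac{\partial\Pi}{\partial y}=1,\qquad \frac{\partial^2\Pi}{\partial y^2}\neq0,\qquad \frac{\partial\Pi}{\partial a}\neq0. \] **Theorem.** Let $m=-\sqrt\varepsilon$ or $m=\sqrt\varepsilon$. For each $x_0\in(-\infty,-1)\cup(-1,0)$ there exist $\varepsilon_0\in(0,1/4]$ and a function $k_{x_0}:(0,\varepsilon_0)\to(0,\infty)$ such that for every $\varepsilon\in(0,\varepsilon_0)$ the following hold with $k=k_{x_0}(\varepsilon)$: $k^2>4\varepsilon$; the value $a=\hat a(k,\varepsilon,x_0;m)$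 is defined (that is, there is exactly one such $a$); for these parameters $x_0\in(x_r,x_u)\cup(-1,x_s)$; and the system with these parameters has a saddle-node canard cycle $\Gamma_{x_0}$ of width $x_0$. -/

import Mathlib

open Real Set Filter Topology

namespace PWLCanard

/-- The four-piece piecewise linear function whose graph is the `x`-nullcline. The first two
formulas agree at `x = -1`, and so do their neighbours at `x = -√ε` and `x = √ε`. -/
noncomputable def f (a k m ε x : ℝ) : ℝ :=
  if x ≤ -1 then x + 1 - k * (√ε - 1) - m * (√ε + a)
  else if x ≤ -√ε then -k * (x + √ε) - m * (√ε + a)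
  else if x ≤ √ε then m * (x - a)
  else x - √ε + m * (√ε - a)

/-- The vector field of the system `x' = y - f(x)`, `y' = ε (a - x)`. -/
noncomputable def field (a k m ε : ℝ) (p : ℝ × ℝ) : ℝ × ℝ :=
  (p.2 - f a k m ε p.1, ε * (a - p.1))

/-- A global solution of the system. -/
def IsSolution (a k m ε : ℝ) (γ : ℝ → ℝ × ℝ) : Prop :=
  ∀ t : ℝ, HasDerivAt γ (field a k m ε (γ t)) t

/-- `Γ` is a periodic orbit: the trace of a non-constant periodic solution. -/
def IsPeriodicOrbit (a k m ε : ℝ) (Γ : Set (ℝ × ℝ)) : Prop :=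
  ∃ (γ : ℝ → ℝ × ℝ) (T : ℝ), IsSolution a k m ε γ ∧ 0 < T ∧ (∀ t, γ (t + T) = γ t) ∧
    (∃ t, γ t ≠ γ 0) ∧ Γ = range γ

/-- `Γ` is a limit cycle: a periodic orbit with a neighbourhood that contains no other one. -/
def IsLimitCycle (a k m ε : ℝ) (Γ : Set (ℝ × ℝ)) : Prop :=
  IsPeriodicOrbit a k m ε Γ ∧
    ∃ U : Set (ℝ × ℝ), IsOpen U ∧ Γ ⊆ U ∧
      ∀ Γ' : Set (ℝ × ℝ), IsPeriodicOrbit a k m ε Γ' → Γ' ⊆ U → Γ' = Γ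

/-- `Γ` has width `x₀`: the point `(x₀, f x₀)` is the only point of `Γ` on the `x`-nullcline to
the left of the line `x = a`. -/
def HasWidth (a k m ε : ℝ) (Γ : Set (ℝ × ℝ)) (x₀ : ℝ) : Prop :=
  {p : ℝ × ℝ | p ∈ Γ ∧ p.2 = f a k m ε p.1 ∧ p.1 < a} = {(x₀, f a k m ε x₀)}

/-- The slow eigenvalue in the band `-1 ≤ x ≤ -√ε`. -/
noncomputable def lamL (k ε : ℝ) : ℝ := (k - √(k ^ 2 - 4 * ε)) / 2

/-- The slow eigenvalue in the half-plane `x ≤ -1`. -/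
noncomputable def lamLL (ε : ℝ) : ℝ := (-1 + √(1 - 4 * ε)) / 2

/-- Widths below `xr` are those of relaxation oscillations. -/
noncomputable def xr (a k ε : ℝ) : ℝ := -(1 + k) + k * √ε - lamL k ε * (√ε + a)

/-- Widths above `xs` are those of cycles governed by the Hopf-like bifurcation. -/
noncomputable def xs (a k ε : ℝ) : ℝ := -√ε - lamL k ε * (√ε + a)

/-- Widths in `(xu, -1]` are close to the width `-1` of the transitory canard. -/
noncomputable def xu (a ε : ℝ) : ℝ := -1 + lamLL ε * (1 + a)

/-- `Γ` is a canard limit cycle of width `x₀` (headless if `x₀ > -1`, with head if `x₀ < -1`). -/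
def IsCanardCycle (a k m ε x₀ : ℝ) (Γ : Set (ℝ × ℝ)) : Prop :=
  IsLimitCycle a k m ε Γ ∧ HasWidth a k m ε Γ x₀ ∧ x₀ ∈ Ioo (xr a k ε) (xs a k ε)

/-- The half-line `{(√ε, y) : y < f(√ε)}`, where the flow crosses the line `x = √ε` transversally
from right to left. -/
def crossSection (a k m ε : ℝ) : Set (ℝ × ℝ) :=
  {p | p.1 = √ε ∧ p.2 < f a k m ε √ε}

/-- For `(y, a)` near `(y₀, a₀)`, the number `P y a` is the second coordinate of the point where
the orbit of `(√ε, y)` in the system with parameter `a` returns for the first time to the cross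
section. -/
def IsPoincareMap (k m ε y₀ a₀ : ℝ) (P : ℝ → ℝ → ℝ) : Prop :=
  ∀ᶠ q : ℝ × ℝ in 𝓝 (y₀, a₀), (√ε, q.1) ∈ crossSection q.2 k m ε ∧
    ∃ (γ : ℝ → ℝ × ℝ) (τ : ℝ), IsSolution q.2 k m ε γ ∧ γ 0 = (√ε, q.1) ∧ 0 < τ ∧
      γ τ = (√ε, P q.1 q.2) ∧ γ τ ∈ crossSection q.2 k m ε ∧
      ∀ t ∈ Ioo 0 τ, γ t ∉ crossSection q.2 k m ε

/-- `Γ` is a saddle-node cycle at `a = a₀`: at its point `(√ε, y₀)` the Poincaré map is `C²` in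
`(y, a)`, has a non-hyperbolic fixed point, and satisfies the two non-degeneracy conditions of a
saddle-node bifurcation unfolded by `a`. -/
def IsSaddleNode (a₀ k m ε : ℝ) (Γ : Set (ℝ × ℝ)) : Prop :=
  ∃ (y₀ : ℝ) (P : ℝ → ℝ → ℝ), (√ε, y₀) ∈ Γ ∧ IsPoincareMap k m ε y₀ a₀ P ∧
    ContDiffAt ℝ 2 (fun q : ℝ × ℝ => P q.1 q.2) (y₀, a₀) ∧
    P y₀ a₀ = y₀ ∧
    deriv (fun y => P y a₀) y₀ = 1 ∧
    iteratedDeriv 2 (fun y => P y a₀) y₀ ≠ 0 ∧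
    deriv (fun a => P y₀ a) a₀ ≠ 0

/-- The relation `a = â(k, ε, x₀; m)`: `a` is the only value in `(-√ε, √ε)` for which the system
has a canard limit cycle of width `x₀`. -/
def IsHatA (k ε x₀ m a : ℝ) : Prop :=
  (|a| < √ε ∧ ∃ Γ, IsCanardCycle a k m ε x₀ Γ) ∧
    ∀ a' : ℝ, |a'| < √ε → (∃ Γ, IsCanardCycle a' k m ε x₀ Γ) → a' = a

end PWLCanard

/-! ### Global solutions, uniqueness and continuous dependence for the Lipschitz field. -/

namespace PWLCanard

section GlobalExistence

variable {E : Type*} [NormedAddCommGroup E] [NormedSpace ℝ E]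

/-! Put `X = x - a` and `V = x'`. In a zone where `f` has slope `κ` the system is the linear
oscillator `X'' + κ X' + ε X = 0`. For fixed `a`, a passage of duration `T` between two vertical
lines satisfies `W dW = exp (-κ T) V dV` for its entry velocity `V` and exit velocity `W`.
Multiplied around a closed orbit, these relations show that the return map has derivative `exp
(-J)`, where `J` is the integral of `f'` along the orbit. A saddle-node cycle of width `x₀` thus
amounts to two equations, closing and `J = 0`, for the two unknowns `a` and `k`, together with two
inequalities.

Closing. The orbit through `(x₀, f x₀)` is followed forwards and backwards to the line `x = a`, and
the defect `D k a` compares the two speeds found there. The stay in the right zone forwards, and in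
the middle zone backwards, is a contraction during a time of order `1/ε`. The orbit therefore enters
and leaves the lower half of the central zone along slow eigendirections, up to exponentially small
errors, and the scaled slopes `r₁`, `r₂` hardly depend on `a`. So `D` behaves like a decreasing
affine function of `a`, with opposite signs near `±√ε` (`strictAntiOn_D`, `D_pos`, `D_neg`), and has
exactly one zero for each `k`. This also gives uniqueness of `â`, since every limit cycle of width
`x₀` makes `D` vanish (`Shoot.closes`).

The equation `J = 0`. The first integrals of the nodes express passage times as logarithms. On `D =
0` this yields `ε J ≈ log q - log c - k² (log G - log k - log c - Q) + ε J₀` (`ε_J_approx`), where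
`c = √ε - a`, `q` is the upward speed at `x = -√ε`, `G` measures the distance from the fast
eigenline at the start of the backward middle passage, and `Q` is the logarithm of the ratio of the
half-widths of the lower arc. Without head, `k = exp (κ / (2Λ))` with `Λ = -log √ε` gives `ε J ≈ Q -
κ`, so the sign changes between `κ = Q - 1` and `κ = Q + 1`. With head, let `b = -1 - x₀`. At `k = b
+ 2` the term `(k² - 1) log √ε` makes `J` negative. For `k` slightly above `b` the gap `G ≈ k - b`
is so small that `J` is positive. The intermediate value theorem along the curve `D = 0` gives the
required `k` (`exists_common_zero`).

Nondegeneracy. The `a`-derivative of the return map is decided by the last passage, through the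
right zone, where everything earlier is damped by `exp (-T₂)` and the remaining term `ε c - w` is
strictly negative. The second derivative is minus the derivative `B` of `J` with respect to the
initial velocity. Without head, the middle and right zones contribute to `B` with opposite signs and
with ratio close to `k²`. The choice of `κ` keeps `log k` far enough from zero for the difference to
beat all errors. With head, the dominant contributions all have the same sign. Finally, near a fixed
point of saddle-node type every other point moves in the same direction, so no other periodic orbit
stays nearby and the orbit is a limit cycle (`Shoot.isLimitCycle`). -/

theorem eqOn_Ioo_of_lipschitz {v : E → E} {K : NNReal} (hv : LipschitzWith K v)
    {α β : ℝ → E} {A B t₀ : ℝ} (ht : t₀ ∈ Ioo A B)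
    (hα : ∀ t ∈ Ioo A B, HasDerivAt α (v (α t)) t)
    (hβ : ∀ t ∈ Ioo A B, HasDerivAt β (v (β t)) t) (h : α t₀ = β t₀) :
    EqOn α β (Ioo A B) :=
  ODE_solution_unique_of_mem_Ioo (v := fun _ => v) (s := fun _ => univ) (K := K)
    (fun _ _ => hv.lipschitzOnWith) ht
    (fun t ht => ⟨hα t ht, mem_univ _⟩) (fun t ht => ⟨hβ t ht, mem_univ _⟩) h

/-- On the ball of radius `R = ‖v x‖ + 1` around `x` the field is bounded by `(K + 1) R`, so the
Picard–Lindelöf time `R / ((K + 1) R)` does not depend on `x`. This uniformity is what allows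
continuation for all time. -/
theorem exists_uniform_local_solution [CompleteSpace E] {v : E → E} {K : NNReal} (hv : LipschitzWith K v) :
    ∃ δ : ℝ, 0 < δ ∧ ∀ x : E, ∃ α : ℝ → E, α 0 = x ∧
      ∀ t ∈ Ioo (-δ) δ, HasDerivAt α (v (α t)) t := by
  refine ⟨1 / (K + 1), by positivity, fun x => ?_⟩
  set δ : ℝ := 1 / (K + 1) with hδ
  have hδ0 : 0 < δ := by positivity
  set R : NNReal := ‖v x‖₊ + 1 with hR
  have hp : IsPicardLindelof (fun _ : ℝ => v) (⟨0, by constructor <;> linarith⟩ : Icc (-δ) δ)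
      x R 0 ((K + 1) * R) K := by
    refine IsPicardLindelof.of_time_independent ?_ hv.lipschitzOnWith ?_
    · intro y hy
      have h1 : ‖v y - v x‖ ≤ K * R := by
        rw [← dist_eq_norm]
        refine (hv.dist_le_mul y x).trans ?_
        have : dist y x ≤ R := hy
        gcongr
      have h2 : ‖v y‖ ≤ ‖v y - v x‖ + ‖v x‖ := by simpa using norm_add_le (v y - v x) (v x)
      push_cast [hR] at h1 ⊢
      nlinarith [norm_nonneg (v x)]
    · simp only [sub_zero, zero_sub, neg_neg, max_self, NNReal.coe_zero]
      rw [hδ]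
      push_cast
      have : (K : ℝ) + 1 ≠ 0 := by positivity
      field_simp
      exact le_refl _
  obtain ⟨α, h0, hα⟩ := hp.exists_eq_forall_mem_Icc_hasDerivWithinAt₀
  exact ⟨α, h0, fun t ht => (hα t (Ioo_subset_Icc_self ht)).hasDerivAt (Icc_mem_nhds ht.1 ht.2)⟩

/-- Solutions restarted at the times `T / 2` and `-(T / 2)` overlap the original one, agree with it
by uniqueness, and reach half an interval further. -/
theorem extend_solution {v : E → E} {K : NNReal} (hv : LipschitzWith K v) {T : ℝ} (hT : 0 < T)
    (h : ∀ x : E, ∃ α : ℝ → E, α 0 = x ∧ ∀ t ∈ Ioo (-T) T, HasDerivAt α (v (α t)) t) (x : E) :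
    ∃ α : ℝ → E, α 0 = x ∧ ∀ t ∈ Ioo (-(3 / 2 * T)) (3 / 2 * T), HasDerivAt α (v (α t)) t := by
  obtain ⟨γ, hγ0, hγ⟩ := h x
  obtain ⟨α, hα0, hα⟩ := h (γ (T / 2))
  obtain ⟨β, hβ0, hβ⟩ := h (γ (-(T / 2)))
  have hα' : ∀ t ∈ Ioo (-(T / 2)) (3 / 2 * T),
      HasDerivAt (fun t => α (t - T / 2)) (v (α (t - T / 2))) t := fun t ht =>
    (hα (t - T / 2) ⟨by linarith [ht.1], by linarith [ht.2]⟩).comp_sub_const t (T / 2)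
  have hβ' : ∀ t ∈ Ioo (-(3 / 2 * T)) (T / 2),
      HasDerivAt (fun t => β (t + T / 2)) (v (β (t + T / 2))) t := fun t ht =>
    (hβ (t + T / 2) ⟨by linarith [ht.1], by linarith [ht.2]⟩).comp_add_const t (T / 2)
  have e1 : EqOn (fun t => α (t - T / 2)) γ (Ioo (-(T / 2)) T) :=
    eqOn_Ioo_of_lipschitz hv (t₀ := T / 2) ⟨by linarith, by linarith⟩
      (fun t ht => hα' t ⟨ht.1, by linarith [ht.2]⟩)
      (fun t ht => hγ t ⟨by linarith [ht.1], ht.2⟩) (by simpa using hα0)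
  have e2 : EqOn (fun t => β (t + T / 2)) γ (Ioo (-T) (T / 2)) :=
    eqOn_Ioo_of_lipschitz hv (t₀ := -(T / 2)) ⟨by linarith, by linarith⟩
      (fun t ht => hβ' t ⟨by linarith [ht.1], by linarith [ht.2]⟩)
      (fun t ht => hγ t ⟨by linarith [ht.1], by linarith [ht.2]⟩) (by simpa using hβ0)
  set δ : ℝ → E := fun t => if T / 2 ≤ t then α (t - T / 2) else
    if t ≤ -(T / 2) then β (t + T / 2) else γ t with hδ
  have d1 : ∀ t ∈ Ioo (-T) T, δ t = γ t := by
    intro t ht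
    simp only [hδ]
    split_ifs with h1 h2
    · exact e1 ⟨by linarith, ht.2⟩
    · exact e2 ⟨ht.1, by linarith⟩
    · rfl
  refine ⟨δ, by rw [d1 0 ⟨by linarith, hT⟩, hγ0], fun t ht => ?_⟩
  have key : ∀ {η : ℝ → E} {A B : ℝ}, t ∈ Ioo A B → (∀ u ∈ Ioo A B, δ u = η u) →
      HasDerivAt η (v (η t)) t → HasDerivAt δ (v (δ t)) t := by
    intro η A B hm heq hd
    rw [heq t hm]
    exact hd.congr_of_eventuallyEq
      (Filter.eventuallyEq_of_mem (Ioo_mem_nhds hm.1 hm.2) heq)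
  rcases lt_or_ge t T with h1 | h1
  · rcases lt_or_ge (-T) t with h2 | h2
    · exact key ⟨h2, h1⟩ d1 (hγ t ⟨h2, h1⟩)
    · refine key (A := -(3 / 2 * T)) (B := -(T / 2)) ⟨ht.1, by linarith⟩ (fun u hu => ?_)
        (hβ' t ⟨ht.1, by linarith⟩)
      simp only [hδ]
      rw [if_neg (by linarith [hu.2]), if_pos hu.2.le]
  · refine key (A := T / 2) (B := 3 / 2 * T) ⟨by linarith, ht.2⟩ (fun u hu => ?_)
      (hα' t ⟨by linarith, ht.2⟩)
    simp only [hδ]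
    rw [if_pos hu.1.le]

/-- A Lipschitz vector field on a Banach space is complete. -/
theorem exists_global_solution [CompleteSpace E] {v : E → E} {K : NNReal} (hv : LipschitzWith K v) (x : E) :
    ∃ α : ℝ → E, α 0 = x ∧ ∀ t, HasDerivAt α (v (α t)) t := by
  obtain ⟨δ, hδ, h0⟩ := exists_uniform_local_solution hv
  have hpos : ∀ n : ℕ, 0 < (3 / 2 : ℝ) ^ n * δ := fun n => by positivity
  have hn : ∀ n : ℕ, ∀ x : E, ∃ α : ℝ → E, α 0 = x ∧
      ∀ t ∈ Ioo (-((3 / 2 : ℝ) ^ n * δ)) ((3 / 2) ^ n * δ), HasDerivAt α (v (α t)) t := by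
    intro n
    induction n with
    | zero => simpa using h0
    | succ n ih =>
      intro x
      have := extend_solution hv (hpos n) ih x
      rwa [← mul_assoc, ← pow_succ'] at this
  choose α hα0 hα using fun n => hn n x
  have hex : ∀ t : ℝ, ∃ n : ℕ, |t| < (3 / 2 : ℝ) ^ n * δ := fun t => by
    obtain ⟨n, hn⟩ := pow_unbounded_of_one_lt (|t| / δ) (by norm_num : (1 : ℝ) < 3 / 2)
    exact ⟨n, by rwa [div_lt_iff₀ hδ] at hn⟩
  choose N hN using hex
  have hag : ∀ n k : ℕ, ∀ t : ℝ, |t| < (3 / 2 : ℝ) ^ n * δ → |t| < (3 / 2 : ℝ) ^ k * δ →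
      α n t = α k t := by
    intro n k t h1 h2
    set A := min ((3 / 2 : ℝ) ^ n * δ) ((3 / 2 : ℝ) ^ k * δ) with hA
    have hA0 : 0 < A := lt_min (hpos n) (hpos k)
    have hAn : A ≤ (3 / 2 : ℝ) ^ n * δ := min_le_left _ _
    have hAk : A ≤ (3 / 2 : ℝ) ^ k * δ := min_le_right _ _
    exact eqOn_Ioo_of_lipschitz hv (A := -A) (B := A) (t₀ := 0) ⟨by linarith, hA0⟩
      (fun u hu => hα n u ⟨by linarith [hu.1], by linarith [hu.2]⟩)
      (fun u hu => hα k u ⟨by linarith [hu.1], by linarith [hu.2]⟩)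
      (by rw [hα0, hα0]) (abs_lt.1 (lt_min h1 h2))
  refine ⟨fun t => α (N t) t, hα0 _, fun t => ?_⟩
  have ht := abs_lt.1 (hN t)
  refine (hα (N t) t ht).congr_of_eventuallyEq ?_
  filter_upwards [Ioo_mem_nhds ht.1 ht.2] with u hu
  exact hag _ _ u (hN u) (abs_lt.2 hu)

end GlobalExistence

theorem IsSolution.comp_add {a k m ε : ℝ} {γ : ℝ → ℝ × ℝ} (h : IsSolution a k m ε γ) (c : ℝ) :
    IsSolution a k m ε (fun t => γ (t + c)) := fun t => (h (t + c)).comp_add_const t c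

/-- Up to constants, `f` is a sum of clamped coordinates, one for each zone, weighted by the slopes.
In this form the Lipschitz bound needs no case distinction. -/
theorem f_eq_max {a k m ε : ℝ} (hk : 0 ≤ √ε) (hε : √ε ≤ 1) (x : ℝ) :
    f a k m ε x = min x (-1) - k * max (-1) (min x (-√ε)) + m * max (-√ε) (min x √ε)
      + max x √ε - √ε + 1 - k * √ε - m * a := by
  unfold f
  split_ifs with h1 h2 h3
  · rw [min_eq_left h1, min_eq_left (by linarith), max_eq_left h1, min_eq_left (by linarith),
      max_eq_left (by linarith), max_eq_right (by linarith)]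
    ring
  · rw [min_eq_right (by linarith), min_eq_left h2, max_eq_right (by linarith),
      min_eq_left (by linarith), max_eq_left (by linarith), max_eq_right (by linarith)]
    ring
  · rw [min_eq_right (by linarith), min_eq_right (by linarith), max_eq_right (by linarith),
      min_eq_left h3, max_eq_right (by linarith), max_eq_right h3]
    ring
  · rw [min_eq_right (by linarith), min_eq_right (by linarith), max_eq_right (by linarith),
      min_eq_right (by linarith), max_eq_right (by linarith), max_eq_left (by linarith)]
    ring

theorem exists_lipschitz_f (a k m : ℝ) {ε : ℝ} (hε : ε ≤ 1) :
    ∃ K, LipschitzWith K (f a k m ε) := by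
  have h1 : √ε ≤ 1 := by simpa using Real.sqrt_le_sqrt hε
  have e : f a k m ε = fun x => min x (-1) - k * max (-1) (min x (-√ε))
      + m * max (-√ε) (min x √ε) + max x √ε + (- √ε + 1 - k * √ε - m * a) := by
    funext x
    rw [f_eq_max (Real.sqrt_nonneg _) h1]
    ring
  rw [e]
  have l1 : LipschitzWith 1 (fun x : ℝ => min x (-1)) := LipschitzWith.id.min_const _
  have l2 : LipschitzWith 1 (fun x : ℝ => max (-1) (min x (-√ε))) :=
    (LipschitzWith.id.min_const _).const_max _
  have l3 : LipschitzWith 1 (fun x : ℝ => max (-√ε) (min x √ε)) :=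
    (LipschitzWith.id.min_const _).const_max _
  have l4 : LipschitzWith 1 (fun x : ℝ => max x √ε) := LipschitzWith.id.max_const _
  have m2 := (lipschitzWith_smul k).comp l2
  have m3 := (lipschitzWith_smul m).comp l3
  exact ⟨_, (((l1.sub m2).add m3).add l4).add (LipschitzWith.const _)⟩

theorem exists_lipschitz_field (a k m : ℝ) {ε : ℝ} (hε : ε ≤ 1) :
    ∃ K, LipschitzWith K (field a k m ε) := by
  obtain ⟨K, hK⟩ := exists_lipschitz_f a k m hε
  have h1 : LipschitzWith _ (fun p : ℝ × ℝ => p.2 - f a k m ε p.1) :=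
    LipschitzWith.prod_snd.sub (hK.comp LipschitzWith.prod_fst)
  have h2 : LipschitzWith _ (fun p : ℝ × ℝ => ε * (a - p.1)) :=
    (lipschitzWith_smul ε).comp ((LipschitzWith.const a).sub LipschitzWith.prod_fst)
  exact ⟨_, h1.prodMk h2⟩

theorem continuous_f (a k m : ℝ) {ε : ℝ} (hε : ε ≤ 1) : Continuous (f a k m ε) :=
  (exists_lipschitz_f a k m hε).choose_spec.continuous

theorem exists_solution (a k m : ℝ) {ε : ℝ} (hε : ε ≤ 1) (p : ℝ × ℝ) (t₀ : ℝ) :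
    ∃ γ, IsSolution a k m ε γ ∧ γ t₀ = p := by
  obtain ⟨K, hK⟩ := exists_lipschitz_field a k m hε
  obtain ⟨γ, h0, hγ⟩ := exists_global_solution hK p
  refine ⟨fun t => γ (t + -t₀), IsSolution.comp_add (γ := γ) hγ (-t₀), by simpa using h0⟩

theorem solution_unique {a k m ε : ℝ} (hε : ε ≤ 1) {γ γ' : ℝ → ℝ × ℝ}
    (h : IsSolution a k m ε γ) (h' : IsSolution a k m ε γ') {t₀ : ℝ} (e : γ t₀ = γ' t₀) :
    γ = γ' := by
  obtain ⟨K, hK⟩ := exists_lipschitz_field a k m hε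
  exact ODE_solution_unique_univ (v := fun _ => field a k m ε) (s := fun _ => univ)
    (fun _ => hK.lipschitzOnWith) (fun t => ⟨h t, mem_univ _⟩) (fun t => ⟨h' t, mem_univ _⟩) e

/-- Continuous dependence on the initial point over a bounded time interval. -/
theorem exists_dist_solution_le {a k m ε : ℝ} (hε : ε ≤ 1) (T : ℝ) :
    ∃ C : ℝ, 0 < C ∧ ∀ γ γ' : ℝ → ℝ × ℝ, IsSolution a k m ε γ → IsSolution a k m ε γ' →
      ∀ t ∈ Icc 0 T, dist (γ t) (γ' t) ≤ dist (γ 0) (γ' 0) * C := by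
  obtain ⟨K, hK⟩ := exists_lipschitz_field a k m hε
  refine ⟨exp (K * T), exp_pos _, fun γ γ' h h' t ht => ?_⟩
  have := dist_le_of_trajectories_ODE (v := fun _ => field a k m ε) (fun _ => hK) (a := 0) (b := T)
    (fun t _ => (h t).continuousAt.continuousWithinAt) (fun t _ => (h t).hasDerivWithinAt)
    (fun t _ => (h' t).continuousAt.continuousWithinAt) (fun t _ => (h' t).hasDerivWithinAt)
    le_rfl t ht
  refine this.trans ?_
  have : t - 0 ≤ T := by linarith [ht.2]
  gcongr

/-- The horizontal velocity along a curve. -/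
noncomputable def vel (a k m ε : ℝ) (γ : ℝ → ℝ × ℝ) (t : ℝ) : ℝ :=
  (γ t).2 - f a k m ε (γ t).1

theorem IsSolution.hasDerivAt_fst {a k m ε : ℝ} {γ : ℝ → ℝ × ℝ} (h : IsSolution a k m ε γ)
    (t : ℝ) : HasDerivAt (fun t => (γ t).1) (vel a k m ε γ t) t :=
  (hasFDerivAt_fst (𝕜 := ℝ) (p := γ t)).comp_hasDerivAt t (h t)

theorem IsSolution.hasDerivAt_snd {a k m ε : ℝ} {γ : ℝ → ℝ × ℝ} (h : IsSolution a k m ε γ)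
    (t : ℝ) : HasDerivAt (fun t => (γ t).2) (ε * (a - (γ t).1)) t :=
  (hasFDerivAt_snd (𝕜 := ℝ) (p := γ t)).comp_hasDerivAt t (h t)

theorem IsSolution.continuous {a k m ε : ℝ} {γ : ℝ → ℝ × ℝ} (h : IsSolution a k m ε γ) :
    Continuous γ := continuous_iff_continuousAt.2 fun t => (h t).continuousAt

theorem IsSolution.continuous_vel {a k m ε : ℝ} (hε : ε ≤ 1) {γ : ℝ → ℝ × ℝ}
    (h : IsSolution a k m ε γ) : Continuous (vel a k m ε γ) := by
  have := h.continuous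
  have hf := continuous_f a k m hε
  unfold vel
  fun_prop

theorem eq_mk_of_vel {a k m ε : ℝ} {γ : ℝ → ℝ × ℝ} {t x v : ℝ} :
    γ t = (x, f a k m ε x + v) ↔ (γ t).1 = x ∧ vel a k m ε γ t = v := by
  unfold vel
  constructor
  · intro h; rw [h]; simp
  · rintro ⟨rfl, h⟩
    ext
    · rfl
    · simp only; linarith

end PWLCanard

/-! ### The linear oscillators that govern the zones. -/

namespace PWLCanard

/-- `C` and `S` are the solutions of `X'' + κ X' + ε X = 0` with initial data `(1, 0)` and
`(0, 1)`. -/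
structure Fund (κ ε : ℝ) (C S : ℝ → ℝ) : Prop where
  C_zero : C 0 = 1
  S_zero : S 0 = 0
  deriv_C : ∀ t, HasDerivAt C (-(ε * S t)) t
  deriv_S : ∀ t, HasDerivAt S (C t - κ * S t) t
  smooth_C : ContDiff ℝ 2 C
  smooth_S : ContDiff ℝ 2 S

/-- Position at time `t` of the linear oscillator with initial data `(X₀, V₀)`. -/
def linX (C S : ℝ → ℝ) (X₀ V₀ t : ℝ) : ℝ := X₀ * C t + V₀ * S t

/-- Velocity at time `t` of the linear oscillator with initial data `(X₀, V₀)`. -/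
def linV (κ ε : ℝ) (C S : ℝ → ℝ) (X₀ V₀ t : ℝ) : ℝ := -(ε * X₀ * S t) + V₀ * (C t - κ * S t)

namespace Fund

variable {κ ε : ℝ} {C S : ℝ → ℝ} (F : Fund κ ε C S)
include F

theorem hasDerivAt_linX (X₀ V₀ t : ℝ) :
    HasDerivAt (linX C S X₀ V₀) (linV κ ε C S X₀ V₀ t) t := by
  have := ((F.deriv_C t).const_mul X₀).add ((F.deriv_S t).const_mul V₀)
  refine this.congr_deriv ?_
  unfold linV; ring

theorem hasDerivAt_linV (X₀ V₀ t : ℝ) :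
    HasDerivAt (linV κ ε C S X₀ V₀)
      (-(κ * linV κ ε C S X₀ V₀ t) - ε * linX C S X₀ V₀ t) t := by
  have := (((F.deriv_S t).const_mul (ε * X₀)).neg).add
    (((F.deriv_C t).sub ((F.deriv_S t).const_mul κ)).const_mul V₀)
  refine this.congr_deriv ?_
  unfold linV linX; ring

theorem linX_zero (X₀ V₀ : ℝ) : linX C S X₀ V₀ 0 = X₀ := by simp [linX, F.C_zero, F.S_zero]

theorem linV_zero (X₀ V₀ : ℝ) : linV κ ε C S X₀ V₀ 0 = V₀ := by
  simp [linV, F.C_zero, F.S_zero]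

/-- Liouville's formula: the left side is the Wronskian `C S' - C' S`, and its product with `exp (κ
t)` has derivative zero. -/
theorem wronskian (t : ℝ) : C t * (C t - κ * S t) + ε * S t ^ 2 = exp (-(κ * t)) := by
  have hd : ∀ t, HasDerivAt (fun t => exp (κ * t) * (C t * (C t - κ * S t) + ε * S t ^ 2)) 0 t := by
    intro t
    have h1 : HasDerivAt (fun t => exp (κ * t)) (exp (κ * t) * (κ * 1)) t :=
      ((hasDerivAt_id t).const_mul κ).exp
    have h2 := (((F.deriv_C t).mul ((F.deriv_C t).sub ((F.deriv_S t).const_mul κ))).add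
      (((F.deriv_S t).pow 2).const_mul ε))
    refine (h1.mul h2).congr_deriv ?_
    simp; ring
  have hc := is_const_of_deriv_eq_zero (fun t => (hd t).differentiableAt)
    (fun t => (hd t).deriv) t 0
  simp only [F.C_zero, F.S_zero, mul_zero, exp_zero] at hc
  rw [Real.exp_neg]
  refine eq_inv_of_mul_eq_one_right (hc.trans ?_)
  ring

/-- Variation of constants with no forcing: applying the inverse of the fundamental matrix to `(X,
V)` gives two quantities with zero derivative, which equal the initial data. -/
theorem eq_lin {X V : ℝ → ℝ} (hX : ∀ t, HasDerivAt X (V t) t)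
    (hV : ∀ t, HasDerivAt V (-(κ * V t) - ε * X t) t) (t : ℝ) :
    X t = linX C S (X 0) (V 0) t ∧ V t = linV κ ε C S (X 0) (V 0) t := by
  have hE : ∀ t, HasDerivAt (fun t => exp (κ * t)) (exp (κ * t) * (κ * 1)) t := fun t =>
    ((hasDerivAt_id t).const_mul κ).exp
  have h1 : ∀ t, HasDerivAt (fun t => exp (κ * t) * ((C t - κ * S t) * X t - S t * V t)) 0 t := by
    intro t
    have h2 := (((F.deriv_C t).sub ((F.deriv_S t).const_mul κ)).mul (hX t)).sub
      ((F.deriv_S t).mul (hV t))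
    refine ((hE t).mul h2).congr_deriv ?_
    simp; ring
  have h2 : ∀ t, HasDerivAt (fun t => exp (κ * t) * (ε * S t * X t + C t * V t)) 0 t := by
    intro t
    have h2 := (((F.deriv_S t).const_mul ε).mul (hX t)).add ((F.deriv_C t).mul (hV t))
    refine ((hE t).mul h2).congr_deriv ?_
    simp; ring
  have c1 := is_const_of_deriv_eq_zero (fun t => (h1 t).differentiableAt)
    (fun t => (h1 t).deriv) t 0
  have c2 := is_const_of_deriv_eq_zero (fun t => (h2 t).differentiableAt)
    (fun t => (h2 t).deriv) t 0
  simp only [F.C_zero, F.S_zero, mul_zero, exp_zero] at c1 c2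
  have w := F.wronskian t
  have we : exp (κ * t) * exp (-(κ * t)) = 1 := by rw [← Real.exp_add]; simp
  have x0 : X 0 = exp (κ * t) * ((C t - κ * S t) * X t - S t * V t) := by linarith
  have v0 : V 0 = exp (κ * t) * (ε * S t * X t + C t * V t) := by linarith
  rw [← w] at we
  constructor
  · unfold linX
    rw [x0, v0]
    linear_combination (-X t) * we
  · unfold linV
    rw [x0, v0]
    linear_combination (-V t) * we

theorem lin_add (X₀ V₀ s t : ℝ) :
    linX C S X₀ V₀ (s + t) = linX C S (linX C S X₀ V₀ s) (linV κ ε C S X₀ V₀ s) t ∧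
    linV κ ε C S X₀ V₀ (s + t) = linV κ ε C S (linX C S X₀ V₀ s) (linV κ ε C S X₀ V₀ s) t := by
  have := F.eq_lin (X := fun t => linX C S X₀ V₀ (s + t)) (V := fun t => linV κ ε C S X₀ V₀ (s + t))
    (fun t => (F.hasDerivAt_linX X₀ V₀ (s + t)).comp_const_add s t)
    (fun t => (F.hasDerivAt_linV X₀ V₀ (s + t)).comp_const_add s t) t
  simpa using this

theorem continuous_linX (X₀ V₀ : ℝ) : Continuous (linX C S X₀ V₀) :=
  continuous_iff_continuousAt.2 fun t => (F.hasDerivAt_linX X₀ V₀ t).continuousAt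

/-- Time and exit velocity of the passage from `x = ℓ₀` to `x = ℓ₁` along a curve of initial
velocities and parameters. -/
theorem hasDerivAt_transit {ℓ₀ ℓ₁ : ℝ} {T V a : ℝ → ℝ} {u T' V' a' : ℝ}
    (hT : HasDerivAt T T' u) (hV : HasDerivAt V V' u) (ha : HasDerivAt a a' u)
    (heq : ∀ᶠ x in 𝓝 u, linX C S (ℓ₀ - a x) (V x) (T x) = ℓ₁ - a x)
    {W : ℝ} (hW : linV κ ε C S (ℓ₀ - a u) (V u) (T u) = W) (hW0 : W ≠ 0) :
    T' = ((C (T u) - 1) * a' - S (T u) * V') / W ∧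
    HasDerivAt (fun x => linV κ ε C S (ℓ₀ - a x) (V x) (T x))
      ((exp (-(κ * T u)) * (V u * V' - a' * (κ * V u + ε * (ℓ₀ - a u)))
        + a' * (κ * W + ε * (ℓ₁ - a u))) / W) u := by
  have hC := (F.deriv_C (T u)).comp u hT
  have hS := (F.deriv_S (T u)).comp u hT
  have hX : HasDerivAt (fun x => linX C S (ℓ₀ - a x) (V x) (T x))
      (-a' * C (T u) + V' * S (T u) + W * T') u := by
    have := ((ha.const_sub ℓ₀).mul hC).add (hV.mul hS)
    refine this.congr_deriv ?_
    rw [← hW]; unfold linV; simp only [Function.comp]; ring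
  have hX2 : HasDerivAt (fun x => linX C S (ℓ₀ - a x) (V x) (T x)) (-a') u :=
    (ha.const_sub ℓ₁).congr_of_eventuallyEq heq
  -- The exit position is `ℓ₁ - a` for all nearby parameters, so its derivative computed by the
  -- chain rule equals `-a'`. This determines `T'`.
  have e1 := hX.unique hX2
  have e2 : T' = ((C (T u) - 1) * a' - S (T u) * V') / W := by
    rw [eq_div_iff hW0]; linarith
  refine ⟨e2, ?_⟩
  have hL : HasDerivAt (fun x => linV κ ε C S (ℓ₀ - a x) (V x) (T x))
      (ε * a' * S (T u) + V' * (C (T u) - κ * S (T u)) + (-(κ * W) - ε * (ℓ₁ - a u)) * T') u := by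
    have := (((((ha.const_sub ℓ₀).const_mul ε).mul hS).neg).add
      (hV.mul (hC.sub (hS.const_mul κ))))
    refine this.congr_deriv ?_
    rw [← hW, ← heq.self_of_nhds]; unfold linV linX; simp only [Function.comp, Pi.sub_apply]; ring
  refine hL.congr_deriv ?_
  rw [e2, eq_div_iff hW0]
  -- After `T'` is inserted, the coefficients quadratic in `C` and `S` combine to the Wronskian.
  -- That is how the factor `exp (-(κ * T u))` arises.
  have l1 := F.wronskian (T u)
  have l2 := heq.self_of_nhds
  rw [← l1, ← l2]
  have : W * ((-(κ * W) - ε * linX C S (ℓ₀ - a u) (V u) (T u)) *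
      (((C (T u) - 1) * a' - S (T u) * V') / W)) = (-(κ * W) - ε * linX C S (ℓ₀ - a u) (V u) (T u)) *
      ((C (T u) - 1) * a' - S (T u) * V') := by field_simp
  rw [add_mul, mul_comm _ W, mul_comm _ W, this, ← hW]
  unfold linV linX; ring

end Fund

/-- Fundamental solutions for distinct real characteristic roots `α`, `β`. -/
noncomputable def nodeS (α β t : ℝ) : ℝ := (exp (β * t) - exp (α * t)) / (β - α)

/-- See `nodeS`. -/
noncomputable def nodeC (α β t : ℝ) : ℝ := (β * exp (α * t) - α * exp (β * t)) / (β - α)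

theorem fund_node {α β : ℝ} (h : α ≠ β) {κ ε : ℝ} (hκ : κ = -(α + β)) (hε : ε = α * β) :
    Fund κ ε (nodeC α β) (nodeS α β) := by
  have h0 : β - α ≠ 0 := sub_ne_zero.2 h.symm
  have hE : ∀ r t : ℝ, HasDerivAt (fun t => exp (r * t)) (exp (r * t) * (r * 1)) t := fun r t =>
    ((hasDerivAt_id t).const_mul r).exp
  refine ⟨?_, ?_, fun t => ?_, fun t => ?_, ?_, ?_⟩
  · simp [nodeC, h0]
  · simp [nodeS]
  · refine ((((hE α t).const_mul β).sub ((hE β t).const_mul α)).div_const (β - α)).congr_deriv ?_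
    rw [hε]; unfold nodeS; field_simp; ring
  · refine (((hE β t).sub (hE α t)).div_const (β - α)).congr_deriv ?_
    rw [hκ]; unfold nodeC nodeS; field_simp; ring
  · unfold nodeC; fun_prop
  · unfold nodeS; fun_prop

/-- `V - β X` is an eigenfunctional of the linear system with eigenvalue `α`. This first integral
and its mirror image replace the explicit solution in all later estimates of passage times. -/
theorem node_integral_left {α β : ℝ} (h : α ≠ β) {κ ε : ℝ} (hκ : κ = -(α + β)) (hε : ε = α * β)
    (X₀ V₀ t : ℝ) : linV κ ε (nodeC α β) (nodeS α β) X₀ V₀ t - β * linX (nodeC α β) (nodeS α β) X₀ V₀ t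
      = (V₀ - β * X₀) * exp (α * t) := by
  have h0 : β - α ≠ 0 := sub_ne_zero.2 h.symm
  unfold linV linX nodeC nodeS; rw [hκ, hε]; field_simp; ring

theorem node_integral_right {α β : ℝ} (h : α ≠ β) {κ ε : ℝ} (hκ : κ = -(α + β)) (hε : ε = α * β)
    (X₀ V₀ t : ℝ) : linV κ ε (nodeC α β) (nodeS α β) X₀ V₀ t - α * linX (nodeC α β) (nodeS α β) X₀ V₀ t
      = (V₀ - α * X₀) * exp (β * t) := by
  have h0 : β - α ≠ 0 := sub_ne_zero.2 h.symm
  unfold linV linX nodeC nodeS; rw [hκ, hε]; field_simp; ring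

/-- Fundamental solutions for the characteristic roots `-κ / 2 ± i ν`. -/
noncomputable def focS (κ ν t : ℝ) : ℝ := exp (-(κ / 2 * t)) * (sin (ν * t) / ν)

/-- See `focS`. -/
noncomputable def focC (κ ν t : ℝ) : ℝ :=
  exp (-(κ / 2 * t)) * (cos (ν * t) + κ / 2 * (sin (ν * t) / ν))

theorem fund_foc {κ ν ε : ℝ} (h : ν ≠ 0) (hε : ε = κ ^ 2 / 4 + ν ^ 2) :
    Fund κ ε (focC κ ν) (focS κ ν) := by
  have hE : ∀ t : ℝ, HasDerivAt (fun t => exp (-(κ / 2 * t)))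
      (exp (-(κ / 2 * t)) * (-(κ / 2 * 1))) t := fun t =>
    ((hasDerivAt_id t).const_mul (κ / 2)).neg.exp
  have hs : ∀ t : ℝ, HasDerivAt (fun t => sin (ν * t)) (cos (ν * t) * (ν * 1)) t := fun t =>
    ((hasDerivAt_id t).const_mul ν).sin
  have hc : ∀ t : ℝ, HasDerivAt (fun t => cos (ν * t)) (-sin (ν * t) * (ν * 1)) t := fun t =>
    ((hasDerivAt_id t).const_mul ν).cos
  refine ⟨?_, ?_, fun t => ?_, fun t => ?_, ?_, ?_⟩
  · simp [focC]
  · simp [focS]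
  · refine ((hE t).mul ((hc t).add (((hs t).div_const ν).const_mul (κ / 2)))).congr_deriv ?_
    rw [hε]; unfold focS; simp only [Pi.add_apply]; field_simp; ring
  · refine ((hE t).mul ((hs t).div_const ν)).congr_deriv ?_
    unfold focS focC; field_simp; ring
  · unfold focC; fun_prop
  · unfold focS; fun_prop

/-- The point of the phase plane with abscissa `x` at which the horizontal velocity is `v`. -/
noncomputable def pt (a k m ε x v : ℝ) : ℝ × ℝ := (x, f a k m ε x + v)

theorem eq_pt {a k m ε : ℝ} {γ : ℝ → ℝ × ℝ} {t x v : ℝ} :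
    γ t = pt a k m ε x v ↔ (γ t).1 = x ∧ vel a k m ε γ t = v := eq_mk_of_vel

/-- The restriction of `f` to `Z` is affine with slope `κ`. -/
def IsZone (a k m ε κ : ℝ) (Z : Set ℝ) : Prop := ∃ β, ∀ x ∈ Z, f a k m ε x = κ * x + β

theorem isZone_farLeft (a k m ε : ℝ) : IsZone a k m ε 1 (Iic (-1)) := by
  refine ⟨1 - k * (√ε - 1) - m * (√ε + a), fun x hx => ?_⟩
  have hx' : x ≤ -1 := hx
  rw [f, if_pos hx']; ring

theorem isZone_left (a k m ε : ℝ) : IsZone a k m ε (-k) (Icc (-1) (-√ε)) := by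
  refine ⟨-k * √ε - m * (√ε + a), fun x hx => ?_⟩
  unfold f
  split_ifs with h1 h2
  · have : x = -1 := le_antisymm h1 hx.1
    rw [this]; ring
  · ring
  all_goals exact absurd hx.2 h2

theorem isZone_center {a k m ε : ℝ} (h : √ε < 1) : IsZone a k m ε m (Icc (-√ε) √ε) := by
  refine ⟨-m * a, fun x hx => ?_⟩
  unfold f
  split_ifs with h1 h2 h3
  · linarith [hx.1]
  · have : x = -√ε := le_antisymm h2 hx.1
    rw [this]; ring
  · ring
  · exact absurd hx.2 h3

theorem isZone_right (a k m ε : ℝ) : IsZone a k m ε 1 (Ici √ε) := by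
  have h0 := Real.sqrt_nonneg ε
  refine ⟨-√ε + m * (√ε - a), fun x hx => ?_⟩
  have hx' : √ε ≤ x := hx
  unfold f
  split_ifs with h1 h2 h3
  · linarith
  · have : √ε = 0 := by linarith
    have hx0 : x = 0 := by linarith
    rw [this, hx0]; ring
  · have : x = √ε := le_antisymm h3 hx'
    rw [this]; ring
  · ring

/-- A solution of the system follows the linear flow of a zone as long as that stays there. -/
theorem follow {a k m ε κ : ℝ} (hε : ε ≤ 1) {C S : ℝ → ℝ} (F : Fund κ ε C S) {Z : Set ℝ}
    (hZ : IsZone a k m ε κ Z) {γ : ℝ → ℝ × ℝ} (hγ : IsSolution a k m ε γ) {τ ℓ V₀ t₁ t₂ : ℝ}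
    (h1 : t₁ ≤ 0) (h2 : 0 ≤ t₂) (h0 : γ τ = pt a k m ε ℓ V₀)
    (hin : ∀ t ∈ Icc t₁ t₂, a + linX C S (ℓ - a) V₀ t ∈ Z) :
    ∀ t ∈ Icc t₁ t₂, γ (τ + t) = pt a k m ε (a + linX C S (ℓ - a) V₀ t)
      (linV κ ε C S (ℓ - a) V₀ t) := by
  obtain ⟨β, hβ⟩ := hZ
  obtain ⟨K, hK⟩ := exists_lipschitz_field a k m hε
  set X := linX C S (ℓ - a) V₀ with hX
  set V := linV κ ε C S (ℓ - a) V₀ with hV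
  set ψ : ℝ → ℝ × ℝ := fun t => (a + X t, κ * (a + X t) + β + V t) with hψ
  have dX : ∀ t, HasDerivAt (fun t => a + X t) (V t) t := fun t =>
    (F.hasDerivAt_linX (ℓ - a) V₀ t).const_add a
  have dψ : ∀ t ∈ Icc t₁ t₂, HasDerivAt ψ (field a k m ε (ψ t)) t := by
    intro t ht
    have d2 := ((((dX t).const_mul κ).add_const β).add (F.hasDerivAt_linV (ℓ - a) V₀ t))
    have := (dX t).prodMk d2
    refine this.congr_deriv ?_
    simp only [field, hψ, hβ _ (hin t ht)]
    ext
    · simp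
    · simp only [← hX, ← hV]; ring
  have hpt : ∀ t ∈ Icc t₁ t₂, ψ t = pt a k m ε (a + X t) (V t) := by
    intro t ht
    simp only [hψ, pt, hβ _ (hin t ht)]
  have dγ : ∀ t, HasDerivAt (fun t => γ (τ + t)) (field a k m ε (γ (τ + t))) t := fun t =>
    (hγ (τ + t)).comp_const_add τ t
  have e0 : γ (τ + 0) = ψ 0 := by
    rw [hpt 0 ⟨h1, h2⟩, hX, hV, F.linX_zero, F.linV_zero, add_zero, h0]; simp
  have er : EqOn (fun t => γ (τ + t)) ψ (Icc 0 t₂) :=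
    ODE_solution_unique_of_mem_Icc_right (v := fun _ => field a k m ε) (s := fun _ => univ)
      (fun _ _ => hK.lipschitzOnWith) (fun t _ => (dγ t).continuousAt.continuousWithinAt)
      (fun t _ => (dγ t).hasDerivWithinAt) (fun _ _ => mem_univ _)
      (fun t ht => (dψ t ⟨h1.trans ht.1, ht.2⟩).continuousAt.continuousWithinAt)
      (fun t ht => (dψ t ⟨h1.trans ht.1, ht.2.le⟩).hasDerivWithinAt) (fun _ _ => mem_univ _) e0
  have el : EqOn (fun t => γ (τ + t)) ψ (Icc t₁ 0) :=
    ODE_solution_unique_of_mem_Icc_left (v := fun _ => field a k m ε) (s := fun _ => univ)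
      (fun _ _ => hK.lipschitzOnWith) (fun t _ => (dγ t).continuousAt.continuousWithinAt)
      (fun t _ => (dγ t).hasDerivWithinAt) (fun _ _ => mem_univ _)
      (fun t ht => (dψ t ⟨ht.1, ht.2.trans h2⟩).continuousAt.continuousWithinAt)
      (fun t ht => (dψ t ⟨ht.1.le, ht.2.trans h2⟩).hasDerivWithinAt) (fun _ _ => mem_univ _) e0
  intro t ht
  rw [← hpt t ht]
  rcases le_total 0 t with h | h
  · exact er ⟨h, ht.2⟩
  · exact el ⟨ht.1, h⟩

/-- The implicit function theorem for a scalar unknown. -/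
theorem exists_implicit {E : Type*} [NormedAddCommGroup E] [NormedSpace ℝ E] [CompleteSpace E]
    {n : WithTop ℕ∞} (hn : n ≠ 0) {H : E × ℝ → ℝ} {q₀ : E} {t₀ : ℝ}
    (hH : ContDiffAt ℝ n H (q₀, t₀)) {c : ℝ} (h0 : H (q₀, t₀) = c) {H' : ℝ}
    (hd : HasDerivAt (fun t => H (q₀, t)) H' t₀) (hne : H' ≠ 0) :
    ∃ T : E → ℝ, T q₀ = t₀ ∧ ContDiffAt ℝ n T q₀ ∧ ∀ᶠ q in 𝓝 q₀, H (q, T q) = c := by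
  have hF : HasFDerivAt H (fderiv ℝ H (q₀, t₀)) (q₀, t₀) :=
    (hH.differentiableAt hn).hasFDerivAt
  -- Restricted to the direction of the scalar unknown, the derivative is multiplication by `H'`,
  -- hence invertible as soon as `H'` is nonzero.
  have hi : HasFDerivAt (fun t : ℝ => ((q₀, t) : E × ℝ)) (ContinuousLinearMap.inr ℝ E ℝ) t₀ :=
    hasFDerivAt_prodMk_right q₀ t₀
  have hcomp := (hF.comp t₀ hi).hasDerivAt
  have hval : (fderiv ℝ H (q₀, t₀) ∘L ContinuousLinearMap.inr ℝ E ℝ) 1 = H' := hcomp.unique hd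
  have hinv : (fderiv ℝ H (q₀, t₀) ∘L ContinuousLinearMap.inr ℝ E ℝ).IsInvertible := by
    refine ⟨ContinuousLinearEquiv.unitsEquivAut ℝ (Units.mk0 H' hne), ?_⟩
    ext
    rw [hval]
    simp
  refine ⟨hH.implicitFunction hn hinv, hH.implicitFunction_apply_self hn hinv,
    hH.contDiffAt_implicitFunction hn hinv, ?_⟩
  rw [← h0]
  exact hH.eventually_apply_implicitFunction hn hinv

end PWLCanard

/-! ### Transversal passages, their jets, and the Poincaré map. -/

namespace PWLCanard

/-- Every solution through `p` arrives at `p'` after time `T`, without meeting the cross section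
in between. -/
def Reach (k m ε a : ℝ) (p p' : ℝ × ℝ) (T : ℝ) : Prop :=
  ∀ γ, IsSolution a k m ε γ → ∀ τ, γ τ = p →
    γ (τ + T) = p' ∧ ∀ t ∈ Ioo 0 T, γ (τ + t) ∉ crossSection a k m ε

theorem Reach.trans {k m ε a : ℝ} {p p' p'' : ℝ × ℝ} {T T' : ℝ} (h : Reach k m ε a p p' T)
    (h' : Reach k m ε a p' p'' T') (hp : p' ∉ crossSection a k m ε) :
    Reach k m ε a p p'' (T + T') := by
  intro γ hγ τ h0
  obtain ⟨h1, h2⟩ := h γ hγ τ h0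
  obtain ⟨h3, h4⟩ := h' γ hγ _ h1
  refine ⟨by rw [← add_assoc]; exact h3, fun t ht => ?_⟩
  rcases lt_trichotomy t T with h5 | h5 | h5
  · exact h2 t ⟨ht.1, h5⟩
  · rw [h5, h1]; exact hp
  · have := h4 (t - T) ⟨by linarith, by linarith [ht.2]⟩
    rwa [show τ + T + (t - T) = τ + t by ring] at this

theorem not_mem_crossSection {a k m ε ℓ w : ℝ} (h : ℓ ≠ √ε ∨ 0 ≤ w) :
    pt a k m ε ℓ w ∉ crossSection a k m ε := by
  rintro ⟨h1, h2⟩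
  simp only [pt] at h1 h2
  rcases h with h | h
  · exact h h1
  · rw [h1] at h2; linarith

section Transit

variable {κ ε : ℝ} {C S : ℝ → ℝ}

theorem Fund.continuous_linX_uncurry (F : Fund κ ε C S) (ℓ : ℝ) :
    Continuous fun z : (ℝ × ℝ) × ℝ => linX C S (ℓ - z.1.2) z.1.1 z.2 := by
  have hC := F.smooth_C.continuous
  have hS := F.smooth_S.continuous
  unfold linX
  fun_prop

theorem Fund.continuous_linV_uncurry (F : Fund κ ε C S) (ℓ : ℝ) :
    Continuous fun z : (ℝ × ℝ) × ℝ => linV κ ε C S (ℓ - z.1.2) z.1.1 z.2 := by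
  have hC := F.smooth_C.continuous
  have hS := F.smooth_S.continuous
  unfold linV
  fun_prop

/-- Nearby passages through an open zone stay inside the zone. -/
theorem Fund.eventually_inside (F : Fund κ ε C S) {ℓ₀ ℓ₁ a₀ w₀ w₁ T : ℝ} (hT : 0 < T)
    {I : Set ℝ} (hI : IsOpen I) (hin : ∀ t ∈ Ioo 0 T, a₀ + linX C S (ℓ₀ - a₀) w₀ t ∈ I)
    (hw₀ : w₀ ≠ 0) (hℓ₀ : ∃ δ > 0, ∀ x, 0 < (x - ℓ₀) * w₀ → |x - ℓ₀| < δ → x ∈ I)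
    (hX : linX C S (ℓ₀ - a₀) w₀ T = ℓ₁ - a₀) (hV : linV κ ε C S (ℓ₀ - a₀) w₀ T = w₁)
    (hw₁ : w₁ ≠ 0) (hℓ₁ : ∃ δ > 0, ∀ x, (x - ℓ₁) * w₁ < 0 → |x - ℓ₁| < δ → x ∈ I) :
    ∀ᶠ z : (ℝ × ℝ) × ℝ in 𝓝 ((w₀, a₀), T),
      linX C S (ℓ₀ - z.1.2) z.1.1 z.2 = ℓ₁ - z.1.2 →
        ∀ t ∈ Ioo 0 z.2, z.1.2 + linX C S (ℓ₀ - z.1.2) z.1.1 t ∈ I := by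
  have cX := F.continuous_linX_uncurry ℓ₀
  have cV := F.continuous_linV_uncurry ℓ₀
  obtain ⟨δ₀, hδ₀, hI₀⟩ := hℓ₀
  obtain ⟨δ₁, hδ₁, hI₁⟩ := hℓ₁
  have cx : Continuous fun z : (ℝ × ℝ) × ℝ => z.1.2 + linX C S (ℓ₀ - z.1.2) z.1.1 z.2 := by
    fun_prop
  -- near the entrance
  have e0 : ∀ᶠ z : (ℝ × ℝ) × ℝ in 𝓝 ((w₀, a₀), (0 : ℝ)),
      0 < linV κ ε C S (ℓ₀ - z.1.2) z.1.1 z.2 * w₀ ∧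
      |z.1.2 + linX C S (ℓ₀ - z.1.2) z.1.1 z.2 - ℓ₀| < δ₀ := by
    refine ((cV.mul continuous_const).continuousAt.eventually_const_lt ?_).and
      ((cx.sub continuous_const).abs.continuousAt.eventually_lt_const ?_)
    · change 0 < linV κ ε C S (ℓ₀ - a₀) w₀ 0 * w₀
      rw [F.linV_zero]; exact mul_self_pos.2 hw₀
    · change |a₀ + linX C S (ℓ₀ - a₀) w₀ 0 - ℓ₀| < δ₀
      rw [F.linX_zero]; simpa using hδ₀
  have e1 : ∀ᶠ z : (ℝ × ℝ) × ℝ in 𝓝 ((w₀, a₀), T),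
      0 < linV κ ε C S (ℓ₀ - z.1.2) z.1.1 z.2 * w₁ ∧
      |z.1.2 + linX C S (ℓ₀ - z.1.2) z.1.1 z.2 - ℓ₁| < δ₁ := by
    refine ((cV.mul continuous_const).continuousAt.eventually_const_lt ?_).and
      ((cx.sub continuous_const).abs.continuousAt.eventually_lt_const ?_)
    · change 0 < linV κ ε C S (ℓ₀ - a₀) w₀ T * w₁
      rw [hV]; exact mul_self_pos.2 hw₁
    · change |a₀ + linX C S (ℓ₀ - a₀) w₀ T - ℓ₁| < δ₁
      rw [hX]; simpa using hδ₁
  rw [nhds_prod_eq, eventually_prod_iff] at e0 e1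
  obtain ⟨p0, hp0, r0, hr0, h0⟩ := e0
  obtain ⟨p1, hp1, r1, hr1, h1⟩ := e1
  obtain ⟨η₀, hη₀, hr0⟩ := Metric.eventually_nhds_iff.1 hr0
  obtain ⟨η₁, hη₁, hr1⟩ := Metric.eventually_nhds_iff.1 hr1
  -- Three time windows. On the first and the last, of length about `η`, the velocity keeps the sign
  -- of `w₀` or `w₁`, and the mean value theorem puts the orbit on the correct side of the boundary
  -- line. In between, compactness of the time interval suffices.
  set η := min (min η₀ η₁) T / 2 with hη
  have hη_pos : 0 < η := by positivity
  have hη0 : η < η₀ := by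
    have := (min_le_left (min η₀ η₁) T).trans (min_le_left _ _); simp only [hη]; linarith
  have hη1 : η < η₁ := by
    have := (min_le_left (min η₀ η₁) T).trans (min_le_right _ _); simp only [hη]; linarith
  have hηT : η < T := by
    have := min_le_right (min η₀ η₁) T; simp only [hη]; linarith
  have e2 : ∀ᶠ q : ℝ × ℝ in 𝓝 (w₀, a₀), ∀ t ∈ Icc η (T - η),
      q.2 + linX C S (ℓ₀ - q.2) q.1 t ∈ I := by
    refine isCompact_Icc.eventually_forall_of_forall_eventually fun t ht => ?_
    have := cx.continuousAt (x := ((w₀, a₀), t))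
    exact this.eventually_mem (hI.mem_nhds
      (hin t ⟨by linarith [ht.1], by linarith [ht.2]⟩))
  have e3 : ∀ᶠ t : ℝ in 𝓝 T, T - η < t ∧ t < T + η :=
    Ioo_mem_nhds (by linarith) (by linarith)
  rw [nhds_prod_eq]
  filter_upwards [prod_mem_prod (inter_mem (inter_mem hp0 hp1) e2) e3] with z hz heq t ht
  obtain ⟨⟨⟨hz0, hz1⟩, hz2⟩, hz3, hz4⟩ := hz
  have hz0 : p0 z.1 := hz0
  have hz1 : p1 z.1 := hz1
  rcases lt_or_ge t η with h | h
  · have ht0 : dist t 0 < η₀ := by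
      rw [Real.dist_0_eq_abs, abs_of_pos ht.1]; linarith
    refine hI₀ _ ?_ (h0 hz0 (hr0 ht0)).2
    obtain ⟨ξ, hξ, hd⟩ := exists_hasDerivAt_eq_slope _ _ ht.1
      (F.continuous_linX (ℓ₀ - z.1.2) z.1.1).continuousOn
      (fun x _ => F.hasDerivAt_linX (ℓ₀ - z.1.2) z.1.1 x)
    rw [F.linX_zero, eq_div_iff (by linarith [ht.1])] at hd
    have hξ0 : dist ξ 0 < η₀ := by
      rw [Real.dist_0_eq_abs, abs_of_pos hξ.1]; linarith [hξ.2]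
    have h5 := (h0 hz0 (hr0 hξ0)).1
    have : (z.1.2 + linX C S (ℓ₀ - z.1.2) z.1.1 t - ℓ₀) * w₀
        = linV κ ε C S (ℓ₀ - z.1.2) z.1.1 ξ * w₀ * t := by linear_combination (-w₀) * hd
    rw [this]
    exact mul_pos h5 ht.1
  · rcases le_or_gt t (T - η) with h' | h'
    · exact hz2 t ⟨h, h'⟩
    · have hd1 : ∀ u, T - η < u → u < z.2 → dist u T < η₁ := by
        intro u hu hu'
        rw [Real.dist_eq, abs_lt]; constructor <;> linarith
      refine hI₁ _ ?_ (h1 hz1 (hr1 (hd1 t h' ht.2))).2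
      obtain ⟨ξ, hξ, hd⟩ := exists_hasDerivAt_eq_slope _ _ ht.2
        (F.continuous_linX (ℓ₀ - z.1.2) z.1.1).continuousOn
        (fun x _ => F.hasDerivAt_linX (ℓ₀ - z.1.2) z.1.1 x)
      rw [heq, eq_div_iff (by linarith [ht.2])] at hd
      have h5 := (h1 hz1 (hr1 (hd1 ξ (by linarith [hξ.1]) hξ.2))).1
      have : (z.1.2 + linX C S (ℓ₀ - z.1.2) z.1.1 t - ℓ₁) * w₁
          = -(linV κ ε C S (ℓ₀ - z.1.2) z.1.1 ξ * w₁ * (z.2 - t)) := by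
        linear_combination w₁ * hd
      rw [this, neg_lt_zero]
      exact mul_pos h5 (by linarith [ht.2])

/-- A transversal passage through a zone from `x = ℓ₀` to `x = ℓ₁`, with initial velocity `w₀`,
exit velocity `w₁` and duration `T`. -/
structure Passage (a k m ε κ : ℝ) (C S : ℝ → ℝ) (ℓ₀ ℓ₁ w₀ w₁ T : ℝ) : Prop where
  fund : Fund κ ε C S
  pos : 0 < T
  ne₀ : w₀ ≠ 0
  ne₁ : w₁ ≠ 0
  linX_eq : linX C S (ℓ₀ - a) w₀ T = ℓ₁ - a
  linV_eq : linV κ ε C S (ℓ₀ - a) w₀ T = w₁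
  inside : ∃ Z I : Set ℝ, (∀ a, IsZone a k m ε κ Z) ∧ I ⊆ Z ∧ ℓ₀ ∈ Z ∧ ℓ₁ ∈ Z ∧ IsOpen I ∧ √ε ∉ I ∧
    (∀ t ∈ Ioo 0 T, a + linX C S (ℓ₀ - a) w₀ t ∈ I) ∧
    (∃ δ > 0, ∀ x, 0 < (x - ℓ₀) * w₀ → |x - ℓ₀| < δ → x ∈ I) ∧
    (∃ δ > 0, ∀ x, (x - ℓ₁) * w₁ < 0 → |x - ℓ₁| < δ → x ∈ I)

/-- Since the exit velocity is nonzero, the implicit function theorem gives a `C²` exit time. By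
`eventually_inside` the nearby orbits do not leave the zone before that time, so the linear flow is
the true one. -/
theorem Passage.exists_local {a k m : ℝ} {ℓ₀ ℓ₁ w₀ w₁ T : ℝ} (hε : ε ≤ 1)
    (h : Passage a k m ε κ C S ℓ₀ ℓ₁ w₀ w₁ T) :
    ∃ τ : ℝ × ℝ → ℝ, ContDiffAt ℝ 2 τ (w₀, a) ∧ τ (w₀, a) = T ∧
      ∀ᶠ q in 𝓝 (w₀, a), linX C S (ℓ₀ - q.2) q.1 (τ q) = ℓ₁ - q.2 ∧ 0 < τ q ∧
        Reach k m ε q.2 (pt q.2 k m ε ℓ₀ q.1)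
          (pt q.2 k m ε ℓ₁ (linV κ ε C S (ℓ₀ - q.2) q.1 (τ q))) (τ q) := by
  obtain ⟨F, hT, h0, h1, hX, hV, Z, I, hZ, hIZ, hZ0, hZ1, hI, hσ, hin, hl0, hl1⟩ := h
  -- The parameter is added to the position so that the target value `ℓ₁` is constant, as the
  -- implicit function theorem requires.
  have hH : ContDiffAt ℝ 2 (fun z : (ℝ × ℝ) × ℝ => linX C S (ℓ₀ - z.1.2) z.1.1 z.2 + z.1.2)
      ((w₀, a), T) := by
    have hC := F.smooth_C
    have hS := F.smooth_S
    apply ContDiff.contDiffAt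
    unfold linX
    fun_prop
  obtain ⟨τ, τ0, cτ, eτ⟩ := exists_implicit (n := 2) (by norm_num) (c := ℓ₁) hH
    (by simp [hX]) (H' := w₁)
    (by rw [← hV]; exact (F.hasDerivAt_linX (ℓ₀ - a) w₀ T).add_const a) h1
  have ct : Tendsto (fun q : ℝ × ℝ => (q, τ q)) (𝓝 (w₀, a)) (𝓝 ((w₀, a), T)) := by
    have := (continuousAt_id (x := (w₀, a))).prodMk cτ.continuousAt
    simpa only [ContinuousAt, id, τ0] using this
  have e1 := ct.eventually (F.eventually_inside hT hI hin h0 hl0 hX hV h1 hl1)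
  have e2 : ∀ᶠ q in 𝓝 (w₀, a), 0 < τ q :=
    cτ.continuousAt.eventually_const_lt (by rw [τ0]; exact hT)
  refine ⟨τ, cτ, τ0, ?_⟩
  filter_upwards [e1, e2, eτ] with q h1 h2 h3
  have h3' : linX C S (ℓ₀ - q.2) q.1 (τ q) = ℓ₁ - q.2 := by linarith
  refine ⟨h3', h2, fun γ hγ s hs => ?_⟩
  have hfol := follow hε F (hZ q.2) hγ (t₁ := 0) (t₂ := τ q) le_rfl h2.le hs (by
    intro t ht
    rcases eq_or_lt_of_le ht.1 with h4 | h4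
    · rw [← h4, F.linX_zero]; simpa using hZ0
    rcases eq_or_lt_of_le ht.2 with h5 | h5
    · rw [h5, h3']; simpa using hZ1
    · exact hIZ (h1 h3' t ⟨h4, h5⟩))
  constructor
  · rw [hfol (τ q) ⟨h2.le, le_rfl⟩, h3']; simp
  · intro t ht
    rw [hfol t ⟨ht.1.le, ht.2.le⟩]
    refine not_mem_crossSection (Or.inl ?_)
    intro h6
    exact hσ (h6 ▸ h1 h3' t ht)

/-- Along the orbits that start on a vertical line with velocity `v` near `z` and parameter near
`a₀`, the functions `W` and `J` record a later velocity and the accumulated contraction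
`∫ f'`; `w`, `j`, `A = ∂W/∂a` and `B = ∂J/∂v` are their values and derivatives. -/
structure Jet (a₀ z : ℝ) (W J : ℝ × ℝ → ℝ) (w j A B : ℝ) : Prop where
  smooth_W : ContDiffAt ℝ 2 W (z, a₀)
  smooth_J : ContDiffAt ℝ 2 J (z, a₀)
  W_eq : W (z, a₀) = w
  J_eq : J (z, a₀) = j
  deriv_v : ∀ᶠ v in 𝓝 z, HasDerivAt (fun v => W (v, a₀)) (v / W (v, a₀) * exp (-J (v, a₀))) v
  deriv_a : HasDerivAt (fun a => W (z, a)) A a₀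
  deriv_J : HasDerivAt (fun v => J (v, a₀)) B z

theorem jet_initial {a₀ z : ℝ} (hz : z ≠ 0) :
    Jet a₀ z (fun q => q.1) (fun _ => 0) z 0 0 0 := by
  refine ⟨contDiffAt_fst, contDiffAt_const, rfl, rfl, ?_, hasDerivAt_const _ _,
    hasDerivAt_const _ _⟩
  filter_upwards [isOpen_ne.mem_nhds hz] with v hv
  have hv : v ≠ 0 := hv
  simpa [hv] using hasDerivAt_id' v

/-- The derivative with respect to `a` of the exit velocity of a passage. -/
noncomputable def nextA (ε a κ ℓ₀ ℓ₁ w₀ w₁ T A : ℝ) : ℝ :=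
  (exp (-(κ * T)) * (w₀ * A - (κ * w₀ + ε * (ℓ₀ - a))) + (κ * w₁ + ε * (ℓ₁ - a))) / w₁

/-- The derivative with respect to the initial velocity of the accumulated contraction. -/
noncomputable def nextB (S : ℝ → ℝ) (κ z w₀ w₁ T j B : ℝ) : ℝ :=
  B - κ * (S T / w₁) * (z / w₀ * exp (-j))

/-- At fixed `a` each passage multiplies `V dV` by `exp (-κ T)`, so the form `v / W * exp (-J)` of
the velocity derivative persists with `J` increased by `κ T`. It is kept on a whole neighbourhood of
`z` because it is differentiated once more for the second derivative of the return map. The other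
two derivatives come from `hasDerivAt_transit` and the chain rule. -/
theorem Jet.next {a₀ z : ℝ} {W J : ℝ × ℝ → ℝ} {w₀ j A B : ℝ} (hj : Jet a₀ z W J w₀ j A B)
    (F : Fund κ ε C S) {ℓ₀ ℓ₁ w₁ T : ℝ} {τ : ℝ × ℝ → ℝ} (hτ : ContDiffAt ℝ 2 τ (w₀, a₀))
    (hT : τ (w₀, a₀) = T)
    (hX : ∀ᶠ q in 𝓝 (w₀, a₀), linX C S (ℓ₀ - q.2) q.1 (τ q) = ℓ₁ - q.2)
    (hV : linV κ ε C S (ℓ₀ - a₀) w₀ T = w₁) (h1 : w₁ ≠ 0) (h0 : w₀ ≠ 0) :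
    Jet a₀ z (fun q => linV κ ε C S (ℓ₀ - q.2) (W q) (τ (W q, q.2)))
      (fun q => J q + κ * τ (W q, q.2)) w₁ (j + κ * T) (nextA ε a₀ κ ℓ₀ ℓ₁ w₀ w₁ T A)
      (nextB S κ z w₀ w₁ T j B) := by
  obtain ⟨cW, cJ, W0, J0, dv, da, dJ⟩ := hj
  have cWa : ContDiffAt ℝ 2 (fun q : ℝ × ℝ => (W q, q.2)) (z, a₀) := cW.prodMk contDiffAt_snd
  have cτ : ContDiffAt ℝ 2 (fun q : ℝ × ℝ => τ (W q, q.2)) (z, a₀) :=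
    ContDiffAt.comp (z, a₀) (g := τ) (by simpa only [W0] using hτ) cWa
  have hC := F.smooth_C
  have hS := F.smooth_S
  have tW : Tendsto (fun q : ℝ × ℝ => (W q, q.2)) (𝓝 (z, a₀)) (𝓝 (w₀, a₀)) := by
    simpa only [ContinuousAt, W0] using cWa.continuousAt
  have tv : Tendsto (fun v : ℝ => (v, a₀)) (𝓝 z) (𝓝 (z, a₀)) :=
    (continuous_id.prodMk continuous_const).tendsto z
  have ta : Tendsto (fun a : ℝ => (z, a)) (𝓝 a₀) (𝓝 (z, a₀)) :=
    (continuous_const.prodMk continuous_id).tendsto a₀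
  have dτ : DifferentiableAt ℝ (fun q : ℝ × ℝ => τ (W q, q.2)) (z, a₀) :=
    cτ.differentiableAt (by norm_num)
  have eX : ∀ᶠ q : ℝ × ℝ in 𝓝 (z, a₀), linX C S (ℓ₀ - q.2) (W q) (τ (W q, q.2)) = ℓ₁ - q.2 :=
    tW.eventually hX
  have cL : ContDiffAt ℝ 2 (fun q => linV κ ε C S (ℓ₀ - q.2) (W q) (τ (W q, q.2))) (z, a₀) := by
    have hCτ := hC.contDiffAt.comp (z, a₀) cτ
    have hSτ := hS.contDiffAt.comp (z, a₀) cτ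
    simp only [Function.comp_def] at hCτ hSτ
    unfold linV
    exact (((contDiffAt_const.mul (contDiffAt_const.sub contDiffAt_snd)).mul hSτ).neg).add
      (cW.mul (hCτ.sub (contDiffAt_const.mul hSτ)))
  have hV' : linV κ ε C S (ℓ₀ - a₀) (W (z, a₀)) (τ (W (z, a₀), a₀)) = w₁ := by
    rw [W0, hT, hV]
  -- derivatives along `v`
  have hv : ∀ᶠ v in 𝓝 z, HasDerivAt (fun v => W (v, a₀)) (v / W (v, a₀) * exp (-J (v, a₀))) v ∧
      W (v, a₀) ≠ 0 ∧ linV κ ε C S (ℓ₀ - a₀) (W (v, a₀)) (τ (W (v, a₀), a₀)) ≠ 0 ∧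
      DifferentiableAt ℝ (fun v => τ (W (v, a₀), a₀)) v ∧
      ∀ᶠ x in 𝓝 v, linX C S (ℓ₀ - a₀) (W (x, a₀)) (τ (W (x, a₀), a₀)) = ℓ₁ - a₀ := by
    refine dv.and ((tv.eventually (cW.continuousAt.eventually_ne (by rw [W0]; exact h0))).and
      ((tv.eventually (cL.continuousAt.eventually_ne (by simp only [hV']; exact h1))).and
      (Filter.Eventually.and ?_ (tv.eventually eX).eventually_nhds)))
    have h5 : ∀ᶠ q in 𝓝 (z, a₀), DifferentiableAt ℝ (fun q : ℝ × ℝ => τ (W q, q.2)) q :=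
      ((cτ.of_le (by norm_num : (1 : WithTop ℕ∞) ≤ 2)).eventually (by norm_num)).mono
        fun q hq => hq.differentiableAt (by norm_num)
    filter_upwards [tv.eventually h5] with v hv
    exact hv.comp v (f := fun v : ℝ => (v, a₀)) (by fun_prop)
  refine ⟨cL, cJ.add (contDiffAt_const.mul cτ), hV', by rw [J0, W0, hT], ?_, ?_, ?_⟩
  · filter_upwards [hv] with v hv
    obtain ⟨hd, hne, hne1, hdτ, hx⟩ := hv
    have := (F.hasDerivAt_transit (ℓ₁ := ℓ₁) hdτ.hasDerivAt hd (hasDerivAt_const v a₀) hx rfl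
      hne1).2
    refine this.congr_deriv ?_
    rw [neg_add, Real.exp_add]
    field_simp
    ring
  · have hdτ : DifferentiableAt ℝ (fun a => τ (W (z, a), a)) a₀ :=
      dτ.comp a₀ (f := fun a : ℝ => (z, a)) (by fun_prop)
    have := (F.hasDerivAt_transit (ℓ₁ := ℓ₁) hdτ.hasDerivAt da (hasDerivAt_id a₀)
      (ta.eventually eX) hV' h1).2
    refine this.congr_deriv ?_
    simp only [W0, hT, id, nextA, one_mul]
  · obtain ⟨hd, hne, hne1, hdτ, hx⟩ := hv.self_of_nhds
    have := (F.hasDerivAt_transit (ℓ₁ := ℓ₁) hdτ.hasDerivAt hd (hasDerivAt_const z a₀) hx hV'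
      h1).1
    have h6 := hdτ.hasDerivAt
    rw [this] at h6
    refine (dJ.add (h6.const_mul κ)).congr_deriv ?_
    simp only [W0, J0, hT, nextB]
    ring

/-- The orbits that start on the section `x = √ε` near velocity `z` are followed up to the line
`x = ℓ`. -/
def Stage (k m ε a₀ z ℓ w j A B : ℝ) : Prop :=
  ∃ W J τ : ℝ × ℝ → ℝ, Jet a₀ z W J w j A B ∧ ∀ᶠ q in 𝓝 (z, a₀), 0 < τ q ∧
    Reach k m ε q.2 (pt q.2 k m ε √ε q.1) (pt q.2 k m ε ℓ (W q)) (τ q)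

theorem Passage.stage {a k m : ℝ} {ℓ₁ z w₁ T : ℝ} (hε : ε ≤ 1)
    (h : Passage a k m ε κ C S √ε ℓ₁ z w₁ T) :
    Stage k m ε a z ℓ₁ w₁ (κ * T) (nextA ε a κ √ε ℓ₁ z w₁ T 0) (nextB S κ z z w₁ T 0 0) := by
  obtain ⟨τ, cτ, τ0, hτ⟩ := h.exists_local hε
  have := (jet_initial (a₀ := a) h.ne₀).next h.fund cτ τ0 (hτ.mono fun q hq => hq.1)
    (h.linV_eq) h.ne₁ h.ne₀
  rw [zero_add] at this
  exact ⟨_, _, τ, this, hτ.mono fun q hq => hq.2⟩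

/-- The condition `hns` keeps the intermediate point off the cross section, so that a closed chain
of passages yields the first return and not a later one. -/
theorem Stage.step {a k m z w₀ j A B : ℝ} {ℓ₀ ℓ₁ w₁ T : ℝ} (hε : ε ≤ 1)
    (hs : Stage k m ε a z ℓ₀ w₀ j A B) (h : Passage a k m ε κ C S ℓ₀ ℓ₁ w₀ w₁ T)
    (hns : ℓ₀ ≠ √ε ∨ 0 < w₀) :
    Stage k m ε a z ℓ₁ w₁ (j + κ * T) (nextA ε a κ ℓ₀ ℓ₁ w₀ w₁ T A)
      (nextB S κ z w₀ w₁ T j B) := by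
  obtain ⟨τ, cτ, τ0, hτ⟩ := h.exists_local hε
  obtain ⟨W, J, τ', hj, hr⟩ := hs
  have := hj.next h.fund cτ τ0 (hτ.mono fun q hq => hq.1) (h.linV_eq) h.ne₁ h.ne₀
  refine ⟨_, _, fun q => τ' q + τ (W q, q.2), this, ?_⟩
  have tW : Tendsto (fun q : ℝ × ℝ => (W q, q.2)) (𝓝 (z, a)) (𝓝 (w₀, a)) := by
    have := (hj.smooth_W.continuousAt.prodMk continuousAt_snd :
      ContinuousAt (fun q : ℝ × ℝ => (W q, q.2)) (z, a))
    simpa only [ContinuousAt, hj.W_eq] using this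
  have hn : ∀ᶠ q : ℝ × ℝ in 𝓝 (z, a), ℓ₀ ≠ √ε ∨ 0 ≤ W q := by
    rcases hns with h | h
    · exact Eventually.of_forall fun _ => Or.inl h
    · exact (hj.smooth_W.continuousAt.eventually_const_lt (by rw [hj.W_eq]; exact h)).mono
        fun q hq => Or.inr hq.le
  filter_upwards [hr, tW.eventually hτ, hn] with q h1 h2 h3
  exact ⟨add_pos h1.1 h2.2.1, h1.2.trans h2.2.2 (not_mem_crossSection h3)⟩

end Transit

theorem f_sqrt {a k m ε : ℝ} (h0 : 0 < ε) : f a k m ε √ε = m * (√ε - a) := by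
  have := Real.sqrt_pos.2 h0
  rw [f, if_neg (by linarith), if_neg (by linarith), if_pos le_rfl]

/-- The Poincaré map obtained from a closed chain of passages, with its derivatives. -/
theorem Stage.saddleNode {k m ε a₀ z A B : ℝ} (h0 : 0 < ε) (hε : ε ≤ 1) (hz : z < 0)
    (hs : Stage k m ε a₀ z √ε z 0 A B) (hA : A ≠ 0) (hB : B ≠ 0) :
    ∃ P : ℝ → ℝ → ℝ, IsPoincareMap k m ε (m * (√ε - a₀) + z) a₀ P ∧
      ContDiffAt ℝ 2 (fun q : ℝ × ℝ => P q.1 q.2) (m * (√ε - a₀) + z, a₀) ∧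
      P (m * (√ε - a₀) + z) a₀ = m * (√ε - a₀) + z ∧
      deriv (fun y => P y a₀) (m * (√ε - a₀) + z) = 1 ∧
      iteratedDeriv 2 (fun y => P y a₀) (m * (√ε - a₀) + z) ≠ 0 ∧
      deriv (fun a => P (m * (√ε - a₀) + z) a) a₀ ≠ 0 := by
  obtain ⟨W, J, τ, hj, hr⟩ := hs
  obtain ⟨cW, cJ, W0, J0, dv, da, dJ⟩ := hj
  set y₀ := m * (√ε - a₀) + z with hy₀
  have hg : ContDiff ℝ 2 (fun q : ℝ × ℝ => (q.1 - m * (√ε - q.2), q.2)) := by fun_prop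
  have hg0 : (y₀ - m * (√ε - a₀), a₀) = (z, a₀) := by simp [hy₀]
  have tg : Tendsto (fun q : ℝ × ℝ => (q.1 - m * (√ε - q.2), q.2)) (𝓝 (y₀, a₀)) (𝓝 (z, a₀)) := by
    have := hg.continuous.continuousAt (x := (y₀, a₀))
    simpa only [ContinuousAt, hg0] using this
  have ty : Tendsto (fun y : ℝ => y - m * (√ε - a₀)) (𝓝 y₀) (𝓝 z) := by
    have : ContinuousAt (fun y : ℝ => y - m * (√ε - a₀)) y₀ := by fun_prop
    simpa [ContinuousAt, hy₀] using this
  have tv : Tendsto (fun v : ℝ => (v, a₀)) (𝓝 z) (𝓝 (z, a₀)) :=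
    (continuous_id.prodMk continuous_const).tendsto z
  have hWne : W (z, a₀) ≠ 0 := by rw [W0]; exact hz.ne
  have hzz : z / W (z, a₀) * exp (-J (z, a₀)) = 1 := by
    rw [W0, J0, div_self hz.ne]; simp
  have hd1 : ∀ᶠ y in 𝓝 y₀, HasDerivAt
      (fun y => m * (√ε - a₀) + W (y - m * (√ε - a₀), a₀))
      ((fun v => v / W (v, a₀) * exp (-J (v, a₀))) (y - m * (√ε - a₀))) y := by
    filter_upwards [ty.eventually dv] with y hy
    exact (hy.comp_sub_const y (m * (√ε - a₀))).const_add _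
  refine ⟨fun y a => m * (√ε - a) + W (y - m * (√ε - a), a), ?_, ?_, ?_, ?_, ?_, ?_⟩
  · have e1 : ∀ᶠ q : ℝ × ℝ in 𝓝 (z, a₀), q.1 < 0 ∧ W q < 0 :=
      ((continuousAt_fst (p := (z, a₀))).eventually_lt_const hz).and
        (cW.continuousAt.eventually_lt_const (by rw [W0]; exact hz))
    have := tg.eventually (e1.and hr)
    filter_upwards [this] with q hq
    obtain ⟨⟨h1, h2⟩, h3, h4⟩ := hq
    have hpt : ∀ v, pt q.2 k m ε √ε v = (√ε, m * (√ε - q.2) + v) := by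
      intro v; rw [pt, f_sqrt h0]
    refine ⟨⟨rfl, by rw [f_sqrt h0]; linarith⟩, ?_⟩
    obtain ⟨γ, hγ, hγ0⟩ := exists_solution q.2 k m hε (√ε, q.1) 0
    obtain ⟨h5, h6⟩ := h4 γ hγ 0 (by rw [hγ0, hpt]; simp)
    rw [zero_add, hpt] at h5
    refine ⟨γ, _, hγ, hγ0, h3, h5, ?_, fun t ht => by simpa using h6 t ht⟩
    rw [h5]
    exact ⟨rfl, by rw [f_sqrt h0]; linarith⟩
  · have hcomp : ContDiffAt ℝ 2 (fun q : ℝ × ℝ => W (q.1 - m * (√ε - q.2), q.2)) (y₀, a₀) :=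
      ContDiffAt.comp (y₀, a₀) (g := W) (f := fun q : ℝ × ℝ => (q.1 - m * (√ε - q.2), q.2))
        (by simpa only [hg0] using cW) hg.contDiffAt
    exact (contDiffAt_const.mul (contDiffAt_const.sub contDiffAt_snd)).add hcomp
  · simp [hy₀, W0]
  · rw [hd1.self_of_nhds.deriv]
    simpa [hy₀] using hzz
  · have h2 : deriv (fun y => m * (√ε - a₀) + W (y - m * (√ε - a₀), a₀)) =ᶠ[𝓝 y₀]
        fun y => (fun v => v / W (v, a₀) * exp (-J (v, a₀))) (y - m * (√ε - a₀)) :=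
      hd1.mono fun y hy => hy.deriv
    rw [iteratedDeriv_succ, iteratedDeriv_one, h2.deriv_eq]
    -- At `z` one has `W = z`, `W' = 1` and `J = 0`. The quotient `v / W` is then stationary, and
    -- only the exponential contributes, with derivative `-B`.
    have h3 : HasDerivAt (fun v => v / W (v, a₀) * exp (-J (v, a₀))) (-B) z := by
      have h4 := dv.self_of_nhds
      rw [hzz] at h4
      refine (((hasDerivAt_id z).div h4 hWne).mul dJ.neg.exp).congr_deriv ?_
      have := hz.ne
      simp only [W0, J0, id, Pi.div_apply, Pi.neg_apply, neg_zero, exp_zero]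
      field_simp
      ring
    have h5 : HasDerivAt (fun y => (fun v => v / W (v, a₀) * exp (-J (v, a₀)))
        (y - m * (√ε - a₀))) (-B) y₀ :=
      HasDerivAt.comp_sub_const (f := fun v => v / W (v, a₀) * exp (-J (v, a₀))) y₀
        (m * (√ε - a₀)) (by rw [show y₀ - m * (√ε - a₀) = z by simp [hy₀]]; exact h3)
    rw [h5.deriv]
    simpa using hB
  · have h2 : DifferentiableAt ℝ W (z, a₀) := cW.differentiableAt (by norm_num)
    have hF := h2.hasFDerivAt
    set L := fderiv ℝ W (z, a₀)
    have hv : L (1, 0) = 1 := by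
      have h3 := hF.comp_hasDerivAt z ((hasDerivAt_id z).prodMk (hasDerivAt_const z a₀))
      have h4 := dv.self_of_nhds
      rw [hzz] at h4
      exact h3.unique h4
    have ha : L (0, 1) = A := by
      have h3 := hF.comp_hasDerivAt a₀ ((hasDerivAt_const a₀ z).prodMk (hasDerivAt_id a₀))
      exact h3.unique da
    -- For fixed height `y` the velocity `y - m (√ε - a)` on the section varies with `a` at rate
    -- `m`. As `∂W/∂v = 1`, this `m` cancels the `-m` coming from the conversion of velocity back to
    -- height, and `A` remains.
    have hcurve : HasDerivAt (fun a : ℝ => (y₀ - m * (√ε - a), a)) (m, 1) a₀ := by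
      have h5 : HasDerivAt (fun a : ℝ => y₀ - m * (√ε - a)) m a₀ := by
        refine ((((hasDerivAt_id a₀).const_sub √ε).const_mul m).const_sub y₀).congr_deriv ?_
        ring
      exact h5.prodMk (hasDerivAt_id a₀)
    have hF' : HasFDerivAt W L (y₀ - m * (√ε - a₀), a₀) := by
      have : (y₀ - m * (√ε - a₀), a₀) = (z, a₀) := by simp [hy₀]
      rw [this]; exact hF
    have h6 := hF'.comp_hasDerivAt (f := fun a : ℝ => (y₀ - m * (√ε - a), a)) a₀ hcurve
    have h7 : L (m, 1) = m + A := by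
      have : ((m, 1) : ℝ × ℝ) = m • (1, 0) + (0, 1) := by simp
      rw [this, map_add, map_smul, hv, ha]; simp
    rw [h7] at h6
    have h8 : HasDerivAt (fun a : ℝ => m * (√ε - a)) (-m) a₀ := by
      refine (((hasDerivAt_id a₀).const_sub √ε).const_mul m).congr_deriv ?_
      ring
    have h9 := h8.add h6
    have h10 : deriv (fun a => m * (√ε - a) + W (y₀ - m * (√ε - a), a)) a₀ = A := by
      refine (h9.congr_deriv (g' := A) ?_).deriv
      ring
    rw [h10]
    exact hA

end PWLCanard

/-! ### From the closing condition and a saddle-node fixed point to an isolated periodic orbit. -/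

namespace PWLCanard

/-- The second derivative test alone gives a weak minimum. Applied to `q` minus a quarter of
`q''(y₀) (y - y₀)²`, whose second derivative is still positive, it gives a strict one. -/
theorem eventually_pos_of_deriv_deriv_pos {q : ℝ → ℝ} {y₀ : ℝ} (hq : ContDiffAt ℝ 2 q y₀)
    (h0 : q y₀ = 0) (h1 : deriv q y₀ = 0) (h2 : 0 < deriv (deriv q) y₀) :
    ∀ᶠ y in 𝓝 y₀, y ≠ y₀ → 0 < q y := by
  set c := deriv (deriv q) y₀ with hc
  have hd : ∀ᶠ y in 𝓝 y₀, DifferentiableAt ℝ q y :=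
    ((hq.of_le (by norm_num : (1 : WithTop ℕ∞) ≤ 2)).eventually (by norm_num)).mono
      fun y hy => hy.differentiableAt (by norm_num)
  have hs : ∀ y, HasDerivAt (fun y => c / 4 * (y - y₀) ^ 2) (c / 2 * (y - y₀)) y := fun y => by
    refine ((((hasDerivAt_id y).sub_const y₀).pow 2).const_mul (c / 4)).congr_deriv ?_
    simp; ring
  have hh : deriv (fun y => q y - c / 4 * (y - y₀) ^ 2) =ᶠ[𝓝 y₀]
      fun y => deriv q y - c / 2 * (y - y₀) :=
    hd.mono fun y hy => (hy.hasDerivAt.sub (hs y)).deriv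
  have hdd : DifferentiableAt ℝ (deriv q) y₀ := by
    by_contra h
    rw [hc, deriv_zero_of_not_differentiableAt h] at h2
    exact lt_irrefl _ h2
  have h3 : deriv (deriv (fun y => q y - c / 4 * (y - y₀) ^ 2)) y₀ = c / 2 := by
    rw [hh.deriv_eq]
    have h4 : HasDerivAt (fun y => c / 2 * (y - y₀)) (c / 2) y₀ := by
      simpa using ((hasDerivAt_id' y₀).sub_const y₀).const_mul (c / 2)
    exact (hdd.hasDerivAt.sub h4).deriv.trans (by rw [← hc]; ring)
  have hmin := isLocalMin_of_deriv_deriv_pos (f := fun y => q y - c / 4 * (y - y₀) ^ 2) (x₀ := y₀)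
    (by rw [h3]; linarith) (by rw [hh.self_of_nhds]; simp [h1])
    (hq.continuousAt.sub (hs y₀).continuousAt)
  filter_upwards [hmin] with y hy hne
  simp only [h0, sub_self] at hy
  have : 0 < c / 4 * (y - y₀) ^ 2 := by
    have := sub_ne_zero.2 hne
    positivity
  norm_num at hy
  linarith

/-- Near a fixed point of saddle-node type a map moves all other points in the same direction. -/
theorem saddleNode_sign {P : ℝ → ℝ} {y₀ : ℝ} (hP : ContDiffAt ℝ 2 P y₀) (h0 : P y₀ = y₀)
    (h1 : deriv P y₀ = 1) (h2 : iteratedDeriv 2 P y₀ ≠ 0) :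
    (∀ᶠ y in 𝓝 y₀, y ≠ y₀ → y < P y) ∨ (∀ᶠ y in 𝓝 y₀, y ≠ y₀ → P y < y) := by
  rw [iteratedDeriv_succ, iteratedDeriv_one] at h2
  have hd : ∀ᶠ y in 𝓝 y₀, DifferentiableAt ℝ P y :=
    ((hP.of_le (by norm_num : (1 : WithTop ℕ∞) ≤ 2)).eventually (by norm_num)).mono
      fun y hy => hy.differentiableAt (by norm_num)
  have e1 : deriv (fun y => P y - y) =ᶠ[𝓝 y₀] fun y => deriv P y - 1 :=
    hd.mono fun y hy => (hy.hasDerivAt.sub (hasDerivAt_id' y)).deriv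
  have e2 : deriv (fun y => y - P y) =ᶠ[𝓝 y₀] fun y => 1 - deriv P y :=
    hd.mono fun y hy => ((hasDerivAt_id' y).sub hy.hasDerivAt).deriv
  rcases lt_or_gt_of_ne h2 with h | h
  · right
    have := eventually_pos_of_deriv_deriv_pos (q := fun y => y - P y) (y₀ := y₀)
      (contDiffAt_id.sub hP) (by simp [h0]) (by rw [e2.self_of_nhds]; simp [h1])
      (by rw [e2.deriv_eq, deriv_const_sub]; linarith)
    exact this.mono fun y hy hne => by linarith [hy hne]
  · left
    have := eventually_pos_of_deriv_deriv_pos (q := fun y => P y - y) (y₀ := y₀)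
      (hP.sub contDiffAt_id) (by simp [h0]) (by rw [e1.self_of_nhds]; simp [h1])
      (by rw [e1.deriv_eq, deriv_sub_const]; exact h)
    exact this.mono fun y hy hne => by linarith [hy hne]

/-- The orbit through the point of the nullcline with abscissa `x₀`: forwards it meets `x = √ε`
downwards at time `ts` and then `x = a`, backwards it meets `x = a`. -/
structure Shoot (a k m ε x₀ ts Tf Tb w Vf Vb : ℝ) : Prop where
  ts_pos : 0 < ts
  ts_lt : ts < Tf
  Tb_pos : 0 < Tb
  w_pos : 0 < w
  Vf_pos : 0 < Vf
  section_eq : ∀ γ, IsSolution a k m ε γ → γ 0 = pt a k m ε x₀ 0 → γ ts = pt a k m ε √ε (-w)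
  fwd_eq : ∀ γ, IsSolution a k m ε γ → γ 0 = pt a k m ε x₀ 0 → γ Tf = pt a k m ε a (-Vf)
  bwd_eq : ∀ γ, IsSolution a k m ε γ → γ 0 = pt a k m ε x₀ 0 → γ (-Tb) = pt a k m ε a (-Vb)
  fwd_null : ∀ γ, IsSolution a k m ε γ → γ 0 = pt a k m ε x₀ 0 →
    ∀ t ∈ Ioc 0 Tf, vel a k m ε γ t = 0 → a < (γ t).1
  fwd_section : ∀ γ, IsSolution a k m ε γ → γ 0 = pt a k m ε x₀ 0 →
    ∀ t ∈ Ioc 0 Tf, (γ t).1 = √ε → vel a k m ε γ t ≤ 0 → t = ts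
  bwd_neg : ∀ γ, IsSolution a k m ε γ → γ 0 = pt a k m ε x₀ 0 →
    ∀ t ∈ Ico (-Tb) 0, vel a k m ε γ t < 0 ∧ (γ t).1 ≤ a

theorem IsSolution.strictAntiOn_fst {a k m ε : ℝ} {γ : ℝ → ℝ × ℝ} (hγ : IsSolution a k m ε γ)
    {s t : ℝ} (h : ∀ u ∈ Ico s t, vel a k m ε γ u < 0) :
    StrictAntiOn (fun u => (γ u).1) (Icc s t) := by
  refine strictAntiOn_of_deriv_neg (convex_Icc s t)
    (continuous_fst.comp hγ.continuous).continuousOn fun u hu => ?_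
  rw [interior_Icc] at hu
  rw [(hγ.hasDerivAt_fst u).deriv]
  exact h u ⟨hu.1.le, hu.2⟩

theorem IsPeriodicOrbit.exists_from {a k m ε : ℝ} {Γ : Set (ℝ × ℝ)}
    (h : IsPeriodicOrbit a k m ε Γ) {p : ℝ × ℝ} (hp : p ∈ Γ) :
    ∃ (γ : ℝ → ℝ × ℝ) (T : ℝ), IsSolution a k m ε γ ∧ 0 < T ∧ (∀ t, γ (t + T) = γ t) ∧
      Γ = range γ ∧ γ 0 = p := by
  obtain ⟨γ, T, hγ, hT, hper, -, rfl⟩ := h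
  obtain ⟨t₀, rfl⟩ := hp
  refine ⟨fun t => γ (t + t₀), T, hγ.comp_add t₀, hT, fun t => ?_, ?_, by simp⟩
  · change γ (t + T + t₀) = γ (t + t₀)
    rw [show γ (t + T + t₀) = γ (t + t₀ + T) by congr 1; ring, hper]
  · ext q
    constructor
    · rintro ⟨t, rfl⟩; exact ⟨t - t₀, by simp⟩
    · rintro ⟨t, rfl⟩; exact ⟨_, rfl⟩

/-- After the forward crossing of `x = a` the orbit moves left until its velocity first vanishes.
That happens to the left of `a`, so by the definition of width it happens at `(x₀, f x₀)` again. The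
backward arc from this point crosses `x = a` as well. Since `x` is strictly monotone on both arcs,
the two crossings are the same point, with the same speed. -/
theorem Shoot.closes {a k m ε x₀ ts Tf Tb w Vf Vb : ℝ} (hε1 : ε ≤ 1)
    (hs : Shoot a k m ε x₀ ts Tf Tb w Vf Vb) {Γ : Set (ℝ × ℝ)}
    (hΓ : IsPeriodicOrbit a k m ε Γ) (hw : HasWidth a k m ε Γ x₀) : Vf = Vb := by
  have hp0 : (x₀, f a k m ε x₀) ∈ Γ := by
    have : (x₀, f a k m ε x₀) ∈ {p : ℝ × ℝ | p ∈ Γ ∧ p.2 = f a k m ε p.1 ∧ p.1 < a} := by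
      rw [hw]; rfl
    exact this.1
  obtain ⟨γ, T, hγ, hT, hper, rfl, h0⟩ := hΓ.exists_from hp0
  have h0' : γ 0 = pt a k m ε x₀ 0 := by rw [h0, pt, add_zero]
  have hcv := hγ.continuous_vel hε1
  have hf := eq_pt.1 (hs.fwd_eq γ hγ h0')
  have hvTf : vel a k m ε γ Tf < 0 := by rw [hf.2]; linarith [hs.Vf_pos]
  have hper' : ∀ n : ℕ, γ (n * T) = γ 0 := by
    intro n
    induction n with
    | zero => simp
    | succ n ih => rw [← ih, ← hper (n * T)]; congr 1; push_cast; ring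
  obtain ⟨n, hn⟩ := exists_nat_gt (Tf / T)
  rw [div_lt_iff₀ hT] at hn
  -- The velocity vanishes again at multiples of the period, so there is a first zero after `Tf`,
  -- and the velocity is negative up to it.
  set N := {t : ℝ | Tf ≤ t ∧ vel a k m ε γ t = 0} with hN
  have hNne : N.Nonempty := ⟨n * T, hn.le, by
    have := (eq_pt.1 ((hper' n).trans h0')).2
    exact this⟩
  have hNc : IsClosed N := (isClosed_le continuous_const continuous_id).inter
    (isClosed_eq hcv continuous_const)
  have hNb : BddBelow N := ⟨Tf, fun t ht => ht.1⟩
  obtain ⟨t1, ht1⟩ : ∃ t1, t1 = sInf N := ⟨_, rfl⟩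
  have htm : t1 ∈ N := ht1 ▸ hNc.csInf_mem hNne hNb
  have hlt : Tf < t1 := lt_of_le_of_ne htm.1 (fun h => by
    rw [h] at hvTf; rw [htm.2] at hvTf; exact lt_irrefl _ hvTf)
  have hneg : ∀ t ∈ Ico Tf t1, vel a k m ε γ t < 0 := by
    intro t ht
    by_contra hge
    push Not at hge
    obtain ⟨u, hu, hu0⟩ := intermediate_value_Icc ht.1 hcv.continuousOn ⟨hvTf.le, hge⟩
    have : t1 ≤ u := ht1 ▸ csInf_le hNb ⟨hu.1, hu0⟩
    linarith [hu.2, ht.2]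
  have hanti := hγ.strictAntiOn_fst hneg
  have hx1 : (γ t1).1 < a := by
    have := hanti ⟨le_rfl, hlt.le⟩ ⟨hlt.le, le_rfl⟩ hlt
    simp only [hf.1] at this
    exact this
  have h1 : γ t1 = (x₀, f a k m ε x₀) := by
    have : γ t1 ∈ {p : ℝ × ℝ | p ∈ range γ ∧ p.2 = f a k m ε p.1 ∧ p.1 < a} :=
      ⟨⟨t1, rfl⟩, by have := htm.2; unfold vel at this; linarith, hx1⟩
    rw [hw] at this
    exact this
  have hγ' := hγ.comp_add t1
  have h2 : (fun t => γ (t + t1)) 0 = pt a k m ε x₀ 0 := by simp only [zero_add]; rw [h1, pt, add_zero]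
  have hb := hs.bwd_eq _ hγ' h2
  have hbn := hs.bwd_neg _ hγ' h2
  have hanti2 : StrictAntiOn (fun u => (γ u).1) (Icc (-Tb + t1) t1) :=
    hγ.strictAntiOn_fst fun u hu => by
      have := (hbn (u - t1) ⟨by linarith [hu.1], by linarith [hu.2]⟩).1
      simpa [vel] using this
  have hb' : (γ (-Tb + t1)).1 = a ∧ vel a k m ε γ (-Tb + t1) = -Vb := eq_pt.1 hb
  have hTb := hs.Tb_pos
  have heq : -Tb + t1 = Tf := by
    rcases lt_trichotomy (-Tb + t1) Tf with h | h | h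
    · have := hanti2 ⟨le_rfl, by linarith⟩ ⟨h.le, hlt.le⟩ h
      simp only [hb'.1, hf.1] at this
      exact absurd this (lt_irrefl _)
    · exact h
    · have := hanti ⟨le_rfl, hlt.le⟩ ⟨h.le, by linarith⟩ h
      simp only [hb'.1, hf.1] at this
      exact absurd this (lt_irrefl _)
  rw [heq] at hb'
  linarith [hb'.2, hf.2]

/-- The closed orbit through the point of the nullcline with abscissa `x₀`. -/
theorem Shoot.exists_orbit {a k m ε x₀ ts Tf Tb w V : ℝ} (hε1 : ε ≤ 1) (hx₀ : x₀ < a)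
    (haσ : a < √ε) (hs : Shoot a k m ε x₀ ts Tf Tb w V V) :
    ∃ γ T, IsSolution a k m ε γ ∧ γ 0 = pt a k m ε x₀ 0 ∧ 0 < T ∧ (∀ t, γ (t + T) = γ t) ∧
      IsPeriodicOrbit a k m ε (range γ) ∧ HasWidth a k m ε (range γ) x₀ ∧
      (∀ t, vel a k m ε γ t = 0 → (γ t).1 ≤ a → (γ t).1 = x₀) ∧
      (∀ t, (γ t).1 = √ε → vel a k m ε γ t ≤ 0 → γ t = pt a k m ε √ε (-w)) := by
  obtain ⟨γ, hγ, h0⟩ := exists_solution a k m hε1 (pt a k m ε x₀ 0) 0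
  have hf := hs.fwd_eq γ hγ h0
  have hb := hs.bwd_eq γ hγ h0
  have hT : 0 < Tf + Tb := by linarith [hs.ts_pos, hs.ts_lt, hs.Tb_pos]
  have hper : ∀ t, γ (t + (Tf + Tb)) = γ t := by
    -- Equal speeds on `x = a` mean that the points at times `Tf` and `-Tb` coincide. By uniqueness
    -- the solution is periodic.
    have := solution_unique hε1 (hγ.comp_add (Tf + Tb)) hγ (t₀ := -Tb)
      (by rw [hb, show -Tb + (Tf + Tb) = Tf by ring, hf])
    intro t
    exact congrFun this t
  have hred : ∀ t, ∃ u ∈ Ico (-Tb) Tf, γ u = γ t := by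
    intro t
    obtain ⟨u, hu, hu'⟩ := Function.Periodic.exists_mem_Ico (f := γ) hper hT t (-Tb)
    exact ⟨u, by simpa using hu, hu'.symm⟩
  have hvel : ∀ {u t}, γ u = γ t → vel a k m ε γ u = vel a k m ε γ t := by
    intro u t h; simp only [vel, h]
  have hnull : ∀ t, vel a k m ε γ t = 0 → (γ t).1 ≤ a → γ t = pt a k m ε x₀ 0 := by
    intro t hv hx
    obtain ⟨u, hu, hut⟩ := hred t
    rw [← hut] at hx ⊢
    rw [← hvel hut] at hv
    rcases lt_trichotomy u 0 with h | h | h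
    · exact absurd hv (hs.bwd_neg γ hγ h0 u ⟨hu.1, h⟩).1.ne
    · rw [h, h0]
    · exact absurd hx (not_le.2 (hs.fwd_null γ hγ h0 u ⟨h, hu.2.le⟩ hv))
  refine ⟨γ, Tf + Tb, hγ, h0, hT, hper, ⟨γ, Tf + Tb, hγ, hT, hper, ⟨Tf, ?_⟩, rfl⟩, ?_, ?_, ?_⟩
  · intro h
    have := hvel h
    rw [(eq_pt.1 h0).2, (eq_pt.1 hf).2] at this
    linarith [hs.Vf_pos]
  · ext p
    constructor
    · rintro ⟨⟨t, rfl⟩, h2, h3⟩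
      rw [hnull t (by unfold vel; linarith) h3.le, pt, add_zero]
      rfl
    · rintro rfl
      refine ⟨⟨0, by rw [h0, pt, add_zero]⟩, rfl, hx₀⟩
  · intro t hv hx
    rw [hnull t hv hx]; rfl
  · intro t hx hv
    obtain ⟨u, hu, hut⟩ := hred t
    rw [← hut] at hx ⊢
    rw [← hvel hut] at hv
    rcases lt_trichotomy u 0 with h | h | h
    · linarith [(hs.bwd_neg γ hγ h0 u ⟨hu.1, h⟩).2]
    · rw [h, h0] at hx
      simp only [pt] at hx
      linarith
    · rw [hs.fwd_section γ hγ h0 u ⟨h, hu.2.le⟩ hx hv, hs.section_eq γ hγ h0]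

theorem continuous_pt {a k m ε : ℝ} (hε1 : ε ≤ 1) (v : ℝ) :
    Continuous fun x => pt a k m ε x v := by
  have := continuous_f a k m hε1
  unfold pt
  fun_prop

/-- Orbits that start near `(x₀, f x₀)` meet the cross section. -/
theorem Shoot.exists_crossing {a k m ε x₀ ts Tf Tb w Vf Vb : ℝ} (hε1 : ε ≤ 1)
    (hs : Shoot a k m ε x₀ ts Tf Tb w Vf Vb) :
    ∀ᶠ x in 𝓝 x₀, ∀ γ, IsSolution a k m ε γ → γ 0 = pt a k m ε x 0 →
      ∃ t, (γ t).1 = √ε ∧ vel a k m ε γ t < 0 := by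
  obtain ⟨γ, hγ, h0⟩ := exists_solution a k m hε1 (pt a k m ε x₀ 0) 0
  have hsec := eq_pt.1 (hs.section_eq γ hγ h0)
  have hw := hs.w_pos
  have hcv := hγ.continuous_vel hε1
  obtain ⟨η, hη, hball⟩ := Metric.continuousAt_iff.1 (hcv.continuousAt (x := ts)) w hw
  have hneg : ∀ t, |t - ts| < η → vel a k m ε γ t < 0 := by
    intro t ht
    have := hball (x := t) (by rwa [Real.dist_eq])
    rw [Real.dist_eq, hsec.2, abs_lt] at this
    linarith [this.2]
  set ρ := min (η / 2) ts with hρ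
  have hρ0 : 0 < ρ := lt_min (by linarith) hs.ts_pos
  have hρη : ρ < η := (min_le_left _ _).trans_lt (by linarith)
  have hρt : ρ ≤ ts := min_le_right _ _
  have hneg' : ∀ t ∈ Icc (ts - ρ) (ts + ρ), vel a k m ε γ t < 0 := fun t ht => by
    refine hneg t ?_
    rw [abs_lt]; constructor <;> linarith [ht.1, ht.2]
  have hanti := hγ.strictAntiOn_fst fun u hu => hneg' u (Ico_subset_Icc_self hu)
  have hx1 : √ε < (γ (ts - ρ)).1 := by
    have := hanti ⟨le_rfl, by linarith⟩ ⟨by linarith, by linarith⟩ (by linarith : ts - ρ < ts)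
    simpa only [hsec.1] using this
  have hx2 : (γ (ts + ρ)).1 < √ε := by
    have := hanti ⟨by linarith, by linarith⟩ ⟨by linarith, le_rfl⟩ (by linarith : ts < ts + ρ)
    simpa only [hsec.1] using this
  have hopen : IsOpen {p : ℝ × ℝ | p.2 - f a k m ε p.1 < 0} := by
    have := continuous_f a k m hε1
    exact isOpen_lt (by fun_prop) continuous_const
  -- A tube around the compact arc that crosses `x = √ε` lies in the region of negative velocity.
  -- Orbits that start close by stay in this tube and end on the other side of the line.
  obtain ⟨δ, hδ, hth⟩ := (isCompact_Icc.image hγ.continuous).exists_thickening_subset_open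
    (s := γ '' Icc (ts - ρ) (ts + ρ)) hopen (by
      rintro p ⟨t, ht, rfl⟩; exact hneg' t ht)
  obtain ⟨C, hC, hdist⟩ := exists_dist_solution_le (a := a) (k := k) (m := m) hε1 (ts + ρ)
  set δ' := min δ (min ((γ (ts - ρ)).1 - √ε) (√ε - (γ (ts + ρ)).1)) with hδ'
  have hδ0 : 0 < δ' := lt_min hδ (lt_min (by linarith) (by linarith))
  have hcont := (continuous_pt (a := a) (k := k) (m := m) hε1 0).continuousAt (x := x₀)
  have hev : ∀ᶠ x in 𝓝 x₀, dist (pt a k m ε x 0) (pt a k m ε x₀ 0) < δ' / C :=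
    hcont.eventually (Metric.ball_mem_nhds _ (by positivity))
  filter_upwards [hev] with x hx γ' hγ' h0'
  have hd : ∀ t ∈ Icc 0 (ts + ρ), dist (γ' t) (γ t) < δ' := by
    intro t ht
    refine (hdist γ' γ hγ' hγ t ht).trans_lt ?_
    rw [h0', h0]
    rwa [lt_div_iff₀ hC] at hx
  have hd1 : ∀ t ∈ Icc 0 (ts + ρ), |(γ' t).1 - (γ t).1| < δ' := fun t ht =>
    (le_max_left _ _).trans_lt (hd t ht)
  have h1 := abs_lt.1 (hd1 (ts - ρ) ⟨by linarith, by linarith⟩)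
  have h2 := abs_lt.1 (hd1 (ts + ρ) ⟨by linarith, by linarith⟩)
  have h3 : δ' ≤ (γ (ts - ρ)).1 - √ε := (min_le_right _ _).trans (min_le_left _ _)
  have h4 : δ' ≤ √ε - (γ (ts + ρ)).1 := (min_le_right _ _).trans (min_le_right _ _)
  obtain ⟨t, ht, htx⟩ := intermediate_value_Icc' (by linarith : ts - ρ ≤ ts + ρ)
    (continuous_fst.comp hγ'.continuous).continuousOn
    (show √ε ∈ Icc ((γ' (ts + ρ)).1) ((γ' (ts - ρ)).1) from ⟨by linarith, by linarith⟩)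
  refine ⟨t, htx, ?_⟩
  have : γ' t ∈ Metric.thickening δ (γ '' Icc (ts - ρ) (ts + ρ)) :=
    Metric.mem_thickening_iff.2 ⟨γ t, ⟨t, ht, rfl⟩,
      (hd t ⟨by linarith [ht.1], ht.2⟩).trans_le (min_le_left _ _)⟩
  exact hth this

/-- A periodic orbit has a point on the nullcline that is not to the right of `x = a`. -/
theorem exists_leftmost {a k m ε : ℝ} (hε : 0 < ε) {γ : ℝ → ℝ × ℝ} {T : ℝ}
    (hγ : IsSolution a k m ε γ) (hT : 0 < T) (hper : ∀ t, γ (t + T) = γ t) :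
    ∃ t, vel a k m ε γ t = 0 ∧ (γ t).1 ≤ a := by
  have hc : Continuous fun t => (γ t).1 := continuous_fst.comp hγ.continuous
  obtain ⟨t, -, ht⟩ := isCompact_Icc.exists_isMinOn (nonempty_Icc.2 hT.le) hc.continuousOn
  have hmin : ∀ u, (γ t).1 ≤ (γ u).1 := by
    intro u
    obtain ⟨v, hv, hv'⟩ := Function.Periodic.exists_mem_Ico (f := γ) hper hT u 0
    rw [hv']
    exact ht ⟨hv.1, by linarith [hv.2]⟩
  refine ⟨t, ?_, ?_⟩
  · have : IsLocalMin (fun t => (γ t).1) t := Eventually.of_forall hmin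
    exact this.hasDerivAt_eq_zero (hγ.hasDerivAt_fst t)
  · by_contra h
    push Not at h
    -- If the leftmost point were to the right of `x = a`, then `y' = ε (a - x)` would be negative
    -- throughout, contradicting periodicity.
    have hanti : StrictAnti fun u => (γ u).2 := by
      refine strictAnti_of_deriv_neg fun u => ?_
      rw [(hγ.hasDerivAt_snd u).deriv]
      have := hmin u
      nlinarith
    have := hanti (by linarith : (0 : ℝ) < 0 + T)
    simp only [hper] at this
    exact lt_irrefl _ this

/-- The neighbourhood `U` is the complement of two closed sets: the part of the nullcline left of
`a` away from abscissa `x₀`, and the part of the section away from `y₀`. A periodic orbit in `U` has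
a leftmost point near `(x₀, f x₀)`, hence meets the section, and only near `y₀`. The set `Y` of
heights at which it does so is compact and invariant under the return map. As this map moves all
points other than `y₀` in one direction, `Y` must contain `y₀`, and the orbit is the given one. -/
theorem Shoot.isLimitCycle {a k m ε x₀ ts Tf Tb w V y₀ : ℝ} (hε0 : 0 < ε) (hε1 : ε ≤ 1)
    (hx₀ : x₀ < a) (hs : Shoot a k m ε x₀ ts Tf Tb w V V) {γ : ℝ → ℝ × ℝ}
    (hγ : IsSolution a k m ε γ) (hγ0 : γ 0 = pt a k m ε x₀ 0)
    (hper : IsPeriodicOrbit a k m ε (range γ))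
    (hnull : ∀ t, vel a k m ε γ t = 0 → (γ t).1 ≤ a → (γ t).1 = x₀)
    (hsec : ∀ t, (γ t).1 = √ε → vel a k m ε γ t ≤ 0 → γ t = pt a k m ε √ε (-w))
    (hy₀ : y₀ = f a k m ε √ε - w) {P : ℝ → ℝ → ℝ} (hP : IsPoincareMap k m ε y₀ a P)
    (hP2 : ContDiffAt ℝ 2 (fun y => P y a) y₀) (hP0 : P y₀ a = y₀)
    (hP1 : deriv (fun y => P y a) y₀ = 1) (hPn : iteratedDeriv 2 (fun y => P y a) y₀ ≠ 0) :
    IsLimitCycle a k m ε (range γ) := by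
  refine ⟨hper, ?_⟩
  have hcf := continuous_f a k m hε1
  have hw := hs.w_pos
  obtain ⟨δ₁', hδ₁', hcross⟩ := Metric.eventually_nhds_iff.1 (hs.exists_crossing hε1)
  set δ₁ := min δ₁' (a - x₀) with hδ₁
  have hδ₁0 : 0 < δ₁ := lt_min hδ₁' (by linarith)
  have hPa : ∀ᶠ y in 𝓝 y₀, (√ε, y) ∈ crossSection a k m ε ∧
      ∃ (γ : ℝ → ℝ × ℝ) (τ : ℝ), IsSolution a k m ε γ ∧ γ 0 = (√ε, y) ∧ 0 < τ ∧
        γ τ = (√ε, P y a) ∧ γ τ ∈ crossSection a k m ε ∧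
        ∀ t ∈ Ioo 0 τ, γ t ∉ crossSection a k m ε := by
    have : Tendsto (fun y : ℝ => (y, a)) (𝓝 y₀) (𝓝 (y₀, a)) :=
      (continuous_id.prodMk continuous_const).tendsto y₀
    exact this.eventually hP
  have hsign := saddleNode_sign hP2 hP0 hP1 hPn
  have hγs : γ ts = (√ε, y₀) := by
    rw [hs.section_eq γ hγ hγ0, hy₀, pt, sub_eq_add_neg]
  have hmono : ∃ δ₂ > 0, δ₂ ≤ w ∧ (∀ y, |y - y₀| < δ₂ → (√ε, y) ∈ crossSection a k m ε ∧
      ∃ (γ : ℝ → ℝ × ℝ) (τ : ℝ), IsSolution a k m ε γ ∧ γ 0 = (√ε, y) ∧ 0 < τ ∧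
        γ τ = (√ε, P y a) ∧ γ τ ∈ crossSection a k m ε ∧
        ∀ t ∈ Ioo 0 τ, γ t ∉ crossSection a k m ε) ∧
      ((∀ y, |y - y₀| < δ₂ → y ≠ y₀ → y < P y a) ∨
        (∀ y, |y - y₀| < δ₂ → y ≠ y₀ → P y a < y)) := by
    obtain ⟨d1, hd1, h1⟩ := Metric.eventually_nhds_iff.1 hPa
    rcases hsign with h | h
    · obtain ⟨d2, hd2, h2⟩ := Metric.eventually_nhds_iff.1 h
      refine ⟨min w (min d1 d2), lt_min hw (lt_min hd1 hd2), min_le_left _ _, fun y hy => h1 ?_,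
        Or.inl fun y hy => h2 ?_⟩
      · exact hy.trans_le ((min_le_right _ _).trans (min_le_left _ _))
      · exact hy.trans_le ((min_le_right _ _).trans (min_le_right _ _))
    · obtain ⟨d2, hd2, h2⟩ := Metric.eventually_nhds_iff.1 h
      refine ⟨min w (min d1 d2), lt_min hw (lt_min hd1 hd2), min_le_left _ _, fun y hy => h1 ?_,
        Or.inr fun y hy => h2 ?_⟩
      · exact hy.trans_le ((min_le_right _ _).trans (min_le_left _ _))
      · exact hy.trans_le ((min_le_right _ _).trans (min_le_right _ _))
  obtain ⟨δ₂, hδ₂0, hδ₂w, hPδ, hmono⟩ := hmono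
  set F₁ : Set (ℝ × ℝ) := {p | p.2 = f a k m ε p.1 ∧ p.1 ≤ a ∧ δ₁ ≤ |p.1 - x₀|} with hF₁
  set F₂ : Set (ℝ × ℝ) := {p | p.1 = √ε ∧ p.2 ≤ f a k m ε √ε ∧ δ₂ ≤ |p.2 - y₀|} with hF₂
  have hc1 : IsClosed F₁ := (isClosed_eq continuous_snd (hcf.comp continuous_fst)).inter
    ((isClosed_le continuous_fst continuous_const).inter
      (isClosed_le continuous_const (continuous_fst.sub continuous_const).abs))
  have hc2 : IsClosed F₂ := (isClosed_eq continuous_fst continuous_const).inter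
    ((isClosed_le continuous_snd continuous_const).inter
      (isClosed_le continuous_const (continuous_snd.sub continuous_const).abs))
  refine ⟨(F₁ ∪ F₂)ᶜ, (hc1.union hc2).isOpen_compl, ?_, fun Γ' hΓ' hsub => ?_⟩
  · rintro p ⟨t, rfl⟩ (⟨h1, h2, h3⟩ | ⟨h1, h2, h3⟩)
    · rw [hnull t (by unfold vel; linarith) h2, sub_self, abs_zero] at h3
      linarith
    · rw [hsec t h1 (by unfold vel; rw [h1]; linarith), pt] at h3
      simp only [hy₀] at h3
      rw [show f a k m ε √ε + -w - (f a k m ε √ε - w) = 0 by ring, abs_zero] at h3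
      linarith
  have hU1 : ∀ p ∈ Γ', p.2 = f a k m ε p.1 → p.1 ≤ a → |p.1 - x₀| < δ₁ := by
    intro p hp h1 h2
    by_contra h3
    exact hsub hp (Or.inl ⟨h1, h2, not_lt.1 h3⟩)
  have hU2 : ∀ y, (√ε, y) ∈ Γ' → y ≤ f a k m ε √ε → |y - y₀| < δ₂ := by
    intro y hp h1
    by_contra h3
    exact hsub hp (Or.inr ⟨rfl, h1, not_lt.1 h3⟩)
  obtain ⟨γ', T', hγ', hT', hper', -, rfl⟩ := hΓ'
  obtain ⟨t1, hv1, hx1⟩ := exists_leftmost hε0 hγ' hT' hper'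
  have hx1' := hU1 (γ' t1) ⟨t1, rfl⟩ (by unfold vel at hv1; linarith) hx1
  obtain ⟨t2, hx2, hv2⟩ := hcross (y := (γ' t1).1)
    (hx1'.trans_le (min_le_left _ _)) _ (hγ'.comp_add t1)
    (by simp only [zero_add]; exact eq_pt.2 ⟨rfl, hv1⟩)
  set Y : Set ℝ := {y | (√ε, y) ∈ range γ' ∧ y ≤ f a k m ε √ε} with hY
  have hcomp : IsCompact (range γ') := by
    have : range γ' = γ' '' Icc 0 T' := by
      ext q
      constructor
      · rintro ⟨t, rfl⟩
        obtain ⟨u, hu, hu'⟩ := Function.Periodic.exists_mem_Ico (f := γ') hper' hT' t 0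
        exact ⟨u, ⟨hu.1, by linarith [hu.2]⟩, hu'.symm⟩
      · rintro ⟨t, -, rfl⟩; exact ⟨t, rfl⟩
    rw [this]
    exact isCompact_Icc.image hγ'.continuous
  have hYc : IsCompact Y := by
    have hcl : IsClosed Y := (hcomp.isClosed.preimage (f := fun y : ℝ => (√ε, y)) (by fun_prop)).inter
      (isClosed_le continuous_id continuous_const)
    refine Metric.isCompact_of_isClosed_isBounded hcl
      ((Metric.isBounded_ball (x := y₀) (r := δ₂)).subset ?_)
    intro y hy
    rw [Metric.mem_ball, Real.dist_eq]
    exact hU2 y hy.1 hy.2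
  have hYne : Y.Nonempty := by
    refine ⟨(γ' (t2 + t1)).2, ⟨t2 + t1, ?_⟩, ?_⟩
    · ext
      · exact hx2
      · rfl
    · simp only [vel] at hv2
      rw [hx2] at hv2
      linarith
  have hPY : ∀ y ∈ Y, P y a ∈ Y := by
    intro y hy
    obtain ⟨hcs, η, τ, hη, hη0, hτ, hητ, hητ', -⟩ := hPδ y (hU2 y hy.1 hy.2)
    obtain ⟨u, hu⟩ := hy.1
    have : η = fun t => γ' (t + u) :=
      solution_unique hε1 hη (hγ'.comp_add u) (t₀ := 0) (by rw [hη0]; simp [hu])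
    rw [hητ] at hητ'
    refine ⟨⟨τ + u, ?_⟩, hητ'.2.le⟩
    rw [← hητ, this]
  -- If points are moved upwards, the greatest element of `Y` cannot move and is `y₀`. If they are
  -- moved downwards, the same holds for the least element.
  have hy₀Y : y₀ ∈ Y := by
    rcases hmono with h | h
    · obtain ⟨y, hy, hmax⟩ := hYc.exists_isGreatest hYne
      by_cases hne : y = y₀
      · exact hne ▸ hy
      · exact absurd (hmax (hPY y hy)) (not_le.2 (h y (hU2 y hy.1 hy.2) hne))
    · obtain ⟨y, hy, hmin⟩ := hYc.exists_isLeast hYne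
      by_cases hne : y = y₀
      · exact hne ▸ hy
      · exact absurd (hmin (hPY y hy)) (not_le.2 (h y (hU2 y hy.1 hy.2) hne))
  obtain ⟨u, hu⟩ := hy₀Y.1
  have hE : (fun t => γ' (t + u)) = fun t => γ (t + ts) :=
    solution_unique hε1 (hγ'.comp_add u) (hγ.comp_add ts) (t₀ := 0) (by simp [hu, hγs])
  ext q
  constructor
  · rintro ⟨t, rfl⟩
    exact ⟨t - u + ts, by rw [← congrFun hE (t - u)]; simp⟩
  · rintro ⟨t, rfl⟩
    exact ⟨t - ts + u, by
      have := congrFun hE (t - ts)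
      simp only [sub_add_cancel] at this
      exact this⟩

end PWLCanard

/-! ### Half-returns of the contracting node and quarter turns of the central focus. -/

namespace PWLCanard

section Node

variable {l u : ℝ}

theorem nodeS_pos_of_pos {α β t : ℝ} (h : α < β) (ht : 0 < t) : 0 < nodeS α β t := by
  unfold nodeS
  have : exp (α * t) < exp (β * t) := exp_lt_exp.2 (by nlinarith)
  exact div_pos (by linarith) (by linarith)

theorem nodeS_symm (α β t : ℝ) : nodeS α β t = nodeS β α t := by
  unfold nodeS
  rw [← neg_sub (exp (α * t)), ← neg_sub α β, neg_div_neg_eq]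

theorem strictAntiOn_nodeC {α β : ℝ} (h : α < β) (h0 : 0 < α * β) :
    StrictAntiOn (nodeC α β) (Ici 0) := by
  have F := fund_node h.ne rfl rfl
  refine strictAntiOn_of_deriv_neg (convex_Ici 0) F.smooth_C.continuous.continuousOn fun t ht => ?_
  rw [interior_Ici] at ht
  rw [(F.deriv_C t).deriv, neg_lt_zero]
  exact mul_pos h0 (nodeS_pos_of_pos h ht)

theorem nodeC_lt_one {α β t : ℝ} (h : α < β) (h0 : 0 < α * β) (ht : 0 < t) : nodeC α β t < 1 := by
  have := strictAntiOn_nodeC h h0 (mem_Ici.2 le_rfl) (mem_Ici.2 ht.le) ht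
  rwa [(fund_node h.ne rfl rfl).C_zero] at this

theorem tendsto_exp_neg_mul (hl : 0 < l) : Tendsto (fun t : ℝ => exp (-l * t)) atTop (𝓝 0) := by
  exact tendsto_exp_atBot.comp (tendsto_id.const_mul_atTop_of_neg (neg_lt_zero.2 hl))

/-- The quantity that governs half-returns of the contracting node to a vertical line. -/
theorem node_turn_pos (hl : 0 < l) (hlu : l < u) {t : ℝ} (ht : 0 < t) :
    nodeC (-l) (-u) t - (l + u) * nodeS (-l) (-u) t < exp (-((l + u) * t)) := by
  have h1 := nodeC_lt_one hlu (mul_pos hl (hl.trans hlu)) ht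
  -- Time reversal: the left side is `exp (-((l + u) t))` times the function `C` of the expanding
  -- node, which is below one for positive times.
  have h2 : nodeC (-l) (-u) t - (l + u) * nodeS (-l) (-u) t
      = exp (-((l + u) * t)) * nodeC l u t := by
    unfold nodeC nodeS
    have h0 : u - l ≠ 0 := sub_ne_zero.2 hlu.ne'
    have h0' : -u - -l ≠ 0 := by rw [neg_sub_neg]; exact sub_ne_zero.2 hlu.ne
    have e1 : exp (-((l + u) * t)) * exp (l * t) = exp (-u * t) := by
      rw [← Real.exp_add]; congr 1; ring
    have e2 : exp (-((l + u) * t)) * exp (u * t) = exp (-l * t) := by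
      rw [← Real.exp_add]; congr 1; ring
    rw [← e1, ← e2]
    field_simp
    ring
  rw [h2]
  have := exp_pos (-((l + u) * t))
  nlinarith

/-- Ratio `(1 - C) / S`, which determines the half-return time of the contracting node. -/
theorem strictMonoOn_node_ratio (hl : 0 < l) (hlu : l < u) :
    StrictMonoOn (fun t => (1 - nodeC (-l) (-u) t) / nodeS (-l) (-u) t) (Ioi 0) := by
  have F := fund_node (α := -l) (β := -u) (neg_injective.ne hlu.ne) (κ := l + u) (by ring) rfl
  have hS : ∀ t, 0 < t → 0 < nodeS (-l) (-u) t := fun t ht => by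
    rw [nodeS_symm]; exact nodeS_pos_of_pos (neg_lt_neg hlu) ht
  have hd : ∀ t, 0 < t → HasDerivAt (fun t => (1 - nodeC (-l) (-u) t) / nodeS (-l) (-u) t)
      ((exp (-((l + u) * t)) - (nodeC (-l) (-u) t - (l + u) * nodeS (-l) (-u) t))
        / nodeS (-l) (-u) t ^ 2) t := fun t ht => by
    refine (((F.deriv_C t).const_sub 1).div (F.deriv_S t) (hS t ht).ne').congr_deriv ?_
    rw [← F.wronskian t]
    congr 1
    ring
  refine strictMonoOn_of_deriv_pos (convex_Ioi 0)
    (fun t ht => (hd t ht).continuousAt.continuousWithinAt) fun t ht => ?_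
  rw [interior_Ioi] at ht
  rw [(hd t ht).deriv]
  exact div_pos (by linarith [node_turn_pos hl hlu ht]) (pow_pos (hS t ht) 2)

/-- Half-return of the contracting node to the line `X = c`. -/
theorem exists_node_return (hl : 0 < l) (hlu : l < u) {c v : ℝ} (hc : 0 < c) (hv : 0 < v) :
    ∃ t, 0 < t ∧ linX (nodeC (-l) (-u)) (nodeS (-l) (-u)) c v t = c := by
  have F := fund_node (α := -l) (β := -u) (neg_injective.ne hlu.ne) (κ := l + u) (by ring) rfl
  have hlim : Tendsto (linX (nodeC (-l) (-u)) (nodeS (-l) (-u)) c v) atTop (𝓝 0) := by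
    have h1 := ((((tendsto_exp_neg_mul hl).const_mul (-u)).sub
      ((tendsto_exp_neg_mul (hl.trans hlu)).const_mul (-l))).div_const (-u - -l)).const_mul c
    have h2 := (((tendsto_exp_neg_mul (hl.trans hlu)).sub
      (tendsto_exp_neg_mul hl)).div_const (-u - -l)).const_mul v
    have := h1.add h2
    rw [mul_zero, mul_zero, sub_zero, zero_div, mul_zero, mul_zero, add_zero] at this
    refine this.congr fun t => ?_
    simp only [linX, nodeC, nodeS]
  have hd := F.hasDerivAt_linX c v 0
  rw [F.linV_zero] at hd
  have hpos : ∀ᶠ t in 𝓝[>] (0 : ℝ), c < linX (nodeC (-l) (-u)) (nodeS (-l) (-u)) c v t := by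
    have h3 := (hasDerivAt_iff_tendsto_slope.1 hd).mono_left
      (nhdsWithin_mono 0 (fun x (hx : 0 < x) => hx.ne'))
    filter_upwards [h3.eventually_const_lt hv, self_mem_nhdsWithin] with t h4 h5
    have h5 : 0 < t := h5
    rw [slope_def_field, F.linX_zero, sub_zero, lt_div_iff₀ h5] at h4
    linarith
  obtain ⟨t1, h1, ht1⟩ := (hpos.and self_mem_nhdsWithin).exists
  have ht1 : 0 < t1 := ht1
  obtain ⟨t2, h2, ht2⟩ := ((eventually_gt_atTop t1).and (hlim.eventually_lt_const hc)).exists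
  obtain ⟨t, ht, hte⟩ := intermediate_value_Icc' h2.le (F.continuous_linX c v).continuousOn
    (show c ∈ Icc _ _ from ⟨ht2.le, h1.le⟩)
  exact ⟨t, ht1.trans_le ht.1, hte⟩

/-- The return condition is equivalent to `(1 - C) / S = v / c`, and this ratio is strictly
increasing. -/
theorem node_return_unique (hl : 0 < l) (hlu : l < u) {c v t t' : ℝ} (hc : 0 < c)
    (ht : 0 < t) (ht' : 0 < t') (h : linX (nodeC (-l) (-u)) (nodeS (-l) (-u)) c v t = c)
    (h' : linX (nodeC (-l) (-u)) (nodeS (-l) (-u)) c v t' = c) : t = t' := by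
  have hS : ∀ t, 0 < t → 0 < nodeS (-l) (-u) t := fun t ht => by
    rw [nodeS_symm]; exact nodeS_pos_of_pos (neg_lt_neg hlu) ht
  refine (strictMonoOn_node_ratio hl hlu).injOn ht ht' ?_
  have e : ∀ t, 0 < t → linX (nodeC (-l) (-u)) (nodeS (-l) (-u)) c v t = c →
      (1 - nodeC (-l) (-u) t) / nodeS (-l) (-u) t = v / c := fun t ht h => by
    rw [div_eq_div_iff (hS t ht).ne' hc.ne']
    unfold linX at h
    linarith
  simp only [e t ht h, e t' ht' h']

/-- With the return condition and the Wronskian, exit velocity times `S` equals `c` times the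
difference of the two sides of `node_turn_pos`, hence is negative. Before the return the increasing
ratio `(1 - C) / S` is still below `v / c`, which says that the orbit is beyond the line. -/
theorem node_return_spec (hl : 0 < l) (hlu : l < u) {c v t : ℝ} (hc : 0 < c) (ht : 0 < t)
    (h : linX (nodeC (-l) (-u)) (nodeS (-l) (-u)) c v t = c) :
    linV (l + u) (l * u) (nodeC (-l) (-u)) (nodeS (-l) (-u)) c v t < 0 ∧
    ∀ r ∈ Ioo 0 t, c < linX (nodeC (-l) (-u)) (nodeS (-l) (-u)) c v r := by
  have F := fund_node (α := -l) (β := -u) (neg_injective.ne hlu.ne) (κ := l + u) (ε := l * u)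
    (by ring) (by ring)
  have hS : ∀ t, 0 < t → 0 < nodeS (-l) (-u) t := fun t ht => by
    rw [nodeS_symm]; exact nodeS_pos_of_pos (neg_lt_neg hlu) ht
  have hSt := hS t ht
  have hv : v * nodeS (-l) (-u) t = c * (1 - nodeC (-l) (-u) t) := by
    unfold linX at h; linarith
  constructor
  · have h1 := node_turn_pos hl hlu ht
    rw [← F.wronskian t] at h1
    have h2 : linV (l + u) (l * u) (nodeC (-l) (-u)) (nodeS (-l) (-u)) c v t * nodeS (-l) (-u) t
        = c * ((nodeC (-l) (-u) t - (l + u) * nodeS (-l) (-u) t) -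
          (nodeC (-l) (-u) t * (nodeC (-l) (-u) t - (l + u) * nodeS (-l) (-u) t) +
            l * u * nodeS (-l) (-u) t ^ 2)) := by
      unfold linV
      linear_combination (nodeC (-l) (-u) t - (l + u) * nodeS (-l) (-u) t) * hv
    have h3 : linV (l + u) (l * u) (nodeC (-l) (-u)) (nodeS (-l) (-u)) c v t
        * nodeS (-l) (-u) t < 0 := by
      rw [h2]; exact mul_neg_of_pos_of_neg hc (by linarith)
    by_contra hge
    push Not at hge
    exact absurd h3 (not_lt.2 (mul_nonneg hge hSt.le))
  · intro r hr
    have h4 := strictMonoOn_node_ratio hl hlu hr.1 (hr.1.trans hr.2) hr.2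
    simp only at h4
    rw [div_lt_div_iff₀ (hS r hr.1) hSt] at h4
    have h5 : (1 - nodeC (-l) (-u) r) * c < v * nodeS (-l) (-u) r := by
      have : (1 - nodeC (-l) (-u) r) * nodeS (-l) (-u) t * c
          < v * nodeS (-l) (-u) r * nodeS (-l) (-u) t := by
        calc _ < (1 - nodeC (-l) (-u) t) * nodeS (-l) (-u) r * c := by gcongr
          _ = _ := by linear_combination (-nodeS (-l) (-u) r) * hv
      nlinarith
    unfold linX
    linarith

end Node

/-- As long as the oscillator stays on the side `X ≥ 0`, a negative velocity stays negative. -/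
theorem Fund.linV_neg {κ ε : ℝ} {C S : ℝ → ℝ} (F : Fund κ ε C S) (hε : 0 ≤ ε) {X₀ V₀ T : ℝ}
    (hV : V₀ < 0) (hX : ∀ t ∈ Icc 0 T, 0 ≤ linX C S X₀ V₀ t) :
    ∀ t ∈ Icc 0 T, linV κ ε C S X₀ V₀ t < 0 := by
  intro t ht
  have hd : ∀ t, HasDerivAt (fun t => exp (κ * t) * linV κ ε C S X₀ V₀ t)
      (-(ε * linX C S X₀ V₀ t * exp (κ * t))) t := fun t => by
    have hE : HasDerivAt (fun t => exp (κ * t)) (exp (κ * t) * (κ * 1)) t :=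
      ((hasDerivAt_id t).const_mul κ).exp
    refine (hE.mul (F.hasDerivAt_linV X₀ V₀ t)).congr_deriv ?_
    ring
  have hanti : AntitoneOn (fun t => exp (κ * t) * linV κ ε C S X₀ V₀ t) (Icc 0 T) := by
    refine antitoneOn_of_deriv_nonpos (convex_Icc 0 T)
      (fun t _ => (hd t).continuousAt.continuousWithinAt)
      (fun t _ => (hd t).differentiableAt.differentiableWithinAt) fun t ht => ?_
    rw [interior_Icc] at ht
    rw [(hd t).deriv, neg_nonpos]
    have := hX t (Ioo_subset_Icc_self ht)
    positivity
  have := hanti ⟨le_rfl, ht.1.trans ht.2⟩ ht ht.1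
  simp only [F.linV_zero, mul_zero, exp_zero, one_mul] at this
  have hp := exp_pos (κ * t)
  by_contra hge
  push Not at hge
  linarith [mul_nonneg hp.le hge]

/-- The imaginary part of the scaled eigenvalues in the central zone. -/
noncomputable def omg : ℝ := √3 / 2

theorem omg_pos : 0 < omg := by unfold omg; positivity

theorem omg_sq : omg ^ 2 = 3 / 4 := by
  unfold omg
  rw [div_pow, Real.sq_sqrt (by norm_num)]; norm_num

/-- Scaled time that the orbit of `(1, -r)` takes to reach the vertical axis in the central zone. -/
noncomputable def tauf (s r : ℝ) : ℝ := (π / 2 - arctan ((r - s / 2) / omg)) / omg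

/-- Scaled speed with which the orbit of `(1, -r)` reaches the vertical axis in the central
zone. -/
noncomputable def gf (s r : ℝ) : ℝ := exp (-(s / 2 * tauf s r)) * √(omg ^ 2 + (r - s / 2) ^ 2)

theorem tauf_pos (s r : ℝ) : 0 < tauf s r :=
  div_pos (by linarith [arctan_lt_pi_div_two ((r - s / 2) / omg)]) omg_pos

theorem gf_pos (s r : ℝ) : 0 < gf s r := by
  unfold gf
  have := omg_pos
  positivity

theorem omg_mul_tauf (s r : ℝ) : omg * tauf s r = π / 2 - arctan ((r - s / 2) / omg) := by
  unfold tauf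
  have := omg_pos.ne'
  field_simp

theorem fund_center {s ε : ℝ} (hs : s ^ 2 = 1) (hε : 0 < ε) :
    Fund (s * √ε) ε (focC (s * √ε) (omg * √ε)) (focS (s * √ε) (omg * √ε)) := by
  refine fund_foc (mul_ne_zero omg_pos.ne' (Real.sqrt_pos.2 hε).ne') ?_
  rw [mul_pow, mul_pow, hs, omg_sq, Real.sq_sqrt hε.le]; ring

/-- The lower quarter passage through the central zone. -/
theorem center_quarter {s ε c r : ℝ} (hs : s ^ 2 = 1) (hε : 0 < ε) (hc : 0 < c) (hr : 0 < r) :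
    linX (focC (s * √ε) (omg * √ε)) (focS (s * √ε) (omg * √ε)) c (-(c * √ε * r))
      (tauf s r / √ε) = 0 ∧
    linV (s * √ε) ε (focC (s * √ε) (omg * √ε)) (focS (s * √ε) (omg * √ε)) c (-(c * √ε * r))
      (tauf s r / √ε) = -(c * √ε * gf s r) ∧
    (∀ t ∈ Ico 0 (tauf s r / √ε), 0 < linX (focC (s * √ε) (omg * √ε)) (focS (s * √ε) (omg * √ε))
      c (-(c * √ε * r)) t) ∧
    (∀ t ∈ Icc 0 (tauf s r / √ε), linV (s * √ε) ε (focC (s * √ε) (omg * √ε))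
      (focS (s * √ε) (omg * √ε)) c (-(c * √ε * r)) t < 0) := by
  have hσ := Real.sqrt_pos.2 hε
  have hω := omg_pos
  have hσ2 := Real.sq_sqrt hε.le
  have F := fund_center hs hε
  set σ := √ε with hσdef
  set x := (r - s / 2) / omg with hx
  set R := √(1 + x ^ 2) with hR
  have hR0 : 0 < R := Real.sqrt_pos.2 (by positivity)
  have hR2 : R ^ 2 = 1 + x ^ 2 := Real.sq_sqrt (by positivity)
  have hr' : r = omg * x + s / 2 := by rw [hx]; field_simp; ring
  have hcos : cos (omg * tauf s r) = x / R := by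
    rw [omg_mul_tauf, Real.cos_pi_div_two_sub, Real.sin_arctan]
  have hsin : sin (omg * tauf s r) = 1 / R := by
    rw [omg_mul_tauf, Real.sin_pi_div_two_sub, Real.cos_arctan]
  have hν : omg * σ * (tauf s r / σ) = omg * tauf s r := by field_simp
  -- Polar form of the damped oscillation. The phase is chosen so that the first zero of the sine is
  -- at time `tauf s r / √ε`, and the initial phase `omg * tauf s r` is less than `π`.
  have hX : ∀ t, linX (focC (s * σ) (omg * σ)) (focS (s * σ) (omg * σ)) c (-(c * σ * r)) t
      = c * R * exp (-(s * σ / 2 * t)) * sin (omg * tauf s r - omg * σ * t) := fun t => by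
    rw [Real.sin_sub, hcos, hsin]
    unfold linX focC focS
    rw [hr']
    field_simp
    ring
  have h1 : linX (focC (s * σ) (omg * σ)) (focS (s * σ) (omg * σ)) c (-(c * σ * r))
      (tauf s r / σ) = 0 := by
    rw [hX, hν, sub_self, sin_zero, mul_zero]
  have h3 : ∀ t ∈ Ico 0 (tauf s r / σ), 0 < linX (focC (s * σ) (omg * σ))
      (focS (s * σ) (omg * σ)) c (-(c * σ * r)) t := by
    intro t ht
    rw [hX]
    have hlt : omg * σ * t < omg * tauf s r := by
      have := ht.2
      rw [lt_div_iff₀ hσ] at this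
      nlinarith
    have h4 : 0 ≤ omg * σ * t := by
      have := ht.1
      positivity
    have h5 : omg * tauf s r < π := by
      rw [omg_mul_tauf]
      linarith [neg_pi_div_two_lt_arctan x]
    have := Real.sin_pos_of_pos_of_lt_pi (x := omg * tauf s r - omg * σ * t)
      (by linarith) (by linarith)
    positivity
  refine ⟨h1, ?_, h3, F.linV_neg hε.le (by
    have : 0 < c * σ * r := by positivity
    linarith) fun t ht => ?_⟩
  · have e1 : exp (-(s * σ / 2 * (tauf s r / σ))) = exp (-(s / 2 * tauf s r)) := by
      congr 1; field_simp
    have e2 : √(omg ^ 2 + (r - s / 2) ^ 2) = omg * R := by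
      rw [show omg ^ 2 + (r - s / 2) ^ 2 = omg ^ 2 * (1 + x ^ 2) by rw [hr']; ring,
        Real.sqrt_mul (by positivity), Real.sqrt_sq hω.le]
    unfold linV focC focS gf
    rw [hν, e1, e2, hcos, hsin, ← hσ2]
    have e3 : σ ^ 2 * c * (1 / R / (omg * σ)) + c * σ * r * (x / R + s * σ / 2 * (1 / R / (omg * σ))
        - s * σ * (1 / R / (omg * σ))) = c * σ * (omg * R) := by
      rw [hr']
      clear_value x R
      field_simp
      linear_combination -hs - 4 * omg_sq - 4 * omg ^ 2 * hR2
    linear_combination (-(exp (-(s / 2 * tauf s r)))) * e3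
  · rcases eq_or_lt_of_le ht.2 with h | h
    · rw [h, h1]
    · exact (h3 t ⟨ht.1, h⟩).le

end PWLCanard

/-! ### Monotone legs and their assembly into the orbit. -/

namespace PWLCanard

/-- Backward pieces of the orbit are treated as forward legs with friction `-κ`. This gives the
dictionary between the two descriptions. -/
theorem Fund.reverse {κ ε : ℝ} {C S : ℝ → ℝ} (F : Fund κ ε C S) :
    Fund (-κ) ε (fun t => C (-t)) (fun t => -S (-t)) := by
  have hn : ∀ t : ℝ, HasDerivAt (fun t : ℝ => -t) (-1) t := fun t => hasDerivAt_neg t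
  refine ⟨by simp [F.C_zero], by simp [F.S_zero], fun t => ?_, fun t => ?_,
    F.smooth_C.comp contDiff_neg, (F.smooth_S.comp contDiff_neg).neg⟩
  · refine ((F.deriv_C (-t)).comp t (hn t)).congr_deriv ?_
    ring
  · refine ((F.deriv_S (-t)).comp t (hn t)).neg.congr_deriv ?_
    ring

/-- The linear flow with friction `κ` moves `(X₀, V₀)` monotonically to `(X₁, V₁)` in time `T`. -/
structure Leg (κ ε : ℝ) (C S : ℝ → ℝ) (X₀ V₀ X₁ V₁ T : ℝ) : Prop where
  fund : Fund κ ε C S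
  pos : 0 < T
  linX_eq : linX C S X₀ V₀ T = X₁
  linV_eq : linV κ ε C S X₀ V₀ T = V₁
  linV_pos : ∀ t ∈ Ioc 0 T, 0 < linV κ ε C S X₀ V₀ t

namespace Leg

variable {κ ε : ℝ} {C S : ℝ → ℝ} {X₀ V₀ X₁ V₁ T : ℝ}

theorem strictMonoOn (h : Leg κ ε C S X₀ V₀ X₁ V₁ T) :
    StrictMonoOn (linX C S X₀ V₀) (Icc 0 T) := by
  refine strictMonoOn_of_deriv_pos (convex_Icc 0 T) (h.fund.continuous_linX X₀ V₀).continuousOn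
    fun t ht => ?_
  rw [interior_Icc] at ht
  rw [(h.fund.hasDerivAt_linX X₀ V₀ t).deriv]
  exact h.linV_pos t ⟨ht.1, ht.2.le⟩

theorem exit_pos (h : Leg κ ε C S X₀ V₀ X₁ V₁ T) : 0 < V₁ :=
  h.linV_eq ▸ h.linV_pos T ⟨h.pos, le_rfl⟩

theorem lt_exit (h : Leg κ ε C S X₀ V₀ X₁ V₁ T) {t : ℝ} (h0 : 0 ≤ t) (ht : t < T) :
    linX C S X₀ V₀ t < X₁ := by
  have := h.strictMonoOn ⟨h0, ht.le⟩ ⟨h.pos.le, le_rfl⟩ ht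
  rwa [h.linX_eq] at this

theorem start_lt (h : Leg κ ε C S X₀ V₀ X₁ V₁ T) {t : ℝ} (h0 : 0 < t) (ht : t ≤ T) :
    X₀ < linX C S X₀ V₀ t := by
  have := h.strictMonoOn ⟨le_rfl, h.pos.le⟩ ⟨h0.le, ht⟩ h0
  rwa [h.fund.linX_zero] at this

theorem mem_Icc (h : Leg κ ε C S X₀ V₀ X₁ V₁ T) {t : ℝ} (ht : t ∈ Icc 0 T) :
    linX C S X₀ V₀ t ∈ Icc X₀ X₁ := by
  constructor
  · rcases eq_or_lt_of_le ht.1 with h1 | h1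
    · rw [← h1, h.fund.linX_zero]
    · exact (h.start_lt h1 ht.2).le
  · rcases eq_or_lt_of_le ht.2 with h1 | h1
    · rw [h1, h.linX_eq]
    · exact (h.lt_exit ht.1 h1).le

/-- A leg of the time-reversed flow, read backwards. -/
theorem reverse_eq {C' S' : ℝ → ℝ} (h : Leg (-κ) ε C' S' X₀ V₀ X₁ V₁ T) (F : Fund κ ε C S)
    (t : ℝ) : linX C S X₁ (-V₁) t = linX C' S' X₀ V₀ (T - t) ∧
      linV κ ε C S X₁ (-V₁) t = -linV (-κ) ε C' S' X₀ V₀ (T - t) := by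
  have hn : ∀ t : ℝ, HasDerivAt (fun t : ℝ => T - t) (-1) t := fun t => by
    simpa using (hasDerivAt_id t).const_sub T
  have := F.eq_lin (X := fun t => linX C' S' X₀ V₀ (T - t))
    (V := fun t => -linV (-κ) ε C' S' X₀ V₀ (T - t))
    (fun t => (((h.fund.hasDerivAt_linX X₀ V₀ (T - t)).comp t (hn t))).congr_deriv (by ring))
    (fun t => (((h.fund.hasDerivAt_linV X₀ V₀ (T - t)).comp t (hn t)).neg).congr_deriv (by ring)) t
  simp only [sub_zero, h.linX_eq, h.linV_eq] at this
  exact ⟨this.1.symm, this.2.symm⟩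

end Leg

theorem linX_neg (C S : ℝ → ℝ) (X V t : ℝ) : linX C S (-X) (-V) t = -linX C S X V t := by
  unfold linX; ring

theorem linV_neg (κ ε : ℝ) (C S : ℝ → ℝ) (X V t : ℝ) :
    linV κ ε C S (-X) (-V) t = -linV κ ε C S X V t := by
  unfold linV; ring

section Orbit

variable {a k m ε x₀ ℓ v τ : ℝ}

/-- The orbit through the point of the nullcline with abscissa `x₀` moves to the right until it
reaches the line `x = ℓ` at time `τ` with velocity `v`. -/
def UpTo (a k m ε x₀ ℓ v τ : ℝ) : Prop :=
  0 ≤ τ ∧ ∀ γ, IsSolution a k m ε γ → γ 0 = pt a k m ε x₀ 0 → γ τ = pt a k m ε ℓ v ∧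
    ∀ t ∈ Ioc 0 τ, 0 < vel a k m ε γ t

/-- The backward orbit through the point of the nullcline with abscissa `x₀` moves to the right
until it reaches the line `x = ℓ` at time `-τ` with velocity `-v`. -/
def DownTo (a k m ε x₀ ℓ v τ : ℝ) : Prop :=
  0 ≤ τ ∧ ∀ γ, IsSolution a k m ε γ → γ 0 = pt a k m ε x₀ 0 → γ (-τ) = pt a k m ε ℓ (-v) ∧
    ∀ t ∈ Ico (-τ) 0, vel a k m ε γ t < 0 ∧ (γ t).1 ≤ ℓ

theorem upTo_refl : UpTo a k m ε x₀ x₀ 0 0 :=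
  ⟨le_rfl, fun _ _ h => ⟨h, fun _ ht => absurd ht.1 (not_lt.2 ht.2)⟩⟩

theorem downTo_refl : DownTo a k m ε x₀ x₀ 0 0 :=
  ⟨le_rfl, fun _ _ h => ⟨by simpa using h, fun _ ht => absurd ht.2 (by linarith [ht.1])⟩⟩

variable {κ : ℝ} {C S : ℝ → ℝ} {ℓ' v' T : ℝ} {Z : Set ℝ}

theorem UpTo.step (hε : ε ≤ 1) (h : UpTo a k m ε x₀ ℓ v τ)
    (hl : Leg κ ε C S (ℓ - a) v (ℓ' - a) v' T) (hZ : IsZone a k m ε κ Z) (hsub : Icc ℓ ℓ' ⊆ Z) :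
    UpTo a k m ε x₀ ℓ' v' (τ + T) := by
  refine ⟨add_nonneg h.1 hl.pos.le, fun γ hγ h0 => ?_⟩
  obtain ⟨h1, h2⟩ := h.2 γ hγ h0
  have hf := follow hε hl.fund hZ hγ le_rfl hl.pos.le h1 (fun t ht => hsub (by
    have := hl.mem_Icc ht
    constructor <;> linarith [this.1, this.2]))
  refine ⟨?_, fun t ht => ?_⟩
  · rw [hf T ⟨hl.pos.le, le_rfl⟩, hl.linX_eq, hl.linV_eq]; simp
  · rcases le_or_gt t τ with h3 | h3
    · exact h2 t ⟨ht.1, h3⟩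
    · have := hf (t - τ) ⟨by linarith, by linarith [ht.2]⟩
      rw [add_sub_cancel] at this
      rw [(eq_pt.1 this).2]
      exact hl.linV_pos _ ⟨by linarith, by linarith [ht.2]⟩

theorem DownTo.step (hε : ε ≤ 1) (h : DownTo a k m ε x₀ ℓ v τ)
    (hl : Leg (-κ) ε C S (ℓ - a) v (ℓ' - a) v' T) (hZ : IsZone a k m ε κ Z)
    (hsub : Icc ℓ ℓ' ⊆ Z) : DownTo a k m ε x₀ ℓ' v' (τ + T) := by
  refine ⟨add_nonneg h.1 hl.pos.le, fun γ hγ h0 => ?_⟩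
  obtain ⟨h1, h2⟩ := h.2 γ hγ h0
  have F : Fund κ ε (fun t => C (-t)) (fun t => -S (-t)) := by simpa using hl.fund.reverse
  have hX : ∀ t, linX (fun t => C (-t)) (fun t => -S (-t)) (ℓ - a) (-v) t
      = linX C S (ℓ - a) v (-t) := fun t => by unfold linX; ring
  have hV : ∀ t, linV κ ε (fun t => C (-t)) (fun t => -S (-t)) (ℓ - a) (-v) t
      = -linV (-κ) ε C S (ℓ - a) v (-t) := fun t => by unfold linV; ring
  have hmem : ∀ t ∈ Icc (-T) 0, a + linX C S (ℓ - a) v (-t) ∈ Icc ℓ ℓ' := fun t ht => by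
    have := hl.mem_Icc (t := -t) ⟨by linarith [ht.2], by linarith [ht.1]⟩
    constructor <;> linarith [this.1, this.2]
  have hf := follow hε F hZ hγ (by linarith [hl.pos] : -T ≤ 0) le_rfl h1 (fun t ht => by
    rw [hX]; exact hsub (hmem t ht))
  have hℓ : ℓ ≤ ℓ' := by
    have := hl.mem_Icc (t := 0) ⟨le_rfl, hl.pos.le⟩
    linarith [this.1.trans this.2]
  refine ⟨?_, fun t ht => ?_⟩
  · rw [show -(τ + T) = -τ + -T by ring, hf (-T) ⟨le_rfl, by linarith [hl.pos]⟩, hX, hV, neg_neg,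
      hl.linX_eq, hl.linV_eq]
    simp
  · rcases le_or_gt (-τ) t with h3 | h3
    · exact ⟨(h2 t ⟨h3, ht.2⟩).1, (h2 t ⟨h3, ht.2⟩).2.trans hℓ⟩
    · have hm : t + τ ∈ Icc (-T) 0 := ⟨by linarith [ht.1], by linarith⟩
      have := hf (t + τ) hm
      rw [show -τ + (t + τ) = t by ring, hX, hV] at this
      obtain ⟨e1, e2⟩ := eq_pt.1 this
      rw [e1, e2]
      exact ⟨neg_lt_zero.2 (hl.linV_pos _ ⟨by linarith, by linarith [ht.1]⟩), (hmem _ hm).2⟩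

end Orbit

/-- Half-return in the right zone. -/
structure Turn (ε : ℝ) (C S : ℝ → ℝ) (c v w T : ℝ) : Prop where
  fund : Fund 1 ε C S
  pos : 0 < T
  w_pos : 0 < w
  linX_eq : linX C S c v T = c
  linV_eq : linV 1 ε C S c v T = -w
  lt_linX : ∀ t ∈ Ioo 0 T, c < linX C S c v t

/-- The forward orbit rises to `x = √ε`, turns in the right zone and falls to `x = a`; the backward
orbit goes through the left part and then through the central zone to `x = a`. The lower forward
passage from `(c, -w)` is the point reflection of the leg from `(-c, w)`, since the linear flow is
odd. -/
theorem shoot_of_legs {a k m ε x₀ v τ p τ' c d w T T' T'' Vf Vb : ℝ} {C S C₁ S₁ C₂ S₂ : ℝ → ℝ}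
    (hε : 0 < ε) (hε1 : ε < 1) (ha : |a| < √ε) (hc : c = √ε - a) (hd : d = √ε + a)
    (hu : UpTo a k m ε x₀ √ε v τ) (hτ : 0 < τ) (hr : Turn ε C S c v w T)
    (hq : Leg m ε C₁ S₁ (-c) w 0 Vf T') (hdn : DownTo a k m ε x₀ (-√ε) p τ')
    (hq' : Leg (-m) ε C₂ S₂ (-d) p 0 Vb T'') :
    Shoot a k m ε x₀ (τ + T) (τ + T + T') (τ' + T'') w Vf Vb := by
  have hσ := Real.sqrt_pos.2 hε
  have hσ1 : √ε < 1 := by rw [Real.sqrt_lt' one_pos]; simpa using hε1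
  obtain ⟨ha1, ha2⟩ := abs_lt.1 ha
  have hTp := hr.pos
  have hT'p := hq.pos
  have hup : ∀ γ, IsSolution a k m ε γ → γ 0 = pt a k m ε x₀ 0 →
      ∀ t ∈ Icc 0 T, γ (τ + t) = pt a k m ε (a + linX C S c v t) (linV 1 ε C S c v t) := by
    intro γ hγ h0
    have := follow hε1.le hr.fund (isZone_right a k m ε) hγ le_rfl hr.pos.le (hu.2 γ hγ h0).1
      (fun t ht => by
        rw [← hc]
        rcases eq_or_lt_of_le ht.1 with h1 | h1
        · rw [← h1, hr.fund.linX_zero, mem_Ici]; linarith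
        rcases eq_or_lt_of_le ht.2 with h2 | h2
        · rw [h2, hr.linX_eq, mem_Ici]; linarith
        · rw [mem_Ici]; linarith [hr.lt_linX t ⟨h1, h2⟩])
    rw [← hc] at this
    exact this
  have hsec : ∀ γ, IsSolution a k m ε γ → γ 0 = pt a k m ε x₀ 0 →
      γ (τ + T) = pt a k m ε √ε (-w) := by
    intro γ hγ h0
    rw [hup γ hγ h0 T ⟨hTp.le, le_rfl⟩, hr.linX_eq, hr.linV_eq, hc]; simp
  have hX : ∀ t, linX C₁ S₁ c (-w) t = -linX C₁ S₁ (-c) w t := fun t => by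
    have := linX_neg C₁ S₁ (-c) w t; rwa [neg_neg] at this
  have hV : ∀ t, linV m ε C₁ S₁ c (-w) t = -linV m ε C₁ S₁ (-c) w t := fun t => by
    have := linV_neg m ε C₁ S₁ (-c) w t; rwa [neg_neg] at this
  have hcen : ∀ γ, IsSolution a k m ε γ → γ 0 = pt a k m ε x₀ 0 →
      ∀ t ∈ Icc 0 T', γ (τ + T + t) = pt a k m ε (a - linX C₁ S₁ (-c) w t)
        (-linV m ε C₁ S₁ (-c) w t) := by
    intro γ hγ h0 t ht
    have h1 := hsec γ hγ h0
    have := follow hε1.le hq.fund (isZone_center (k := k) (m := m) (a := a) hσ1) hγ le_rfl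
      hq.pos.le h1 (fun t ht => by
        rw [← hc, hX]
        have := hq.mem_Icc ht
        constructor <;> linarith [this.1, this.2]) t ht
    rw [← hc, hX, hV] at this
    exact this
  refine ⟨by linarith, by linarith, by linarith [hdn.1, hq'.pos], hr.w_pos, hq.exit_pos, hsec,
    fun γ hγ h0 => ?_, fun γ hγ h0 => ?_, fun γ hγ h0 t ht hv => ?_,
    fun γ hγ h0 t ht hx hv => ?_, fun γ hγ h0 t ht => ?_⟩
  · rw [hcen γ hγ h0 T' ⟨hT'p.le, le_rfl⟩, hq.linX_eq, hq.linV_eq]; simp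
  · have := (hdn.step (κ := m) (ℓ' := a) (v' := Vb) (T := T'') (C := C₂) (S := S₂) hε1.le (by
      rw [show -√ε - a = -d by linarith, sub_self]; exact hq') (isZone_center hσ1)
      (Icc_subset_Icc_right (by linarith))).2 γ hγ h0
    exact this.1
  · rcases le_or_gt t τ with h1 | h1
    · exact absurd hv ((hu.2 γ hγ h0).2 t ⟨ht.1, h1⟩).ne'
    rcases le_or_gt t (τ + T) with h2 | h2
    · have := hup γ hγ h0 (t - τ) ⟨by linarith, by linarith⟩
      rw [add_sub_cancel] at this
      rw [(eq_pt.1 this).1]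
      rcases eq_or_lt_of_le h2 with h3 | h3
      · rw [h3, add_sub_cancel_left, hr.linX_eq]; linarith
      · linarith [hr.lt_linX (t - τ) ⟨by linarith, by linarith⟩]
    · have := hcen γ hγ h0 (t - (τ + T)) ⟨by linarith, by linarith [ht.2]⟩
      rw [add_sub_cancel] at this
      rw [(eq_pt.1 this).2] at hv
      linarith [hq.linV_pos (t - (τ + T)) ⟨by linarith, by linarith [ht.2]⟩]
  · rcases le_or_gt t τ with h1 | h1
    · exact absurd hv (not_le.2 ((hu.2 γ hγ h0).2 t ⟨ht.1, h1⟩))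
    rcases le_or_gt t (τ + T) with h2 | h2
    · have := hup γ hγ h0 (t - τ) ⟨by linarith, by linarith⟩
      rw [add_sub_cancel] at this
      rw [(eq_pt.1 this).1] at hx
      rcases eq_or_lt_of_le h2 with h3 | h3
      · exact h3
      · linarith [hr.lt_linX (t - τ) ⟨by linarith, by linarith⟩]
    · have := hcen γ hγ h0 (t - (τ + T)) ⟨by linarith, by linarith [ht.2]⟩
      rw [add_sub_cancel] at this
      rw [(eq_pt.1 this).1] at hx
      linarith [hq.start_lt (t := t - (τ + T)) (by linarith) (by linarith [ht.2])]
  · exact ((hdn.step (κ := m) (ℓ' := a) (v' := Vb) (T := T'') (C := C₂) (S := S₂) hε1.le (by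
      rw [show -√ε - a = -d by linarith, sub_self]; exact hq') (isZone_center hσ1)
      (Icc_subset_Icc_right (by linarith))).2 γ hγ h0).2 t ht

section Passages

variable {a k m ε κ : ℝ} {C S C' S' : ℝ → ℝ} {ℓ₀ ℓ₁ v₀ v₁ T : ℝ} {Z : Set ℝ}

theorem Leg.passage (h : Leg κ ε C S (ℓ₀ - a) v₀ (ℓ₁ - a) v₁ T) (hv : 0 < v₀)
    (hZ : ∀ a, IsZone a k m ε κ Z) (hsub : Icc ℓ₀ ℓ₁ ⊆ Z) (hσ : √ε ∉ Ioo ℓ₀ ℓ₁) :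
    Passage a k m ε κ C S ℓ₀ ℓ₁ v₀ v₁ T := by
  have hlt : ℓ₀ < ℓ₁ := by linarith [h.start_lt h.pos le_rfl, h.linX_eq]
  refine ⟨h.fund, h.pos, hv.ne', h.exit_pos.ne', h.linX_eq, h.linV_eq, Z, Ioo ℓ₀ ℓ₁, hZ,
    Ioo_subset_Icc_self.trans hsub, hsub ⟨le_rfl, hlt.le⟩, hsub ⟨hlt.le, le_rfl⟩, isOpen_Ioo, hσ,
    fun t ht => ⟨?_, ?_⟩, ⟨ℓ₁ - ℓ₀, by linarith, fun x hx hx' => ?_⟩,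
    ⟨ℓ₁ - ℓ₀, by linarith, fun x hx hx' => ?_⟩⟩
  · linarith [h.start_lt ht.1 ht.2.le]
  · linarith [h.lt_exit ht.1.le ht.2]
  · have := pos_of_mul_pos_left hx hv.le
    exact ⟨by linarith, by linarith [(abs_lt.1 hx').2]⟩
  · have := neg_of_mul_neg_left hx h.exit_pos.le
    exact ⟨by linarith [(abs_lt.1 hx').1], by linarith⟩

theorem Leg.passage_reverse (h : Leg (-κ) ε C' S' (ℓ₀ - a) v₀ (ℓ₁ - a) v₁ T) (hv : 0 < v₀)
    (F : Fund κ ε C S) (hZ : ∀ a, IsZone a k m ε κ Z) (hsub : Icc ℓ₀ ℓ₁ ⊆ Z)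
    (hσ : √ε ∉ Ioo ℓ₀ ℓ₁) : Passage a k m ε κ C S ℓ₁ ℓ₀ (-v₁) (-v₀) T := by
  have hlt : ℓ₀ < ℓ₁ := by linarith [h.start_lt h.pos le_rfl, h.linX_eq]
  have hr := h.reverse_eq F
  refine ⟨F, h.pos, (neg_neg_of_pos h.exit_pos).ne, (neg_neg_of_pos hv).ne, ?_, ?_, Z, Ioo ℓ₀ ℓ₁,
    hZ, Ioo_subset_Icc_self.trans hsub, hsub ⟨hlt.le, le_rfl⟩, hsub ⟨le_rfl, hlt.le⟩, isOpen_Ioo,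
    hσ, fun t ht => ?_, ⟨ℓ₁ - ℓ₀, by linarith, fun x hx hx' => ?_⟩,
    ⟨ℓ₁ - ℓ₀, by linarith, fun x hx hx' => ?_⟩⟩
  · rw [(hr T).1, sub_self, h.fund.linX_zero]
  · rw [(hr T).2, sub_self, h.fund.linV_zero]
  · rw [(hr t).1]
    exact ⟨by linarith [h.start_lt (t := T - t) (by linarith [ht.2]) (by linarith [ht.1])],
      by linarith [h.lt_exit (t := T - t) (by linarith [ht.2]) (by linarith [ht.1])]⟩
  · have h1 := h.exit_pos
    have : x - ℓ₁ < 0 := by nlinarith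
    exact ⟨by linarith [(abs_lt.1 hx').1], by linarith⟩
  · have : 0 < x - ℓ₀ := by nlinarith
    exact ⟨by linarith, by linarith [(abs_lt.1 hx').2]⟩

/-- A turn around the leftmost point: a leg traversed backwards and then another one. -/
theorem Leg.passage_turn {x₀ T' v₁' : ℝ} (h : Leg (-κ) ε C' S' (x₀ - a) 0 (ℓ₁ - a) v₁ T)
    (h' : Leg κ ε C S (x₀ - a) 0 (ℓ₁ - a) v₁' T') {b : ℝ} (hb : b < x₀)
    (hZ : ∀ a, IsZone a k m ε κ Z) (hsub : Ioc b ℓ₁ ⊆ Z) (hσ : √ε ∉ Ioo b ℓ₁) :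
    Passage a k m ε κ C S ℓ₁ ℓ₁ (-v₁) v₁' (T + T') := by
  have hlt : x₀ < ℓ₁ := by linarith [h.start_lt h.pos le_rfl, h.linX_eq]
  have hr := h.reverse_eq h'.fund
  have hadd := h'.fund.lin_add (ℓ₁ - a) (-v₁) T
  rw [(hr T).1, (hr T).2, sub_self, h.fund.linX_zero, h.fund.linV_zero, neg_zero] at hadd
  have h1 := h.exit_pos
  have h1' := h'.exit_pos
  refine ⟨h'.fund, add_pos h.pos h'.pos, (neg_neg_of_pos h1).ne, h1'.ne', ?_, ?_, Z,
    Ioo b ℓ₁, hZ, Ioo_subset_Ioc_self.trans hsub, hsub ⟨hb.trans hlt, le_rfl⟩,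
    hsub ⟨hb.trans hlt, le_rfl⟩, isOpen_Ioo, hσ, fun t ht => ?_,
    ⟨ℓ₁ - b, by linarith, fun x hx hx' => ?_⟩, ⟨ℓ₁ - b, by linarith, fun x hx hx' => ?_⟩⟩
  · rw [(hadd T').1, h'.linX_eq]
  · rw [(hadd T').2, h'.linV_eq]
  · rcases le_or_gt t T with h2 | h2
    · rw [(hr t).1]
      have := h.mem_Icc (t := T - t) ⟨by linarith, by linarith [ht.1]⟩
      exact ⟨by linarith [this.1],
        by linarith [h.lt_exit (t := T - t) (by linarith) (by linarith [ht.1])]⟩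
    · have := (hadd (t - T)).1
      rw [add_sub_cancel] at this
      rw [this]
      have := h'.mem_Icc (t := t - T) ⟨by linarith, by linarith [ht.2]⟩
      exact ⟨by linarith [this.1],
        by linarith [h'.lt_exit (t := t - T) (by linarith) (by linarith [ht.2])]⟩
  · have : x - ℓ₁ < 0 := by nlinarith
    exact ⟨by linarith [(abs_lt.1 hx').1], by linarith⟩
  · have : x - ℓ₁ < 0 := by nlinarith
    exact ⟨by linarith [(abs_lt.1 hx').1], by linarith⟩

/-- The downward passage through the central zone. -/
theorem passage_center {c d w p V T T' : ℝ} (hc : c = ℓ₁ - a) (hd : d = a - ℓ₀)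
    (h : Leg κ ε C S (-c) w 0 V T) (h' : Leg (-κ) ε C' S' (-d) p 0 V T') (hw : 0 < w) (hp : 0 < p)
    (hZ : ∀ a, IsZone a k m ε κ Z) (hsub : Icc ℓ₀ ℓ₁ ⊆ Z) (hσ : √ε ∉ Ioo ℓ₀ ℓ₁) :
    Passage a k m ε κ C S ℓ₁ ℓ₀ (-w) (-p) (T + T') := by
  have hc0 : 0 < c := by linarith [h.start_lt h.pos le_rfl, h.linX_eq]
  have hd0 : 0 < d := by linarith [h'.start_lt h'.pos le_rfl, h'.linX_eq]
  have hX : ∀ t, linX C S c (-w) t = -linX C S (-c) w t := fun t => by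
    have := linX_neg C S (-c) w t; rwa [neg_neg] at this
  have hV : ∀ t, linV κ ε C S c (-w) t = -linV κ ε C S (-c) w t := fun t => by
    have := linV_neg κ ε C S (-c) w t; rwa [neg_neg] at this
  have hr := h'.reverse_eq h.fund
  have hadd := h.fund.lin_add c (-w) T
  rw [hX, hV, h.linX_eq, h.linV_eq, neg_zero] at hadd
  refine ⟨h.fund, add_pos h.pos h'.pos, (neg_neg_of_pos hw).ne, (neg_neg_of_pos hp).ne, ?_, ?_, Z,
    Ioo ℓ₀ ℓ₁, hZ, Ioo_subset_Icc_self.trans hsub, hsub ⟨by linarith, le_rfl⟩,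
    hsub ⟨le_rfl, by linarith⟩, isOpen_Ioo, hσ, fun t ht => ?_,
    ⟨ℓ₁ - ℓ₀, by linarith, fun x hx hx' => ?_⟩, ⟨ℓ₁ - ℓ₀, by linarith, fun x hx hx' => ?_⟩⟩
  · rw [← hc, (hadd T').1, (hr T').1, sub_self, h'.fund.linX_zero]; linarith
  · rw [← hc, (hadd T').2, (hr T').2, sub_self, h'.fund.linV_zero]
  · rw [← hc]
    rcases le_or_gt t T with h2 | h2
    · rw [hX]
      have := h.mem_Icc (t := t) ⟨ht.1.le, h2⟩
      exact ⟨by linarith [this.2], by linarith [h.start_lt ht.1 h2]⟩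
    · have := (hadd (t - T)).1
      rw [add_sub_cancel] at this
      rw [this, (hr _).1]
      have h3 := h'.mem_Icc (t := T' - (t - T)) ⟨by linarith [ht.2], by linarith⟩
      exact ⟨by linarith [h'.start_lt (t := T' - (t - T)) (by linarith [ht.2]) (by linarith)],
        by linarith [h3.2]⟩
  · have : x - ℓ₁ < 0 := by nlinarith
    exact ⟨by linarith [(abs_lt.1 hx').1], by linarith⟩
  · have : 0 < x - ℓ₀ := by nlinarith
    exact ⟨by linarith, by linarith [(abs_lt.1 hx').2]⟩

theorem Turn.passage {c v w : ℝ} (hc : c = √ε - a) (h : Turn ε C S c v w T) (hv : 0 < v) :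
    Passage a k m ε 1 C S √ε √ε v (-w) T := by
  refine ⟨h.fund, h.pos, hv.ne', (neg_neg_of_pos h.w_pos).ne, ?_, ?_, Ici √ε, Ioi √ε,
    fun a => isZone_right a k m ε, Ioi_subset_Ici_self, mem_Ici.2 le_rfl, mem_Ici.2 le_rfl,
    isOpen_Ioi, by simp, fun t ht => ?_, ⟨1, one_pos, fun x hx _ => ?_⟩,
    ⟨1, one_pos, fun x hx _ => ?_⟩⟩
  · rw [← hc, h.linX_eq]
  · rw [← hc, h.linV_eq]
  · rw [← hc, mem_Ioi]; linarith [h.lt_linX t ht]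
  · have := pos_of_mul_pos_left hx hv.le
    rw [mem_Ioi]; linarith
  · have := h.w_pos
    have : 0 < x - √ε := by nlinarith
    rw [mem_Ioi]; linarith

end Passages

end PWLCanard

/-! ### Expanding and contracting legs of nodes: existence, first integrals, smoothness. -/

namespace PWLCanard

section Roots

variable {k ε : ℝ}

/-- The fast eigenvalue, in absolute value, of a zone of slope `±k`. -/
noncomputable def fastR (k ε : ℝ) : ℝ := k - lamL k ε

theorem lamL_add_fastR (k ε : ℝ) : lamL k ε + fastR k ε = k := by unfold fastR; ring

theorem lamL_mul_fastR (h : 4 * ε < k ^ 2) : lamL k ε * fastR k ε = ε := by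
  unfold fastR lamL
  have := Real.sq_sqrt (sub_nonneg.2 h.le)
  linear_combination (-1 / 4) * this

theorem lamL_pos (hε : 0 < ε) (hk : 0 < k) : 0 < lamL k ε := by
  unfold lamL
  have : √(k ^ 2 - 4 * ε) < k := by rw [Real.sqrt_lt' hk]; linarith
  linarith

theorem lamL_lt_fastR (h : 4 * ε < k ^ 2) : lamL k ε < fastR k ε := by
  unfold fastR lamL
  have := Real.sqrt_pos.2 (sub_pos.2 h)
  linarith

theorem contDiffAt_lamL {E : Type*} [NormedAddCommGroup E] [NormedSpace ℝ E] {κ : E → ℝ} {x : E}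
    (hκ : ContDiffAt ℝ 1 κ x) (h : 4 * ε < κ x ^ 2) : ContDiffAt ℝ 1 (fun y => lamL (κ y) ε) x := by
  unfold lamL
  exact (hκ.sub (((hκ.pow 2).sub contDiffAt_const).sqrt (sub_pos.2 h).ne')).div_const 2

theorem contDiffAt_fastR {E : Type*} [NormedAddCommGroup E] [NormedSpace ℝ E] {κ : E → ℝ} {x : E}
    (hκ : ContDiffAt ℝ 1 κ x) (h : 4 * ε < κ x ^ 2) : ContDiffAt ℝ 1 (fun y => fastR (κ y) ε) x :=
  hκ.sub (contDiffAt_lamL hκ h)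

end Roots

section NodeLegs

variable {l u h v d : ℝ}

theorem linX_expand (hlu : l < u) (t : ℝ) : linX (nodeC l u) (nodeS l u) (-h) v t
    = ((v + l * h) * exp (u * t) - (v + u * h) * exp (l * t)) / (u - l) := by
  unfold linX nodeC nodeS
  have : u - l ≠ 0 := (sub_pos.2 hlu).ne'
  field_simp; ring

theorem linV_expand (hlu : l < u) (t : ℝ) :
    linV (-(l + u)) (l * u) (nodeC l u) (nodeS l u) (-h) v t
    = (u * (v + l * h) * exp (u * t) - l * (v + u * h) * exp (l * t)) / (u - l) := by
  unfold linV nodeC nodeS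
  have : u - l ≠ 0 := (sub_pos.2 hlu).ne'
  field_simp; ring

/-- The coefficient of the growing fast mode is at least that of the slow mode, and the fast
exponential is the larger one. -/
theorem linV_expand_pos (hl : 0 < l) (hlu : l < u) (hh : 0 < h) (hv : 0 ≤ v) {t : ℝ}
    (ht : 0 < t) : 0 < linV (-(l + u)) (l * u) (nodeC l u) (nodeS l u) (-h) v t := by
  rw [linV_expand hlu]
  refine div_pos (sub_pos.2 ?_) (sub_pos.2 hlu)
  have h1 : exp (l * t) < exp (u * t) := exp_lt_exp.2 (by nlinarith)
  have h2 : l * (v + u * h) ≤ u * (v + l * h) := by nlinarith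
  have h3 : 0 < l * (v + u * h) := mul_pos hl (by have := mul_pos (hl.trans hlu) hh; linarith)
  calc _ < l * (v + u * h) * exp (u * t) := by gcongr
    _ ≤ _ := by gcongr

theorem exists_expand (hl : 0 < l) (hlu : l < u) (hd : d < h) (hd0 : 0 < d) (hv : 0 ≤ v) :
    ∃ t, 0 < t ∧ linX (nodeC l u) (nodeS l u) (-h) v t = -d := by
  have F := fund_node (α := l) (β := u) hlu.ne rfl rfl
  have hlim : Tendsto (linX (nodeC l u) (nodeS l u) (-h) v) atTop atTop := by
    have h1 : Tendsto (fun t : ℝ => exp ((u - l) * t)) atTop atTop :=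
      tendsto_exp_atTop.comp (tendsto_id.const_mul_atTop (sub_pos.2 hlu))
    have hp : 0 < v + l * h := by have := mul_pos hl (hd0.trans hd); linarith
    have h2 : Tendsto (fun t : ℝ => (v + l * h) * exp ((u - l) * t) - (v + u * h)) atTop atTop :=
      tendsto_atTop_add_const_right _ _ (h1.const_mul_atTop hp)
    have h3 : Tendsto (fun t : ℝ => exp (l * t)) atTop atTop :=
      tendsto_exp_atTop.comp (tendsto_id.const_mul_atTop hl)
    refine ((h3.atTop_mul_atTop₀ h2).atTop_div_const (sub_pos.2 hlu)).congr fun t => ?_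
    rw [linX_expand hlu]
    congr 1
    have : exp (u * t) = exp (l * t) * exp ((u - l) * t) := by rw [← Real.exp_add]; congr 1; ring
    rw [this]; ring
  obtain ⟨b, hb0, hb⟩ := ((eventually_gt_atTop (0 : ℝ)).and (hlim.eventually_gt_atTop (-d))).exists
  obtain ⟨t, ht, hte⟩ := intermediate_value_Icc hb0.le (F.continuous_linX (-h) v).continuousOn
    (show -d ∈ Icc _ _ from ⟨by rw [F.linX_zero]; linarith, hb.le⟩)
  refine ⟨t, lt_of_le_of_ne ht.1 ?_, hte⟩
  rintro rfl
  rw [F.linX_zero] at hte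
  linarith

theorem linX_contract (hlu : l < u) (t : ℝ) : linX (nodeC (-l) (-u)) (nodeS (-l) (-u)) (-h) v t
    = -(((u * h - v) * exp (-l * t) - (l * h - v) * exp (-u * t)) / (u - l)) := by
  unfold linX nodeC nodeS
  have : u - l ≠ 0 := (sub_pos.2 hlu).ne'
  have : -u - -l ≠ 0 := by rw [neg_sub_neg]; exact (sub_neg.2 hlu).ne
  rw [show -u - -l = -(u - l) by ring]
  field_simp; ring

theorem linV_contract (hlu : l < u) (t : ℝ) :
    linV (l + u) (l * u) (nodeC (-l) (-u)) (nodeS (-l) (-u)) (-h) v t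
    = (l * (u * h - v) * exp (-l * t) - u * (l * h - v) * exp (-u * t)) / (u - l) := by
  unfold linV nodeC nodeS
  rw [show -u - -l = -(u - l) by ring]
  have : u - l ≠ 0 := (sub_pos.2 hlu).ne'
  field_simp; ring

/-- The condition `v < u * h` places the starting point below the fast eigenline `V = -u X`. The
slow mode then has positive weight, and the orbit approaches the node without turning back. -/
theorem linV_contract_pos (hl : 0 < l) (hlu : l < u) (hv : 0 ≤ v) (hv' : v < u * h) {t : ℝ}
    (ht : 0 < t) : 0 < linV (l + u) (l * u) (nodeC (-l) (-u)) (nodeS (-l) (-u)) (-h) v t := by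
  rw [linV_contract hlu]
  refine div_pos (sub_pos.2 ?_) (sub_pos.2 hlu)
  have h1 : exp (-u * t) < exp (-l * t) := exp_lt_exp.2 (by nlinarith)
  have h2 : u * (l * h - v) ≤ l * (u * h - v) := by nlinarith
  have h3 : 0 < l * (u * h - v) := mul_pos hl (by linarith)
  calc _ ≤ l * (u * h - v) * exp (-u * t) := by gcongr
    _ < _ := by gcongr

theorem exists_contract (hl : 0 < l) (hlu : l < u) (hd : d < h) (hd0 : 0 < d) :
    ∃ t, 0 < t ∧ linX (nodeC (-l) (-u)) (nodeS (-l) (-u)) (-h) v t = -d := by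
  have F := fund_node (α := -l) (β := -u) (neg_injective.ne hlu.ne) rfl rfl
  have hlim : Tendsto (linX (nodeC (-l) (-u)) (nodeS (-l) (-u)) (-h) v) atTop (𝓝 0) := by
    have := ((((tendsto_exp_neg_mul hl).const_mul (u * h - v)).sub
      ((tendsto_exp_neg_mul (hl.trans hlu)).const_mul (l * h - v))).div_const (u - l)).neg
    rw [mul_zero, mul_zero, sub_zero, zero_div, neg_zero] at this
    exact this.congr fun t => (linX_contract hlu t).symm
  obtain ⟨b, hb0, hb⟩ := ((eventually_gt_atTop (0 : ℝ)).and
    (hlim.eventually_const_lt (neg_lt_zero.2 hd0))).exists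
  obtain ⟨t, ht, hte⟩ := intermediate_value_Icc hb0.le (F.continuous_linX (-h) v).continuousOn
    (show -d ∈ Icc _ _ from ⟨by rw [F.linX_zero]; linarith, hb.le⟩)
  refine ⟨t, lt_of_le_of_ne ht.1 ?_, hte⟩
  rintro rfl
  rw [F.linX_zero] at hte
  linarith

end NodeLegs

/-- The zero of `H` in `I`. -/
noncomputable def hitTime (H : ℝ → ℝ) (I : Set ℝ) : ℝ :=
  Classical.epsilon fun t => t ∈ I ∧ H t = 0

theorem hitTime_spec {H : ℝ → ℝ} {I : Set ℝ} (h : ∃ t ∈ I, H t = 0) :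
    hitTime H I ∈ I ∧ H (hitTime H I) = 0 := by
  obtain ⟨t, ht⟩ := h
  exact Classical.epsilon_spec (p := fun t => t ∈ I ∧ H t = 0) ⟨t, ht⟩

/-- `hitTime` is an arbitrary choice of zero, but zeros in `I` are unique for nearby parameters. It
therefore agrees with the branch of the implicit function theorem, which stays in the open set `I`.
-/
theorem contDiffAt_hitTime {E : Type*} [NormedAddCommGroup E] [NormedSpace ℝ E] [CompleteSpace E]
    {H : E → ℝ → ℝ} {I : Set ℝ} (hI : IsOpen I) {x : E}
    (hH : ContDiffAt ℝ 1 (fun y : E × ℝ => H y.1 y.2) (x, hitTime (H x) I))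
    (hex : ∃ t ∈ I, H x t = 0) {H' : ℝ} (hd : HasDerivAt (H x) H' (hitTime (H x) I)) (hne : H' ≠ 0)
    (huniq : ∀ᶠ y in 𝓝 x, ∀ t ∈ I, ∀ t' ∈ I, H y t = 0 → H y t' = 0 → t = t') :
    ContDiffAt ℝ 1 (fun y => hitTime (H y) I) x := by
  have hs := hitTime_spec hex
  obtain ⟨τ, τ0, cτ, eτ⟩ := exists_implicit (by norm_num) hH hs.2 hd hne
  refine cτ.congr_of_eventuallyEq ?_
  have hτ : ∀ᶠ y in 𝓝 x, τ y ∈ I :=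
    cτ.continuousAt.eventually_mem (hI.mem_nhds (by rw [τ0]; exact hs.1))
  filter_upwards [eτ, hτ, huniq] with y h1 h2 h3
  have := hitTime_spec ⟨τ y, h2, h1⟩
  exact h3 _ this.1 _ h2 this.2 h1

/-- Duration of the expanding leg from `(-h, v)` to the line `X = -d` in a zone of slope `-k`. -/
noncomputable def expT (ε k h v d : ℝ) : ℝ := hitTime (fun t =>
  linX (nodeC (lamL k ε) (fastR k ε)) (nodeS (lamL k ε) (fastR k ε)) (-h) v t + d) (Ioi 0)

/-- Exit velocity of the leg of `expT`. -/
noncomputable def expV (ε k h v d : ℝ) : ℝ :=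
  linV (-k) ε (nodeC (lamL k ε) (fastR k ε)) (nodeS (lamL k ε) (fastR k ε)) (-h) v (expT ε k h v d)

/-- Duration of the contracting leg from `(-h, v)` to the line `X = -d` in a zone of slope `k`. -/
noncomputable def conT (ε k h v d : ℝ) : ℝ := hitTime (fun t =>
  linX (nodeC (-lamL k ε) (-fastR k ε)) (nodeS (-lamL k ε) (-fastR k ε)) (-h) v t + d) (Ioi 0)

/-- Exit velocity of the leg of `conT`. -/
noncomputable def conV (ε k h v d : ℝ) : ℝ :=
  linV k ε (nodeC (-lamL k ε) (-fastR k ε)) (nodeS (-lamL k ε) (-fastR k ε)) (-h) v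
    (conT ε k h v d)

section Legs

variable {ε k h v d : ℝ}

theorem fund_expand (hk : 4 * ε < k ^ 2) : Fund (-k) ε (nodeC (lamL k ε) (fastR k ε))
    (nodeS (lamL k ε) (fastR k ε)) :=
  fund_node (lamL_lt_fastR hk).ne (by rw [lamL_add_fastR]) (lamL_mul_fastR hk).symm

theorem fund_contract (hk : 4 * ε < k ^ 2) : Fund k ε (nodeC (-lamL k ε) (-fastR k ε))
    (nodeS (-lamL k ε) (-fastR k ε)) :=
  fund_node (neg_injective.ne (lamL_lt_fastR hk).ne)
    (by rw [← neg_add, neg_neg, lamL_add_fastR]) (by rw [neg_mul_neg, lamL_mul_fastR hk])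

theorem linV_expand_pos' (hε : 0 < ε) (hk0 : 0 < k) (hk : 4 * ε < k ^ 2) (hh : 0 < h) (hv : 0 ≤ v)
    {t : ℝ} (ht : 0 < t) : 0 < linV (-k) ε (nodeC (lamL k ε) (fastR k ε))
      (nodeS (lamL k ε) (fastR k ε)) (-h) v t := by
  have := linV_expand_pos (lamL_pos hε hk0) (lamL_lt_fastR hk) hh hv ht
  rwa [lamL_add_fastR, lamL_mul_fastR hk] at this

theorem linV_contract_pos' (hε : 0 < ε) (hk0 : 0 < k) (hk : 4 * ε < k ^ 2) (hv : 0 ≤ v)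
    (hv' : v < fastR k ε * h) {t : ℝ} (ht : 0 < t) : 0 < linV k ε
      (nodeC (-lamL k ε) (-fastR k ε)) (nodeS (-lamL k ε) (-fastR k ε)) (-h) v t := by
  have := linV_contract_pos (lamL_pos hε hk0) (lamL_lt_fastR hk) hv hv' ht
  rwa [lamL_add_fastR, lamL_mul_fastR hk] at this

theorem leg_expand (hε : 0 < ε) (hk0 : 0 < k) (hk : 4 * ε < k ^ 2) (hd : d < h) (hd0 : 0 < d)
    (hv : 0 ≤ v) : Leg (-k) ε (nodeC (lamL k ε) (fastR k ε)) (nodeS (lamL k ε) (fastR k ε))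
      (-h) v (-d) (expV ε k h v d) (expT ε k h v d) := by
  obtain ⟨t, ht, hX⟩ := exists_expand (lamL_pos hε hk0) (lamL_lt_fastR hk) hd hd0 hv
  have := hitTime_spec (H := fun t => linX (nodeC (lamL k ε) (fastR k ε))
    (nodeS (lamL k ε) (fastR k ε)) (-h) v t + d) (I := Ioi 0) ⟨t, ht, by simp [hX]⟩
  exact ⟨fund_expand hk, this.1, eq_neg_of_add_eq_zero_left this.2, rfl,
    fun t ht => linV_expand_pos' hε hk0 hk (hd0.trans hd) hv ht.1⟩

theorem leg_contract (hε : 0 < ε) (hk0 : 0 < k) (hk : 4 * ε < k ^ 2) (hd : d < h) (hd0 : 0 < d)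
    (hv : 0 ≤ v) (hv' : v < fastR k ε * h) :
    Leg k ε (nodeC (-lamL k ε) (-fastR k ε)) (nodeS (-lamL k ε) (-fastR k ε))
      (-h) v (-d) (conV ε k h v d) (conT ε k h v d) := by
  obtain ⟨t, ht, hX⟩ := exists_contract (v := v) (lamL_pos hε hk0) (lamL_lt_fastR hk) hd hd0
  have := hitTime_spec (H := fun t => linX (nodeC (-lamL k ε) (-fastR k ε))
    (nodeS (-lamL k ε) (-fastR k ε)) (-h) v t + d) (I := Ioi 0) ⟨t, ht, by simp [hX]⟩
  exact ⟨fund_contract hk, this.1, eq_neg_of_add_eq_zero_left this.2, rfl,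
    fun t ht => linV_contract_pos' hε hk0 hk hv hv' ht.1⟩

/-- The first integral with the slow exponent, evaluated at the exit. Together with its fast
companion it determines exit speed and duration. Their product involves `exp (k T)`, the exponential
of the accumulated expansion. -/
theorem expand_slow (hε : 0 < ε) (hk0 : 0 < k) (hk : 4 * ε < k ^ 2) (hd : d < h) (hd0 : 0 < d)
    (hv : 0 ≤ v) : expV ε k h v d + fastR k ε * d
      = (v + fastR k ε * h) * exp (lamL k ε * expT ε k h v d) := by
  have hl := leg_expand hε hk0 hk hd hd0 hv
  have := node_integral_left (lamL_lt_fastR hk).ne (κ := -k) (by rw [lamL_add_fastR])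
    (lamL_mul_fastR hk).symm (-h) v (expT ε k h v d)
  rw [hl.linX_eq, hl.linV_eq] at this
  linarith

theorem expand_fast (hε : 0 < ε) (hk0 : 0 < k) (hk : 4 * ε < k ^ 2) (hd : d < h) (hd0 : 0 < d)
    (hv : 0 ≤ v) : expV ε k h v d + lamL k ε * d
      = (v + lamL k ε * h) * exp (fastR k ε * expT ε k h v d) := by
  have hl := leg_expand hε hk0 hk hd hd0 hv
  have := node_integral_right (lamL_lt_fastR hk).ne (κ := -k) (by rw [lamL_add_fastR])
    (lamL_mul_fastR hk).symm (-h) v (expT ε k h v d)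
  rw [hl.linX_eq, hl.linV_eq] at this
  linarith

theorem contract_slow (hε : 0 < ε) (hk0 : 0 < k) (hk : 4 * ε < k ^ 2) (hd : d < h) (hd0 : 0 < d)
    (hv : 0 ≤ v) (hv' : v < fastR k ε * h) : fastR k ε * d - conV ε k h v d
      = (fastR k ε * h - v) * exp (-(lamL k ε * conT ε k h v d)) := by
  have hl := leg_contract hε hk0 hk hd hd0 hv hv'
  have := node_integral_left (neg_injective.ne (lamL_lt_fastR hk).ne) (κ := k)
    (by rw [← neg_add, neg_neg, lamL_add_fastR]) (by rw [neg_mul_neg, lamL_mul_fastR hk])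
    (-h) v (conT ε k h v d)
  rw [hl.linX_eq, hl.linV_eq, neg_mul (lamL k ε)] at this
  linarith

theorem contract_fast (hε : 0 < ε) (hk0 : 0 < k) (hk : 4 * ε < k ^ 2) (hd : d < h) (hd0 : 0 < d)
    (hv : 0 ≤ v) (hv' : v < fastR k ε * h) : lamL k ε * d - conV ε k h v d
      = (lamL k ε * h - v) * exp (-(fastR k ε * conT ε k h v d)) := by
  have hl := leg_contract hε hk0 hk hd hd0 hv hv'
  have := node_integral_right (neg_injective.ne (lamL_lt_fastR hk).ne) (κ := k)
    (by rw [← neg_add, neg_neg, lamL_add_fastR]) (by rw [neg_mul_neg, lamL_mul_fastR hk])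
    (-h) v (conT ε k h v d)
  rw [hl.linX_eq, hl.linV_eq, neg_mul (fastR k ε)] at this
  linarith

end Legs

section Smooth

variable {E : Type*} [NormedAddCommGroup E] [NormedSpace ℝ E] {ε : ℝ}
  {α β : E → ℝ} {X₀ V₀ T κ : E → ℝ} {x : E}

theorem contDiffAt_nodeC (hα : ContDiffAt ℝ 1 α x) (hβ : ContDiffAt ℝ 1 β x) (h : α x ≠ β x)
    (hT : ContDiffAt ℝ 1 T x) : ContDiffAt ℝ 1 (fun y => nodeC (α y) (β y) (T y)) x := by
  unfold nodeC
  exact ((hβ.mul (hα.mul hT).exp).sub (hα.mul (hβ.mul hT).exp)).div (hβ.sub hα)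
    (sub_ne_zero.2 h.symm)

theorem contDiffAt_nodeS (hα : ContDiffAt ℝ 1 α x) (hβ : ContDiffAt ℝ 1 β x) (h : α x ≠ β x)
    (hT : ContDiffAt ℝ 1 T x) : ContDiffAt ℝ 1 (fun y => nodeS (α y) (β y) (T y)) x := by
  unfold nodeS
  exact ((hβ.mul hT).exp.sub (hα.mul hT).exp).div (hβ.sub hα) (sub_ne_zero.2 h.symm)

theorem contDiffAt_linX_node (hα : ContDiffAt ℝ 1 α x) (hβ : ContDiffAt ℝ 1 β x) (h : α x ≠ β x)
    (hX : ContDiffAt ℝ 1 X₀ x) (hV : ContDiffAt ℝ 1 V₀ x) (hT : ContDiffAt ℝ 1 T x) :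
    ContDiffAt ℝ 1 (fun y => linX (nodeC (α y) (β y)) (nodeS (α y) (β y)) (X₀ y) (V₀ y) (T y)) x :=
  (hX.mul (contDiffAt_nodeC hα hβ h hT)).add (hV.mul (contDiffAt_nodeS hα hβ h hT))

theorem contDiffAt_linV_node (hκ : ContDiffAt ℝ 1 κ x) (hα : ContDiffAt ℝ 1 α x)
    (hβ : ContDiffAt ℝ 1 β x) (h : α x ≠ β x)
    (hX : ContDiffAt ℝ 1 X₀ x) (hV : ContDiffAt ℝ 1 V₀ x) (hT : ContDiffAt ℝ 1 T x) :
    ContDiffAt ℝ 1 (fun y => linV (κ y) ε (nodeC (α y) (β y)) (nodeS (α y) (β y)) (X₀ y) (V₀ y)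
      (T y)) x := by
  unfold linV
  exact (((contDiffAt_const.mul hX).mul (contDiffAt_nodeS hα hβ h hT)).neg).add
    (hV.mul ((contDiffAt_nodeC hα hβ h hT).sub (hκ.mul (contDiffAt_nodeS hα hβ h hT))))

variable [CompleteSpace E] {k h v d : E → ℝ}

theorem contDiffAt_expT (hε : 0 < ε) (hk : ContDiffAt ℝ 1 k x) (hh : ContDiffAt ℝ 1 h x)
    (hv : ContDiffAt ℝ 1 v x) (hd : ContDiffAt ℝ 1 d x)
    (hdom : ∀ᶠ y in 𝓝 x, 0 < k y ∧ 4 * ε < k y ^ 2 ∧ d y < h y ∧ 0 < d y ∧ 0 ≤ v y) :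
    ContDiffAt ℝ 1 (fun y => expT ε (k y) (h y) (v y) (d y)) x := by
  obtain ⟨h1, h2, h3, h4, h5⟩ := hdom.self_of_nhds
  have hl := leg_expand hε h1 h2 h3 h4 h5
  unfold expT
  refine contDiffAt_hitTime (H := fun y t => linX (nodeC (lamL (k y) ε) (fastR (k y) ε))
    (nodeS (lamL (k y) ε) (fastR (k y) ε)) (-h y) (v y) t + d y) isOpen_Ioi ?_
    ⟨_, hl.pos, by simp [hl.linX_eq]⟩ ((hl.fund.hasDerivAt_linX (-h x) (v x) _).add_const _)
    (linV_expand_pos' hε h1 h2 (h4.trans h3) h5 hl.pos).ne' ?_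
  · set t := hitTime (fun t => linX (nodeC (lamL (k x) ε) (fastR (k x) ε))
      (nodeS (lamL (k x) ε) (fastR (k x) ε)) (-h x) (v x) t + d x) (Ioi 0)
    have c : ∀ {g : E → ℝ}, ContDiffAt ℝ 1 g x → ContDiffAt ℝ 1 (fun y : E × ℝ => g y.1) (x, t) :=
      fun hg => ContDiffAt.comp (x, t) (f := Prod.fst) hg contDiffAt_fst
    exact (contDiffAt_linX_node (c (contDiffAt_lamL hk h2)) (c (contDiffAt_fastR hk h2))
      (lamL_lt_fastR h2).ne (c hh).neg (c hv) contDiffAt_snd).add (c hd)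
  · filter_upwards [hdom] with y hy t ht t' ht' e e'
    obtain ⟨h1, h2, h3, h4, h5⟩ := hy
    have F := fund_expand h2
    have hm : StrictMonoOn (linX (nodeC (lamL (k y) ε) (fastR (k y) ε))
        (nodeS (lamL (k y) ε) (fastR (k y) ε)) (-h y) (v y)) (Ici 0) := by
      refine strictMonoOn_of_deriv_pos (convex_Ici 0) (F.continuous_linX _ _).continuousOn
        fun t ht => ?_
      rw [interior_Ici] at ht
      rw [(F.hasDerivAt_linX _ _ t).deriv]
      exact linV_expand_pos' hε h1 h2 (h4.trans h3) h5 ht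
    exact hm.injOn (mem_Ici.2 (le_of_lt ht)) (mem_Ici.2 (le_of_lt ht')) (by linarith)

theorem contDiffAt_expV (hε : 0 < ε) (hk : ContDiffAt ℝ 1 k x) (hh : ContDiffAt ℝ 1 h x)
    (hv : ContDiffAt ℝ 1 v x) (hd : ContDiffAt ℝ 1 d x)
    (hdom : ∀ᶠ y in 𝓝 x, 0 < k y ∧ 4 * ε < k y ^ 2 ∧ d y < h y ∧ 0 < d y ∧ 0 ≤ v y) :
    ContDiffAt ℝ 1 (fun y => expV ε (k y) (h y) (v y) (d y)) x := by
  have h2 := hdom.self_of_nhds.2.1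
  exact contDiffAt_linV_node hk.neg (contDiffAt_lamL hk h2) (contDiffAt_fastR hk h2)
    (lamL_lt_fastR h2).ne hh.neg hv (contDiffAt_expT hε hk hh hv hd hdom)

theorem contDiffAt_conT (hε : 0 < ε) (hk : ContDiffAt ℝ 1 k x) (hh : ContDiffAt ℝ 1 h x)
    (hv : ContDiffAt ℝ 1 v x) (hd : ContDiffAt ℝ 1 d x)
    (hdom : ∀ᶠ y in 𝓝 x, 0 < k y ∧ 4 * ε < k y ^ 2 ∧ d y < h y ∧ 0 < d y ∧ 0 ≤ v y ∧
      v y < fastR (k y) ε * h y) :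
    ContDiffAt ℝ 1 (fun y => conT ε (k y) (h y) (v y) (d y)) x := by
  obtain ⟨h1, h2, h3, h4, h5, h6⟩ := hdom.self_of_nhds
  have hl := leg_contract hε h1 h2 h3 h4 h5 h6
  unfold conT
  refine contDiffAt_hitTime (H := fun y t => linX (nodeC (-lamL (k y) ε) (-fastR (k y) ε))
    (nodeS (-lamL (k y) ε) (-fastR (k y) ε)) (-h y) (v y) t + d y) isOpen_Ioi ?_
    ⟨_, hl.pos, by simp [hl.linX_eq]⟩ ((hl.fund.hasDerivAt_linX (-h x) (v x) _).add_const _)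
    (linV_contract_pos' hε h1 h2 h5 h6 hl.pos).ne' ?_
  · set t := hitTime (fun t => linX (nodeC (-lamL (k x) ε) (-fastR (k x) ε))
      (nodeS (-lamL (k x) ε) (-fastR (k x) ε)) (-h x) (v x) t + d x) (Ioi 0)
    have c : ∀ {g : E → ℝ}, ContDiffAt ℝ 1 g x → ContDiffAt ℝ 1 (fun y : E × ℝ => g y.1) (x, t) :=
      fun hg => ContDiffAt.comp (x, t) (f := Prod.fst) hg contDiffAt_fst
    exact (contDiffAt_linX_node (c (contDiffAt_lamL hk h2)).neg (c (contDiffAt_fastR hk h2)).neg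
      (neg_injective.ne (lamL_lt_fastR h2).ne) (c hh).neg (c hv) contDiffAt_snd).add (c hd)
  · filter_upwards [hdom] with y hy t ht t' ht' e e'
    obtain ⟨h1, h2, h3, h4, h5, h6⟩ := hy
    have F := fund_contract h2
    have hm : StrictMonoOn (linX (nodeC (-lamL (k y) ε) (-fastR (k y) ε))
        (nodeS (-lamL (k y) ε) (-fastR (k y) ε)) (-h y) (v y)) (Ici 0) := by
      refine strictMonoOn_of_deriv_pos (convex_Ici 0) (F.continuous_linX _ _).continuousOn
        fun t ht => ?_
      rw [interior_Ici] at ht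
      rw [(F.hasDerivAt_linX _ _ t).deriv]
      exact linV_contract_pos' hε h1 h2 h5 h6 ht
    exact hm.injOn (mem_Ici.2 (le_of_lt ht)) (mem_Ici.2 (le_of_lt ht')) (by linarith)

theorem contDiffAt_conV (hε : 0 < ε) (hk : ContDiffAt ℝ 1 k x) (hh : ContDiffAt ℝ 1 h x)
    (hv : ContDiffAt ℝ 1 v x) (hd : ContDiffAt ℝ 1 d x)
    (hdom : ∀ᶠ y in 𝓝 x, 0 < k y ∧ 4 * ε < k y ^ 2 ∧ d y < h y ∧ 0 < d y ∧ 0 ≤ v y ∧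
      v y < fastR (k y) ε * h y) :
    ContDiffAt ℝ 1 (fun y => conV ε (k y) (h y) (v y) (d y)) x := by
  have h2 := hdom.self_of_nhds.2.1
  exact contDiffAt_linV_node hk (contDiffAt_lamL hk h2).neg (contDiffAt_fastR hk h2).neg
    (neg_injective.ne (lamL_lt_fastR h2).ne) hh.neg hv (contDiffAt_conT hε hk hh hv hd hdom)

end Smooth

end PWLCanard

/-! ### The turn in the right zone and the upper and lower central passages. -/

namespace PWLCanard

/-- Duration of the half-return from `(c, v)` to the line `X = c` in the right zone. -/
noncomputable def turnT (ε c v : ℝ) : ℝ := hitTime (fun t =>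
  linX (nodeC (-lamL 1 ε) (-fastR 1 ε)) (nodeS (-lamL 1 ε) (-fastR 1 ε)) c v t - c) (Ioi 0)

/-- Exit speed of the half-return of `turnT`. -/
noncomputable def turnW (ε c v : ℝ) : ℝ :=
  -linV 1 ε (nodeC (-lamL 1 ε) (-fastR 1 ε)) (nodeS (-lamL 1 ε) (-fastR 1 ε)) c v (turnT ε c v)

section TurnFacts

variable {ε c v : ℝ}

theorem turn (hε : 0 < ε) (hε' : 4 * ε < 1) (hc : 0 < c) (hv : 0 < v) :
    Turn ε (nodeC (-lamL 1 ε) (-fastR 1 ε)) (nodeS (-lamL 1 ε) (-fastR 1 ε)) c v (turnW ε c v)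
      (turnT ε c v) := by
  have hk : 4 * ε < 1 ^ 2 := by linarith
  have hl := lamL_pos hε one_pos
  have hlu := lamL_lt_fastR hk
  obtain ⟨t, ht, hX⟩ := exists_node_return hl hlu hc hv
  have hs := hitTime_spec (H := fun t => linX (nodeC (-lamL 1 ε) (-fastR 1 ε))
    (nodeS (-lamL 1 ε) (-fastR 1 ε)) c v t - c) (I := Ioi 0) ⟨t, ht, by simp [hX]⟩
  have hsp := node_return_spec hl hlu hc hs.1 (sub_eq_zero.1 hs.2)
  rw [lamL_add_fastR, lamL_mul_fastR hk] at hsp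
  exact ⟨fund_contract hk, hs.1, neg_pos.2 hsp.1, sub_eq_zero.1 hs.2, (neg_neg _).symm, hsp.2⟩

theorem turn_slow (hε : 0 < ε) (hε' : 4 * ε < 1) (hc : 0 < c) (hv : 0 < v) :
    fastR 1 ε * c - turnW ε c v = (v + fastR 1 ε * c) * exp (-(lamL 1 ε * turnT ε c v)) := by
  have hk : 4 * ε < 1 ^ 2 := by linarith
  have ht := turn hε hε' hc hv
  have := node_integral_left (neg_injective.ne (lamL_lt_fastR hk).ne) (κ := 1)
    (by rw [← neg_add, neg_neg, lamL_add_fastR]) (by rw [neg_mul_neg, lamL_mul_fastR hk])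
    c v (turnT ε c v)
  rw [ht.linX_eq, ht.linV_eq, neg_mul (lamL 1 ε)] at this
  linarith

theorem turn_fast (hε : 0 < ε) (hε' : 4 * ε < 1) (hc : 0 < c) (hv : 0 < v) :
    lamL 1 ε * c - turnW ε c v = (v + lamL 1 ε * c) * exp (-(fastR 1 ε * turnT ε c v)) := by
  have hk : 4 * ε < 1 ^ 2 := by linarith
  have ht := turn hε hε' hc hv
  have := node_integral_right (neg_injective.ne (lamL_lt_fastR hk).ne) (κ := 1)
    (by rw [← neg_add, neg_neg, lamL_add_fastR]) (by rw [neg_mul_neg, lamL_mul_fastR hk])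
    c v (turnT ε c v)
  rw [ht.linX_eq, ht.linV_eq, neg_mul (fastR 1 ε)] at this
  linarith

variable {E : Type*} [NormedAddCommGroup E] [NormedSpace ℝ E] [CompleteSpace E] {x : E}
  {c v : E → ℝ}

theorem contDiffAt_turnT (hε : 0 < ε) (hε' : 4 * ε < 1) (hc : ContDiffAt ℝ 1 c x)
    (hv : ContDiffAt ℝ 1 v x) (hdom : ∀ᶠ y in 𝓝 x, 0 < c y ∧ 0 < v y) :
    ContDiffAt ℝ 1 (fun y => turnT ε (c y) (v y)) x := by
  have hk : 4 * ε < 1 ^ 2 := by linarith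
  have hlu := lamL_lt_fastR hk
  obtain ⟨h1, h2⟩ := hdom.self_of_nhds
  have ht := turn hε hε' h1 h2
  have hV : linV 1 ε (nodeC (-lamL 1 ε) (-fastR 1 ε)) (nodeS (-lamL 1 ε) (-fastR 1 ε)) (c x) (v x)
      (turnT ε (c x) (v x)) ≠ 0 := by
    rw [ht.linV_eq]; exact (neg_neg_of_pos ht.w_pos).ne
  unfold turnT
  refine contDiffAt_hitTime (H := fun y t => linX (nodeC (-lamL 1 ε) (-fastR 1 ε))
    (nodeS (-lamL 1 ε) (-fastR 1 ε)) (c y) (v y) t - c y) isOpen_Ioi ?_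
    ⟨_, ht.pos, by simp [ht.linX_eq]⟩ ((ht.fund.hasDerivAt_linX (c x) (v x) _).sub_const _) hV ?_
  · set t := hitTime (fun t => linX (nodeC (-lamL 1 ε) (-fastR 1 ε))
      (nodeS (-lamL 1 ε) (-fastR 1 ε)) (c x) (v x) t - c x) (Ioi 0)
    have cc : ∀ {g : E → ℝ}, ContDiffAt ℝ 1 g x → ContDiffAt ℝ 1 (fun y : E × ℝ => g y.1) (x, t) :=
      fun hg => ContDiffAt.comp (x, t) (f := Prod.fst) hg contDiffAt_fst
    exact (contDiffAt_linX_node contDiffAt_const contDiffAt_const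
      (neg_injective.ne hlu.ne) (cc hc) (cc hv) contDiffAt_snd).sub (cc hc)
  · filter_upwards [hdom] with y hy t ht t' ht' e e'
    exact node_return_unique (lamL_pos hε one_pos) hlu hy.1 ht ht' (sub_eq_zero.1 e)
      (sub_eq_zero.1 e')

theorem contDiffAt_turnW (hε : 0 < ε) (hε' : 4 * ε < 1) (hc : ContDiffAt ℝ 1 c x)
    (hv : ContDiffAt ℝ 1 v x) (hdom : ∀ᶠ y in 𝓝 x, 0 < c y ∧ 0 < v y) :
    ContDiffAt ℝ 1 (fun y => turnW ε (c y) (v y)) x :=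
  (contDiffAt_linV_node contDiffAt_const contDiffAt_const contDiffAt_const
    (neg_injective.ne (lamL_lt_fastR (by linarith : 4 * ε < 1 ^ 2)).ne) hc hv
    (contDiffAt_turnT hε hε' hc hv hdom)).neg

end TurnFacts

theorem leg_quarter {s ε c r : ℝ} (hs : s ^ 2 = 1) (hε : 0 < ε) (hc : 0 < c) (hr : 0 < r) :
    Leg (s * √ε) ε (focC (s * √ε) (omg * √ε)) (focS (s * √ε) (omg * √ε)) (-c) (c * √ε * r) 0
      (c * √ε * gf s r) (tauf s r / √ε) := by
  obtain ⟨h1, h2, -, h4⟩ := center_quarter hs hε hc hr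
  have hX := fun t => linX_neg (focC (s * √ε) (omg * √ε)) (focS (s * √ε) (omg * √ε)) c
    (-(c * √ε * r)) t
  have hV := fun t => linV_neg (s * √ε) ε (focC (s * √ε) (omg * √ε)) (focS (s * √ε) (omg * √ε)) c
    (-(c * √ε * r)) t
  simp only [neg_neg] at hX hV
  refine ⟨fund_center hs hε, div_pos (tauf_pos s r) (Real.sqrt_pos.2 hε), ?_, ?_, fun t ht => ?_⟩
  · rw [hX, h1, neg_zero]
  · rw [hV, h2, neg_neg]
  · rw [hV, neg_pos]; exact h4 t ⟨ht.1.le, ht.2⟩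

/-- Duration of the upper passage through the central zone. -/
noncomputable def topT (s ε d q : ℝ) : ℝ := hitTime (fun t =>
  linX (focC (s * √ε) (omg * √ε)) (focS (s * √ε) (omg * √ε)) (-d) q t - (2 * √ε - d))
  (Ioo 0 (1 / (2 * √ε)))

/-- Exit velocity of the upper passage through the central zone. -/
noncomputable def topV (s ε d q : ℝ) : ℝ :=
  linV (s * √ε) ε (focC (s * √ε) (omg * √ε)) (focS (s * √ε) (omg * √ε)) (-d) q (topT s ε d q)

section Top

variable {s ε d q : ℝ}

/-- Up to time `1 / (2 √ε)` the focus turns by an angle of at most `omg / 2`, so the cosine is at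
least `29 / 32` and the damping factor at least `3 / 4`. A quarter of the speed survives. The term
with `d` only helps. -/
theorem top_linV_ge (hs : s ^ 2 = 1) (hε : 0 < ε) (hd : 0 ≤ d) (hq : 0 ≤ q) {t : ℝ} (ht0 : 0 ≤ t)
    (ht : t ≤ 1 / (2 * √ε)) : q / 4 ≤ linV (s * √ε) ε (focC (s * √ε) (omg * √ε))
      (focS (s * √ε) (omg * √ε)) (-d) q t := by
  have hσ := Real.sqrt_pos.2 hε
  set σ := √ε
  have hω := omg_pos
  have hω2 := omg_sq
  have hst : σ * t ≤ 1 / 2 := by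
    rw [le_div_iff₀ (by positivity)] at ht; linarith
  have hst0 : 0 ≤ σ * t := by positivity
  obtain ⟨hs1, hs2⟩ : -1 ≤ s ∧ s ≤ 1 := abs_le.1 (by
    rw [← abs_one, ← sq_le_sq]; linarith)
  have hω1 : omg ≤ 1 := by nlinarith
  have hθ : omg * σ * t = omg * (σ * t) := by ring
  have hsin0 : 0 ≤ sin (omg * σ * t) := by
    refine Real.sin_nonneg_of_nonneg_of_le_pi (by positivity) ?_
    rw [hθ]; nlinarith [Real.pi_gt_three]
  have hsin : sin (omg * σ * t) ≤ omg * σ * t := Real.sin_le (by positivity)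
  have hcos : 1 - (omg * σ * t) ^ 2 / 2 ≤ cos (omg * σ * t) := Real.one_sub_sq_div_two_le_cos
  have hcos' : 29 / 32 ≤ cos (omg * σ * t) := by
    have : (omg * σ * t) ^ 2 ≤ 3 / 16 := by
      rw [hθ, mul_pow, hω2]; nlinarith
    linarith
  have hdiv : sin (omg * σ * t) / (omg * σ) ≤ t := by
    rw [div_le_iff₀ (by positivity)]; linarith
  have hdiv0 : 0 ≤ sin (omg * σ * t) / (omg * σ) := by positivity
  have hbr : 1 / 2 ≤ cos (omg * σ * t) - s * σ / 2 * (sin (omg * σ * t) / (omg * σ)) := by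
    have h1 : s * σ / 2 * (sin (omg * σ * t) / (omg * σ)) ≤ σ / 2 * t := by
      calc _ ≤ 1 * σ / 2 * (sin (omg * σ * t) / (omg * σ)) := by gcongr
        _ ≤ 1 * σ / 2 * t := by gcongr
        _ = _ := by ring
    linarith
  have hexp : 3 / 4 ≤ exp (-(s * σ / 2 * t)) := by
    have := Real.add_one_le_exp (-(s * σ / 2 * t))
    have h2 : s * (σ * t) ≤ 1 * (σ * t) := by gcongr
    linarith
  have hprod : 1 / 4 ≤ exp (-(s * σ / 2 * t)) *
      (cos (omg * σ * t) - s * σ / 2 * (sin (omg * σ * t) / (omg * σ))) := by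
    calc (1 : ℝ) / 4 ≤ 3 / 4 * (1 / 2) := by norm_num
      _ ≤ _ := by gcongr
  have hS : 0 ≤ focS (s * σ) (omg * σ) t := by unfold focS; positivity
  have hCS : focC (s * σ) (omg * σ) t - s * σ * focS (s * σ) (omg * σ) t
      = exp (-(s * σ / 2 * t)) *
      (cos (omg * σ * t) - s * σ / 2 * (sin (omg * σ * t) / (omg * σ))) := by
    unfold focC focS; ring
  unfold linV
  rw [hCS]
  have h1 : 0 ≤ ε * d * focS (s * σ) (omg * σ) t := by positivity
  nlinarith

theorem strictMonoOn_top (hs : s ^ 2 = 1) (hε : 0 < ε) (hd : 0 ≤ d) (hq : 0 < q) :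
    StrictMonoOn (linX (focC (s * √ε) (omg * √ε)) (focS (s * √ε) (omg * √ε)) (-d) q)
      (Icc 0 (1 / (2 * √ε))) := by
  have F := fund_center hs hε
  refine strictMonoOn_of_deriv_pos (convex_Icc _ _) (F.continuous_linX _ _).continuousOn
    fun t ht => ?_
  rw [interior_Icc] at ht
  rw [(F.hasDerivAt_linX _ _ t).deriv]
  linarith [top_linV_ge hs hε hd hq.le ht.1.le ht.2.le]

theorem top_linX_ge (hs : s ^ 2 = 1) (hε : 0 < ε) (hd : 0 ≤ d) (hq : 0 ≤ q) {t : ℝ} (ht0 : 0 ≤ t)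
    (ht : t ≤ 1 / (2 * √ε)) : -d + q / 4 * t ≤ linX (focC (s * √ε) (omg * √ε))
      (focS (s * √ε) (omg * √ε)) (-d) q t := by
  have F := fund_center hs hε
  have hd' : ∀ t, HasDerivAt (fun t => linX (focC (s * √ε) (omg * √ε))
      (focS (s * √ε) (omg * √ε)) (-d) q t - q / 4 * t)
      (linV (s * √ε) ε (focC (s * √ε) (omg * √ε)) (focS (s * √ε) (omg * √ε)) (-d) q t - q / 4) t :=
    fun t => by
      exact ((F.hasDerivAt_linX (-d) q t).sub ((hasDerivAt_id' t).const_mul (q / 4))).congr_deriv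
        (by rw [mul_one])
  have hm : MonotoneOn (fun t => linX (focC (s * √ε) (omg * √ε))
      (focS (s * √ε) (omg * √ε)) (-d) q t - q / 4 * t) (Icc 0 (1 / (2 * √ε))) := by
    refine monotoneOn_of_deriv_nonneg (convex_Icc _ _)
      (fun t _ => (hd' t).continuousAt.continuousWithinAt)
      (fun t _ => (hd' t).differentiableAt.differentiableWithinAt) fun t ht => ?_
    rw [interior_Icc] at ht
    rw [(hd' t).deriv]
    linarith [top_linV_ge hs hε hd hq ht.1.le ht.2.le]
  have := hm ⟨le_rfl, ht0.trans ht⟩ ⟨ht0, ht⟩ ht0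
  simp only [F.linX_zero, mul_zero, sub_zero] at this
  linarith

theorem exists_top (hs : s ^ 2 = 1) (hε : 0 < ε) (hd : 0 < d) (hd' : d < 2 * √ε)
    (hq : 16 * ε < q) : ∃ t ∈ Ioo 0 (1 / (2 * √ε)), linX (focC (s * √ε) (omg * √ε))
      (focS (s * √ε) (omg * √ε)) (-d) q t - (2 * √ε - d) = 0 := by
  have F := fund_center hs hε
  have hσ := Real.sqrt_pos.2 hε
  have hσ2 := Real.sq_sqrt hε.le
  have hq0 : 0 < q := by linarith
  have hb : 0 < 1 / (2 * √ε) := by positivity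
  have h1 := top_linX_ge hs hε hd.le hq0.le hb.le le_rfl
  -- A speed of at least `q / 4` during time `1 / (2 √ε)` covers the width `2 √ε` of the zone
  -- exactly when `16 ε < q`, up to strictness.
  have h2 : 2 * √ε - d < -d + q / 4 * (1 / (2 * √ε)) := by
    have : 2 * √ε < q / 4 * (1 / (2 * √ε)) := by
      rw [mul_one_div, lt_div_iff₀ (by positivity)]; nlinarith
    linarith
  obtain ⟨t, ht, hte⟩ := intermediate_value_Ioo hb.le (F.continuous_linX (-d) q).continuousOn
    (show 2 * √ε - d ∈ Ioo _ _ from ⟨by rw [F.linX_zero]; linarith, h2.trans_le h1⟩)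
  exact ⟨t, ht, by rw [hte, sub_self]⟩

theorem leg_top (hs : s ^ 2 = 1) (hε : 0 < ε) (hd : 0 < d) (hd' : d < 2 * √ε)
    (hq : 16 * ε < q) : Leg (s * √ε) ε (focC (s * √ε) (omg * √ε)) (focS (s * √ε) (omg * √ε)) (-d) q
      (2 * √ε - d) (topV s ε d q) (topT s ε d q) := by
  have h := hitTime_spec (exists_top hs hε hd hd' hq)
  refine ⟨fund_center hs hε, h.1.1, sub_eq_zero.1 h.2, rfl, fun t ht => ?_⟩
  have hq0 : 0 < q := by linarith
  linarith [top_linV_ge hs hε hd.le hq0.le ht.1.le (ht.2.trans h.1.2.le)]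

theorem topT_le (hs : s ^ 2 = 1) (hε : 0 < ε) (hd : 0 < d) (hd' : d < 2 * √ε)
    (hq : 16 * ε < q) : topT s ε d q * q ≤ 8 * √ε := by
  have h := hitTime_spec (exists_top hs hε hd hd' hq)
  have h1 := top_linX_ge hs hε hd.le (by linarith : 0 ≤ q) h.1.1.le h.1.2.le
  rw [sub_eq_zero.1 h.2] at h1
  unfold topT
  linarith

/-- The combination `V + s √ε X` has derivative `-ε X`. Along the passage `|X| ≤ 2 √ε` and `T ≤ 1 /
(2 √ε)`, so this integrates to at most `ε`. The change of `s √ε X` across the zone contributes `2 ε`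
more. -/
theorem abs_topV_sub_le (hs : s ^ 2 = 1) (hε : 0 < ε) (hd : 0 < d) (hd' : d < 2 * √ε)
    (hq : 16 * ε < q) : |topV s ε d q - q| ≤ 3 * ε := by
  have hl := leg_top hs hε hd hd' hq
  have hσ := Real.sqrt_pos.2 hε
  have hσ2 := Real.sq_sqrt hε.le
  have hT : topT s ε d q ≤ 1 / (2 * √ε) := (hitTime_spec (exists_top hs hε hd hd' hq)).1.2.le
  have hT' : √ε * topT s ε d q ≤ 1 / 2 := by
    rw [le_div_iff₀ (by positivity)] at hT; linarith
  have F := hl.fund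
  have hder : ∀ t, HasDerivAt (fun t => linV (s * √ε) ε (focC (s * √ε) (omg * √ε))
      (focS (s * √ε) (omg * √ε)) (-d) q t + s * √ε * linX (focC (s * √ε) (omg * √ε))
      (focS (s * √ε) (omg * √ε)) (-d) q t)
      (-(ε * linX (focC (s * √ε) (omg * √ε)) (focS (s * √ε) (omg * √ε)) (-d) q t)) t := fun t => by
    refine ((F.hasDerivAt_linV (-d) q t).add
      ((F.hasDerivAt_linX (-d) q t).const_mul (s * √ε))).congr_deriv ?_
    ring
  obtain ⟨ξ, hξ, he⟩ := exists_hasDerivAt_eq_slope _ _ hl.pos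
    (fun t _ => (hder t).continuousAt.continuousWithinAt) (fun t _ => hder t)
  rw [F.linX_zero, F.linV_zero, hl.linX_eq, hl.linV_eq, sub_zero, eq_div_iff hl.pos.ne'] at he
  have hX := hl.mem_Icc (Ioo_subset_Icc_self hξ)
  set X := linX (focC (s * √ε) (omg * √ε)) (focS (s * √ε) (omg * √ε)) (-d) q ξ
  set T := topT s ε d q
  have hTp := hl.pos
  obtain ⟨hs1, hs2⟩ : -1 ≤ s ∧ s ≤ 1 := abs_le.1 (by
    rw [← abs_one, ← sq_le_sq]; linarith)
  have hXT : |X| * T ≤ 1 := by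
    have : |X| ≤ 2 * √ε := abs_le.2 ⟨by linarith [hX.1], by linarith [hX.2]⟩
    calc _ ≤ 2 * √ε * T := by gcongr
      _ ≤ _ := by linarith
  have hXT' : -1 ≤ X * T ∧ X * T ≤ 1 := abs_le.1 (by rwa [abs_mul, abs_of_pos hTp])
  have e : topV s ε d q - q = -(ε * (X * T)) - 2 * (s * ε) := by
    have h3 : s * √ε * (2 * √ε) = 2 * (s * ε) := by linear_combination 2 * s * hσ2
    linarith
  rw [e, abs_le]
  constructor <;> nlinarith

end Top

section TopSmooth

variable {E : Type*} [NormedAddCommGroup E] [NormedSpace ℝ E] {s ε : ℝ} {d q T : E → ℝ} {x : E}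

theorem contDiffAt_top (hd : ContDiffAt ℝ 1 d x) (hq : ContDiffAt ℝ 1 q x)
    (hT : ContDiffAt ℝ 1 T x) (F : Fund (s * √ε) ε (focC (s * √ε) (omg * √ε))
      (focS (s * √ε) (omg * √ε))) :
    ContDiffAt ℝ 1 (fun y => linX (focC (s * √ε) (omg * √ε)) (focS (s * √ε) (omg * √ε)) (-d y)
      (q y) (T y)) x ∧ ContDiffAt ℝ 1 (fun y => linV (s * √ε) ε (focC (s * √ε) (omg * √ε))
      (focS (s * √ε) (omg * √ε)) (-d y) (q y) (T y)) x := by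
  have hC : ContDiffAt ℝ 1 (fun y => focC (s * √ε) (omg * √ε) (T y)) x :=
    (F.smooth_C.of_le (by norm_num)).contDiffAt.comp x hT
  have hS : ContDiffAt ℝ 1 (fun y => focS (s * √ε) (omg * √ε) (T y)) x :=
    (F.smooth_S.of_le (by norm_num)).contDiffAt.comp x hT
  exact ⟨(hd.neg.mul hC).add (hq.mul hS), (((contDiffAt_const.mul hd.neg).mul hS).neg).add
    (hq.mul (hC.sub (contDiffAt_const.mul hS)))⟩

variable [CompleteSpace E]

theorem contDiffAt_topT (hs : s ^ 2 = 1) (hε : 0 < ε) (hd : ContDiffAt ℝ 1 d x)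
    (hq : ContDiffAt ℝ 1 q x) (hdom : ∀ᶠ y in 𝓝 x, 0 < d y ∧ d y < 2 * √ε ∧ 16 * ε < q y) :
    ContDiffAt ℝ 1 (fun y => topT s ε (d y) (q y)) x := by
  obtain ⟨h1, h2, h3⟩ := hdom.self_of_nhds
  have hl := leg_top hs hε h1 h2 h3
  unfold topT
  refine contDiffAt_hitTime (H := fun y t => linX (focC (s * √ε) (omg * √ε))
    (focS (s * √ε) (omg * √ε)) (-d y) (q y) t - (2 * √ε - d y)) isOpen_Ioo ?_
    (exists_top hs hε h1 h2 h3) ((hl.fund.hasDerivAt_linX (-d x) (q x) _).sub_const _)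
    (hl.linV_pos _ ⟨hl.pos, le_rfl⟩).ne' ?_
  · set t := hitTime (fun t => linX (focC (s * √ε) (omg * √ε))
      (focS (s * √ε) (omg * √ε)) (-d x) (q x) t - (2 * √ε - d x)) (Ioo 0 (1 / (2 * √ε)))
    have cc : ∀ {g : E → ℝ}, ContDiffAt ℝ 1 g x → ContDiffAt ℝ 1 (fun y : E × ℝ => g y.1) (x, t) :=
      fun hg => ContDiffAt.comp (x, t) (f := Prod.fst) hg contDiffAt_fst
    exact (contDiffAt_top (cc hd) (cc hq) contDiffAt_snd hl.fund).1.sub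
      (contDiffAt_const.sub (cc hd))
  · have hq0 : 0 < 16 * ε := by linarith
    filter_upwards [hdom] with y hy t ht t' ht' e e'
    exact (strictMonoOn_top hs hε hy.1.le (hq0.trans hy.2.2)).injOn (Ioo_subset_Icc_self ht)
      (Ioo_subset_Icc_self ht') (by linarith)

theorem contDiffAt_topV (hs : s ^ 2 = 1) (hε : 0 < ε) (hd : ContDiffAt ℝ 1 d x)
    (hq : ContDiffAt ℝ 1 q x) (hdom : ∀ᶠ y in 𝓝 x, 0 < d y ∧ d y < 2 * √ε ∧ 16 * ε < q y) :
    ContDiffAt ℝ 1 (fun y => topV s ε (d y) (q y)) x :=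
  (contDiffAt_top hd hq (contDiffAt_topT hs hε hd hq hdom) (fund_center hs hε)).2

end TopSmooth

theorem hasDerivAt_tauf (s r : ℝ) :
    HasDerivAt (tauf s) (-(1 / (omg ^ 2 + (r - s / 2) ^ 2))) r := by
  have hω := omg_pos
  have h1 : HasDerivAt (fun r => (r - s / 2) / omg) (1 / omg) r :=
    ((hasDerivAt_id r).sub_const (s / 2)).div_const omg
  refine ((h1.arctan.const_sub (π / 2)).div_const omg).congr_deriv ?_
  have : omg ^ 2 + (r - s / 2) ^ 2 ≠ 0 := by positivity
  field_simp

theorem hasDerivAt_gf {s : ℝ} (hs : s ^ 2 = 1) (r : ℝ) :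
    HasDerivAt (gf s) (gf s r * (r / (1 - s * r + r ^ 2))) r := by
  have hω := omg_pos
  have hQ : omg ^ 2 + (r - s / 2) ^ 2 = 1 - s * r + r ^ 2 := by rw [omg_sq]; linear_combination hs / 4
  have hQ0 : 0 < omg ^ 2 + (r - s / 2) ^ 2 := by positivity
  have h1 := (((hasDerivAt_tauf s r).const_mul (s / 2)).neg).exp
  have h2 : HasDerivAt (fun r => omg ^ 2 + (r - s / 2) ^ 2) (2 * (r - s / 2)) r := by
    refine ((((hasDerivAt_id r).sub_const (s / 2)).pow 2).const_add (omg ^ 2)).congr_deriv ?_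
    simp
  refine (h1.mul (h2.sqrt hQ0.ne')).congr_deriv ?_
  rw [← hQ]
  unfold gf
  have h3 := Real.sq_sqrt hQ0.le
  have h4 := Real.sqrt_pos.2 hQ0
  set Q := omg ^ 2 + (r - s / 2) ^ 2
  set R := √Q
  rw [← h3]
  simp only [Pi.neg_apply]
  field_simp
  ring

end PWLCanard

/-! ### The closing defect and the integral of `f'` as functions of `k` and `a`. -/

namespace PWLCanard

/-- Parameters of the problem, together with the part of the orbit to the left of the line
`x = ℓ`: the velocities `q₀ a`, `-p₀ a` with which the orbit through the point of the nullcline with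
abscissa `x₀` meets this line forwards and backwards, and the contribution `J₀ a` to `∫ f'`. -/
structure LeftData where
  s : ℝ
  ε : ℝ
  x₀ : ℝ
  ℓ : ℝ
  q₀ : ℝ → ℝ
  p₀ : ℝ → ℝ
  J₀ : ℝ → ℝ

namespace LeftData

variable (L : LeftData)

/-- The speed at `x = -√ε`, forwards. -/
noncomputable def q (k a : ℝ) : ℝ := expV L.ε k (a - L.ℓ) (L.q₀ a) (√L.ε + a)

/-- Duration of the left leg, forwards. -/
noncomputable def t₁ (k a : ℝ) : ℝ := expT L.ε k (a - L.ℓ) (L.q₀ a) (√L.ε + a)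

/-- The speed at `x = -√ε`, backwards. -/
noncomputable def p (k a : ℝ) : ℝ := conV L.ε k (a - L.ℓ) (L.p₀ a) (√L.ε + a)

/-- Duration of the left leg, backwards. -/
noncomputable def t₂ (k a : ℝ) : ℝ := conT L.ε k (a - L.ℓ) (L.p₀ a) (√L.ε + a)

/-- The upward speed at `x = √ε`. -/
noncomputable def v (k a : ℝ) : ℝ := topV L.s L.ε (√L.ε + a) (L.q k a)

/-- Duration of the upper passage of the central zone. -/
noncomputable def T₁ (k a : ℝ) : ℝ := topT L.s L.ε (√L.ε + a) (L.q k a)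

/-- The downward speed at `x = √ε`. -/
noncomputable def w (k a : ℝ) : ℝ := turnW L.ε (√L.ε - a) (L.v k a)

/-- Time spent in the right zone. -/
noncomputable def T₂ (k a : ℝ) : ℝ := turnT L.ε (√L.ε - a) (L.v k a)

/-- Scaled slope at which the orbit enters the central zone at its lower right corner. -/
noncomputable def r₁ (k a : ℝ) : ℝ := L.w k a / ((√L.ε - a) * √L.ε)

/-- Scaled slope at which the orbit leaves the central zone at its lower left corner. -/
noncomputable def r₂ (k a : ℝ) : ℝ := L.p k a / ((√L.ε + a) * √L.ε)

/-- Duration of the lower passage of the central zone. -/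
noncomputable def T₃ (k a : ℝ) : ℝ := (tauf L.s (L.r₁ k a) + tauf (-L.s) (L.r₂ k a)) / √L.ε

/-- The closing defect. -/
noncomputable def D (k a : ℝ) : ℝ :=
  (√L.ε - a) * gf L.s (L.r₁ k a) - (√L.ε + a) * gf (-L.s) (L.r₂ k a)

/-- The integral of `f'` along the orbit. -/
noncomputable def J (k a : ℝ) : ℝ :=
  L.s * √L.ε * (L.T₁ k a + L.T₃ k a) + L.T₂ k a - k * (L.t₁ k a + L.t₂ k a) + L.J₀ a

/-- The construction makes sense for `k ∈ K` and `|a| < √ε`. -/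
structure Valid (K : Set ℝ) : Prop where
  isOpen : IsOpen K
  s_sq : L.s ^ 2 = 1
  ε_pos : 0 < L.ε
  ε_lt : 4 * L.ε < 1
  k_pos : ∀ k ∈ K, 0 < k
  lt_k : ∀ k ∈ K, 4 * L.ε < k ^ 2
  ℓ_lt : L.ℓ < -√L.ε
  le_ℓ : -1 ≤ L.ℓ
  q₀_nonneg : ∀ a, |a| < √L.ε → 0 ≤ L.q₀ a
  p₀_nonneg : ∀ a, |a| < √L.ε → 0 ≤ L.p₀ a
  p₀_lt : ∀ k ∈ K, ∀ a, |a| < √L.ε → L.p₀ a < fastR k L.ε * (a - L.ℓ)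
  lt_q : ∀ k ∈ K, ∀ a, |a| < √L.ε → 16 * L.ε < L.q k a
  smooth_q₀ : ∀ a, |a| < √L.ε → ContDiffAt ℝ 1 L.q₀ a
  smooth_p₀ : ∀ a, |a| < √L.ε → ContDiffAt ℝ 1 L.p₀ a
  smooth_J₀ : ∀ a, |a| < √L.ε → ContDiffAt ℝ 1 L.J₀ a
  upTo : ∀ k ∈ K, ∀ a, |a| < √L.ε → ∃ τ, UpTo a k (L.s * √L.ε) L.ε L.x₀ L.ℓ (L.q₀ a) τ
  downTo : ∀ k ∈ K, ∀ a, |a| < √L.ε → ∃ τ, DownTo a k (L.s * √L.ε) L.ε L.x₀ L.ℓ (L.p₀ a) τ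

namespace Valid

variable {L} {K : Set ℝ} {k a : ℝ}

theorem leg_q (h : L.Valid K) (hk : k ∈ K) (ha : |a| < √L.ε) :
    Leg (-k) L.ε (nodeC (lamL k L.ε) (fastR k L.ε)) (nodeS (lamL k L.ε) (fastR k L.ε))
      (-(a - L.ℓ)) (L.q₀ a) (-(√L.ε + a)) (L.q k a) (L.t₁ k a) :=
  leg_expand h.ε_pos (h.k_pos k hk) (h.lt_k k hk) (by linarith [h.ℓ_lt])
    (by linarith [(abs_lt.1 ha).1]) (h.q₀_nonneg a ha)

theorem leg_p (h : L.Valid K) (hk : k ∈ K) (ha : |a| < √L.ε) :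
    Leg k L.ε (nodeC (-lamL k L.ε) (-fastR k L.ε)) (nodeS (-lamL k L.ε) (-fastR k L.ε))
      (-(a - L.ℓ)) (L.p₀ a) (-(√L.ε + a)) (L.p k a) (L.t₂ k a) :=
  leg_contract h.ε_pos (h.k_pos k hk) (h.lt_k k hk) (by linarith [h.ℓ_lt])
    (by linarith [(abs_lt.1 ha).1]) (h.p₀_nonneg a ha) (h.p₀_lt k hk a ha)

theorem leg_v (h : L.Valid K) (hk : k ∈ K) (ha : |a| < √L.ε) :
    Leg (L.s * √L.ε) L.ε (focC (L.s * √L.ε) (omg * √L.ε)) (focS (L.s * √L.ε) (omg * √L.ε))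
      (-(√L.ε + a)) (L.q k a) (√L.ε - a) (L.v k a) (L.T₁ k a) := by
  obtain ⟨h1, h2⟩ := abs_lt.1 ha
  have := leg_top h.s_sq h.ε_pos (d := √L.ε + a) (by linarith) (by linarith) (h.lt_q k hk a ha)
  rwa [show 2 * √L.ε - (√L.ε + a) = √L.ε - a by ring] at this

theorem turn_w (h : L.Valid K) (hk : k ∈ K) (ha : |a| < √L.ε) :
    Turn L.ε (nodeC (-lamL 1 L.ε) (-fastR 1 L.ε)) (nodeS (-lamL 1 L.ε) (-fastR 1 L.ε)) (√L.ε - a)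
      (L.v k a) (L.w k a) (L.T₂ k a) :=
  turn h.ε_pos h.ε_lt (by linarith [(abs_lt.1 ha).2]) (h.leg_v hk ha).exit_pos

theorem sqrt_pos (h : L.Valid K) : 0 < √L.ε := Real.sqrt_pos.2 h.ε_pos

theorem c_pos (ha : |a| < √L.ε) : 0 < √L.ε - a := by linarith [(abs_lt.1 ha).2]

theorem d_pos (ha : |a| < √L.ε) : 0 < √L.ε + a := by linarith [(abs_lt.1 ha).1]

theorem r₁_pos (h : L.Valid K) (hk : k ∈ K) (ha : |a| < √L.ε) : 0 < L.r₁ k a :=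
  div_pos (h.turn_w hk ha).w_pos (mul_pos (c_pos ha) h.sqrt_pos)

theorem r₂_pos (h : L.Valid K) (hk : k ∈ K) (ha : |a| < √L.ε) : 0 < L.r₂ k a :=
  div_pos (h.leg_p hk ha).exit_pos (mul_pos (d_pos ha) h.sqrt_pos)

theorem r₁_mul (h : L.Valid K) (ha : |a| < √L.ε) : (√L.ε - a) * √L.ε * L.r₁ k a = L.w k a :=
  mul_div_cancel₀ _ (mul_pos (c_pos ha) h.sqrt_pos).ne'

theorem r₂_mul (h : L.Valid K) (ha : |a| < √L.ε) : (√L.ε + a) * √L.ε * L.r₂ k a = L.p k a :=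
  mul_div_cancel₀ _ (mul_pos (d_pos ha) h.sqrt_pos).ne'

theorem leg_w (h : L.Valid K) (hk : k ∈ K) (ha : |a| < √L.ε) :
    Leg (L.s * √L.ε) L.ε (focC (L.s * √L.ε) (omg * √L.ε)) (focS (L.s * √L.ε) (omg * √L.ε))
      (-(√L.ε - a)) (L.w k a) 0 ((√L.ε - a) * √L.ε * gf L.s (L.r₁ k a))
      (tauf L.s (L.r₁ k a) / √L.ε) := by
  rw [← h.r₁_mul ha]
  exact leg_quarter h.s_sq h.ε_pos (c_pos ha) (h.r₁_pos hk ha)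

theorem leg_pc (h : L.Valid K) (hk : k ∈ K) (ha : |a| < √L.ε) :
    Leg (-(L.s * √L.ε)) L.ε (focC (-L.s * √L.ε) (omg * √L.ε)) (focS (-L.s * √L.ε) (omg * √L.ε))
      (-(√L.ε + a)) (L.p k a) 0 ((√L.ε + a) * √L.ε * gf (-L.s) (L.r₂ k a))
      (tauf (-L.s) (L.r₂ k a) / √L.ε) := by
  rw [← h.r₂_mul ha, ← neg_mul]
  exact leg_quarter (by rw [neg_sq, h.s_sq]) h.ε_pos (d_pos ha) (h.r₂_pos hk ha)

/-- The two speeds on `x = a` are `√ε` times the two terms of `D`, so the orbit closes exactly when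
`D` vanishes. -/
theorem shoot (h : L.Valid K) (hk : k ∈ K) (ha : |a| < √L.ε) :
    ∃ ts Tf Tb, Shoot a k (L.s * √L.ε) L.ε L.x₀ ts Tf Tb (L.w k a)
      ((√L.ε - a) * √L.ε * gf L.s (L.r₁ k a)) ((√L.ε + a) * √L.ε * gf (-L.s) (L.r₂ k a)) := by
  have hε1 : L.ε < 1 := by linarith [h.ε_lt, h.ε_pos]
  have hσ := h.sqrt_pos
  have hσ1 : √L.ε < 1 := by rw [Real.sqrt_lt' one_pos]; simpa using hε1
  obtain ⟨τ, hu⟩ := h.upTo k hk a ha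
  obtain ⟨τ', hd⟩ := h.downTo k hk a ha
  have hu2 := hu.step hε1.le (ℓ' := -√L.ε) (v' := L.q k a) (T := L.t₁ k a)
    (by
      have := h.leg_q hk ha
      rwa [show -(a - L.ℓ) = L.ℓ - a by ring, show -(√L.ε + a) = -√L.ε - a by ring] at this)
    (isZone_left _ _ _ _) (Icc_subset_Icc_left h.le_ℓ)
  have hu3 := hu2.step hε1.le (ℓ' := √L.ε) (v' := L.v k a) (T := L.T₁ k a)
    (by
      have := h.leg_v hk ha
      rwa [show -(√L.ε + a) = -√L.ε - a by ring] at this)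
    (isZone_center hσ1) (Icc_subset_Icc_left le_rfl)
  have hd2 := hd.step (κ := -k) hε1.le (ℓ' := -√L.ε) (v' := L.p k a) (T := L.t₂ k a)
    (by
      have := h.leg_p hk ha
      rw [neg_neg]
      rwa [show -(a - L.ℓ) = L.ℓ - a by ring, show -(√L.ε + a) = -√L.ε - a by ring] at this)
    (isZone_left _ _ _ _) (Icc_subset_Icc_left h.le_ℓ)
  exact ⟨_, _, _, shoot_of_legs h.ε_pos hε1 ha rfl rfl hu3
    (by linarith [(h.leg_q hk ha).pos, (h.leg_v hk ha).pos, hu.1])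
    (h.turn_w hk ha) (h.leg_w hk ha) hd2 (h.leg_pc hk ha)⟩

theorem eventually_mem (h : L.Valid K) (hk : k ∈ K) (ha : |a| < √L.ε) :
    ∀ᶠ y : ℝ × ℝ in 𝓝 (k, a), y.1 ∈ K ∧ |y.2| < √L.ε :=
  (continuousAt_fst.eventually_mem (h.isOpen.mem_nhds hk)).and
    (continuousAt_snd.abs.eventually_lt_const ha)

section Smooth

variable (h : L.Valid K) (hk : k ∈ K) (ha : |a| < √L.ε)
include h hk ha

theorem smooth_left : ContDiffAt ℝ 1 (fun y : ℝ × ℝ => L.q y.1 y.2) (k, a) ∧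
    ContDiffAt ℝ 1 (fun y : ℝ × ℝ => L.t₁ y.1 y.2) (k, a) ∧
    ContDiffAt ℝ 1 (fun y : ℝ × ℝ => L.p y.1 y.2) (k, a) ∧
    ContDiffAt ℝ 1 (fun y : ℝ × ℝ => L.t₂ y.1 y.2) (k, a) := by
  have hev := h.eventually_mem hk ha
  have c2 : ∀ {g : ℝ → ℝ}, ContDiffAt ℝ 1 g a →
      ContDiffAt ℝ 1 (fun y : ℝ × ℝ => g y.2) (k, a) :=
    fun hg => ContDiffAt.comp (k, a) (f := Prod.snd) hg contDiffAt_snd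
  have e1 := hev.mono fun y hy => show 0 < y.1 ∧ 4 * L.ε < y.1 ^ 2 ∧ √L.ε + y.2 < y.2 - L.ℓ ∧
    0 < √L.ε + y.2 ∧ 0 ≤ L.q₀ y.2 from ⟨h.k_pos _ hy.1, h.lt_k _ hy.1, by linarith [h.ℓ_lt],
      d_pos hy.2, h.q₀_nonneg _ hy.2⟩
  have e2 := hev.mono fun y hy => show 0 < y.1 ∧ 4 * L.ε < y.1 ^ 2 ∧ √L.ε + y.2 < y.2 - L.ℓ ∧
    0 < √L.ε + y.2 ∧ 0 ≤ L.p₀ y.2 ∧ L.p₀ y.2 < fastR y.1 L.ε * (y.2 - L.ℓ) from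
    ⟨h.k_pos _ hy.1, h.lt_k _ hy.1, by linarith [h.ℓ_lt], d_pos hy.2, h.p₀_nonneg _ hy.2,
      h.p₀_lt _ hy.1 _ hy.2⟩
  have h1 : ContDiffAt ℝ 1 (fun y : ℝ × ℝ => y.2 - L.ℓ) (k, a) := contDiffAt_snd.sub contDiffAt_const
  have h2 : ContDiffAt ℝ 1 (fun y : ℝ × ℝ => √L.ε + y.2) (k, a) :=
    contDiffAt_const.add contDiffAt_snd
  have h3 := c2 (h.smooth_q₀ a ha)
  have h4 := c2 (h.smooth_p₀ a ha)
  exact ⟨contDiffAt_expV h.ε_pos contDiffAt_fst h1 h3 h2 e1,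
    contDiffAt_expT h.ε_pos contDiffAt_fst h1 h3 h2 e1,
    contDiffAt_conV h.ε_pos contDiffAt_fst h1 h4 h2 e2,
    contDiffAt_conT h.ε_pos contDiffAt_fst h1 h4 h2 e2⟩

theorem smooth_right : ContDiffAt ℝ 1 (fun y : ℝ × ℝ => L.v y.1 y.2) (k, a) ∧
    ContDiffAt ℝ 1 (fun y : ℝ × ℝ => L.T₁ y.1 y.2) (k, a) ∧
    ContDiffAt ℝ 1 (fun y : ℝ × ℝ => L.w y.1 y.2) (k, a) ∧
    ContDiffAt ℝ 1 (fun y : ℝ × ℝ => L.T₂ y.1 y.2) (k, a) := by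
  have hev := h.eventually_mem hk ha
  have hq := (h.smooth_left hk ha).1
  have h1 : ContDiffAt ℝ 1 (fun y : ℝ × ℝ => √L.ε - y.2) (k, a) :=
    contDiffAt_const.sub contDiffAt_snd
  have h2 : ContDiffAt ℝ 1 (fun y : ℝ × ℝ => √L.ε + y.2) (k, a) :=
    contDiffAt_const.add contDiffAt_snd
  have e1 := hev.mono fun y hy => show 0 < √L.ε + y.2 ∧ √L.ε + y.2 < 2 * √L.ε ∧
    16 * L.ε < L.q y.1 y.2 from ⟨d_pos hy.2, by linarith [c_pos hy.2], h.lt_q _ hy.1 _ hy.2⟩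
  have e2 := hev.mono fun y hy => show 0 < √L.ε - y.2 ∧ 0 < L.v y.1 y.2 from
    ⟨c_pos hy.2, (h.leg_v hy.1 hy.2).exit_pos⟩
  have hv := contDiffAt_topV h.s_sq h.ε_pos h2 hq e1
  exact ⟨hv, contDiffAt_topT h.s_sq h.ε_pos h2 hq e1, contDiffAt_turnW h.ε_pos h.ε_lt h1 hv e2,
    contDiffAt_turnT h.ε_pos h.ε_lt h1 hv e2⟩

theorem continuousAt_r : ContinuousAt (fun y : ℝ × ℝ => L.r₁ y.1 y.2) (k, a) ∧
    ContinuousAt (fun y : ℝ × ℝ => L.r₂ y.1 y.2) (k, a) := by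
  have hσ := h.sqrt_pos
  refine ⟨(h.smooth_right hk ha).2.2.1.continuousAt.div (by fun_prop)
    (mul_pos (c_pos ha) hσ).ne', (h.smooth_left hk ha).2.2.1.continuousAt.div (by fun_prop)
    (mul_pos (d_pos ha) hσ).ne'⟩

theorem continuousAt_D : ContinuousAt (fun y : ℝ × ℝ => L.D y.1 y.2) (k, a) := by
  obtain ⟨h1, h2⟩ := h.continuousAt_r hk ha
  have g1 := (hasDerivAt_gf h.s_sq (L.r₁ k a)).continuousAt
  have g2 := (hasDerivAt_gf (s := -L.s) (by rw [neg_sq, h.s_sq]) (L.r₂ k a)).continuousAt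
  have g1' := ContinuousAt.comp (x := (k, a)) (f := fun y : ℝ × ℝ => L.r₁ y.1 y.2) g1 h1
  have g2' := ContinuousAt.comp (x := (k, a)) (f := fun y : ℝ × ℝ => L.r₂ y.1 y.2) g2 h2
  exact ((continuousAt_const.sub continuousAt_snd).mul g1').sub
    ((continuousAt_const.add continuousAt_snd).mul g2')

theorem continuousAt_J : ContinuousAt (fun y : ℝ × ℝ => L.J y.1 y.2) (k, a) := by
  obtain ⟨h1, h2⟩ := h.continuousAt_r hk ha
  have g1 := (hasDerivAt_tauf L.s (L.r₁ k a)).continuousAt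
  have g2 := (hasDerivAt_tauf (-L.s) (L.r₂ k a)).continuousAt
  have g1' := ContinuousAt.comp (x := (k, a)) (f := fun y : ℝ × ℝ => L.r₁ y.1 y.2) g1 h1
  have g2' := ContinuousAt.comp (x := (k, a)) (f := fun y : ℝ × ℝ => L.r₂ y.1 y.2) g2 h2
  obtain ⟨-, i1, -, i2⟩ := h.smooth_left hk ha
  obtain ⟨-, i3, -, i4⟩ := h.smooth_right hk ha
  have i5 : ContinuousAt (fun y : ℝ × ℝ => L.J₀ y.2) (k, a) :=
    ContinuousAt.comp (x := (k, a)) (f := Prod.snd) (h.smooth_J₀ a ha).continuousAt continuousAt_snd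
  exact (((continuousAt_const.mul (i3.continuousAt.add ((g1'.add g2').div_const _))).add
    i4.continuousAt).sub (continuousAt_fst.mul (i1.continuousAt.add i2.continuousAt))).add i5

end Smooth

end Valid

end LeftData

/-- For each `k` the strictly decreasing function `D k` has a single zero `α k`. Monotonicity makes
`α` continuous without any derivative in `k`, and the intermediate value theorem applies to `J k (α
k)`. -/
theorem exists_common_zero {k₁ k₂ η : ℝ} {D J : ℝ → ℝ → ℝ} (hk : k₁ ≤ k₂) (hη : 0 ≤ η)
    (hD : ∀ k ∈ Icc k₁ k₂, ∀ a ∈ Icc (-η) η, ContinuousAt (fun y : ℝ × ℝ => D y.1 y.2) (k, a))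
    (hJ : ∀ k ∈ Icc k₁ k₂, ∀ a ∈ Icc (-η) η, ContinuousAt (fun y : ℝ × ℝ => J y.1 y.2) (k, a))
    (hanti : ∀ k ∈ Icc k₁ k₂, StrictAntiOn (D k) (Icc (-η) η))
    (hl : ∀ k ∈ Icc k₁ k₂, 0 < D k (-η)) (hr : ∀ k ∈ Icc k₁ k₂, D k η < 0)
    (h₁ : ∀ a ∈ Icc (-η) η, D k₁ a = 0 → 0 < J k₁ a)
    (h₂ : ∀ a ∈ Icc (-η) η, D k₂ a = 0 → J k₂ a < 0) :
    ∃ k ∈ Icc k₁ k₂, ∃ a ∈ Icc (-η) η, D k a = 0 ∧ J k a = 0 := by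
  have hroot : ∀ k : ℝ, ∃ a, k ∈ Icc k₁ k₂ → a ∈ Icc (-η) η ∧ D k a = 0 := by
    intro k
    by_cases hkk : k ∈ Icc k₁ k₂
    · have hc : ContinuousOn (D k) (Icc (-η) η) := fun a ha =>
        (ContinuousAt.comp (x := a) (f := fun a : ℝ => (k, a)) (hD k hkk a ha)
          (by fun_prop)).continuousWithinAt
      obtain ⟨a, ha, h0⟩ := intermediate_value_Icc' (by linarith : -η ≤ η) hc
        (show (0 : ℝ) ∈ Icc _ _ from ⟨(hr k hkk).le, (hl k hkk).le⟩)
      exact ⟨a, fun _ => ⟨ha, h0⟩⟩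
    · exact ⟨0, fun h => absurd h hkk⟩
  choose α hα using hroot
  have hcα : ContinuousOn α (Icc k₁ k₂) := by
    intro k hkk
    obtain ⟨ham, ha0⟩ := hα k hkk
    have hlt : -η < α k := lt_of_le_of_ne ham.1 fun h => by
      have := hl k hkk; rw [h, ha0] at this; exact lt_irrefl _ this
    have hgt : α k < η := lt_of_le_of_ne ham.2 fun h => by
      have := hr k hkk; rw [← h, ha0] at this; exact lt_irrefl _ this
    rw [ContinuousWithinAt, tendsto_order]
    have hDk : ∀ b ∈ Icc (-η) η, ContinuousAt (fun y => D y b) k := fun b hb =>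
      ContinuousAt.comp (x := k) (f := fun y : ℝ => (y, b)) (hD k hkk b hb) (by fun_prop)
    -- If `b < α k`, then `D k b > 0` and this persists for nearby parameters. Since `D` decreases
    -- in `a`, the nearby zeros stay to the right of `b`. The maximum with `-η` keeps the comparison
    -- point in the interval. The other half is symmetric.
    constructor
    · intro b hb
      have hb' : max b (-η) ∈ Icc (-η) η := ⟨le_max_right _ _, max_le (by linarith) (by linarith)⟩
      have h1 : 0 < D k (max b (-η)) := by
        rw [← ha0]; exact hanti k hkk hb' ham (max_lt hb hlt)
      have h2 := (hDk _ hb').eventually_const_lt h1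
      filter_upwards [nhdsWithin_le_nhds h2, self_mem_nhdsWithin] with y hy hyk
      obtain ⟨hym, hy0⟩ := hα y hyk
      by_contra hle
      push Not at hle
      have := (hanti y hyk).antitoneOn hym hb' (hle.trans (le_max_left _ _))
      linarith
    · intro b hb
      have hb' : min b η ∈ Icc (-η) η := ⟨le_min (by linarith) (by linarith), min_le_right _ _⟩
      have h1 : D k (min b η) < 0 := by
        rw [← ha0]; exact hanti k hkk ham hb' (lt_min hb hgt)
      have h2 := (hDk _ hb').eventually_lt_const h1
      filter_upwards [nhdsWithin_le_nhds h2, self_mem_nhdsWithin] with y hy hyk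
      obtain ⟨hym, hy0⟩ := hα y hyk
      by_contra hle
      push Not at hle
      have := (hanti y hyk).antitoneOn hb' hym ((min_le_left _ _).trans hle)
      linarith
  have hcJ : ContinuousOn (fun k => J k (α k)) (Icc k₁ k₂) := fun k hkk =>
    ContinuousAt.comp_continuousWithinAt (g := fun y : ℝ × ℝ => J y.1 y.2)
      (f := fun k => (k, α k)) (hJ k hkk _ (hα k hkk).1) (continuousWithinAt_id.prodMk (hcα k hkk))
  have l1 : k₁ ∈ Icc k₁ k₂ := ⟨le_rfl, hk⟩
  have l2 : k₂ ∈ Icc k₁ k₂ := ⟨hk, le_rfl⟩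
  obtain ⟨k, hkk, h0⟩ := intermediate_value_Icc' hk hcJ
    (show (0 : ℝ) ∈ Icc _ _ from ⟨(h₂ _ (hα _ l2).1 (hα _ l2).2).le,
      (h₁ _ (hα _ l1).1 (hα _ l1).2).le⟩)
  exact ⟨k, hkk, α k, (hα k hkk).1, (hα k hkk).2, h0⟩

end PWLCanard

/-! ### Uniform bounds along the orbit. -/

namespace PWLCanard

namespace LeftData

/-- Uniform bounds, with a constant `M` that does not depend on `ε`. -/
structure Tame (L : LeftData) (M : ℝ) (K : Set ℝ) : Prop extends L.Valid K where
  one_le : 1 ≤ M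
  small : 10 ^ 6 * M ^ 10 * √L.ε ≤ 1
  tiny : exp (-(1 / (16 * M ^ 2 * L.ε))) ≤ L.ε ^ 8
  k_ge : ∀ k ∈ K, 1 ≤ M * k
  k_le : ∀ k ∈ K, k ≤ M
  h_ge : 2 ≤ M * -L.ℓ
  q₀_le : ∀ a, |a| < √L.ε → L.q₀ a ≤ 1
  p₀_le : ∀ a, |a| < √L.ε → L.p₀ a ≤ M
  dq₀_le : ∀ a, |a| < √L.ε → |L.q₀ a * deriv L.q₀ a| ≤ M
  dp₀_le : ∀ a, |a| < √L.ε → |L.p₀ a * deriv L.p₀ a| ≤ M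
  gap : ∀ k ∈ K, ∀ a, |a| < √L.ε → 4 * fastR k L.ε * √L.ε ≤ fastR k L.ε * (a - L.ℓ) - L.p₀ a

namespace Tame

variable {L : LeftData} {M : ℝ} {K : Set ℝ} {k a : ℝ}

section Basic

variable (h : L.Tame M K)
include h

theorem M_pos : 0 < M := one_pos.trans_le h.one_le

theorem pow_mul_le {n : ℕ} (hn : n ≤ 10) : 10 ^ 6 * M ^ n * √L.ε ≤ 1 := by
  refine le_trans ?_ h.small
  have := h.sqrt_pos
  gcongr
  exact h.one_le

theorem sqrt_le : √L.ε ≤ 1 / 10 ^ 6 := by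
  have := h.pow_mul_le (n := 0) (by norm_num)
  linarith

theorem mul_sqrt_le : 10 ^ 6 * (M * √L.ε) ≤ 1 := by
  have := h.pow_mul_le (n := 1) (by norm_num)
  linarith

theorem sq_sqrt : √L.ε ^ 2 = L.ε := Real.sq_sqrt h.ε_pos.le

theorem ε_le : L.ε ≤ 1 / 10 ^ 6 * √L.ε := by
  have := h.sqrt_le
  have := h.sqrt_pos
  nlinarith [h.sq_sqrt]

theorem abs_s : |L.s| = 1 := by
  have := h.s_sq
  rw [← sq_abs] at this
  nlinarith [abs_nonneg L.s]

theorem abs_m_mul (x : ℝ) : |L.s * √L.ε * x| = √L.ε * |x| := by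
  rw [abs_mul, abs_mul, h.abs_s, abs_of_pos h.sqrt_pos, one_mul]

end Basic

variable (h : L.Tame M K) (hk : k ∈ K) (ha : |a| < √L.ε)
include h

include hk in
theorem lamL_bounds : 0 < lamL k L.ε ∧ lamL k L.ε ≤ 2 * M * L.ε ∧ k / 2 ≤ fastR k L.ε ∧
    fastR k L.ε < k ∧ 0 < k := by
  have h1 := lamL_pos h.ε_pos (h.k_pos k hk)
  have h2 := lamL_lt_fastR (h.lt_k k hk)
  have h3 := lamL_add_fastR k L.ε
  have h4 := lamL_mul_fastR (h.lt_k k hk)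
  have h5 := h.k_pos k hk
  have h6 : k / 2 ≤ fastR k L.ε := by linarith
  refine ⟨h1, ?_, h6, by linarith, h5⟩
  have h7 : lamL k L.ε * (k / 2) ≤ L.ε :=
    (mul_le_mul_of_nonneg_left h6 h1.le).trans_eq h4
  have h8 := h.k_ge k hk
  have h9 := h.M_pos
  calc lamL k L.ε ≤ lamL k L.ε * (M * k) := le_mul_of_one_le_right h1.le h8
    _ = 2 * M * (lamL k L.ε * (k / 2)) := by ring
    _ ≤ _ := by gcongr

include hk in
theorem fastR_ge : 1 ≤ 2 * M * fastR k L.ε := by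
  have := (h.lamL_bounds hk).2.2.1
  have h8 := h.k_ge k hk
  have h9 := h.M_pos
  nlinarith

theorem lamL_one_bounds : L.ε < lamL 1 L.ε ∧ lamL 1 L.ε ≤ 2 * L.ε ∧ 1 / 2 < fastR 1 L.ε ∧
    fastR 1 L.ε < 1 := by
  have hlt : 4 * L.ε < 1 ^ 2 := by linarith [h.ε_lt]
  have h1 := lamL_pos h.ε_pos one_pos
  have h2 := lamL_lt_fastR hlt
  have h3 := lamL_add_fastR 1 L.ε
  have h4 := lamL_mul_fastR hlt
  refine ⟨?_, ?_, by linarith, by linarith⟩ <;> nlinarith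

include ha in
theorem h_bounds : 1 ≤ M * (a - L.ℓ) ∧ a - L.ℓ ≤ 2 ∧ 0 < a - L.ℓ := by
  have h1 := h.h_ge
  have h2 := h.mul_sqrt_le
  have h3 := h.M_pos
  obtain ⟨h4, h5⟩ := abs_lt.1 ha
  have h6 := h.le_ℓ
  have h7 := h.sqrt_le
  have h8 : M * -√L.ε ≤ M * a := by gcongr
  refine ⟨by linarith, by linarith, by linarith [h.ℓ_lt]⟩

include hk ha

theorem q_slow : L.q k a + fastR k L.ε * (√L.ε + a)
    = (L.q₀ a + fastR k L.ε * (a - L.ℓ)) * exp (lamL k L.ε * L.t₁ k a) :=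
  expand_slow h.ε_pos (h.k_pos k hk) (h.lt_k k hk) (by linarith [h.ℓ_lt]) (Valid.d_pos ha)
    (h.q₀_nonneg a ha)

theorem q_fast : L.q k a + lamL k L.ε * (√L.ε + a)
    = (L.q₀ a + lamL k L.ε * (a - L.ℓ)) * exp (fastR k L.ε * L.t₁ k a) :=
  expand_fast h.ε_pos (h.k_pos k hk) (h.lt_k k hk) (by linarith [h.ℓ_lt]) (Valid.d_pos ha)
    (h.q₀_nonneg a ha)

theorem p_slow : fastR k L.ε * (√L.ε + a) - L.p k a
    = (fastR k L.ε * (a - L.ℓ) - L.p₀ a) * exp (-(lamL k L.ε * L.t₂ k a)) :=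
  contract_slow h.ε_pos (h.k_pos k hk) (h.lt_k k hk) (by linarith [h.ℓ_lt]) (Valid.d_pos ha)
    (h.p₀_nonneg a ha) (h.p₀_lt k hk a ha)

theorem p_fast : lamL k L.ε * (√L.ε + a) - L.p k a
    = (lamL k L.ε * (a - L.ℓ) - L.p₀ a) * exp (-(fastR k L.ε * L.t₂ k a)) :=
  contract_fast h.ε_pos (h.k_pos k hk) (h.lt_k k hk) (by linarith [h.ℓ_lt]) (Valid.d_pos ha)
    (h.p₀_nonneg a ha) (h.p₀_lt k hk a ha)

theorem w_slow : fastR 1 L.ε * (√L.ε - a) - L.w k a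
    = (L.v k a + fastR 1 L.ε * (√L.ε - a)) * exp (-(lamL 1 L.ε * L.T₂ k a)) :=
  turn_slow h.ε_pos h.ε_lt (Valid.c_pos ha) (h.leg_v hk ha).exit_pos

theorem w_fast : lamL 1 L.ε * (√L.ε - a) - L.w k a
    = (L.v k a + lamL 1 L.ε * (√L.ε - a)) * exp (-(fastR 1 L.ε * L.T₂ k a)) :=
  turn_fast h.ε_pos h.ε_lt (Valid.c_pos ha) (h.leg_v hk ha).exit_pos

theorem q_ge : 1 ≤ 4 * M ^ 2 * L.q k a := by
  have h1 := h.q_slow hk ha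
  obtain ⟨l1, l2, l3, l4, l5⟩ := h.lamL_bounds hk
  have h2 := h.fastR_ge hk
  obtain ⟨h3, -, h4⟩ := h.h_bounds ha
  have h5 : 1 ≤ exp (lamL k L.ε * L.t₁ k a) :=
    Real.one_le_exp (mul_pos l1 (h.leg_q hk ha).pos).le
  have h6 := h.q₀_nonneg a ha
  have h7 := h.mul_sqrt_le
  have hμ : 0 < fastR k L.ε := by linarith
  have h8 : fastR k L.ε * (a - L.ℓ) ≤ L.q k a + fastR k L.ε * (√L.ε + a) := by
    rw [h1]
    calc _ ≤ (L.q₀ a + fastR k L.ε * (a - L.ℓ)) * 1 := by linarith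
      _ ≤ _ := by gcongr
  have hM := h.M_pos
  have h9 : √L.ε + a ≤ 2 * √L.ε := by linarith [(abs_lt.1 ha).2]
  have h10 : 1 / 2 ≤ M * (a - L.ℓ - (√L.ε + a)) := by nlinarith
  have h11 : fastR k L.ε * (a - L.ℓ - (√L.ε + a)) ≤ L.q k a := by linarith
  calc (1 : ℝ) ≤ 2 * (2 * M * fastR k L.ε) * (1 / 2) := by linarith
    _ ≤ 2 * (2 * M * fastR k L.ε) * (M * (a - L.ℓ - (√L.ε + a))) := by gcongr
    _ = 4 * M ^ 2 * (fastR k L.ε * (a - L.ℓ - (√L.ε + a))) := by ring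
    _ ≤ _ := by gcongr

theorem q_pos : 0 < L.q k a := (h.leg_q hk ha).exit_pos

/-- The fast first integral is at most the slow one at the exit, because the fast rate exceeds the
slow rate. Comparing their initial forms gives `exp ((μ - l) t₁) ≤ (q₀ + μ h) / (q₀ + l h) ≤ μ / l`.
-/
theorem exp_sub_le : exp ((fastR k L.ε - lamL k L.ε) * L.t₁ k a) ≤ fastR k L.ε / lamL k L.ε := by
  obtain ⟨l1, l2, l3, l4, l5⟩ := h.lamL_bounds hk
  have hlt := lamL_lt_fastR (h.lt_k k hk)
  have h1 := h.q_slow hk ha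
  have h2 := h.q_fast hk ha
  obtain ⟨-, -, h4⟩ := h.h_bounds ha
  have h6 := h.q₀_nonneg a ha
  have hd := Valid.d_pos ha
  have h7 : (L.q₀ a + lamL k L.ε * (a - L.ℓ)) * exp (fastR k L.ε * L.t₁ k a)
      ≤ (L.q₀ a + fastR k L.ε * (a - L.ℓ)) * exp (lamL k L.ε * L.t₁ k a) := by
    rw [← h1, ← h2]; gcongr
  rw [le_div_iff₀ l1]
  have e : exp (fastR k L.ε * L.t₁ k a)
      = exp ((fastR k L.ε - lamL k L.ε) * L.t₁ k a) * exp (lamL k L.ε * L.t₁ k a) := by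
    rw [← Real.exp_add]; congr 1; ring
  rw [e, ← mul_assoc] at h7
  have h8 := le_of_mul_le_mul_right h7 (exp_pos _)
  set E := exp ((fastR k L.ε - lamL k L.ε) * L.t₁ k a)
  have hE : 1 ≤ E := Real.one_le_exp (mul_pos (sub_pos.2 hlt) (h.leg_q hk ha).pos).le
  have h9 : lamL k L.ε * (a - L.ℓ) * E ≤ fastR k L.ε * (a - L.ℓ) := by
    have : L.q₀ a ≤ L.q₀ a * E := le_mul_of_one_le_right h6 hE
    nlinarith
  have h10 : E * lamL k L.ε * (a - L.ℓ) ≤ fastR k L.ε * (a - L.ℓ) := by linarith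
  exact le_of_mul_le_mul_right h10 h4

/-- As `l μ = ε`, the ratio `μ / l` is `(μ / √ε)²`. The crude bound `log x ≤ x` turns `exp_sub_le`
into `t₁ ≤ 4 / √ε`. So the forward passage is short compared with `1 / ε` and its slow factor is
negligible. -/
theorem lamL_t₁_le : lamL k L.ε * L.t₁ k a ≤ 8 * M * √L.ε := by
  obtain ⟨l1, l2, l3, l4, l5⟩ := h.lamL_bounds hk
  have hlt := lamL_lt_fastR (h.lt_k k hk)
  have hμ : 0 < fastR k L.ε := by linarith
  have h0 := h.exp_sub_le hk ha
  have hM := h.M_pos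
  have hσ := h.sqrt_pos
  have h4 := lamL_mul_fastR (h.lt_k k hk)
  set μ := fastR k L.ε
  set l := lamL k L.ε
  have hρ : μ / l = (μ / √L.ε) ^ 2 := by
    rw [div_pow, h.sq_sqrt, ← h4]; field_simp
  have h5 : (μ - l) * L.t₁ k a ≤ 2 * (μ / √L.ε) := by
    have h6 := (Real.le_log_iff_exp_le (by positivity)).2 h0
    rw [hρ, Real.log_pow] at h6
    have h7 := Real.log_le_self (x := μ / √L.ε) (by positivity)
    push_cast at h6
    linarith
  have h6 : μ / 2 ≤ μ - l := by
    have h7 := h.fastR_ge hk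
    have h8 := h.mul_sqrt_le
    have h9 := h.ε_le
    have : l ≤ 1 / M / 4 := by
      rw [le_div_iff₀ (by norm_num), le_div_iff₀ hM]
      have : M * L.ε ≤ M * (1 / 10 ^ 6 * √L.ε) := by gcongr
      have h10 : M * M * √L.ε * 10 ^ 6 ≤ 1 := by
        have := h.pow_mul_le (n := 2) (by norm_num); linarith
      calc l * 4 * M ≤ 2 * M * L.ε * 4 * M := by gcongr
        _ = 8 * M * (M * L.ε) := by ring
        _ ≤ 8 * M * (M * (1 / 10 ^ 6 * √L.ε)) := by gcongr
        _ ≤ 1 := by nlinarith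
    have : 1 / M / 2 ≤ μ := by
      rw [div_le_iff₀ (by norm_num), div_le_iff₀ hM]; linarith
    linarith
  have ht := (h.leg_q hk ha).pos
  have h7 : μ / 2 * L.t₁ k a ≤ 2 * (μ / √L.ε) :=
    (mul_le_mul_of_nonneg_right h6 ht.le).trans h5
  have h8 : L.t₁ k a ≤ 4 / √L.ε := by
    have : μ * (L.t₁ k a) ≤ μ * (4 / √L.ε) := by
      calc _ = 2 * (μ / 2 * L.t₁ k a) := by ring
        _ ≤ 2 * (2 * (μ / √L.ε)) := by gcongr
        _ = _ := by ring
    exact le_of_mul_le_mul_left this hμ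
  have hε := h.ε_pos
  calc _ ≤ 2 * M * L.ε * (4 / √L.ε) := by gcongr
    _ = 8 * M * √L.ε := by
      nth_rewrite 1 [← h.sq_sqrt]; field_simp; ring

theorem exp_lamL_t₁_le : exp (lamL k L.ε * L.t₁ k a) ≤ 1 + 16 * M * √L.ε := by
  have h1 := h.lamL_t₁_le hk ha
  have h2 := h.mul_sqrt_le
  have hx : 0 ≤ lamL k L.ε * L.t₁ k a :=
    mul_nonneg (h.lamL_bounds hk).1.le (h.leg_q hk ha).pos.le
  have h3 := Real.exp_bound_div_one_sub_of_interval hx (by linarith)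
  refine h3.trans ?_
  rw [div_le_iff₀ (by linarith)]
  nlinarith

theorem q_le : L.q k a ≤ 6 * M := by
  have h1 := h.q_slow hk ha
  obtain ⟨l1, l2, l3, l4, l5⟩ := h.lamL_bounds hk
  obtain ⟨-, h3, h4⟩ := h.h_bounds ha
  have h5 := h.exp_lamL_t₁_le hk ha
  have h6 := h.q₀_le a ha
  have h6' := h.q₀_nonneg a ha
  have h7 := h.mul_sqrt_le
  have hd := Valid.d_pos ha
  have hM := h.one_le
  have hkM := h.k_le k hk
  have hμ : 0 < fastR k L.ε := by linarith
  have h8 : L.q₀ a + fastR k L.ε * (a - L.ℓ) ≤ 1 + M * 2 := by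
    gcongr; linarith
  have h9 : exp (lamL k L.ε * L.t₁ k a) ≤ 2 := by linarith
  have h10 : (L.q₀ a + fastR k L.ε * (a - L.ℓ)) * exp (lamL k L.ε * L.t₁ k a)
      ≤ (1 + M * 2) * 2 := by
    gcongr
  have := mul_pos hμ hd
  linarith

theorem abs_v_sub_le : |L.v k a - L.q k a| ≤ 3 * L.ε :=
  abs_topV_sub_le h.s_sq h.ε_pos (Valid.d_pos ha) (by linarith [(abs_lt.1 ha).2])
    (h.lt_q k hk a ha)

theorem v_bounds : 1 ≤ 8 * M ^ 2 * L.v k a ∧ L.v k a ≤ 7 * M ∧ 0 < L.v k a := by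
  have h1 := abs_le.1 (h.abs_v_sub_le hk ha)
  have h2 := h.q_ge hk ha
  have h3 := h.q_le hk ha
  have h4 := h.ε_le
  have h5 := h.pow_mul_le (n := 2) (by norm_num)
  have hσ := h.sqrt_pos
  have hσ' := h.sqrt_le
  have hM := h.one_le
  have h6 : M ^ 2 * (L.q k a - 3 * L.ε) ≤ M ^ 2 * L.v k a := by gcongr; linarith
  have h7 : M ^ 2 * L.ε ≤ M ^ 2 * (1 / 10 ^ 6 * √L.ε) := by gcongr
  exact ⟨by nlinarith, by linarith, (h.leg_v hk ha).exit_pos⟩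

/-- The upward speed exceeds `fastR * c`, so the slow integral must be at least halved during the
turn. With a slow rate of order `ε` this takes a time of order `1 / ε`, during which the fast
exponential becomes smaller than any power needed. The hypothesis `tiny` converts this into `ε ^ 8`.
-/
theorem exp_T₂_le : exp (-(fastR 1 L.ε * L.T₂ k a)) ≤ L.ε ^ 8 ∧ exp (-L.T₂ k a) ≤ L.ε ^ 8 := by
  obtain ⟨l1, l2, l3, l4⟩ := h.lamL_one_bounds
  have h1 := h.w_slow hk ha
  have hw := (h.turn_w hk ha).w_pos
  have hc := Valid.c_pos ha
  have hT := (h.turn_w hk ha).pos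
  obtain ⟨v1, v2, v3⟩ := h.v_bounds hk ha
  have hε := h.ε_pos
  have hM := h.one_le
  have h5 := h.pow_mul_le (n := 2) (by norm_num)
  have hcv : fastR 1 L.ε * (√L.ε - a) ≤ L.v k a := by
    have h6 : √L.ε - a ≤ 2 * √L.ε := by linarith [(abs_lt.1 ha).1]
    have h7 : 8 * M ^ 2 * (2 * √L.ε) ≤ 8 * M ^ 2 * L.v k a := by nlinarith
    have h8 := le_of_mul_le_mul_left h7 (by positivity)
    calc _ ≤ 1 * (√L.ε - a) := by gcongr
      _ ≤ _ := by linarith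
  have h6 : exp (-(lamL 1 L.ε * L.T₂ k a)) ≤ 1 / 2 := by
    have h7 : (L.v k a + fastR 1 L.ε * (√L.ε - a)) * exp (-(lamL 1 L.ε * L.T₂ k a))
        ≤ (L.v k a + fastR 1 L.ε * (√L.ε - a)) * (1 / 2) := by
      rw [← h1]; linarith
    exact le_of_mul_le_mul_left h7 (by have := mul_pos (by linarith : 0 < fastR 1 L.ε) hc; linarith)
  have h7 : 1 / 2 ≤ lamL 1 L.ε * L.T₂ k a := by
    have h8 := Real.add_one_le_exp (-(lamL 1 L.ε * L.T₂ k a))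
    linarith
  have h8 : 1 / 2 ≤ 2 * L.ε * L.T₂ k a := h7.trans (by gcongr)
  have h9 : 1 / (16 * M ^ 2 * L.ε) ≤ fastR 1 L.ε * L.T₂ k a := by
    have : 1 / (8 * L.ε) ≤ fastR 1 L.ε * L.T₂ k a := by
      rw [div_le_iff₀ (by positivity)]
      nlinarith [mul_le_mul_of_nonneg_right l3.le (mul_pos hε hT).le]
    refine le_trans ?_ this
    gcongr
    nlinarith
  have h10 : exp (-(fastR 1 L.ε * L.T₂ k a)) ≤ L.ε ^ 8 := by
    refine le_trans ?_ h.tiny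
    rw [exp_le_exp]; linarith
  refine ⟨h10, le_trans ?_ h10⟩
  rw [exp_le_exp]
  nlinarith

/-- Since `p > 0`, the slow integral at the exit is at most `fastR * d`, while the gap condition
bounds it below at the entrance by `4 fastR √ε`. -/
theorem exp_lamL_t₂_le : exp (-(lamL k L.ε * L.t₂ k a)) * (4 * √L.ε) ≤ √L.ε + a := by
  obtain ⟨l1, l2, l3, l4, l5⟩ := h.lamL_bounds hk
  have h1 := h.p_slow hk ha
  have hp := (h.leg_p hk ha).exit_pos
  have hg := h.gap k hk a ha
  have hμ : 0 < fastR k L.ε := by linarith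
  set E := exp (-(lamL k L.ε * L.t₂ k a))
  have hE : 0 < E := exp_pos _
  have h3 : 4 * fastR k L.ε * √L.ε * E ≤ fastR k L.ε * (√L.ε + a) := by
    calc _ ≤ (fastR k L.ε * (a - L.ℓ) - L.p₀ a) * E := by gcongr
      _ ≤ _ := by linarith
  have h4 : fastR k L.ε * (E * (4 * √L.ε)) ≤ fastR k L.ε * (√L.ε + a) := by linarith
  exact le_of_mul_le_mul_left h4 hμ

/-- The slow integral is at least halved, so `t₂ ≥ 1 / (4 M ε)`. The spectral gap is at least `1 /
(4 M)`. The product of these bounds is the exponent `1 / (16 M² ε)` in `tiny`. -/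
theorem exp_t₂_le : exp (-((fastR k L.ε - lamL k L.ε) * L.t₂ k a)) ≤ L.ε ^ 8 ∧
    exp (-(fastR k L.ε * L.t₂ k a)) ≤ L.ε ^ 8 ∧ exp (-(k * L.t₂ k a)) ≤ L.ε ^ 8 := by
  obtain ⟨l1, l2, l3, l4, l5⟩ := h.lamL_bounds hk
  have hT := (h.leg_p hk ha).pos
  have hε := h.ε_pos
  have hM := h.one_le
  have hσ := h.sqrt_pos
  have h1 := h.exp_lamL_t₂_le hk ha
  have h2 : exp (-(lamL k L.ε * L.t₂ k a)) ≤ 1 / 2 := by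
    have : exp (-(lamL k L.ε * L.t₂ k a)) * (4 * √L.ε) ≤ 1 / 2 * (4 * √L.ε) := by
      linarith [(abs_lt.1 ha).2]
    exact le_of_mul_le_mul_right this (by positivity)
  have h7 : 1 / 2 ≤ lamL k L.ε * L.t₂ k a := by
    have h8 := Real.add_one_le_exp (-(lamL k L.ε * L.t₂ k a))
    linarith
  have h8 : 1 / 2 ≤ 2 * M * L.ε * L.t₂ k a := h7.trans (by gcongr)
  have h9 : lamL k L.ε ≤ 1 / (2 * M) - 1 / (2 * M) / 2 := by
    have h10 := h.pow_mul_le (n := 2) (by norm_num)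
    have h11 := h.ε_le
    have : 8 * M ^ 2 * L.ε ≤ 1 := by
      calc _ ≤ 8 * M ^ 2 * (1 / 10 ^ 6 * √L.ε) := by gcongr
        _ ≤ 1 := by nlinarith
    rw [show 1 / (2 * M) - 1 / (2 * M) / 2 = 1 / (4 * M) by field_simp; norm_num,
      le_div_iff₀ (by positivity)]
    nlinarith
  have h10 : 1 / (2 * M) ≤ fastR k L.ε := by
    rw [div_le_iff₀ (by positivity)]; linarith [h.fastR_ge hk]
  have h11 : 1 / (16 * M ^ 2 * L.ε) ≤ (fastR k L.ε - lamL k L.ε) * L.t₂ k a := by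
    have h12 : 1 / (4 * M) * L.t₂ k a ≤ (fastR k L.ε - lamL k L.ε) * L.t₂ k a := by
      gcongr
      have : 1 / (2 * M) / 2 = 1 / (4 * M) := by field_simp; norm_num
      linarith
    refine le_trans ?_ h12
    rw [div_mul_eq_mul_div, one_mul, div_le_div_iff₀ (by positivity) (by positivity)]
    have : 2 * M * (1 / 2) ≤ 2 * M * (2 * M * L.ε * L.t₂ k a) := by gcongr
    nlinarith [mul_pos (mul_pos (pow_pos (h.M_pos) 2) hε) hT]
  have h12 : exp (-((fastR k L.ε - lamL k L.ε) * L.t₂ k a)) ≤ L.ε ^ 8 := by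
    refine le_trans ?_ h.tiny
    rw [exp_le_exp]; linarith
  refine ⟨h12, le_trans ?_ h12, le_trans ?_ h12⟩ <;>
  · rw [exp_le_exp, neg_le_neg_iff]
    gcongr
    linarith

theorem r₁_lt : L.r₁ k a < 2 * √L.ε := by
  have hc := Valid.c_pos ha
  have hσ := h.sqrt_pos
  obtain ⟨l1, l2, l3, l4⟩ := h.lamL_one_bounds
  have h1 := h.w_fast hk ha
  have h2 := (h.v_bounds hk ha).2.2
  have h3 : 0 < (L.v k a + lamL 1 L.ε * (√L.ε - a)) * exp (-(fastR 1 L.ε * L.T₂ k a)) := by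
    have : 0 < lamL 1 L.ε * (√L.ε - a) := mul_pos (h.ε_pos.trans l1) hc
    positivity
  unfold r₁
  rw [div_lt_iff₀ (mul_pos hc hσ)]
  have h4 : lamL 1 L.ε * (√L.ε - a) ≤ 2 * L.ε * (√L.ε - a) := by gcongr
  have h5 : 2 * √L.ε * ((√L.ε - a) * √L.ε) = 2 * L.ε * (√L.ε - a) := by
    linear_combination 2 * (√L.ε - a) * h.sq_sqrt
  linarith

theorem p_le : L.p k a ≤ lamL k L.ε * (√L.ε + a) + M * L.ε ^ 7 * (√L.ε + a) := by
  have h1 := h.p_fast hk ha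
  obtain ⟨l1, l2, l3, l4, l5⟩ := h.lamL_bounds hk
  obtain ⟨-, -, h4⟩ := h.h_bounds ha
  have hp0 := h.p₀_nonneg a ha
  have hp1 := h.p₀_le a ha
  have hσ := h.sqrt_pos
  have hd := Valid.d_pos ha
  have hε := h.ε_pos
  have hM := h.M_pos
  obtain ⟨e1, -, -⟩ := h.exp_t₂_le hk ha
  have e2 := h.exp_lamL_t₂_le hk ha
  have e3 : exp (-(fastR k L.ε * L.t₂ k a)) = exp (-(lamL k L.ε * L.t₂ k a)) *
      exp (-((fastR k L.ε - lamL k L.ε) * L.t₂ k a)) := by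
    rw [← Real.exp_add]; congr 1; ring
  have e4 : exp (-(lamL k L.ε * L.t₂ k a)) ≤ (√L.ε + a) / (4 * √L.ε) := by
    rwa [le_div_iff₀ (by positivity)]
  have h5 : L.p k a ≤ lamL k L.ε * (√L.ε + a) + L.p₀ a * exp (-(fastR k L.ε * L.t₂ k a)) := by
    have := mul_pos (mul_pos l1 h4) (exp_pos (-(fastR k L.ε * L.t₂ k a)))
    linarith
  refine h5.trans ?_
  refine add_le_add le_rfl ?_
  rw [e3]
  have hσε : L.ε ≤ 4 * √L.ε := by linarith [h.ε_le]
  calc _ ≤ M * ((√L.ε + a) / (4 * √L.ε) * L.ε ^ 8) := by gcongr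
    _ ≤ M * ((√L.ε + a) / L.ε * L.ε ^ 8) := by gcongr
    _ = _ := by field_simp

theorem r₂_lt : L.r₂ k a ≤ 3 * M * √L.ε := by
  have hd := Valid.d_pos ha
  have hσ := h.sqrt_pos
  have hε := h.ε_pos
  obtain ⟨l1, l2, l3, l4, l5⟩ := h.lamL_bounds hk
  have hp := h.p_le hk ha
  have hM := h.M_pos
  unfold r₂
  rw [div_le_iff₀ (mul_pos hd hσ)]
  have h6 : L.ε ^ 7 ≤ L.ε := by
    refine pow_le_of_le_one hε.le ?_ (by norm_num)
    linarith [h.ε_lt]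
  calc L.p k a ≤ 2 * M * L.ε * (√L.ε + a) + M * L.ε * (√L.ε + a) := by
        refine hp.trans ?_; gcongr
    _ = 3 * M * √L.ε * ((√L.ε + a) * √L.ε) := by
      linear_combination (-3) * M * (√L.ε + a) * h.sq_sqrt

end Tame

end LeftData

end PWLCanard

/-! ### Dependence on `a`: monotonicity of the closing defect. -/

namespace PWLCanard

namespace LeftData

namespace Valid

variable {L : LeftData} {K : Set ℝ} {k a : ℝ} (h : L.Valid K) (hk : k ∈ K) (ha : |a| < √L.ε)

theorem eventually_abs_lt (ha : |a| < √L.ε) : ∀ᶠ x in 𝓝 a, |x| < √L.ε :=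
  continuous_abs.continuousAt.eventually_lt_const ha

theorem hasDerivAt_section {F : ℝ → ℝ → ℝ}
    (hF : ContDiffAt ℝ 1 (fun y : ℝ × ℝ => F y.1 y.2) (k, a)) :
    HasDerivAt (F k) (deriv (F k) a) a := by
  have h1 : DifferentiableAt ℝ (fun x => F k x) a :=
    (hF.differentiableAt (by norm_num)).comp a (f := fun x : ℝ => (k, x)) (by fun_prop)
  exact h1.hasDerivAt

include h hk ha

/-- This formula and the next three are `hasDerivAt_transit` with `a' = 1`, multiplied by the exit
speed so that they can be chained. -/
theorem deriv_q : L.q k a * deriv (L.q k) a = exp (k * L.t₁ k a) *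
    (L.q₀ a * deriv L.q₀ a + k * L.q₀ a + L.ε * (a - L.ℓ)) - k * L.q k a
      - L.ε * (√L.ε + a) := by
  obtain ⟨s1, s2, -, -⟩ := h.smooth_left hk ha
  have hl := h.leg_q hk ha
  have e : L.q k = fun x => linV (-k) L.ε (nodeC (lamL k L.ε) (fastR k L.ε))
      (nodeS (lamL k L.ε) (fastR k L.ε)) (L.ℓ - x) (L.q₀ x) (L.t₁ k x) := by
    funext x; rw [← neg_sub]; rfl
  have := (hl.fund.hasDerivAt_transit (ℓ₁ := -√L.ε) (hasDerivAt_section s2)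
    ((h.smooth_q₀ a ha).differentiableAt (by norm_num)).hasDerivAt (hasDerivAt_id' a)
    ((eventually_abs_lt ha).mono fun x hx => by
      have := (h.leg_q hk hx).linX_eq
      rw [neg_sub] at this
      rw [this]; ring) (by rw [← hl.linV_eq, neg_sub]) hl.exit_pos.ne').2
  rw [← e] at this
  rw [(hasDerivAt_section s1).unique this, neg_mul, neg_neg]
  field_simp [hl.exit_pos.ne']
  ring

theorem deriv_p : L.p k a * deriv (L.p k) a = exp (-(k * L.t₂ k a)) *
    (L.p₀ a * deriv L.p₀ a - k * L.p₀ a + L.ε * (a - L.ℓ)) + k * L.p k a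
      - L.ε * (√L.ε + a) := by
  obtain ⟨-, -, s1, s2⟩ := h.smooth_left hk ha
  have hl := h.leg_p hk ha
  have e : L.p k = fun x => linV k L.ε (nodeC (-lamL k L.ε) (-fastR k L.ε))
      (nodeS (-lamL k L.ε) (-fastR k L.ε)) (L.ℓ - x) (L.p₀ x) (L.t₂ k x) := by
    funext x; rw [← neg_sub]; rfl
  have := (hl.fund.hasDerivAt_transit (ℓ₁ := -√L.ε) (hasDerivAt_section s2)
    ((h.smooth_p₀ a ha).differentiableAt (by norm_num)).hasDerivAt (hasDerivAt_id' a)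
    ((eventually_abs_lt ha).mono fun x hx => by
      have := (h.leg_p hk hx).linX_eq
      rw [neg_sub] at this
      rw [this]; ring) (by rw [← hl.linV_eq, neg_sub]) hl.exit_pos.ne').2
  rw [← e] at this
  rw [(hasDerivAt_section s1).unique this]
  field_simp [hl.exit_pos.ne']
  ring

theorem deriv_v : L.v k a * deriv (L.v k) a = exp (-(L.s * √L.ε * L.T₁ k a)) *
    (L.q k a * deriv (L.q k) a - (L.s * √L.ε * L.q k a - L.ε * (√L.ε + a)))
      + L.s * √L.ε * L.v k a + L.ε * (√L.ε - a) := by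
  obtain ⟨s1, s2, -, -⟩ := h.smooth_right hk ha
  have hl := h.leg_v hk ha
  have e : L.v k = fun x => linV (L.s * √L.ε) L.ε (focC (L.s * √L.ε) (omg * √L.ε))
      (focS (L.s * √L.ε) (omg * √L.ε)) (-√L.ε - x) (L.q k x) (L.T₁ k x) := by
    funext x; rw [show -√L.ε - x = -(√L.ε + x) by ring]; rfl
  have := (hl.fund.hasDerivAt_transit (ℓ₁ := √L.ε) (hasDerivAt_section s2)
    (hasDerivAt_section (h.smooth_left hk ha).1) (hasDerivAt_id' a)
    ((eventually_abs_lt ha).mono fun x hx => by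
      have := (h.leg_v hk hx).linX_eq
      rw [show -√L.ε - x = -(√L.ε + x) by ring, this])
    (by rw [← hl.linV_eq, show -√L.ε - a = -(√L.ε + a) by ring]) hl.exit_pos.ne').2
  rw [← e] at this
  rw [(hasDerivAt_section s1).unique this]
  field_simp [hl.exit_pos.ne']
  ring

theorem deriv_w : L.w k a * deriv (L.w k) a = exp (-L.T₂ k a) *
    (L.v k a * deriv (L.v k) a - (L.v k a + L.ε * (√L.ε - a)))
      + L.ε * (√L.ε - a) - L.w k a := by
  obtain ⟨s0, -, s1, s2⟩ := h.smooth_right hk ha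
  have hl := h.turn_w hk ha
  have e : (fun x => -L.w k x) = fun x => linV 1 L.ε (nodeC (-lamL 1 L.ε) (-fastR 1 L.ε))
      (nodeS (-lamL 1 L.ε) (-fastR 1 L.ε)) (√L.ε - x) (L.v k x) (L.T₂ k x) := by
    funext x; exact neg_neg _
  have := (hl.fund.hasDerivAt_transit (ℓ₁ := √L.ε) (hasDerivAt_section s2)
    (hasDerivAt_section s0) (hasDerivAt_id' a)
    ((eventually_abs_lt ha).mono fun x hx => (h.turn_w hk hx).linX_eq) hl.linV_eq
    (neg_neg_of_pos hl.w_pos).ne).2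
  rw [← e] at this
  have e2 := (hasDerivAt_section s1).neg.unique this
  have hw := hl.w_pos.ne'
  rw [eq_div_iff (neg_ne_zero.2 hw)] at e2
  rw [one_mul] at e2
  linear_combination e2

end Valid

/-- Relative size of the variation of `r₁` with `a`. -/
noncomputable def e₁ (L : LeftData) (k a : ℝ) : ℝ :=
  exp (-L.T₂ k a) * (L.v k a * ((√L.ε - a) * deriv (L.v k) a + L.v k a)) / ((√L.ε - a) ^ 2 * L.ε)

/-- Relative size of the variation of `r₂` with `a`. -/
noncomputable def e₂ (L : LeftData) (k a : ℝ) : ℝ :=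
  exp (-(k * L.t₂ k a)) * ((√L.ε + a) * (L.p₀ a * deriv L.p₀ a - k * L.p₀ a + L.ε * (a - L.ℓ))
    - (L.ε * (a - L.ℓ) ^ 2 - k * L.p₀ a * (a - L.ℓ) + L.p₀ a ^ 2)) / ((√L.ε + a) ^ 2 * L.ε)

namespace Tame

variable {L : LeftData} {M : ℝ} {K : Set ℝ} {k a : ℝ} (h : L.Tame M K) (hk : k ∈ K)
  (ha : |a| < √L.ε)
include h hk ha

/-- The slope `r₁` is the ratio of exit speed to distance, constant along an eigendirection. All
algebraic terms of its derivative cancel, leaving a multiple of `exp (-T₂)`. -/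
theorem hasDerivAt_r₁ : ∃ r', HasDerivAt (L.r₁ k) r' a ∧
    (√L.ε - a) * L.r₁ k a * r' = L.e₁ k a := by
  have hc := Valid.c_pos ha
  have hσ := h.sqrt_pos
  have hε := h.ε_pos
  have hw := (h.turn_w hk ha).w_pos
  have hd := Valid.hasDerivAt_section (h.smooth_right hk ha).2.2.1
  have hd2 : HasDerivAt (fun x => (√L.ε - x) * √L.ε) (-√L.ε) a := by
    simpa using ((hasDerivAt_id a).const_sub √L.ε).mul_const √L.ε
  have hd3 := hd.div hd2 (mul_pos hc hσ).ne'
  refine ⟨_, hd3, ?_⟩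
  have e1 := h.deriv_w hk ha
  -- The product of the slow and fast integrals is a quadratic form in position and velocity which
  -- the flow multiplies by `exp (-T₂)`. It removes the part of `deriv_w` that is not exponentially
  -- small.
  have e2 : (fastR 1 L.ε * (√L.ε - a) - L.w k a) * (lamL 1 L.ε * (√L.ε - a) - L.w k a)
      = (L.v k a + fastR 1 L.ε * (√L.ε - a)) * (L.v k a + lamL 1 L.ε * (√L.ε - a)) *
        exp (-L.T₂ k a) := by
    rw [h.w_slow hk ha, h.w_fast hk ha]
    have : exp (-L.T₂ k a) = exp (-(lamL 1 L.ε * L.T₂ k a)) * exp (-(fastR 1 L.ε * L.T₂ k a)) := by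
      rw [← Real.exp_add]; congr 1
      linear_combination (L.T₂ k a) * (lamL_add_fastR 1 L.ε)
    rw [this]; ring
  have s1 := lamL_add_fastR 1 L.ε
  have s2 := lamL_mul_fastR (k := 1) (ε := L.ε) (by linarith [h.ε_lt])
  have hσ2 := h.sq_sqrt
  unfold r₁ e₁
  have hfr : fastR 1 L.ε = 1 - lamL 1 L.ε := by linarith
  rw [hfr] at e2 s2
  have e4 : L.w k a * ((√L.ε - a) * deriv (L.w k) a + L.w k a) = exp (-L.T₂ k a) *
      (L.v k a * ((√L.ε - a) * deriv (L.v k) a + L.v k a)) := by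
    linear_combination (√L.ε - a) * e1 + e2 +
      (-exp (-L.T₂ k a) * (√L.ε - a) ^ 2 + (√L.ε - a) ^ 2) * (-s2)
  rw [← e4]
  generalize √L.ε = σ at *
  rw [← hσ2]
  have hc' := hc.ne'
  field_simp
  ring

theorem hasDerivAt_r₂ : ∃ r', HasDerivAt (L.r₂ k) r' a ∧
    (√L.ε + a) * L.r₂ k a * r' = L.e₂ k a := by
  have hc := Valid.d_pos ha
  have hσ := h.sqrt_pos
  have hε := h.ε_pos
  have hw := (h.leg_p hk ha).exit_pos
  have hd := Valid.hasDerivAt_section (h.smooth_left hk ha).2.2.1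
  have hd2 : HasDerivAt (fun x => (√L.ε + x) * √L.ε) (√L.ε) a := by
    simpa using ((hasDerivAt_id a).const_add √L.ε).mul_const √L.ε
  have hd3 := hd.div hd2 (mul_pos hc hσ).ne'
  refine ⟨_, hd3, ?_⟩
  have e1 := h.deriv_p hk ha
  have e2 : (fastR k L.ε * (√L.ε + a) - L.p k a) * (lamL k L.ε * (√L.ε + a) - L.p k a)
      = (fastR k L.ε * (a - L.ℓ) - L.p₀ a) * (lamL k L.ε * (a - L.ℓ) - L.p₀ a) *
        exp (-(k * L.t₂ k a)) := by
    rw [h.p_slow hk ha, h.p_fast hk ha]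
    have : exp (-(k * L.t₂ k a)) = exp (-(lamL k L.ε * L.t₂ k a)) *
        exp (-(fastR k L.ε * L.t₂ k a)) := by
      rw [← Real.exp_add]; congr 1
      linear_combination (L.t₂ k a) * (lamL_add_fastR k L.ε)
    rw [this]; ring
  have s1 := lamL_add_fastR k L.ε
  have s2 := lamL_mul_fastR (h.lt_k k hk)
  have hσ2 := h.sq_sqrt
  unfold r₂ e₂
  have hfr : fastR k L.ε = k - lamL k L.ε := by linarith
  rw [hfr] at e2 s2
  have e4 : L.p k a * ((√L.ε + a) * deriv (L.p k) a - L.p k a) = exp (-(k * L.t₂ k a)) *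
      ((√L.ε + a) * (L.p₀ a * deriv L.p₀ a - k * L.p₀ a + L.ε * (a - L.ℓ))
      - (L.ε * (a - L.ℓ) ^ 2 - k * L.p₀ a * (a - L.ℓ) + L.p₀ a ^ 2)) := by
    linear_combination (√L.ε + a) * e1 - e2 + ((√L.ε + a) ^ 2 -
      exp (-(k * L.t₂ k a)) * (a - L.ℓ) ^ 2) * s2
  rw [← e4]
  generalize √L.ε = σ at *
  rw [← hσ2]
  have hc' := hc.ne'
  field_simp

/-- The explicit factors `√ε ∓ a` contribute `-gf` each. The variation of the slopes contributes `gf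
* e / (1 - s r + r²)`, with denominator at least `3 / 4` and `|e| ≤ 1 / 2`, which is smaller. -/
theorem deriv_D_neg (h1 : |L.e₁ k a| ≤ 1 / 2) (h2 : |L.e₂ k a| ≤ 1 / 2) :
    ∃ D', HasDerivAt (L.D k) D' a ∧ D' < 0 := by
  obtain ⟨r1', hr1, he1⟩ := h.hasDerivAt_r₁ hk ha
  obtain ⟨r2', hr2, he2⟩ := h.hasDerivAt_r₂ hk ha
  have hs := h.s_sq
  have hs' : (-L.s) ^ 2 = 1 := by rw [neg_sq, hs]
  have d1 := ((hasDerivAt_id' a).const_sub √L.ε).mul ((hasDerivAt_gf hs (L.r₁ k a)).comp a hr1)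
  have d2 := ((hasDerivAt_id' a).const_add √L.ε).mul ((hasDerivAt_gf hs' (L.r₂ k a)).comp a hr2)
  refine ⟨_, d1.sub d2, ?_⟩
  simp only [Function.comp]
  have g1 := gf_pos L.s (L.r₁ k a)
  have g2 := gf_pos (-L.s) (L.r₂ k a)
  have key : ∀ {s r c r' e G : ℝ}, s ^ 2 = 1 → 0 < G → c * r * r' = e → |e| ≤ 1 / 2 →
      |c * (G * (r / (1 - s * r + r ^ 2)) * r')| < G := by
    intro s r c r' e G hs hG he hle
    have hQ : 3 / 4 ≤ 1 - s * r + r ^ 2 := by nlinarith [sq_nonneg (2 * r - s)]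
    have e3 : c * (G * (r / (1 - s * r + r ^ 2)) * r') = G * (e / (1 - s * r + r ^ 2)) := by
      rw [← he]; ring
    rw [e3, abs_mul, abs_of_pos hG, abs_div, abs_of_pos (by linarith : 0 < 1 - s * r + r ^ 2)]
    have : |e| / (1 - s * r + r ^ 2) < 1 := by
      rw [div_lt_one (by linarith)]; linarith
    calc _ < G * 1 := by gcongr
      _ = G := mul_one G
  have k1 := abs_lt.1 (key hs g1 he1 h1)
  have k2 := abs_lt.1 (key hs' g2 he2 h2)
  linarith [k1.1, k1.2, k2.1, k2.2]

/-- The product of the two first integrals isolates `exp (k t₁)`. Its initial value is at least `ε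
h²` with `M h ≥ 1`, and its final value is at most `49 M²`. -/
theorem exp_k_t₁_le : exp (k * L.t₁ k a) * L.ε ≤ 49 * M ^ 4 := by
  have h1 := h.q_slow hk ha
  have h2 := h.q_fast hk ha
  obtain ⟨l1, l2, l3, l4, l5⟩ := h.lamL_bounds hk
  obtain ⟨h3, h4, h5⟩ := h.h_bounds ha
  have hq0 := h.q₀_nonneg a ha
  have hM := h.one_le
  have hq := h.q_le hk ha
  have hq' := h.q_pos hk ha
  have hd := Valid.d_pos ha
  have hd2 : √L.ε + a ≤ 2 * √L.ε := by linarith [(abs_lt.1 ha).2]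
  have hσ := h.sqrt_pos
  have hμ : 0 < fastR k L.ε := by linarith
  have hkM := h.k_le k hk
  have hs := h.sqrt_le
  have e : exp (k * L.t₁ k a) = exp (lamL k L.ε * L.t₁ k a) * exp (fastR k L.ε * L.t₁ k a) := by
    rw [← Real.exp_add]; congr 1
    linear_combination (-L.t₁ k a) * (lamL_add_fastR k L.ε)
  have e2 : (L.q₀ a + fastR k L.ε * (a - L.ℓ)) * (L.q₀ a + lamL k L.ε * (a - L.ℓ)) *
      exp (k * L.t₁ k a) = (L.q k a + fastR k L.ε * (√L.ε + a)) *
        (L.q k a + lamL k L.ε * (√L.ε + a)) := by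
    rw [h1, h2, e]; ring
  have b1 : L.q k a + fastR k L.ε * (√L.ε + a) ≤ 7 * M := by
    have : fastR k L.ε * (√L.ε + a) ≤ M * 1 := by
      gcongr
      · linarith
      · linarith
    linarith
  have b2 : L.q k a + lamL k L.ε * (√L.ε + a) ≤ 7 * M := by
    refine le_trans ?_ b1
    have := lamL_lt_fastR (h.lt_k k hk)
    gcongr
  have b3 : L.ε * (a - L.ℓ) ^ 2 ≤
      (L.q₀ a + fastR k L.ε * (a - L.ℓ)) * (L.q₀ a + lamL k L.ε * (a - L.ℓ)) := by
    have e4 := lamL_mul_fastR (h.lt_k k hk)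
    have e5 : L.ε * (a - L.ℓ) ^ 2 = (fastR k L.ε * (a - L.ℓ)) * (lamL k L.ε * (a - L.ℓ)) := by
      linear_combination (-(a - L.ℓ) ^ 2) * e4
    rw [e5]
    gcongr <;> linarith
  have b4 : L.ε * (a - L.ℓ) ^ 2 * exp (k * L.t₁ k a) ≤ 7 * M * (7 * M) := by
    calc _ ≤ _ := mul_le_mul_of_nonneg_right b3 (exp_pos _).le
      _ = _ := e2
      _ ≤ _ := by gcongr
  have hE := exp_pos (k * L.t₁ k a)
  have hε := h.ε_pos
  calc exp (k * L.t₁ k a) * L.ε ≤ exp (k * L.t₁ k a) * L.ε * (M * (a - L.ℓ)) ^ 2 :=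
        le_mul_of_one_le_right (by positivity) (one_le_pow₀ h3)
    _ = M ^ 2 * (L.ε * (a - L.ℓ) ^ 2 * exp (k * L.t₁ k a)) := by ring
    _ ≤ M ^ 2 * (7 * M * (7 * M)) := by gcongr
    _ = _ := by ring

theorem exp_T₁_le : exp (-(L.s * √L.ε * L.T₁ k a)) ≤ 2 ∧ √L.ε * L.T₁ k a ≤ 32 * M ^ 2 * L.ε := by
  have h1 := topT_le h.s_sq h.ε_pos (Valid.d_pos ha) (by linarith [(abs_lt.1 ha).2])
    (h.lt_q k hk a ha)
  have h2 := h.q_ge hk ha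
  have hT := (h.leg_v hk ha).pos
  have hσ := h.sqrt_pos
  have hM := h.M_pos
  have h3 : √L.ε * L.T₁ k a ≤ 32 * M ^ 2 * L.ε := by
    have h1 : L.T₁ k a * L.q k a ≤ 8 * √L.ε := h1
    calc √L.ε * L.T₁ k a ≤ √L.ε * L.T₁ k a * (4 * M ^ 2 * L.q k a) :=
          le_mul_of_one_le_right (by positivity) h2
      _ = 4 * M ^ 2 * √L.ε * (L.T₁ k a * L.q k a) := by ring
      _ ≤ 4 * M ^ 2 * √L.ε * (8 * √L.ε) := by gcongr
      _ = _ := by linear_combination 32 * M ^ 2 * h.sq_sqrt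
  refine ⟨?_, h3⟩
  have h4 : -(L.s * √L.ε * L.T₁ k a) ≤ 1 / 2 := by
    have := h.abs_m_mul (L.T₁ k a)
    rw [abs_of_pos hT] at this
    have h5 := h.pow_mul_le (n := 2) (by norm_num)
    have h6 := h.ε_le
    have h7 : 32 * M ^ 2 * L.ε ≤ 32 * M ^ 2 * (1 / 10 ^ 6 * √L.ε) := by gcongr
    have h8 := neg_abs_le (L.s * √L.ε * L.T₁ k a)
    linarith
  have h5 := Real.exp_bound_div_one_sub_of_interval (x := 1 / 2) (by norm_num) (by norm_num)
  calc _ ≤ exp (1 / 2) := exp_le_exp.2 h4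
    _ ≤ _ := h5.trans (by norm_num)

/-- The expanding leg amplifies a change of `a` by `exp (k t₁)`, which is of order `1 / ε` at most,
and the upper central passage at most doubles the result. -/
theorem abs_deriv_v_le : |L.v k a * deriv (L.v k) a| * L.ε ≤ 500 * M ^ 5 := by
  have e1 := h.exp_k_t₁_le hk ha
  obtain ⟨e2, -⟩ := h.exp_T₁_le hk ha
  have hq := h.q_le hk ha
  have hq' := h.q_pos hk ha
  obtain ⟨-, v1, v2⟩ := h.v_bounds hk ha
  have hq0 := h.q₀_nonneg a ha
  have hq1 := h.q₀_le a ha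
  have hdq := h.dq₀_le a ha
  have hM := h.one_le
  have hkM := h.k_le k hk
  have hk0 := h.k_pos k hk
  have hε := h.ε_pos
  have hσ := h.sqrt_pos
  have hs := h.sqrt_le
  have hε1 : L.ε ≤ 1 / 10 ^ 6 := by linarith [h.ε_le]
  obtain ⟨h3, h4, h5⟩ := h.h_bounds ha
  have hd := Valid.d_pos ha
  have hc := Valid.c_pos ha
  have hd2 : √L.ε + a ≤ 1 := by linarith [(abs_lt.1 ha).2]
  have hc2 : √L.ε - a ≤ 1 := by linarith [(abs_lt.1 ha).1]
  have hP : ∀ n : ℕ, (1 : ℝ) ≤ M ^ n := fun n => one_le_pow₀ hM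
  set E := exp (k * L.t₁ k a) with hE
  have hE0 : 0 < E := exp_pos _
  have b1 : |L.q₀ a * deriv L.q₀ a + k * L.q₀ a + L.ε * (a - L.ℓ)| ≤ 3 * M := by
    have i1 : k * L.q₀ a ≤ M * 1 := by gcongr
    have i2 : L.ε * (a - L.ℓ) ≤ 1 / 10 ^ 6 * 2 := by gcongr
    have i3 : 0 ≤ k * L.q₀ a := by positivity
    have i4 : 0 ≤ L.ε * (a - L.ℓ) := by positivity
    obtain ⟨i5, i6⟩ := abs_le.1 hdq
    rw [abs_le]; constructor <;> linarith
  have b2 : |L.q k a * deriv (L.q k) a| * L.ε ≤ 170 * M ^ 5 := by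
    rw [h.deriv_q hk ha, ← hE]
    have i1 : |E * (L.q₀ a * deriv L.q₀ a + k * L.q₀ a + L.ε * (a - L.ℓ)) - k * L.q k a
        - L.ε * (√L.ε + a)| ≤ E * (3 * M) + M * (6 * M) + 1 * 1 := by
      have j1 : |E * (L.q₀ a * deriv L.q₀ a + k * L.q₀ a + L.ε * (a - L.ℓ))| ≤ E * (3 * M) := by
        rw [abs_mul, abs_of_pos hE0]; gcongr
      have j2 : k * L.q k a ≤ M * (6 * M) := by gcongr
      have j3 : L.ε * (√L.ε + a) ≤ 1 * 1 := by gcongr; linarith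
      have j4 : 0 ≤ k * L.q k a := by positivity
      have j5 : 0 ≤ L.ε * (√L.ε + a) := by positivity
      obtain ⟨j6, j7⟩ := abs_le.1 j1
      rw [abs_le]; constructor <;> linarith
    calc _ ≤ (E * (3 * M) + M * (6 * M) + 1 * 1) * L.ε := by gcongr
      _ = 3 * M * (E * L.ε) + (6 * M ^ 2 + 1) * L.ε := by ring
      _ ≤ 3 * M * (49 * M ^ 4) + (6 * M ^ 2 + 1) * (1 / 10 ^ 6) := by gcongr
      _ ≤ _ := by
        have j1 : M ^ 2 ≤ M ^ 5 := pow_le_pow_right₀ hM (by norm_num)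
        have := hP 5
        nlinarith
  rw [h.deriv_v hk ha]
  set F := exp (-(L.s * √L.ε * L.T₁ k a)) with hF
  have hF0 : 0 < F := exp_pos _
  have i1 : |F * (L.q k a * deriv (L.q k) a - (L.s * √L.ε * L.q k a - L.ε * (√L.ε + a)))
      + L.s * √L.ε * L.v k a + L.ε * (√L.ε - a)|
      ≤ 2 * (|L.q k a * deriv (L.q k) a| + M + 1) + M + 1 := by
    have j1 := h.abs_m_mul (L.q k a)
    have j2 := h.abs_m_mul (L.v k a)
    rw [abs_of_pos hq'] at j1
    rw [abs_of_pos v2] at j2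
    have j3 : √L.ε * L.q k a ≤ 1 / 10 ^ 6 * (6 * M) := by gcongr
    have j4 : √L.ε * L.v k a ≤ 1 / 10 ^ 6 * (7 * M) := by gcongr
    have j5 : L.ε * (√L.ε + a) ≤ 1 * 1 := by gcongr; linarith
    have j6 : L.ε * (√L.ε - a) ≤ 1 * 1 := by gcongr; linarith
    have j5' : 0 ≤ L.ε * (√L.ε + a) := by positivity
    have j6' : 0 ≤ L.ε * (√L.ε - a) := by positivity
    have j7 : |F * (L.q k a * deriv (L.q k) a - (L.s * √L.ε * L.q k a - L.ε * (√L.ε + a)))|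
        ≤ 2 * (|L.q k a * deriv (L.q k) a| + M + 1) := by
      rw [abs_mul, abs_of_pos hF0]
      have j8 : |L.q k a * deriv (L.q k) a - (L.s * √L.ε * L.q k a - L.ε * (√L.ε + a))|
          ≤ |L.q k a * deriv (L.q k) a| + M + 1 := by
        have j9 : |L.s * √L.ε * L.q k a - L.ε * (√L.ε + a)| ≤ M + 1 := by
          obtain ⟨j10, j11⟩ := abs_le.1 j1.le
          rw [abs_le]; constructor <;> linarith
        have := abs_sub (L.q k a * deriv (L.q k) a) (L.s * √L.ε * L.q k a - L.ε * (√L.ε + a))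
        linarith
      gcongr
    obtain ⟨j10, j11⟩ := abs_le.1 j2.le
    obtain ⟨j12, j13⟩ := abs_le.1 j7
    rw [abs_le]; constructor <;> linarith
  calc _ ≤ (2 * (|L.q k a * deriv (L.q k) a| + M + 1) + M + 1) * L.ε := by gcongr
    _ = 2 * (|L.q k a * deriv (L.q k) a| * L.ε) + (3 * M + 3) * L.ε := by ring
    _ ≤ 2 * (170 * M ^ 5) + (3 * M + 3) * (1 / 10 ^ 6) := by gcongr
    _ ≤ _ := by
      have j1 : M ≤ M ^ 5 := le_self_pow₀ hM (by norm_num)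
      have := hP 5
      linarith

/-- The contraction factors are at most `ε ^ 8`. Against them stand losses that are only polynomial:
one factor `1 / ε` from the derivative of `v` in `e₁`, powers of `M`, and denominators of size at
least `ε² / 100`. -/
theorem e_le (ha' : |a| ≤ 9 / 10 * √L.ε) : |L.e₁ k a| ≤ 1 / 2 ∧ |L.e₂ k a| ≤ 1 / 2 := by
  obtain ⟨a1, a2⟩ := abs_le.1 ha'
  have hσ := h.sqrt_pos
  have hε := h.ε_pos
  have hM := h.one_le
  have hc : 1 / 100 * L.ε ≤ (√L.ε - a) ^ 2 := by have := h.sq_sqrt; nlinarith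
  have hd : 1 / 100 * L.ε ≤ (√L.ε + a) ^ 2 := by have := h.sq_sqrt; nlinarith
  have hε1 : L.ε ≤ 1 / 10 ^ 6 := by linarith [h.ε_le, h.sqrt_le]
  have hMe : M ^ 5 * L.ε ≤ 1 / 10 ^ 6 := by
    have h1 := h.pow_mul_le (n := 5) (by norm_num)
    have : M ^ 5 * L.ε ≤ M ^ 5 * (1 / 10 ^ 6 * √L.ε) := by gcongr; exact h.ε_le
    nlinarith
  obtain ⟨-, v1, v2⟩ := h.v_bounds hk ha
  have hs := h.sqrt_le
  constructor
  · have h1 := (h.exp_T₂_le hk ha).2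
    have h2 := h.abs_deriv_v_le hk ha
    have h3 : |L.v k a * ((√L.ε - a) * deriv (L.v k) a + L.v k a)| * L.ε ≤ 600 * M ^ 5 := by
      have e : L.v k a * ((√L.ε - a) * deriv (L.v k) a + L.v k a)
          = (√L.ε - a) * (L.v k a * deriv (L.v k) a) + L.v k a ^ 2 := by ring
      have h4 : |(√L.ε - a) * (L.v k a * deriv (L.v k) a) + L.v k a ^ 2| ≤
          1 * |L.v k a * deriv (L.v k) a| + (7 * M) ^ 2 := by
        refine (abs_add_le _ _).trans ?_
        rw [abs_mul, abs_of_pos (Valid.c_pos ha), abs_of_pos (pow_pos v2 2)]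
        gcongr
        linarith
      rw [e]
      calc _ ≤ (1 * |L.v k a * deriv (L.v k) a| + (7 * M) ^ 2) * L.ε := by gcongr
        _ = |L.v k a * deriv (L.v k) a| * L.ε + 49 * M ^ 2 * L.ε := by ring
        _ ≤ 500 * M ^ 5 + 49 * M ^ 5 * 1 := by
          gcongr
          · norm_num
          · linarith
        _ ≤ _ := by have := one_le_pow₀ (n := 5) hM; linarith
    unfold e₁
    have hden : 0 < (√L.ε - a) ^ 2 * L.ε := by have := Valid.c_pos ha; positivity
    rw [abs_div, abs_of_pos hden, abs_mul, abs_of_pos (exp_pos _), div_le_iff₀ hden]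
    set Y := |L.v k a * ((√L.ε - a) * deriv (L.v k) a + L.v k a)|
    calc _ ≤ L.ε ^ 8 * Y := by gcongr
      _ = L.ε ^ 6 * L.ε * (Y * L.ε) := by ring
      _ ≤ L.ε ^ 6 * L.ε * (600 * M ^ 5) := by gcongr
      _ = L.ε ^ 6 * 600 * (M ^ 5 * L.ε) := by ring
      _ ≤ L.ε ^ 6 * 600 * (1 / 10 ^ 6) := by gcongr
      _ = L.ε ^ 2 * (L.ε ^ 4 * (600 / 10 ^ 6)) := by ring
      _ ≤ L.ε ^ 2 * (1 * (600 / 10 ^ 6)) := by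
        gcongr
        exact pow_le_one₀ hε.le (by linarith)
      _ ≤ 1 / 2 * (1 / 100 * L.ε * L.ε) := by nlinarith [sq_nonneg L.ε]
      _ ≤ _ := by gcongr
  · have h1 := (h.exp_t₂_le hk ha).2.2
    obtain ⟨h3, h4, h5⟩ := h.h_bounds ha
    have hp0 := h.p₀_nonneg a ha
    have hp1 := h.p₀_le a ha
    have hk0 := h.k_pos k hk
    have hk1 := h.k_le k hk
    have hdp := abs_le.1 (h.dp₀_le a ha)
    have hM2 : M ≤ M ^ 5 := le_self_pow₀ hM (by norm_num)
    have hM3 : M ^ 2 ≤ M ^ 5 := pow_le_pow_right₀ hM (by norm_num)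
    have hM4 : 1 ≤ M ^ 5 := one_le_pow₀ hM
    have h6 : |(√L.ε + a) * (L.p₀ a * deriv L.p₀ a - k * L.p₀ a + L.ε * (a - L.ℓ))
        - (L.ε * (a - L.ℓ) ^ 2 - k * L.p₀ a * (a - L.ℓ) + L.p₀ a ^ 2)| ≤ 20 * M ^ 5 := by
      have j1 : k * L.p₀ a ≤ M * M := by gcongr
      have j1' : 0 ≤ k * L.p₀ a := by positivity
      have j2 : L.ε * (a - L.ℓ) ≤ 1 * 2 := by gcongr; linarith
      have j2' : 0 ≤ L.ε * (a - L.ℓ) := by positivity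
      have j3 : L.ε * (a - L.ℓ) ^ 2 ≤ 1 * 2 ^ 2 := by gcongr; linarith
      have j3' : 0 ≤ L.ε * (a - L.ℓ) ^ 2 := by positivity
      have j4 : k * L.p₀ a * (a - L.ℓ) ≤ M * M * 2 := by gcongr
      have j4' : 0 ≤ k * L.p₀ a * (a - L.ℓ) := by positivity
      have j5 : L.p₀ a ^ 2 ≤ M ^ 2 := by gcongr
      have j5' : 0 ≤ L.p₀ a ^ 2 := by positivity
      have j6 : |(√L.ε + a) * (L.p₀ a * deriv L.p₀ a - k * L.p₀ a + L.ε * (a - L.ℓ))|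
          ≤ 1 * (M + M ^ 2 + 2) := by
        rw [abs_mul, abs_of_pos (Valid.d_pos ha)]
        gcongr
        · linarith
        · rw [abs_le]; constructor <;> linarith [hdp.1, hdp.2]
      obtain ⟨j7, j8⟩ := abs_le.1 j6
      rw [abs_le]; constructor <;> linarith
    unfold e₂
    have hden : 0 < (√L.ε + a) ^ 2 * L.ε := by have := Valid.d_pos ha; positivity
    rw [abs_div, abs_of_pos hden, abs_mul, abs_of_pos (exp_pos _), div_le_iff₀ hden]
    calc _ ≤ L.ε ^ 8 * (20 * M ^ 5) := by gcongr
      _ = L.ε ^ 7 * 20 * (M ^ 5 * L.ε) := by ring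
      _ ≤ L.ε ^ 7 * 20 * (1 / 10 ^ 6) := by gcongr
      _ = L.ε ^ 2 * (L.ε ^ 5 * (20 / 10 ^ 6)) := by ring
      _ ≤ L.ε ^ 2 * (1 * (20 / 10 ^ 6)) := by
        gcongr
        exact pow_le_one₀ hε.le (by linarith)
      _ ≤ 1 / 2 * (1 / 100 * L.ε * L.ε) := by nlinarith [sq_nonneg L.ε]
      _ ≤ _ := by gcongr

omit ha in
theorem strictAntiOn_D : StrictAntiOn (L.D k) (Icc (-(9 / 10 * √L.ε)) (9 / 10 * √L.ε)) := by
  have hσ := h.sqrt_pos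
  have key : ∀ a ∈ Icc (-(9 / 10 * √L.ε)) (9 / 10 * √L.ε), ∃ D', HasDerivAt (L.D k) D' a ∧ D' < 0 :=
    fun a ha => by
      have h1 : |a| ≤ 9 / 10 * √L.ε := abs_le.2 ha
      have h2 : |a| < √L.ε := by linarith
      obtain ⟨e1, e2⟩ := h.e_le hk h2 h1
      exact h.deriv_D_neg hk h2 e1 e2
  refine strictAntiOn_of_deriv_neg (convex_Icc _ _) (fun a ha => ?_) fun a ha => ?_
  · obtain ⟨D', hd, -⟩ := key a ha
    exact hd.continuousAt.continuousWithinAt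
  · rw [interior_Icc] at ha
    obtain ⟨D', hd, hn⟩ := key a (Ioo_subset_Icc_self ha)
    rw [hd.deriv]; exact hn

end Tame

end LeftData

theorem tauf_zero_add (s : ℝ) : tauf s 0 + tauf (-s) 0 = π / omg := by
  unfold tauf
  rw [show (0 - -s / 2) / omg = -((0 - s / 2) / omg) by ring, arctan_neg]
  have := omg_pos.ne'
  field_simp
  ring

/-- For slopes zero the lower arc is exactly half a turn of the focus, and the ratio is its total
damping. -/
theorem gf_zero_div (s : ℝ) : gf s 0 / gf (-s) 0 = exp (-(s / 2 * (π / omg))) := by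
  rw [← tauf_zero_add]
  unfold gf
  have h1 : omg ^ 2 + (0 - -s / 2) ^ 2 = omg ^ 2 + (0 - s / 2) ^ 2 := by ring
  have h2 : 0 < √(omg ^ 2 + (0 - s / 2) ^ 2) := by
    have := omg_pos
    positivity
  rw [h1, mul_div_mul_right _ _ h2.ne', ← Real.exp_sub]
  congr 1
  ring

theorem pi_div_omg : π / omg / 2 < 1.85 ∧ 1.8 < π / omg / 2 := by
  have hω := omg_pos
  have h2 := omg_sq
  have h3 : omg < 0.8661 := by nlinarith
  have h4 : 0.866 < omg := by nlinarith
  constructor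
  · rw [div_div, div_lt_iff₀ (by positivity)]; nlinarith [Real.pi_lt_d2]
  · rw [div_div, lt_div_iff₀ (by positivity)]; nlinarith [Real.pi_gt_d2]

/-- The logarithmic derivative `r / (1 - s r + r²)` of `gf s` lies between `0` and `1` on the
interval considered. The lower bound gives this comparison and the upper one gives the next. -/
theorem gf_zero_le {s r : ℝ} (hs : s ^ 2 = 1) (h0 : 0 ≤ r) (h1 : r ≤ 1 / 4) :
    gf s 0 ≤ gf s r := by
  have hd := fun r => hasDerivAt_gf hs r
  have hQ : ∀ x : ℝ, 3 / 4 ≤ 1 - s * x + x ^ 2 := fun x => by nlinarith [sq_nonneg (2 * x - s)]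
  have : MonotoneOn (gf s) (Icc 0 (1 / 4)) := by
    refine monotoneOn_of_deriv_nonneg (convex_Icc _ _)
      (fun x _ => (hd x).continuousAt.continuousWithinAt)
      (fun x _ => (hd x).differentiableAt.differentiableWithinAt) fun x hx => ?_
    rw [interior_Icc] at hx
    rw [(hd x).deriv]
    have := gf_pos s x
    have := hQ x
    have := hx.1
    positivity
  exact this ⟨le_rfl, by norm_num⟩ ⟨h0, h1⟩ h0

theorem gf_le_mul_exp {s r : ℝ} (hs : s ^ 2 = 1) (h0 : 0 ≤ r) (h1 : r ≤ 1 / 4) :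
    gf s r ≤ gf s 0 * exp r := by
  have hd := fun r => hasDerivAt_gf hs r
  have hQ : ∀ x : ℝ, 3 / 4 ≤ 1 - s * x + x ^ 2 := fun x => by nlinarith [sq_nonneg (2 * x - s)]
  have hd' : ∀ x, HasDerivAt (fun x => gf s x * exp (-x)) (gf s x * (x / (1 - s * x + x ^ 2)) *
      exp (-x) + gf s x * (exp (-x) * -1)) x := fun x => (hd x).mul (hasDerivAt_neg x).exp
  have : AntitoneOn (fun x => gf s x * exp (-x)) (Icc 0 (1 / 4)) := by
    refine antitoneOn_of_deriv_nonpos (convex_Icc _ _)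
      (fun x _ => (hd' x).continuousAt.continuousWithinAt)
      (fun x _ => (hd' x).differentiableAt.differentiableWithinAt) fun x hx => ?_
    rw [interior_Icc] at hx
    rw [(hd' x).deriv]
    have h2 := gf_pos s x
    have h3 := hQ x
    have h4 : x / (1 - s * x + x ^ 2) ≤ 1 := by
      rw [div_le_one (by linarith)]; linarith [hx.2]
    have h5 := mul_pos h2 (exp_pos (-x))
    nlinarith
  have := this ⟨le_rfl, by norm_num⟩ ⟨h0, h1⟩ h0
  simp only [neg_zero, exp_zero, mul_one] at this
  rwa [Real.exp_neg, ← div_eq_mul_inv, div_le_iff₀ (exp_pos _)] at this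

theorem gf_bounds {s r : ℝ} (hs : s ^ 2 = 1) (h0 : 0 ≤ r) (h1 : r ≤ 1 / 4) :
    gf s 0 ≤ gf s r ∧ gf s r ≤ 2 * gf s 0 := by
  refine ⟨gf_zero_le hs h0 h1, (gf_le_mul_exp hs h0 h1).trans ?_⟩
  have h2 := Real.exp_bound_div_one_sub_of_interval h0 (by linarith)
  have h3 : 1 / (1 - r) ≤ 2 := by rw [div_le_iff₀ (by linarith)]; linarith
  have h4 := gf_pos s 0
  rw [mul_comm]
  gcongr
  linarith

theorem abs_log_gf_sub_le {s r : ℝ} (hs : s ^ 2 = 1) (h0 : 0 ≤ r) (h1 : r ≤ 1 / 4) :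
    |log (gf s r) - log (gf s 0)| ≤ r := by
  have h2 := Real.log_le_log (gf_pos s 0) (gf_zero_le hs h0 h1)
  have h3 := Real.log_le_log (gf_pos s r) (gf_le_mul_exp hs h0 h1)
  rw [Real.log_mul (gf_pos _ _).ne' (exp_pos _).ne', Real.log_exp] at h3
  rw [abs_le]; constructor <;> linarith

theorem gf_ratio_le {s : ℝ} (hs : s ^ 2 = 1) : gf s 0 ≤ 7 * gf (-s) 0 := by
  have h1 := gf_zero_div s
  rw [div_eq_iff (gf_pos _ _).ne'] at h1
  rw [h1]
  have h2 := gf_pos (-s) 0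
  gcongr
  have h3 : -(s / 2 * (π / omg)) ≤ 1.85 := by
    have h4 := pi_div_omg
    have h5 := abs_le.1 (sq_le_one_iff_abs_le_one s |>.1 hs.le)
    nlinarith
  have h6 : exp 1.85 ≤ 7 := by
    have h7 : exp 1.85 = exp 1 * exp 0.85 := by rw [← Real.exp_add]; norm_num
    have h8 : exp 0.85 = exp 1 * exp (-0.15) := by rw [← Real.exp_add]; norm_num
    have h9 : exp (-0.15) ≤ 0.9 := by
      have h10 : exp (-0.15) = (exp 0.15)⁻¹ := by rw [← Real.exp_neg]
      rw [h10]
      have := Real.add_one_le_exp 0.15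
      rw [inv_le_comm₀ (by positivity) (by norm_num)]
      linarith
    have h11 := Real.exp_one_lt_d9
    have h12 := exp_pos 1
    rw [h7, h8]
    calc exp 1 * (exp 1 * exp (-0.15)) ≤ 2.7182818286 * (2.7182818286 * 0.9) := by gcongr
      _ ≤ 7 := by norm_num
  exact (exp_le_exp.2 h3).trans h6

namespace LeftData.Tame

variable {L : LeftData} {M : ℝ} {K : Set ℝ} {k a : ℝ} (h : L.Tame M K) (hk : k ∈ K)
  (ha : |a| < √L.ε)
include h hk ha

theorem r_le : L.r₁ k a ≤ 1 / 4 ∧ L.r₂ k a ≤ 1 / 4 := by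
  have h1 := h.r₁_lt hk ha
  have h2 := h.r₂_lt hk ha
  have h3 := h.sqrt_le
  have h4 := h.mul_sqrt_le
  constructor <;> linarith

/-- For `a ≤ -(9 / 10) √ε` the right half-width is at least `19` times the left one, whereas the two
values of `gf` differ by a factor of at most `2 * 7`. -/
theorem D_pos (ha' : a ≤ -(9 / 10 * √L.ε)) : 0 < L.D k a := by
  obtain ⟨h1, h2⟩ := h.r_le hk ha
  have hs := h.s_sq
  have b1 := (gf_bounds hs (h.r₁_pos hk ha).le h1).1
  have b2 := (gf_bounds (s := -L.s) (by rw [neg_sq, hs]) (h.r₂_pos hk ha).le h2).2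
  have b3 := gf_ratio_le (s := -L.s) (by rw [neg_sq, hs])
  rw [neg_neg] at b3
  have g := gf_pos L.s 0
  have hσ := h.sqrt_pos
  have hd := Valid.d_pos ha
  have hc := Valid.c_pos ha
  unfold D
  have i1 : (√L.ε + a) * gf (-L.s) (L.r₂ k a) ≤ (1 / 10 * √L.ε) * (2 * (7 * gf L.s 0)) :=
    mul_le_mul (by linarith) (by linarith) (gf_pos _ _).le (by positivity)
  have i2 : (19 / 10 * √L.ε) * gf L.s 0 ≤ (√L.ε - a) * gf L.s (L.r₁ k a) := by
    gcongr
    linarith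
  have := mul_pos hσ g
  linarith

theorem D_neg (ha' : 9 / 10 * √L.ε ≤ a) : L.D k a < 0 := by
  obtain ⟨h1, h2⟩ := h.r_le hk ha
  have hs := h.s_sq
  have b1 := (gf_bounds hs (h.r₁_pos hk ha).le h1).2
  have b2 := (gf_bounds (s := -L.s) (by rw [neg_sq, hs]) (h.r₂_pos hk ha).le h2).1
  have b3 := gf_ratio_le hs
  have g := gf_pos (-L.s) 0
  have hσ := h.sqrt_pos
  have hd := Valid.d_pos ha
  have hc := Valid.c_pos ha
  unfold D
  have i1 : (√L.ε - a) * gf L.s (L.r₁ k a) ≤ (1 / 10 * √L.ε) * (2 * (7 * gf (-L.s) 0)) :=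
    mul_le_mul (by linarith) (by linarith) (gf_pos _ _).le (by positivity)
  have i2 : (19 / 10 * √L.ε) * gf (-L.s) 0 ≤ (√L.ε + a) * gf (-L.s) (L.r₂ k a) := by
    gcongr
    linarith
  have := mul_pos hσ g
  linarith

omit ha in
/-- The defect vanishes for at most one value of `a`. -/
theorem D_zero_unique {a a' : ℝ} (ha : |a| < √L.ε) (ha' : |a'| < √L.ε) (h0 : L.D k a = 0)
    (h0' : L.D k a' = 0) : a = a' := by
  have key : ∀ {b}, |b| < √L.ε → L.D k b = 0 → b ∈ Icc (-(9 / 10 * √L.ε)) (9 / 10 * √L.ε) := by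
    intro b hb hb0
    constructor
    · by_contra hlt
      push Not at hlt
      exact absurd hb0 (h.D_pos hk hb hlt.le).ne'
    · by_contra hlt
      push Not at hlt
      exact absurd hb0 (h.D_neg hk hb hlt.le).ne
  exact (h.strictAntiOn_D hk).injOn (key ha h0) (key ha' h0') (h0.trans h0'.symm)

end LeftData.Tame

end PWLCanard

/-! ### Logarithmic asymptotics of the speeds. -/

namespace PWLCanard

theorem abs_log_sub_le {x y δ : ℝ} (hy : 0 < y) (hδ : δ ≤ 1 / 4) (h : |x - y| ≤ δ * y) :
    0 < x ∧ |log x - log y| ≤ 2 * δ := by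
  obtain ⟨h1, h2⟩ := abs_le.1 h
  have hx : 3 / 4 * y ≤ x := by nlinarith
  have hx0 : 0 < x := by linarith
  refine ⟨hx0, ?_⟩
  rw [← Real.log_div hx0.ne' hy.ne', abs_le]
  constructor
  · have h3 := Real.log_le_sub_one_of_pos (div_pos hy hx0)
    rw [Real.log_div hy.ne' hx0.ne'] at h3
    rw [Real.log_div hx0.ne' hy.ne']
    have h4 : y / x - 1 ≤ 2 * δ := by
      rw [sub_le_iff_le_add, div_le_iff₀ hx0]
      have : 0 ≤ δ := by
        have := (abs_nonneg _).trans h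
        exact nonneg_of_mul_nonneg_left this hy
      nlinarith
    linarith
  · refine (Real.log_le_sub_one_of_pos (div_pos hx0 hy)).trans ?_
    have h5 : 0 ≤ δ := by
      have := (abs_nonneg _).trans h
      exact nonneg_of_mul_nonneg_left this hy
    rw [sub_le_iff_le_add, div_le_iff₀ hy]
    nlinarith

namespace LeftData.Tame

variable {L : LeftData} {M : ℝ} {K : Set ℝ} {k a : ℝ} (h : L.Tame M K) (hk : k ∈ K)
  (ha : |a| ≤ 9 / 10 * √L.ε)
include h

theorem lt_of_le (ha : |a| ≤ 9 / 10 * √L.ε) : |a| < √L.ε := by linarith [h.sqrt_pos]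

theorem ε_le' : L.ε ≤ 1 / 10 ^ 12 := by linarith [h.ε_le, h.sqrt_le]

theorem pow_mul_ε_le {n : ℕ} (hn : n ≤ 10) : 10 ^ 12 * (M ^ n * L.ε) ≤ 1 := by
  have h1 := h.pow_mul_le hn
  have h2 := h.ε_le
  have h3 := h.M_pos
  have : M ^ n * L.ε ≤ M ^ n * (1 / 10 ^ 6 * √L.ε) := by gcongr
  linarith

theorem pow_mul_ε_le_sqrt {n : ℕ} (hn : n ≤ 10) :
    10 ^ 6 * (M ^ n * L.ε) ≤ √L.ε ∧ 0 < M ^ n * L.ε := by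
  have h1 := mul_le_mul_of_nonneg_right (h.pow_mul_le hn) h.sqrt_pos.le
  refine ⟨?_, mul_pos (pow_pos h.M_pos n) h.ε_pos⟩
  have h2 := h.sq_sqrt
  calc 10 ^ 6 * (M ^ n * L.ε) = 10 ^ 6 * M ^ n * √L.ε * √L.ε := by
        linear_combination (-(10 ^ 6 * M ^ n)) * h2
    _ ≤ √L.ε := by linarith

include ha in
theorem c_bounds : √L.ε ≤ 10 * (√L.ε - a) ∧ √L.ε - a ≤ 2 * √L.ε := by
  obtain ⟨h1, h2⟩ := abs_le.1 ha
  have := h.sqrt_pos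
  constructor <;> linarith

include ha in
theorem d_bounds : √L.ε ≤ 10 * (√L.ε + a) ∧ √L.ε + a ≤ 2 * √L.ε := by
  obtain ⟨h1, h2⟩ := abs_le.1 ha
  have := h.sqrt_pos
  constructor <;> linarith

include ha in
theorem pow_le_c : 10 * M * L.ε ^ 8 ≤ L.ε ^ 6 * (√L.ε - a) ∧
    10 * M * L.ε ^ 8 ≤ L.ε ^ 6 * (√L.ε + a) := by
  have h1 := (h.c_bounds ha).1
  have h2 := (h.d_bounds ha).1
  have hε := h.ε_pos
  have h3 : 100 * M * L.ε ^ 8 ≤ L.ε ^ 6 * √L.ε := by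
    have h4 := h.pow_mul_le (n := 1) (by norm_num)
    have h5 := h.ε_le
    have hM := h.M_pos
    have hσ := h.sqrt_pos
    have h6 : L.ε * L.ε ≤ 1 * (1 / 10 ^ 6 * √L.ε) := by
      gcongr
      linarith [h.ε_le']
    have h7 : 100 * M * (L.ε * L.ε) ≤ √L.ε := by
      have h8 : M * L.ε ≤ 1 := by have := h.pow_mul_ε_le (n := 1) (by norm_num); linarith
      calc 100 * M * (L.ε * L.ε) = 100 * (M * L.ε) * L.ε := by ring
        _ ≤ 100 * 1 * (1 / 10 ^ 6 * √L.ε) := by gcongr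
        _ ≤ _ := by linarith
    calc _ = L.ε ^ 6 * (100 * M * (L.ε * L.ε)) := by ring
      _ ≤ _ := by gcongr
  constructor
  · have : L.ε ^ 6 * √L.ε ≤ L.ε ^ 6 * (10 * (√L.ε - a)) := by gcongr
    linarith
  · have : L.ε ^ 6 * √L.ε ≤ L.ε ^ 6 * (10 * (√L.ε + a)) := by gcongr
    linarith

include hk ha

/-- The fast integral measures the distance of the exit point from the slow eigendirection, and
after the long stay in the right zone it is multiplied by at most `ε ^ 8`. -/
theorem w_near : 0 < lamL 1 L.ε * (√L.ε - a) - L.w k a ∧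
    lamL 1 L.ε * (√L.ε - a) - L.w k a ≤ L.ε ^ 6 * (√L.ε - a) := by
  have ha' := h.lt_of_le ha
  obtain ⟨l1, l2, l3, l4⟩ := h.lamL_one_bounds
  obtain ⟨v1, v2, v3⟩ := h.v_bounds hk ha'
  have hc := Valid.c_pos ha'
  have hε := h.ε_pos
  have e := (h.exp_T₂_le hk ha').1
  have h1 := h.w_fast hk ha'
  have h2 : 0 < lamL 1 L.ε * (√L.ε - a) := mul_pos (hε.trans l1) hc
  rw [h1]
  refine ⟨by positivity, le_trans ?_ (h.pow_le_c ha).1⟩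
  have h3 : L.v k a + lamL 1 L.ε * (√L.ε - a) ≤ 10 * M := by
    have : lamL 1 L.ε * (√L.ε - a) ≤ 1 * 1 := by
      gcongr
      · linarith [h.ε_le']
      · linarith [(h.c_bounds ha).2, h.sqrt_le]
    linarith [h.one_le]
  have hM := h.M_pos
  gcongr

theorem p_near : |L.p k a - lamL k L.ε * (√L.ε + a)| ≤ L.ε ^ 6 * (√L.ε + a) := by
  have ha' := h.lt_of_le ha
  obtain ⟨l1, l2, l3, l4, l5⟩ := h.lamL_bounds hk
  obtain ⟨h3, h4, h5⟩ := h.h_bounds ha'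
  have e := (h.exp_t₂_le hk ha').2.1
  have h1 := h.p_fast hk ha'
  have hM := h.one_le
  have hε := h.ε_pos
  rw [abs_sub_comm, h1, abs_mul, abs_of_pos (exp_pos _)]
  refine le_trans ?_ (h.pow_le_c ha).2
  have h6 : |lamL k L.ε * (a - L.ℓ) - L.p₀ a| ≤ 10 * M := by
    have i1 : lamL k L.ε * (a - L.ℓ) ≤ 2 * M * L.ε * 2 := by gcongr
    have i2 : 0 ≤ lamL k L.ε * (a - L.ℓ) := by positivity
    have i3 := h.p₀_nonneg a ha'
    have i4 := h.p₀_le a ha'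
    have i5 : 2 * M * L.ε * 2 ≤ M := by
      have := h.pow_mul_ε_le (n := 1) (by norm_num)
      linarith
    rw [abs_le]; constructor <;> linarith
  gcongr

/-- The exit lies on the slow eigendirection up to `ε ^ 6`, and `lamL 1 ε = ε + O(ε²)`. The error
bound `√ε` is generous and is chosen for uniformity with the other logarithms. -/
theorem log_w : |log (L.w k a) - (log L.ε + log (√L.ε - a))| ≤ √L.ε := by
  have ha' := h.lt_of_le ha
  obtain ⟨w1, w2⟩ := h.w_near hk ha
  obtain ⟨l1, l2, l3, l4⟩ := h.lamL_one_bounds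
  have hc := Valid.c_pos ha'
  have hε := h.ε_pos
  have h6 := h.ε_le'
  have s1 := lamL_add_fastR 1 L.ε
  have s2 := lamL_mul_fastR (k := 1) (ε := L.ε) (by linarith)
  rw [← Real.log_mul hε.ne' hc.ne']
  have h3 : lamL 1 L.ε - L.ε ≤ 4 * L.ε ^ 2 := by nlinarith
  have h4 : L.ε ^ 6 ≤ L.ε ^ 2 := pow_le_pow_of_le_one hε.le (by linarith) (by norm_num)
  have i2 : L.w k a - L.ε * (√L.ε - a) ≤ 4 * L.ε ^ 2 * (√L.ε - a) := by nlinarith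
  have i3 : -(4 * L.ε ^ 2 * (√L.ε - a)) ≤ L.w k a - L.ε * (√L.ε - a) := by
    have := mul_le_mul_of_nonneg_right h4 hc.le
    have := mul_le_mul_of_nonneg_right l1.le hc.le
    have : 0 ≤ L.ε ^ 2 * (√L.ε - a) := by positivity
    linarith
  have h5 := (abs_log_sub_le (x := L.w k a) (mul_pos hε hc) (δ := 4 * L.ε) (by linarith)
    (by rw [abs_le]; constructor <;> nlinarith)).2
  linarith [h.ε_le]

theorem log_p : |log k + log (L.p k a) - (log L.ε + log (√L.ε + a))| ≤ √L.ε := by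
  have ha' := h.lt_of_le ha
  have w1 := abs_le.1 (h.p_near hk ha)
  obtain ⟨l1, l2, l3, l4, l5⟩ := h.lamL_bounds hk
  have hc := Valid.d_pos ha'
  have hε := h.ε_pos
  have h6 := h.ε_le'
  have hM := h.one_le
  have hkM := h.k_le k hk
  have s1 := lamL_add_fastR k L.ε
  have s2 := lamL_mul_fastR (h.lt_k k hk)
  have hp := (h.leg_p hk ha').exit_pos
  rw [← Real.log_mul hε.ne' hc.ne', ← Real.log_mul l5.ne' hp.ne']
  have h7 := h.pow_mul_ε_le (n := 2) (by norm_num)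
  have h3 : k * lamL k L.ε - L.ε ≤ 4 * M ^ 2 * L.ε ^ 2 := by
    have : lamL k L.ε ^ 2 ≤ (2 * M * L.ε) ^ 2 := by gcongr
    nlinarith
  have h3' : 0 ≤ k * lamL k L.ε - L.ε := by nlinarith
  have h4 : k * L.ε ^ 6 ≤ M ^ 2 * L.ε ^ 2 := by
    have i1 : L.ε ^ 6 ≤ L.ε ^ 2 := pow_le_pow_of_le_one hε.le (by linarith) (by norm_num)
    have i2 : k ≤ M ^ 2 := by nlinarith
    gcongr
  have hMε := h.pow_mul_ε_le_sqrt (n := 2) (by norm_num)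
  have e1 : k * L.p k a - L.ε * (√L.ε + a) = k * (L.p k a - lamL k L.ε * (√L.ε + a)) +
      (k * lamL k L.ε - L.ε) * (√L.ε + a) := by ring
  have i1 : |k * (L.p k a - lamL k L.ε * (√L.ε + a))| ≤ M ^ 2 * L.ε ^ 2 * (√L.ε + a) := by
    rw [abs_mul, abs_of_pos l5]
    calc _ ≤ k * (L.ε ^ 6 * (√L.ε + a)) := by gcongr; exact h.p_near hk ha
      _ = k * L.ε ^ 6 * (√L.ε + a) := by ring
      _ ≤ _ := by gcongr
  have i2 : |(k * lamL k L.ε - L.ε) * (√L.ε + a)| ≤ 4 * M ^ 2 * L.ε ^ 2 * (√L.ε + a) := by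
    rw [abs_mul, abs_of_pos hc, abs_of_nonneg h3']
    gcongr
  have h5 := (abs_log_sub_le (x := k * L.p k a) (mul_pos hε hc) (δ := 5 * M ^ 2 * L.ε)
    (by linarith) (by
      rw [e1]
      refine (abs_add_le _ _).trans ((add_le_add i1 i2).trans_eq ?_)
      ring)).2
  linarith [hMε.1, hMε.2]

omit ha in
-- The slow rate is `O(M ε)` while `k` is at least `1 / M`, so replacing either expression by `k`
-- costs a relative error `O(M² ε)`.
theorem log_fastR_sub : |log (fastR k L.ε - lamL k L.ε) - log k| ≤ √L.ε ∧
    |log (fastR k L.ε) - log k| ≤ √L.ε ∧ 0 < fastR k L.ε - lamL k L.ε := by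
  obtain ⟨l1, l2, l3, l4, l5⟩ := h.lamL_bounds hk
  have hM := h.M_pos
  have hε := h.ε_pos
  have hMε := h.pow_mul_ε_le_sqrt (n := 2) (by norm_num)
  have h7 := h.pow_mul_ε_le (n := 2) (by norm_num)
  have s1 := lamL_add_fastR k L.ε
  have h3 : 2 * lamL k L.ε ≤ 4 * M ^ 2 * L.ε * k := by
    calc _ ≤ 4 * M * L.ε * 1 := by linarith
      _ ≤ 4 * M * L.ε * (M * k) := by gcongr; exact h.k_ge k hk
      _ = _ := by ring
  have i1 := abs_log_sub_le (x := fastR k L.ε - lamL k L.ε) l5 (δ := 4 * M ^ 2 * L.ε)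
    (by linarith) (by rw [abs_le]; constructor <;> linarith)
  have i2 := abs_log_sub_le (x := fastR k L.ε) l5 (δ := 4 * M ^ 2 * L.ε)
    (by linarith) (by rw [abs_le]; constructor <;> linarith)
  exact ⟨by linarith [i1.2, hMε.1, hMε.2], by linarith [i2.2, hMε.1, hMε.2], i1.1⟩

omit hk ha in
theorem log_fastR_one : |log (fastR 1 L.ε - lamL 1 L.ε)| ≤ √L.ε := by
  obtain ⟨l1, l2, l3, l4⟩ := h.lamL_one_bounds
  have s1 := lamL_add_fastR 1 L.ε
  have hε := h.ε_pos
  have := (abs_log_sub_le (x := fastR 1 L.ε - lamL 1 L.ε) one_pos (δ := 4 * L.ε)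
    (by linarith [h.ε_le']) (by rw [abs_le]; constructor <;> linarith)).2
  rw [Real.log_one, sub_zero] at this
  linarith [h.ε_le]

theorem log_left : |log (fastR k L.ε * (√L.ε + a) - L.p k a) - (log k + log (√L.ε + a))| ≤ √L.ε ∧
    0 < fastR k L.ε * (√L.ε + a) - L.p k a := by
  have ha' := h.lt_of_le ha
  obtain ⟨l1, l2, l3, l4, l5⟩ := h.lamL_bounds hk
  have w1 := abs_le.1 (h.p_near hk ha)
  have hd := Valid.d_pos ha'
  have hp := (h.leg_p hk ha').exit_pos
  have hε := h.ε_pos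
  have hM := h.one_le
  have hMε := h.pow_mul_ε_le_sqrt (n := 2) (by norm_num)
  have h7 := h.pow_mul_ε_le (n := 2) (by norm_num)
  have s1 := lamL_add_fastR k L.ε
  rw [← Real.log_mul l5.ne' hd.ne']
  have h4 : L.ε ^ 6 ≤ M * L.ε := by
    have : L.ε ^ 6 ≤ L.ε := pow_le_of_le_one hε.le (by linarith [h.ε_le']) (by norm_num)
    nlinarith
  have h3 : lamL k L.ε * 2 + L.ε ^ 6 ≤ 5 * M ^ 2 * L.ε * k := by
    calc _ ≤ 5 * M * L.ε * 1 := by linarith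
      _ ≤ 5 * M * L.ε * (M * k) := by gcongr; exact h.k_ge k hk
      _ = _ := by ring
  have h5 := mul_le_mul_of_nonneg_right h3 hd.le
  have i1 := abs_log_sub_le (x := fastR k L.ε * (√L.ε + a) - L.p k a) (mul_pos l5 hd)
    (δ := 5 * M ^ 2 * L.ε) (by linarith) (by
      have e : fastR k L.ε = k - lamL k L.ε := by linarith
      rw [e, abs_le]
      constructor
      · linarith [w1.2]
      · have := mul_pos l1 hd
        have : 0 ≤ 5 * M ^ 2 * L.ε * (k * (√L.ε + a)) := by positivity
        linarith)
  exact ⟨by linarith [i1.2, hMε.1, hMε.2], i1.1⟩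

theorem log_right : |log (fastR 1 L.ε * (√L.ε - a) - L.w k a) - log (√L.ε - a)| ≤ √L.ε ∧
    0 < fastR 1 L.ε * (√L.ε - a) - L.w k a := by
  have ha' := h.lt_of_le ha
  obtain ⟨l1, l2, l3, l4⟩ := h.lamL_one_bounds
  obtain ⟨w1, w2⟩ := h.w_near hk ha
  have hc := Valid.c_pos ha'
  have hw := (h.turn_w hk ha').w_pos
  have hε := h.ε_pos
  have s1 := lamL_add_fastR 1 L.ε
  have i1 := abs_log_sub_le (x := fastR 1 L.ε * (√L.ε - a) - L.w k a) hc
    (δ := 4 * L.ε) (by linarith [h.ε_le']) (by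
      have h2 := mul_le_mul_of_nonneg_right l2 hc.le
      have e : fastR 1 L.ε = 1 - lamL 1 L.ε := by linarith
      have := mul_pos hε hc
      rw [e, abs_le]
      constructor <;> linarith)
  exact ⟨by linarith [i1.2, h.ε_le], i1.1⟩

theorem log_v : |log (L.v k a) - log (L.q k a)| ≤ √L.ε ∧
    |log (L.v k a + fastR 1 L.ε * (√L.ε - a)) - log (L.q k a)| ≤ 24 * M ^ 2 * √L.ε := by
  have ha' := h.lt_of_le ha
  obtain ⟨l1, l2, l3, l4⟩ := h.lamL_one_bounds
  obtain ⟨c1, c2⟩ := h.c_bounds ha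
  have hq := h.q_pos hk ha'
  have hq' := h.q_ge hk ha'
  obtain ⟨v1, v2⟩ := abs_le.1 (h.abs_v_sub_le hk ha')
  have hε := h.ε_pos
  have hσ := h.sqrt_pos
  have h2 := h.pow_mul_le (n := 2) (by norm_num)
  have hMε := h.pow_mul_ε_le_sqrt (n := 2) (by norm_num)
  have h7 := h.pow_mul_ε_le (n := 2) (by norm_num)
  have b1 : 3 * L.ε ≤ 12 * M ^ 2 * L.ε * L.q k a := by nlinarith
  have b2 : 3 * √L.ε ≤ 12 * M ^ 2 * √L.ε * L.q k a := by nlinarith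
  have i1 := abs_log_sub_le (x := L.v k a) hq (δ := 12 * M ^ 2 * L.ε) (by linarith)
    (by rw [abs_le]; constructor <;> linarith)
  have i2 := abs_log_sub_le (x := L.v k a + fastR 1 L.ε * (√L.ε - a)) hq
    (δ := 12 * M ^ 2 * √L.ε) (by linarith) (by
      have hc := Valid.c_pos ha'
      have i3 : fastR 1 L.ε * (√L.ε - a) ≤ 1 * (2 * √L.ε) := by gcongr
      have i4 : 0 < fastR 1 L.ε * (√L.ε - a) := by positivity
      have := h.ε_le
      rw [abs_le]; constructor <;> linarith)
  exact ⟨by linarith [i1.2, hMε.1, hMε.2], by linarith [i2.2]⟩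

theorem log_q : |log (L.q k a + fastR k L.ε * (√L.ε + a)) - log (L.q k a)| ≤
    16 * M ^ 3 * √L.ε := by
  have ha' := h.lt_of_le ha
  obtain ⟨l1, l2, l3, l4, l5⟩ := h.lamL_bounds hk
  obtain ⟨c1, c2⟩ := h.d_bounds ha
  have hd := Valid.d_pos ha'
  have hq := h.q_pos hk ha'
  have hq' := h.q_ge hk ha'
  have hσ := h.sqrt_pos
  have hM := h.M_pos
  have hμ : 0 < fastR k L.ε := by linarith
  have hkM := h.k_le k hk
  have h2 := h.pow_mul_le (n := 3) (by norm_num)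
  have i2 := abs_log_sub_le (x := L.q k a + fastR k L.ε * (√L.ε + a)) hq
    (δ := 8 * M ^ 3 * √L.ε) (by linarith) (by
      rw [add_sub_cancel_left, abs_of_pos (mul_pos hμ hd)]
      calc _ ≤ M * (2 * √L.ε) * 1 := by rw [mul_one]; gcongr; linarith
        _ ≤ M * (2 * √L.ε) * (4 * M ^ 2 * L.q k a) := by gcongr
        _ = _ := by ring)
  linarith [i2.2]

theorem abs_mT₁_le : |L.s * √L.ε * L.T₁ k a| ≤ √L.ε := by
  have ha' := h.lt_of_le ha
  have hT := (h.leg_v hk ha').pos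
  rw [h.abs_m_mul, abs_of_pos hT]
  refine (h.exp_T₁_le hk ha').2.trans ?_
  have hσ := h.sqrt_pos
  have h2 := h.pow_mul_ε_le_sqrt (n := 2) (by norm_num)
  linarith

omit hk in
theorem abs_mT₃_le : |L.s * √L.ε * L.T₃ k a| ≤ 8 ∧ 0 < L.T₃ k a := by
  have ha' := h.lt_of_le ha
  have hσ := h.sqrt_pos
  have hT : 0 < L.T₃ k a := div_pos (add_pos (tauf_pos _ _) (tauf_pos _ _)) hσ
  refine ⟨?_, hT⟩
  rw [h.abs_m_mul, abs_of_pos hT]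
  unfold T₃
  rw [mul_div_cancel₀ _ hσ.ne']
  have hb : ∀ s r, tauf s r ≤ 4 := by
    intro s r
    have h1 := pi_div_omg.1
    have h2 : tauf s r ≤ π / omg := by
      unfold tauf
      have := omg_pos
      gcongr
      linarith [neg_pi_div_two_lt_arctan ((r - s / 2) / omg)]
    linarith
  linarith [hb L.s (L.r₁ k a), hb (-L.s) (L.r₂ k a)]

end LeftData.Tame

end PWLCanard

/-! ### Nondegeneracy: contributions of the central and right zones. -/

namespace PWLCanard

theorem exp_eight_le : exp 8 ≤ 3000 := by
  have h1 : exp 8 = exp 1 ^ 8 := by rw [← Real.exp_nat_mul]; norm_num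
  rw [h1]
  calc exp 1 ^ 8 ≤ 2.7182818286 ^ 8 := by gcongr; exact Real.exp_one_lt_d9.le
    _ ≤ 3000 := by norm_num

theorem abs_focS_le {κ ν t : ℝ} (hν : 0 < ν) (ht : 0 ≤ t) :
    |focS κ ν t| ≤ exp (|κ * t| / 2) / ν ∧ |focS κ ν t| ≤ exp (|κ * t| / 2) * t := by
  have h1 : exp (-(κ / 2 * t)) ≤ exp (|κ * t| / 2) := by
    rw [exp_le_exp]; linarith [neg_abs_le (κ * t)]
  unfold focS
  rw [abs_mul, abs_of_pos (exp_pos _), abs_div, abs_of_pos hν]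
  constructor
  · calc _ ≤ exp (|κ * t| / 2) * (1 / ν) := by gcongr; exact abs_sin_le_one _
      _ = _ := by ring
  · gcongr
    rw [div_le_iff₀ hν]
    have := Real.abs_sin_le_abs (x := ν * t)
    rw [abs_of_nonneg (mul_nonneg hν.le ht)] at this
    linarith

namespace LeftData.Tame

variable {L : LeftData} {M : ℝ} {K : Set ℝ} {k a : ℝ} (h : L.Tame M K) (hk : k ∈ K)
  (ha : |a| ≤ 9 / 10 * √L.ε)
include h hk ha

theorem pass_center (hD : L.D k a = 0) : Passage a k (L.s * √L.ε) L.ε (L.s * √L.ε)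
    (focC (L.s * √L.ε) (omg * √L.ε)) (focS (L.s * √L.ε) (omg * √L.ε)) √L.ε (-√L.ε)
    (-L.w k a) (-L.p k a) (L.T₃ k a) := by
  have ha' := h.lt_of_le ha
  have h1 := h.leg_w hk ha'
  have h2 := h.leg_pc hk ha'
  unfold D at hD
  have e : (√L.ε + a) * √L.ε * gf (-L.s) (L.r₂ k a) = (√L.ε - a) * √L.ε * gf L.s (L.r₁ k a) := by
    linear_combination (-√L.ε) * hD
  rw [e] at h2
  have := passage_center (ℓ₁ := √L.ε) (ℓ₀ := -√L.ε) (a := a) (k := k) (m := L.s * √L.ε)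
    (c := √L.ε - a) (d := √L.ε + a) rfl (by ring) h1 h2
    (h.turn_w hk ha').w_pos (h.leg_p hk ha').exit_pos
    (fun a => isZone_center (by linarith [h.sqrt_le])) le_rfl (by simp)
  rw [← add_div] at this
  exact this

theorem pass_v : Passage a k (L.s * √L.ε) L.ε (L.s * √L.ε)
    (focC (L.s * √L.ε) (omg * √L.ε)) (focS (L.s * √L.ε) (omg * √L.ε)) (-√L.ε) √L.ε
    (L.q k a) (L.v k a) (L.T₁ k a) := by
  have ha' := h.lt_of_le ha
  have h1 := h.leg_v hk ha'
  rw [show -(√L.ε + a) = -√L.ε - a by ring] at h1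
  exact h1.passage (h.q_pos hk ha') (fun a => isZone_center (by linarith [h.sqrt_le])) le_rfl
    (by simp)

/-- The identity `lamL - ε = lamL²` puts the slow eigendirection above the slope `ε` by at least
`ε²`, far more than the error `ε ^ 6`. The resulting margin of `w` over `ε c` decides the sign of
the derivative with respect to `a`. -/
theorem w_ge : L.ε * (√L.ε - a) / 2 ≤ L.w k a ∧ L.w k a ≤ 2 * L.ε * (√L.ε - a) ∧
    L.ε ^ 2 * (√L.ε - a) / 2 ≤ L.w k a - L.ε * (√L.ε - a) := by
  have hc := Valid.c_pos (h.lt_of_le ha)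
  obtain ⟨w1, w2⟩ := h.w_near hk ha
  obtain ⟨l1, l2, l3, l4⟩ := h.lamL_one_bounds
  have hε := h.ε_pos
  have h6 := h.ε_le'
  have s1 := lamL_add_fastR 1 L.ε
  have s2 := lamL_mul_fastR (k := 1) (ε := L.ε) (by linarith)
  have h1 : L.ε ^ 2 ≤ lamL 1 L.ε - L.ε := by nlinarith
  have h2 : L.ε ^ 6 ≤ L.ε ^ 2 / 2 := by
    have : L.ε ^ 4 ≤ 1 / 2 := by
      have : L.ε ^ 4 ≤ L.ε := pow_le_of_le_one hε.le (by linarith) (by norm_num)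
      linarith
    calc L.ε ^ 6 = L.ε ^ 2 * L.ε ^ 4 := by ring
      _ ≤ L.ε ^ 2 * (1 / 2) := by gcongr
      _ = _ := by ring
  have i1 := mul_le_mul_of_nonneg_right h1 hc.le
  have i2 := mul_le_mul_of_nonneg_right h2 hc.le
  have i3 := mul_le_mul_of_nonneg_right l2 hc.le
  have i4 := mul_pos hε hc
  have i5 : 0 < L.ε ^ 2 * (√L.ε - a) := by positivity
  refine ⟨by linarith, by linarith, by linarith⟩

/-- The derivative of the return map with respect to `a` cannot vanish. -/
theorem nextA_ne_zero {A : ℝ} (hA : L.q k a * A * L.ε ≤ 10 ^ 4 * M ^ 8) :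
    nextA L.ε a 1 √L.ε √L.ε (L.v k a) (-L.w k a) (L.T₂ k a)
      (nextA L.ε a (L.s * √L.ε) (-√L.ε) √L.ε (L.q k a) (L.v k a) (L.T₁ k a) A) ≠ 0 := by
  have ha' := h.lt_of_le ha
  have hv := (h.leg_v hk ha').exit_pos
  have hw := (h.turn_w hk ha').w_pos
  have hq := h.q_pos hk ha'
  have hε := h.ε_pos
  have hε' := h.ε_le'
  have hM := h.one_le
  obtain ⟨-, v2, -⟩ := h.v_bounds hk ha'
  have q2 := h.q_le hk ha'
  obtain ⟨e1, -⟩ := h.exp_T₁_le hk ha'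
  have e2 := (h.exp_T₂_le hk ha').2
  obtain ⟨c1, c2⟩ := h.c_bounds ha
  obtain ⟨d1, d2⟩ := h.d_bounds ha
  have hσ := h.sqrt_pos
  have hσ' := h.sqrt_le
  have hM8 : M ≤ M ^ 8 := le_self_pow₀ hM (by norm_num)
  have h8 : 1 ≤ M ^ 8 := one_le_pow₀ hM
  have hv' : nextA L.ε a (L.s * √L.ε) (-√L.ε) √L.ε (L.q k a) (L.v k a) (L.T₁ k a) A * L.v k a =
      exp (-(L.s * √L.ε * L.T₁ k a)) * (L.q k a * A - (L.s * √L.ε * L.q k a +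
        L.ε * (-√L.ε - a))) + (L.s * √L.ε * L.v k a + L.ε * (√L.ε - a)) :=
    div_mul_cancel₀ _ hv.ne'
  set A' := nextA L.ε a (L.s * √L.ε) (-√L.ε) √L.ε (L.q k a) (L.v k a) (L.T₁ k a) A
  have m1 := h.abs_m_mul (L.q k a)
  have m2 := h.abs_m_mul (L.v k a)
  rw [abs_of_pos hq] at m1
  rw [abs_of_pos hv] at m2
  have m1' := abs_le.1 m1.le
  have m2' := abs_le.1 m2.le
  have m3 : √L.ε * L.q k a ≤ 1 / 10 ^ 6 * (6 * M) := by gcongr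
  have m4 : √L.ε * L.v k a ≤ 1 / 10 ^ 6 * (7 * M) := by gcongr
  have m5 : L.ε * (√L.ε + a) ≤ 1 * 1 := by gcongr <;> linarith
  have m6 : L.ε * (√L.ε - a) ≤ 1 * 1 := by gcongr <;> linarith
  have b1 : (L.q k a * A - (L.s * √L.ε * L.q k a + L.ε * (-√L.ε - a))) * L.ε ≤
      2 * 10 ^ 4 * M ^ 8 := by
    have : (-(L.s * √L.ε * L.q k a) + L.ε * (√L.ε + a)) * L.ε ≤ (2 * M) * 1 := by
      have i1 : -(L.s * √L.ε * L.q k a) + L.ε * (√L.ε + a) ≤ 2 * M := by linarith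
      calc _ ≤ 2 * M * L.ε := by gcongr
        _ ≤ _ := by gcongr; linarith
    linarith
  have b2 : exp (-(L.s * √L.ε * L.T₁ k a)) * ((L.q k a * A - (L.s * √L.ε * L.q k a +
      L.ε * (-√L.ε - a))) * L.ε) ≤ 2 * (2 * 10 ^ 4 * M ^ 8) := by
    calc _ ≤ exp (-(L.s * √L.ε * L.T₁ k a)) * (2 * 10 ^ 4 * M ^ 8) := by gcongr
      _ ≤ _ := by gcongr
  have b3 : A' * L.v k a * L.ε ≤ 5 * 10 ^ 4 * M ^ 8 := by
    have : (L.s * √L.ε * L.v k a + L.ε * (√L.ε - a)) * L.ε ≤ (2 * M) * 1 := by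
      have i1 : L.s * √L.ε * L.v k a + L.ε * (√L.ε - a) ≤ 2 * M := by linarith
      calc _ ≤ 2 * M * L.ε := by gcongr
        _ ≤ _ := by gcongr; linarith
    rw [hv', add_mul, mul_assoc]
    linarith
  unfold nextA
  -- The numerator is shown to be negative: the term `ε c - w` is at most `-ε² c / 2`, and
  -- everything inherited from earlier passages carries `exp (-T₂)`. For this only an upper bound on
  -- the inherited derivative is needed.
  refine div_ne_zero (ne_of_lt ?_) (neg_ne_zero.2 hw.ne')
  rw [one_mul]
  have w3 := (h.w_ge hk ha).2.2
  have hc := Valid.c_pos ha'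
  have b4 : exp (-L.T₂ k a) * ((L.v k a * A' - (1 * L.v k a + L.ε * (√L.ε - a))) * L.ε) ≤
      L.ε ^ 8 * (5 * 10 ^ 4 * M ^ 8) := by
    have : (L.v k a * A' - (1 * L.v k a + L.ε * (√L.ε - a))) * L.ε ≤ 5 * 10 ^ 4 * M ^ 8 := by
      have : 0 ≤ (1 * L.v k a + L.ε * (√L.ε - a)) * L.ε := by positivity
      linarith
    calc _ ≤ exp (-L.T₂ k a) * (5 * 10 ^ 4 * M ^ 8) := by gcongr
      _ ≤ _ := by gcongr
  have b5 : L.ε ^ 8 * (5 * 10 ^ 4 * M ^ 8) ≤ 1 / 10 ^ 6 * L.ε ^ 4 := by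
    have h9 := h.pow_mul_ε_le (n := 8) (by norm_num)
    calc _ = 5 * 10 ^ 4 * L.ε ^ 4 * L.ε ^ 3 * (M ^ 8 * L.ε) := by ring
      _ ≤ 5 * 10 ^ 4 * L.ε ^ 4 * 1 * (1 / 10 ^ 12) := by
        gcongr
        · exact pow_le_one₀ hε.le (by linarith)
        · linarith
      _ ≤ _ := by nlinarith [pow_pos hε 4]
  have b6 : L.ε ^ 4 / 20 ≤ L.ε ^ 2 * (√L.ε - a) / 2 * L.ε := by
    have : L.ε ≤ 10 * (√L.ε - a) := by linarith [h.ε_le]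
    have := mul_le_mul_of_nonneg_left this (pow_pos hε 3).le
    linarith
  have b7 := mul_le_mul_of_nonneg_right w3 hε.le
  have b8 := pow_pos hε 4
  refine neg_of_mul_neg_left (b := L.ε) ?_ hε.le
  rw [add_mul, mul_assoc]
  linarith

/-- The main term of the right zone in the second derivative of the return map. -/
noncomputable def _root_.PWLCanard.LeftData.rightB (L : LeftData) (k a : ℝ) : ℝ :=
  nodeS (-lamL 1 L.ε) (-fastR 1 L.ε) (L.T₂ k a) / L.v k a * exp (-(L.s * √L.ε * L.T₁ k a))

/-- For large `T₂` the function `nodeS` is close to `exp (-lamL T₂)`, which the slow integral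
identifies as approximately `c / q`. A further division by `v ≈ q` gives `c / q²`. -/
theorem rightB_log : 0 < L.rightB k a ∧
    |log (L.rightB k a) - (log (√L.ε - a) - 2 * log (L.q k a))| ≤ 30 * M ^ 2 * √L.ε := by
  have ha' := h.lt_of_le ha
  obtain ⟨l1, l2, l3, l4⟩ := h.lamL_one_bounds
  have hv := (h.leg_v hk ha').exit_pos
  have hε := h.ε_pos
  have hM := h.one_le
  have hσ := h.sqrt_pos
  have hc := Valid.c_pos ha'
  obtain ⟨v1, v2⟩ := h.log_v hk ha
  obtain ⟨r1, r2⟩ := h.log_right hk ha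
  have t1 := h.abs_mT₁_le hk ha
  have f1 := h.log_fastR_one
  have ws := h.w_slow hk ha'
  have hsub : 0 < fastR 1 L.ε - lamL 1 L.ε := by
    have := lamL_lt_fastR (k := 1) (ε := L.ε) (by linarith [h.ε_lt])
    linarith
  have hvc : 0 < L.v k a + fastR 1 L.ε * (√L.ε - a) := by positivity
  set E := exp (-(lamL 1 L.ε * L.T₂ k a)) with hE
  set F := exp (-(fastR 1 L.ε * L.T₂ k a)) with hF
  have hE0 : 0 < E := exp_pos _
  have hF0 : 0 < F := exp_pos _
  have hF1 := (h.exp_T₂_le hk ha').1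
  have logE : log E = log (fastR 1 L.ε * (√L.ε - a) - L.w k a) -
      log (L.v k a + fastR 1 L.ε * (√L.ε - a)) := by
    rw [ws, Real.log_mul hvc.ne' hE0.ne']; ring
  have hEF : |E - F - E| ≤ 4 * L.ε ^ 6 * E := by
    rw [sub_sub_cancel_left, abs_neg, abs_of_pos hF0]
    have i1 : L.v k a + fastR 1 L.ε * (√L.ε - a) ≤ 8 * M := by
      have : fastR 1 L.ε * (√L.ε - a) ≤ 1 * 1 := by
        gcongr
        linarith [(h.c_bounds ha).2, h.sqrt_le]
      linarith [(h.v_bounds hk ha').2.1]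
    have i2 : (√L.ε - a) / 4 ≤ fastR 1 L.ε * (√L.ε - a) - L.w k a := by
      have := (h.w_ge hk ha).2.1
      have := mul_le_mul_of_nonneg_right l3.le hc.le
      have := mul_le_mul_of_nonneg_right h.ε_le' hc.le
      linarith
    have i3 : (√L.ε - a) / 4 ≤ 8 * M * E := by
      rw [ws] at i2
      exact i2.trans (by gcongr)
    have i4 := (h.pow_le_c ha).1
    have i5 : L.ε ^ 6 * (√L.ε - a) ≤ L.ε ^ 6 * (32 * M * E) := by gcongr; linarith
    have hM0 := h.M_pos
    have i7 : L.ε ^ 8 ≤ 4 * L.ε ^ 6 * E := by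
      have : 10 * M * L.ε ^ 8 ≤ 10 * M * (4 * L.ε ^ 6 * E) := by
        have : 0 ≤ M * (L.ε ^ 6 * E) := by positivity
        linarith
      exact le_of_mul_le_mul_left this (by positivity)
    exact hF1.trans i7
  have hε6 : L.ε ^ 6 ≤ 1 / 10 ^ 6 * √L.ε := by
    have : L.ε ^ 6 ≤ L.ε := pow_le_of_le_one hε.le (by linarith [h.ε_le']) (by norm_num)
    linarith [h.ε_le]
  obtain ⟨g1, g2⟩ := abs_log_sub_le hE0 (by linarith [h.sqrt_le]) hEF
  have e : L.rightB k a = (E - F) / (fastR 1 L.ε - lamL 1 L.ε) / L.v k a *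
      exp (-(L.s * √L.ε * L.T₁ k a)) := by
    unfold rightB nodeS
    rw [hE, hF, neg_mul, neg_mul, ← neg_sub (exp _), ← neg_sub (-lamL 1 L.ε), neg_div_neg_eq]
    ring
  rw [e]
  refine ⟨by positivity, ?_⟩
  rw [Real.log_mul (by positivity) (exp_pos _).ne', Real.log_div (by positivity) hv.ne',
    Real.log_div g1.ne' hsub.ne', Real.log_exp]
  have hM2 : √L.ε ≤ M ^ 2 * √L.ε := le_mul_of_one_le_left hσ.le (one_le_pow₀ hM)
  rw [abs_le] at *
  constructor <;> linarith

theorem rightB_ge : √L.ε - a ≤ 108 * M ^ 2 * L.rightB k a := by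
  have ha' := h.lt_of_le ha
  obtain ⟨h1, h2⟩ := h.rightB_log hk ha
  have hq := h.q_pos hk ha'
  have hq2 := h.q_le hk ha'
  have hM := h.one_le
  have hc := Valid.c_pos ha'
  have h3 := h.pow_mul_le (n := 2) (by norm_num)
  have h4 : log (√L.ε - a) - 2 * log (L.q k a) - 1 ≤ log (L.rightB k a) := by
    have := (abs_le.1 h2).1
    linarith
  have h5 := Real.exp_le_exp.2 h4
  rw [Real.exp_log h1, Real.exp_sub, Real.exp_sub, Real.exp_log hc,
    show 2 * log (L.q k a) = log (L.q k a) + log (L.q k a) by ring, Real.exp_add,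
    Real.exp_log hq, div_div, div_le_iff₀ (by positivity)] at h5
  have h6 : L.q k a * L.q k a * exp 1 ≤ 6 * M * (6 * M) * 3 := by
    gcongr
    linarith [Real.exp_one_lt_d9]
  calc _ ≤ _ := h5
    _ ≤ L.rightB k a * (6 * M * (6 * M) * 3) := by gcongr
    _ = _ := by ring

theorem topB_le : |L.s * √L.ε * (focS (L.s * √L.ε) (omg * √L.ε) (L.T₁ k a) / L.v k a) *
    (L.w k a / L.q k a)| ≤ √L.ε * L.rightB k a := by
  have ha' := h.lt_of_le ha
  have hT := (h.leg_v hk ha').pos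
  have hv := (h.leg_v hk ha').exit_pos
  have hw := (h.turn_w hk ha').w_pos
  have hq := h.q_pos hk ha'
  have hq' := h.q_ge hk ha'
  have hM := h.one_le
  have hσ := h.sqrt_pos
  have hε := h.ε_pos
  have hc := Valid.c_pos ha'
  obtain ⟨v1, v2, -⟩ := h.v_bounds hk ha'
  have hS := (abs_focS_le (κ := L.s * √L.ε) (ν := omg * √L.ε) (by have := omg_pos; positivity)
    hT.le).2
  have hm := h.abs_mT₁_le hk ha
  have hE : exp (|L.s * √L.ε * L.T₁ k a| / 2) ≤ 3 := by
    refine le_trans (exp_le_exp.2 (show _ ≤ 1 by linarith [h.sqrt_le])) ?_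
    linarith [Real.exp_one_lt_d9]
  have hT' := (h.exp_T₁_le hk ha').2
  have hw' := (h.w_ge hk ha).2.1
  have hr := h.rightB_ge hk ha
  rw [abs_mul, abs_of_pos (div_pos hw hq), h.abs_m_mul, abs_div, abs_of_pos hv]
  set X := |focS (L.s * √L.ε) (omg * √L.ε) (L.T₁ k a)|
  have i1 : √L.ε * X ≤ 96 * M ^ 2 * L.ε := by
    calc _ ≤ √L.ε * (3 * L.T₁ k a) := by gcongr; exact hS.trans (by gcongr)
      _ = 3 * (√L.ε * L.T₁ k a) := by ring
      _ ≤ 3 * (32 * M ^ 2 * L.ε) := by gcongr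
      _ = _ := by ring
  have i2 : 1 / L.v k a ≤ 8 * M ^ 2 := by rw [div_le_iff₀ hv]; linarith
  have i3 : 1 / L.q k a ≤ 4 * M ^ 2 := by rw [div_le_iff₀ hq]; linarith
  have hR := (h.rightB_log hk ha).1
  have hp := h.pow_mul_ε_le (n := 8) (by norm_num)
  calc √L.ε * (X / L.v k a) * (L.w k a / L.q k a)
      = √L.ε * X * (1 / L.v k a) * (L.w k a * (1 / L.q k a)) := by ring
    _ ≤ 96 * M ^ 2 * L.ε * (8 * M ^ 2) * (2 * L.ε * (√L.ε - a) * (4 * M ^ 2)) := by gcongr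
    _ = 6144 * M ^ 6 * L.ε * L.ε * (√L.ε - a) := by ring
    _ ≤ 6144 * M ^ 6 * L.ε * L.ε * (108 * M ^ 2 * L.rightB k a) := by gcongr
    _ = 663552 * (M ^ 8 * L.ε) * (L.ε * L.rightB k a) := by ring
    _ ≤ 663552 * (1 / 10 ^ 12) * (√L.ε * L.rightB k a) := by
      gcongr
      · linarith
      · linarith [h.ε_le]
    _ ≤ _ := by
      have := mul_pos hσ hR
      linarith

/-- The right zone contributes `-rightB`, and the upper central passage a term `θ` that is smaller
by a factor `√ε`. Both carry the contraction `exp (-j)` accumulated before. -/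
theorem nextB_right {B j : ℝ} : ∃ θ, |θ| ≤ √L.ε * L.rightB k a ∧
    nextB (nodeS (-lamL 1 L.ε) (-fastR 1 L.ε)) 1 (-L.w k a) (L.v k a) (-L.w k a) (L.T₂ k a)
      (j + L.s * √L.ε * L.T₁ k a)
      (nextB (focS (L.s * √L.ε) (omg * √L.ε)) (L.s * √L.ε) (-L.w k a) (L.q k a) (L.v k a)
        (L.T₁ k a) j B) = B + exp (-j) * (θ - L.rightB k a) := by
  have ha' := h.lt_of_le ha
  have hv := (h.leg_v hk ha').exit_pos.ne'
  have hw := (h.turn_w hk ha').w_pos.ne'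
  refine ⟨_, h.topB_le hk ha, ?_⟩
  unfold nextB rightB
  rw [neg_add j, Real.exp_add]
  field_simp
  ring

omit hk in
theorem abs_centerB_le :
    |L.s * √L.ε * focS (L.s * √L.ε) (omg * √L.ε) (L.T₃ k a)| ≤ 4000 := by
  have hσ := h.sqrt_pos
  have hω := omg_pos
  obtain ⟨t1, t2⟩ := h.abs_mT₃_le ha (k := k)
  have hS := (abs_focS_le (κ := L.s * √L.ε) (ν := omg * √L.ε) (by positivity) t2.le).1
  have hE : exp (|L.s * √L.ε * L.T₃ k a| / 2) ≤ 3000 :=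
    (exp_le_exp.2 (by linarith)).trans exp_eight_le
  have hω2 : (0.86 : ℝ) ≤ omg := by nlinarith [omg_sq]
  rw [h.abs_m_mul]
  calc _ ≤ √L.ε * (3000 / (0.86 * √L.ε)) := by gcongr; exact hS.trans (by gcongr)
    _ = 3000 / 0.86 := by field_simp
    _ ≤ _ := by norm_num

/-- Here `k * lamL - ε = lamL²`, and this surplus dominates the error of size `ε ^ 6` in `p`. The
inequality fixes the sign of a term in the derivative with respect to `a`. -/
theorem kp_ge : L.ε * (√L.ε + a) ≤ k * L.p k a := by
  have ha' := h.lt_of_le ha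
  have h1 := (abs_le.1 (h.p_near hk ha)).1
  obtain ⟨l1, l2, l3, l4, l5⟩ := h.lamL_bounds hk
  have hd := Valid.d_pos ha'
  have hε := h.ε_pos
  have s1 := lamL_add_fastR k L.ε
  have s2 := lamL_mul_fastR (h.lt_k k hk)
  have hM := h.one_le
  have hkM := h.k_le k hk
  have i1 : L.ε ≤ lamL k L.ε * M := by
    have : lamL k L.ε * fastR k L.ε ≤ lamL k L.ε * M := by gcongr; linarith
    linarith
  have i2 : k * L.ε ^ 6 ≤ lamL k L.ε ^ 2 := by
    have j1 : L.ε ^ 2 ≤ (lamL k L.ε * M) ^ 2 := by gcongr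
    have j2 := h.pow_mul_ε_le (n := 3) (by norm_num)
    have j3 : M ^ 2 * (k * L.ε ^ 6) ≤ M ^ 2 * lamL k L.ε ^ 2 := by
      calc _ ≤ M ^ 2 * (M * L.ε ^ 6) := by gcongr
        _ = (M ^ 3 * L.ε) * L.ε ^ 3 * L.ε ^ 2 := by ring
        _ ≤ 1 * 1 * (lamL k L.ε * M) ^ 2 := by
          gcongr
          · linarith
          · exact pow_le_one₀ hε.le (by linarith [h.ε_le'])
        _ = _ := by ring
    exact le_of_mul_le_mul_left j3 (by have := h.M_pos; positivity)
  have i3 := mul_le_mul_of_nonneg_right i2 hd.le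
  have i4 := mul_le_mul_of_nonneg_left h1 l5.le
  have i5 : k * (lamL k L.ε * (√L.ε + a)) = L.ε * (√L.ε + a) + lamL k L.ε ^ 2 * (√L.ε + a) := by
    linear_combination (-lamL k L.ε * (√L.ε + a)) * s1 + (√L.ε + a) * s2
  linarith

/-- The variation with `a` after the first central passage. -/
theorem nextA_center_neg : L.p k a * nextA L.ε a (L.s * √L.ε) √L.ε (-√L.ε) (-L.w k a) (-L.p k a)
    (L.T₃ k a) 0 ≥ 0 := by
  have ha' := h.lt_of_le ha
  have hp := (h.leg_p hk ha').exit_pos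
  have hw := (h.turn_w hk ha').w_pos
  have hε := h.ε_pos
  have hc := Valid.c_pos ha'
  have hd := Valid.d_pos ha'
  have m1 := h.abs_m_mul (L.w k a)
  have m2 := h.abs_m_mul (L.p k a)
  rw [abs_of_pos hw] at m1
  rw [abs_of_pos hp] at m2
  have hw' := (h.w_ge hk ha).2.1
  have hp' := h.p_le hk ha'
  obtain ⟨l1, l2, -⟩ := h.lamL_bounds hk
  have hσ := h.sqrt_pos
  have hσ' := h.sqrt_le
  have hM := h.M_pos
  have i1 : √L.ε * L.w k a ≤ 1 / 10 ^ 6 * (2 * L.ε * (√L.ε - a)) := by gcongr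
  have i2 : √L.ε * L.p k a ≤ L.ε * (√L.ε + a) := by
    have j1 : L.ε ^ 7 ≤ L.ε := pow_le_of_le_one hε.le (by linarith [h.ε_le']) (by norm_num)
    have j2 : L.p k a ≤ 3 * M * L.ε * (√L.ε + a) := by
      refine hp'.trans ?_
      calc _ ≤ 2 * M * L.ε * (√L.ε + a) + M * L.ε * (√L.ε + a) := by gcongr
        _ = _ := by ring
    have j3 := h.mul_sqrt_le
    calc _ ≤ √L.ε * (3 * M * L.ε * (√L.ε + a)) := by gcongr
      _ = 3 * (M * √L.ε) * (L.ε * (√L.ε + a)) := by ring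
      _ ≤ 1 * (L.ε * (√L.ε + a)) := by gcongr; linarith
      _ = _ := one_mul _
  have e := exp_pos (-(L.s * √L.ε * L.T₃ k a))
  have i3 : L.s * √L.ε * L.w k a - L.ε * (√L.ε - a) ≤ 0 := by
    have := mul_pos hε hc
    linarith [le_abs_self (L.s * √L.ε * L.w k a)]
  have i4 := mul_nonpos_of_nonneg_of_nonpos e.le i3
  unfold nextA
  have : L.p k a * ((exp (-(L.s * √L.ε * L.T₃ k a)) * (-L.w k a * 0 -
      (L.s * √L.ε * -L.w k a + L.ε * (√L.ε - a))) + (L.s * √L.ε * -L.p k a +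
        L.ε * (-√L.ε - a))) / -L.p k a) = -(exp (-(L.s * √L.ε * L.T₃ k a)) *
      (L.s * √L.ε * L.w k a - L.ε * (√L.ε - a)) - (L.s * √L.ε * L.p k a +
        L.ε * (√L.ε + a))) := by
    field_simp; ring
  rw [this]
  linarith [neg_abs_le (L.s * √L.ε * L.p k a)]

/-- A left part of the orbit whose data are under control gives a saddle-node. -/
theorem stage_of_left {A B j : ℝ} (hJ : j + L.s * √L.ε * L.T₁ k a + L.T₂ k a = 0)
    (hs : Stage k (L.s * √L.ε) L.ε a (-L.w k a) (-√L.ε) (L.q k a) j A B)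
    (hA : L.q k a * A * L.ε ≤ 10 ^ 4 * M ^ 8)
    (hB : ∀ θ, |θ| ≤ √L.ε * L.rightB k a → B + exp (-j) * (θ - L.rightB k a) ≠ 0) :
    ∃ A B, A ≠ 0 ∧ B ≠ 0 ∧
      Stage k (L.s * √L.ε) L.ε a (-L.w k a) √L.ε (-L.w k a) 0 A B := by
  have ha' := h.lt_of_le ha
  have hε1 : L.ε ≤ 1 := by linarith [h.ε_lt, h.ε_pos]
  have hσ := h.sqrt_pos
  have s1 := hs.step hε1 (h.pass_v hk ha) (Or.inl (by linarith))
  have s2 := s1.step hε1 ((h.turn_w hk ha').passage rfl (h.leg_v hk ha').exit_pos)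
    (Or.inr (h.leg_v hk ha').exit_pos)
  rw [one_mul, hJ] at s2
  refine ⟨_, _, h.nextA_ne_zero hk ha hA, ?_, s2⟩
  obtain ⟨θ, h1, h2⟩ := h.nextB_right hk ha (B := B) (j := j)
  rw [h2]
  exact hB θ h1

end LeftData.Tame

end PWLCanard

/-! ### Nondegeneracy of the closed orbit without head and with head. -/

namespace PWLCanard

theorem nodeS_pos {α β t : ℝ} (h : α ≠ β) (ht : 0 < t) : 0 < nodeS α β t := by
  rcases lt_or_gt_of_ne h with h | h
  · exact nodeS_pos_of_pos h ht
  · rw [nodeS_symm]; exact nodeS_pos_of_pos h ht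

/-- A gap `η ≤ 1` between logarithms gives a relative gap of at least `η / 2`, from `exp η - 1 ≥ η`
above and `1 - exp (-η) ≥ η / 2` below. -/
theorem mul_half_le_abs_sub {X R η : ℝ} (hX : 0 < X) (hR : 0 < R) (hη : 0 ≤ η) (hη1 : η ≤ 1)
    (h : η ≤ |log X - log R|) : R * (η / 2) ≤ |X - R| := by
  have e : exp (log X - log R) * R = X := by
    rw [Real.exp_sub, Real.exp_log hX, Real.exp_log hR]; field_simp
  rcases le_abs.1 h with h1 | h1
  · have h2 := Real.add_one_le_exp (log X - log R)
    have h3 : (η + 1) * R ≤ X := by rw [← e]; gcongr; linarith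
    exact le_trans (by nlinarith) (le_abs_self _)
  · have h2 := Real.exp_bound_div_one_sub_of_interval (x := η / 2) (by linarith) (by linarith)
    have h3 : exp (log X - log R) ≤ 1 - η / 2 := by
      have h4 : exp (log X - log R) ≤ exp (-η) := exp_le_exp.2 (by linarith)
      have h5 : exp (-η) ≤ 1 / (1 + η) := by
        rw [Real.exp_neg, one_div]
        gcongr
        linarith [Real.add_one_le_exp η]
      refine h4.trans (h5.trans ?_)
      rw [div_le_iff₀ (by linarith)]
      nlinarith
    have h6 : X ≤ (1 - η / 2) * R := by rw [← e]; gcongr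
    rw [abs_sub_comm]
    exact le_trans (by linarith) (le_abs_self _)

namespace LeftData.Tame

variable {L : LeftData} {M : ℝ} {K : Set ℝ} {k a : ℝ} (h : L.Tame M K) (hk : k ∈ K)
  (ha : |a| ≤ 9 / 10 * √L.ε)
include h hk ha

/-- Without head: the contribution of the left zone compared with that of the right zone. -/
theorem log_leftB (hq0 : L.q₀ a = 0) (hp0 : L.p₀ a = 0) {X : ℝ}
    (hX : X = k * (nodeS (lamL k L.ε) (fastR k L.ε) (L.t₂ k a + L.t₁ k a) / L.q k a) *
      (L.w k a / L.p k a) * exp (-(k * (L.t₂ k a + L.t₁ k a)))) :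
    0 < X ∧ |log X - (2 * log k + log (√L.ε - a) - 2 * log (L.q k a))| ≤ 30 * M ^ 3 * √L.ε := by
  have ha' := h.lt_of_le ha
  obtain ⟨l1, l2, l3, l4, l5⟩ := h.lamL_bounds hk
  obtain ⟨f1, f2, hsub⟩ := h.log_fastR_sub hk
  have hw := (h.turn_w hk ha').w_pos
  have hp := (h.leg_p hk ha').exit_pos
  have hq := h.q_pos hk ha'
  have hε := h.ε_pos
  have hM := h.one_le
  have hσ := h.sqrt_pos
  have hc := Valid.c_pos ha'
  have hd := Valid.d_pos ha'
  obtain ⟨g1, g2⟩ := h.log_left hk ha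
  have g3 := h.log_q hk ha
  have g4 := h.log_w hk ha
  have g5 := h.log_p hk ha
  have q1 := h.q_slow hk ha'
  have p1 := h.p_slow hk ha'
  rw [hq0, zero_add] at q1
  rw [hp0, sub_zero] at p1
  obtain ⟨-, -, h5⟩ := h.h_bounds ha'
  have t1 := (h.leg_q hk ha').pos
  have t2 := (h.leg_p hk ha').pos
  have hμ : 0 < fastR k L.ε := by linarith
  set t := L.t₂ k a + L.t₁ k a with ht
  have ht0 : 0 < t := by positivity
  set E := exp (-(lamL k L.ε * t)) with hE
  set F := exp (-(fastR k L.ε * t)) with hF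
  have hE0 : 0 < E := exp_pos _
  have hF0 : 0 < F := exp_pos _
  have hqd : 0 < L.q k a + fastR k L.ε * (√L.ε + a) := by positivity
  have logE : log E = log (fastR k L.ε * (√L.ε + a) - L.p k a) -
      log (L.q k a + fastR k L.ε * (√L.ε + a)) := by
    rw [p1, q1, Real.log_mul (by positivity) (exp_pos _).ne',
      Real.log_mul (by positivity) (exp_pos _).ne', hE, Real.log_exp, Real.log_exp, Real.log_exp]
    rw [ht]; ring
  have hEF : |E - F - E| ≤ L.ε ^ 8 * E := by
    rw [sub_sub_cancel_left, abs_neg, abs_of_pos hF0]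
    have : F = exp (-((fastR k L.ε - lamL k L.ε) * t)) * E := by
      rw [hE, hF, ← Real.exp_add]; congr 1; ring
    rw [this]
    gcongr
    refine le_trans (exp_le_exp.2 ?_) (h.exp_t₂_le hk ha').1
    rw [neg_le_neg_iff]
    gcongr
    linarith
  have hε8 : L.ε ^ 8 ≤ 1 / 10 ^ 6 * √L.ε := by
    have : L.ε ^ 8 ≤ L.ε := pow_le_of_le_one hε.le (by linarith [h.ε_le']) (by norm_num)
    linarith [h.ε_le]
  obtain ⟨e1, e2⟩ := abs_log_sub_le hE0 (by linarith [h.sqrt_le]) hEF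
  have hX' : X = k * ((E - F) / (fastR k L.ε - lamL k L.ε) / L.q k a) * (L.w k a / L.p k a) := by
    rw [hX, hE, hF]
    unfold nodeS
    have i1 : exp (-(lamL k L.ε * t)) = exp (fastR k L.ε * t) * exp (-(k * t)) := by
      rw [← Real.exp_add]; congr 1
      linear_combination (-t) * (lamL_add_fastR k L.ε)
    have i2 : exp (-(fastR k L.ε * t)) = exp (lamL k L.ε * t) * exp (-(k * t)) := by
      rw [← Real.exp_add]; congr 1
      linear_combination (-t) * (lamL_add_fastR k L.ε)
    rw [i1, i2]; ring
  rw [hX']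
  refine ⟨by positivity, ?_⟩
  rw [Real.log_mul (by positivity) (by positivity), Real.log_mul l5.ne' (by positivity),
    Real.log_div (by positivity) hq.ne', Real.log_div e1.ne' hsub.ne', Real.log_div hw.ne' hp.ne']
  have hM2 : √L.ε ≤ M ^ 3 * √L.ε := le_mul_of_one_le_left hσ.le (one_le_pow₀ hM)
  rw [abs_le] at *
  constructor <;> linarith

/-- Without head, the passage of the left zone hides what happens before. -/
theorem abs_center_headless_le : |L.s * √L.ε * (focS (L.s * √L.ε) (omg * √L.ε) (L.T₃ k a)) /
    L.p k a * exp (L.s * √L.ε * L.T₃ k a - k * (L.t₂ k a + L.t₁ k a))| ≤ √L.ε * L.rightB k a := by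
  have ha' := h.lt_of_le ha
  have hp := (h.leg_p hk ha').exit_pos
  have hk0 := h.k_pos k hk
  have hM := h.M_pos
  have hM1 := h.one_le
  have hσ := h.sqrt_pos
  have hε := h.ε_pos
  have t1 := (h.leg_q hk ha').pos
  have hR := h.rightB_ge hk ha
  have hR0 := (h.rightB_log hk ha).1
  have hpk := h.kp_ge hk ha
  have hkM := h.k_le k hk
  obtain ⟨c1, c2⟩ := h.c_bounds ha
  obtain ⟨d1, d2⟩ := h.d_bounds ha
  have e1 : exp (L.s * √L.ε * L.T₃ k a - k * (L.t₂ k a + L.t₁ k a)) ≤ 3000 * L.ε ^ 8 := by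
    have i1 : exp (L.s * √L.ε * L.T₃ k a) ≤ 3000 :=
      (exp_le_exp.2 ((le_abs_self _).trans (h.abs_mT₃_le ha).1)).trans exp_eight_le
    have i2 := (h.exp_t₂_le hk ha').2.2
    calc _ ≤ exp (L.s * √L.ε * L.T₃ k a + -(k * L.t₂ k a)) := by
          rw [exp_le_exp]
          have := mul_pos hk0 t1
          linarith
      _ = exp (L.s * √L.ε * L.T₃ k a) * exp (-(k * L.t₂ k a)) := Real.exp_add _ _
      _ ≤ _ := by gcongr
  rw [abs_mul, abs_div, abs_of_pos hp, abs_of_pos (exp_pos _), div_mul_eq_mul_div, div_le_iff₀ hp]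
  have i1 : √L.ε ≤ 1080 * M ^ 2 * L.rightB k a := by linarith
  have i2 : L.ε * √L.ε ≤ 10 * M * L.p k a := by
    have : k * L.p k a ≤ M * L.p k a := by gcongr
    have := mul_le_mul_of_nonneg_left d1 hε.le
    linarith
  have i3 : √L.ε * (√L.ε * (L.ε * √L.ε)) ≤ 10800 * M ^ 3 * (√L.ε * L.rightB k a * L.p k a) := by
    calc _ ≤ √L.ε * (1080 * M ^ 2 * L.rightB k a * (10 * M * L.p k a)) := by gcongr
      _ = _ := by ring
  have i4 : 10800 * M ^ 3 * (4000 * (3000 * L.ε ^ 8)) ≤ √L.ε * (√L.ε * (L.ε * √L.ε)) := by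
    have j1 := h.pow_mul_ε_le (n := 3) (by norm_num)
    have j2 : L.ε ^ 4 ≤ 1 / 10 ^ 12 := by
      refine (pow_le_of_le_one hε.le (by linarith [h.ε_le']) (by norm_num)).trans h.ε_le'
    have j3 := h.ε_le
    have j4 := h.sq_sqrt
    calc _ = 12 * 10800 * 10 ^ 6 * (M ^ 3 * L.ε) * L.ε ^ 4 * (L.ε * L.ε * L.ε) := by ring
      _ ≤ 12 * 10800 * 10 ^ 6 * (1 / 10 ^ 12) * (1 / 10 ^ 12) *
          (L.ε * L.ε * (1 / 10 ^ 6 * √L.ε)) := by gcongr; linarith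
      _ ≤ L.ε * L.ε * √L.ε := by
        have : 0 < L.ε * L.ε * √L.ε := by positivity
        linarith
      _ = _ := by linear_combination (-L.ε * √L.ε) * j4
  have i5 : 10800 * M ^ 3 * (4000 * (3000 * L.ε ^ 8)) ≤
      10800 * M ^ 3 * (√L.ε * L.rightB k a * L.p k a) := i4.trans i3
  have i6 := le_of_mul_le_mul_left i5 (by positivity)
  refine le_trans ?_ i6
  gcongr
  exact h.abs_centerB_le ha

/-- Up to a positive factor, `B` is `X - R` plus terms of relative size `√ε`, where `X` comes from
the turn in the middle zone and `R` from the right zone. Both are of size `c / q²`, with `log X -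
log R ≈ 2 log k`. The hypothesis `hkk` makes `2 log k` larger than every error, so the two cannot
cancel. -/
theorem saddleNode_of_headless (hℓ : -1 < L.ℓ) (hq0 : L.q₀ a = 0)
    (hp0 : L.p₀ a = 0) (hJ0 : L.J₀ a = 0) (hD : L.D k a = 0) (hJ : L.J k a = 0)
    (hkk : 10 ^ 3 * M ^ 3 * √L.ε ≤ |2 * log k|) : ∃ A B, A ≠ 0 ∧ B ≠ 0 ∧
      Stage k (L.s * √L.ε) L.ε a (-L.w k a) √L.ε (-L.w k a) 0 A B := by
  have ha' := h.lt_of_le ha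
  obtain ⟨l1, l2, l3, l4, l5⟩ := h.lamL_bounds hk
  have hε1 : L.ε ≤ 1 := by linarith [h.ε_lt, h.ε_pos]
  have hε := h.ε_pos
  have hM := h.one_le
  have hσ := h.sqrt_pos
  have hc := Valid.c_pos ha'
  have hd := Valid.d_pos ha'
  have hw := (h.turn_w hk ha').w_pos
  have hp := (h.leg_p hk ha').exit_pos
  have hq := h.q_pos hk ha'
  have s1 := (h.pass_center hk ha hD).stage hε1
  have hq' := h.leg_q hk ha'
  have hp' := h.leg_p hk ha'
  rw [hq0, neg_sub, show -(√L.ε + a) = -√L.ε - a by ring] at hq'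
  rw [hp0, neg_sub, show -(√L.ε + a) = -√L.ε - a by ring] at hp'
  have pl := Leg.passage_turn (κ := -k) (Z := Icc (-1) (-√L.ε)) (k := k)
    (m := L.s * √L.ε) (by rwa [neg_neg]) hq' hℓ
    (fun a => isZone_left a k _ _) Ioc_subset_Icc_self (by rw [mem_Ioo]; intro hh; linarith)
  have s2 := s1.step hε1 pl (Or.inl (by linarith))
  refine h.stage_of_left hk ha ?_ s2 ?_ ?_
  · unfold J at hJ
    rw [hJ0] at hJ
    linear_combination hJ
  · have a1 := h.nextA_center_neg hk ha
    set A₁ := nextA L.ε a (L.s * √L.ε) √L.ε (-√L.ε) (-L.w k a) (-L.p k a) (L.T₃ k a) 0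
    have e : L.q k a * nextA L.ε a (-k) (-√L.ε) (-√L.ε) (-L.p k a) (L.q k a)
        (L.t₂ k a + L.t₁ k a) A₁ = -(exp (-(-k * (L.t₂ k a + L.t₁ k a))) *
          (L.p k a * A₁ + (k * L.p k a - L.ε * (√L.ε + a))))
          - (k * L.q k a + L.ε * (√L.ε + a)) := by
      unfold nextA
      rw [mul_div_cancel₀ _ hq.ne']; ring
    rw [e]
    have i1 := h.kp_ge hk ha
    have i2 : 0 ≤ exp (-(-k * (L.t₂ k a + L.t₁ k a))) *
          (L.p k a * A₁ + (k * L.p k a - L.ε * (√L.ε + a))) :=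
      mul_nonneg (exp_pos _).le (by linarith)
    have i3 : 0 ≤ k * L.q k a + L.ε * (√L.ε + a) := by positivity
    refine le_trans (mul_nonpos_of_nonpos_of_nonneg (by linarith) hε.le) (by positivity)
  · intro θ hθ
    obtain ⟨r1, r2⟩ := h.rightB_log hk ha
    obtain ⟨x1, x2⟩ := h.log_leftB hk ha hq0 hp0 rfl
    have y1 := h.abs_center_headless_le hk ha
    set t := L.t₂ k a + L.t₁ k a
    set X := k * (nodeS (lamL k L.ε) (fastR k L.ε) t / L.q k a) * (L.w k a / L.p k a) *
      exp (-(k * t))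
    set Y := L.s * √L.ε * (focS (L.s * √L.ε) (omg * √L.ε) (L.T₃ k a)) / L.p k a *
      exp (L.s * √L.ε * L.T₃ k a - k * t)
    have e1 : exp (-(L.s * √L.ε * L.T₃ k a)) = exp (-(k * t)) *
        exp (-(L.s * √L.ε * L.T₃ k a + -k * t)) := by
      rw [← Real.exp_add]; congr 1; ring
    have e2 : exp (L.s * √L.ε * L.T₃ k a - k * t) *
        exp (-(L.s * √L.ε * L.T₃ k a + -k * t)) = 1 := by
      rw [← Real.exp_add, ← Real.exp_zero]; congr 1; ring
    -- The common factor is the exponential of minus the contraction accumulated up to the end of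
    -- the left turn. Relative to it, the lower central passage contributes `Y`, which is tiny
    -- because of the long middle passage.
    have e3 : nextB (nodeS (lamL k L.ε) (fastR k L.ε)) (-k) (-L.w k a) (-L.p k a) (L.q k a) t
        (L.s * √L.ε * L.T₃ k a) (nextB (focS (L.s * √L.ε) (omg * √L.ε)) (L.s * √L.ε) (-L.w k a)
          (-L.w k a) (-L.p k a) (L.T₃ k a) 0 0) + exp (-(L.s * √L.ε * L.T₃ k a + -k * t)) *
          (θ - L.rightB k a)
        = exp (-(L.s * √L.ε * L.T₃ k a + -k * t)) * (Y + X + θ - L.rightB k a) := by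
      unfold nextB
      rw [neg_zero, Real.exp_zero, e1, div_self (neg_ne_zero.2 hw.ne'), neg_div_neg_eq]
      have e4 : L.s * √L.ε * (focS (L.s * √L.ε) (omg * √L.ε) (L.T₃ k a)) / L.p k a =
          Y * exp (-(L.s * √L.ε * L.T₃ k a + -k * t)) := by
        change _ = L.s * √L.ε * (focS (L.s * √L.ε) (omg * √L.ε) (L.T₃ k a)) / L.p k a *
          exp (L.s * √L.ε * L.T₃ k a - k * t) * exp (-(L.s * √L.ε * L.T₃ k a + -k * t))
        linear_combination (-(L.s * √L.ε * (focS (L.s * √L.ε) (omg * √L.ε) (L.T₃ k a)) /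
          L.p k a)) * e2
      rw [div_neg]
      have e5 : L.s * √L.ε * (focS (L.s * √L.ε) (omg * √L.ε) (L.T₃ k a) / L.p k a) =
          Y * exp (-(L.s * √L.ε * L.T₃ k a + -k * t)) := by rw [← e4]; ring
      linear_combination e5
    rw [e3]
    refine mul_ne_zero (exp_pos _).ne' fun h0 => ?_
    have hM3 : M ^ 2 ≤ M ^ 3 := pow_le_pow_right₀ hM (by norm_num)
    have hM4 : 1 ≤ M ^ 3 := one_le_pow₀ hM
    have h3 := h.pow_mul_le (n := 3) (by norm_num)
    have i1 : M ^ 2 * √L.ε ≤ M ^ 3 * √L.ε := by gcongr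
    -- Of the margin `1000 M³ √ε` at most `60 M³ √ε` is lost in the two logarithmic expansions. A
    -- relative gap of `450 M³ √ε` remains against perturbations of `2 √ε`.
    have i2 : 900 * M ^ 3 * √L.ε ≤ |log X - log (L.rightB k a)| := by
      have := abs_sub_abs_le_abs_sub (2 * log k) (2 * log k - (log X - log (L.rightB k a)))
      rw [sub_sub_cancel] at this
      have i3 : |2 * log k - (log X - log (L.rightB k a))| ≤ 60 * M ^ 3 * √L.ε := by
        rw [abs_le] at *
        constructor <;> linarith
      have : 0 < M ^ 3 * √L.ε := by positivity
      linarith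
    have i3 := mul_half_le_abs_sub x1 r1 (by positivity) (by linarith) i2
    have i4 : |X - L.rightB k a| ≤ 2 * (√L.ε * L.rightB k a) := by
      rw [show X - L.rightB k a = -(Y + θ) by linarith, abs_neg]
      exact (abs_add_le _ _).trans (by linarith)
    have i5 : √L.ε * L.rightB k a ≤ M ^ 3 * (√L.ε * L.rightB k a) :=
      le_mul_of_one_le_left (by positivity) hM4
    have := mul_pos hσ r1
    linarith

/-- Here the two middle passages, the far left turn and the right zone all contribute negatively to
`B`. The lower central passage may have the other sign, but the backward middle passage, read in the
direction of the flow, expands so strongly that its contribution outweighs it. For the parameter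
derivative, the far left zone resets the sensitivity to a bounded size, and the forward expansion
costs only a factor of order `1 / ε`. -/
theorem saddleNode_of_head (hℓ : L.ℓ = -1) {C S C' S' : ℝ → ℝ} {T T' : ℝ}
    (h₁ : Leg (-1) L.ε C' S' (L.x₀ - a) 0 (-1 - a) (L.p₀ a) T)
    (h₂ : Leg 1 L.ε C S (L.x₀ - a) 0 (-1 - a) (L.q₀ a) T') (hS : 0 < S (T + T'))
    (hJ0 : L.J₀ a = T + T') (hD : L.D k a = 0) (hJ : L.J k a = 0) : ∃ A B, A ≠ 0 ∧ B ≠ 0 ∧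
      Stage k (L.s * √L.ε) L.ε a (-L.w k a) √L.ε (-L.w k a) 0 A B := by
  have ha' := h.lt_of_le ha
  obtain ⟨l1, l2, l3, l4, l5⟩ := h.lamL_bounds hk
  have hε1 : L.ε ≤ 1 := by linarith [h.ε_lt, h.ε_pos]
  have hε := h.ε_pos
  have hM := h.one_le
  have hσ := h.sqrt_pos
  have hc := Valid.c_pos ha'
  have hd := Valid.d_pos ha'
  have hw := (h.turn_w hk ha').w_pos
  have hp := (h.leg_p hk ha').exit_pos
  have hq := h.q_pos hk ha'
  have hp₀ := h₁.exit_pos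
  have hq₀ := h₂.exit_pos
  have hkM := h.k_le k hk
  have hp₀M := h.p₀_le a ha'
  have hq₀M := h.q₀_le a ha'
  obtain ⟨-, b1, b2⟩ := h.h_bounds ha'
  rw [hℓ, sub_neg_eq_add] at b1 b2
  have s1 := (h.pass_center hk ha hD).stage hε1
  have hq' := h.leg_q hk ha'
  have hp' := h.leg_p hk ha'
  rw [hℓ, neg_sub, show -(√L.ε + a) = -√L.ε - a by ring] at hq' hp'
  have pr := Leg.passage_reverse (κ := -k) (k := k) (Z := Icc (-1) (-√L.ε)) (m := L.s * √L.ε)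
    (by rwa [neg_neg]) hp₀ (fund_expand (h.lt_k k hk)) (fun a => isZone_left a k _ _) le_rfl
    (by rw [mem_Ioo]; intro hh; linarith)
  have pt := Leg.passage_turn (κ := 1) (k := k) (Z := Iic (-1)) (m := L.s * √L.ε) h₁ h₂
    (sub_one_lt L.x₀) (fun a => isZone_farLeft a k _ _) (fun x hx => hx.2)
    (by rw [mem_Ioo]; intro hh; linarith)
  have pf := Leg.passage (k := k) (Z := Icc (-1) (-√L.ε)) (m := L.s * √L.ε) hq' hq₀
    (fun a => isZone_left a k _ _) le_rfl (by rw [mem_Ioo]; intro hh; linarith)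
  have s2 := s1.step hε1 pr (Or.inl (by linarith))
  have s3 := s2.step hε1 pt (Or.inl (by linarith))
  have s4 := s3.step hε1 pf (Or.inl (by linarith))
  refine h.stage_of_left hk ha ?_ s4 ?_ ?_
  · unfold J at hJ
    rw [hJ0] at hJ
    linear_combination hJ
  · have a1 := h.nextA_center_neg hk ha
    set A₁ := nextA L.ε a (L.s * √L.ε) √L.ε (-√L.ε) (-L.w k a) (-L.p k a) (L.T₃ k a) 0
    set A₂ := nextA L.ε a (-k) (-√L.ε) (-1) (-L.p k a) (-L.p₀ a) (L.t₂ k a) A₁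
    set A₃ := nextA L.ε a 1 (-1) (-1) (-L.p₀ a) (L.q₀ a) (T + T') A₂
    have e2 : L.p₀ a * A₂ = exp (-(-k * L.t₂ k a)) *
        (L.p k a * A₁ + (k * L.p k a - L.ε * (√L.ε + a))) - k * L.p₀ a + L.ε * (1 + a) := by
      change L.p₀ a * nextA L.ε a (-k) (-√L.ε) (-1) (-L.p k a) (-L.p₀ a) (L.t₂ k a) A₁ = _
      unfold nextA
      rw [div_neg, mul_neg, mul_div_cancel₀ _ hp₀.ne']; ring
    have e3 : L.q₀ a * A₃ = exp (-(1 * (T + T'))) *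
        (-(L.p₀ a * A₂) + L.p₀ a + L.ε * (1 + a)) + (L.q₀ a - L.ε * (1 + a)) := by
      change L.q₀ a * nextA L.ε a 1 (-1) (-1) (-L.p₀ a) (L.q₀ a) (T + T') A₂ = _
      unfold nextA
      rw [mul_div_cancel₀ _ hq₀.ne']; ring
    have e4 : L.q k a * nextA L.ε a (-k) (-1) (-√L.ε) (L.q₀ a) (L.q k a) (L.t₁ k a) A₃ =
        exp (k * L.t₁ k a) * (L.q₀ a * A₃ + k * L.q₀ a + L.ε * (1 + a)) -
          (k * L.q k a + L.ε * (√L.ε + a)) := by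
      unfold nextA
      rw [mul_div_cancel₀ _ hq.ne', show -(-k * L.t₁ k a) = k * L.t₁ k a by ring]; ring
    have i1 := h.kp_ge hk ha
    have hMM : M ≤ M ^ 2 := le_self_pow₀ hM (by norm_num)
    have i2 : -M ^ 2 ≤ L.p₀ a * A₂ := by
      rw [e2]
      have j1 : 0 ≤ exp (-(-k * L.t₂ k a)) *
          (L.p k a * A₁ + (k * L.p k a - L.ε * (√L.ε + a))) :=
        mul_nonneg (exp_pos _).le (by linarith)
      have j2 : k * L.p₀ a ≤ M * M := by gcongr
      have j3 := mul_pos hε b2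
      linarith
    have i0 : L.ε * (1 + a) ≤ 1 / 10 ^ 12 * 2 := by
      have := h.ε_le'
      have : 1 + a ≤ 2 := by linarith
      have : 0 < 1 + a := by linarith
      gcongr
    have i0' : 0 ≤ L.ε * (1 + a) := (mul_pos hε (by linarith)).le
    have i3 : L.q₀ a * A₃ ≤ 4 * M ^ 2 := by
      rw [e3]
      have j1 : exp (-(1 * (T + T'))) ≤ 1 := by
        rw [Real.exp_le_one_iff]; linarith [h₁.pos, h₂.pos]
      have j2 : exp (-(1 * (T + T'))) * (-(L.p₀ a * A₂) + L.p₀ a + L.ε * (1 + a)) ≤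
          1 * (M ^ 2 + M + 1) := by
        calc _ ≤ exp (-(1 * (T + T'))) * (M ^ 2 + M + 1) := by gcongr <;> linarith
          _ ≤ _ := by gcongr
      linarith [one_le_pow₀ (n := 2) hM]
    have i4 : k * L.q₀ a ≤ M * 1 := by gcongr
    have i5 := h.exp_k_t₁_le hk ha'
    have i6 : 0 ≤ k * L.q k a + L.ε * (√L.ε + a) := by positivity
    rw [e4]
    have i7 : exp (k * L.t₁ k a) * (L.q₀ a * A₃ + k * L.q₀ a + L.ε * (1 + a)) ≤
        exp (k * L.t₁ k a) * (6 * M ^ 2) := by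
      gcongr
      linarith [one_le_pow₀ (n := 2) hM]
    calc _ ≤ exp (k * L.t₁ k a) * (6 * M ^ 2) * L.ε := by gcongr; linarith
      _ = exp (k * L.t₁ k a) * L.ε * (6 * M ^ 2) := by ring
      _ ≤ 49 * M ^ 4 * (6 * M ^ 2) := by gcongr
      _ = 294 * M ^ 6 := by ring
      _ ≤ 10 ^ 4 * M ^ 8 := by
        have : M ^ 6 ≤ M ^ 8 := pow_le_pow_right₀ hM (by norm_num)
        have : 0 < M ^ 6 := by positivity
        linarith
  · intro θ hθ
    obtain ⟨r1, -⟩ := h.rightB_log hk ha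
    refine ne_of_lt ?_
    have x1 : exp (-(L.s * √L.ε * L.T₃ k a + -k * L.t₂ k a + 1 * (T + T') + -k * L.t₁ k a)) *
        (θ - L.rightB k a) < 0 := by
      refine mul_neg_of_pos_of_neg (exp_pos _) ?_
      have : √L.ε * L.rightB k a < 1 * L.rightB k a := by
        gcongr; linarith [h.sqrt_le]
      linarith [le_abs_self θ]
    have hlt := lamL_lt_fastR (h.lt_k k hk)
    have x2 := nodeS_pos hlt.ne (h.leg_q hk ha').pos
    have x3 := h.abs_centerB_le ha (k := k)
    -- `4000` is the bound of `abs_centerB_le`. It is exceeded because `nodeS` is at least `1 / (2 M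
    -- ε ^ 8)` after the long passage, while `w` is only as small as `ε²`.
    have x4 : 4000 < k * nodeS (lamL k L.ε) (fastR k L.ε) (L.t₂ k a) * L.w k a / L.p₀ a *
        exp (-(L.s * √L.ε * L.T₃ k a)) := by
      have g1 : 1 / 3000 ≤ exp (-(L.s * √L.ε * L.T₃ k a)) := by
        rw [Real.exp_neg, ← one_div]
        gcongr
        exact (exp_le_exp.2 ((le_abs_self _).trans (h.abs_mT₃_le ha).1)).trans exp_eight_le
      have g2 : L.ε ^ 2 / 20 ≤ L.w k a := by
        have := (h.w_ge hk ha).1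
        have i1 : L.ε ≤ 10 * (√L.ε - a) := by linarith [(h.c_bounds ha).1, h.ε_le]
        have := mul_le_mul_of_nonneg_left i1 hε.le
        linarith
      have hε8 : 0 < L.ε ^ 8 := pow_pos hε 8
      have g3 : 1 / (2 * M * L.ε ^ 8) ≤ nodeS (lamL k L.ε) (fastR k L.ε) (L.t₂ k a) := by
        unfold nodeS
        have ht := (h.leg_p hk ha').pos
        have i1 := (h.exp_t₂_le hk ha').1
        rw [Real.exp_neg, inv_le_comm₀ (exp_pos _) hε8] at i1
        have i2 : exp (fastR k L.ε * L.t₂ k a) = exp (lamL k L.ε * L.t₂ k a) *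
            exp ((fastR k L.ε - lamL k L.ε) * L.t₂ k a) := by
          rw [← Real.exp_add]; congr 1; ring
        have i3 : 1 ≤ exp (lamL k L.ε * L.t₂ k a) := Real.one_le_exp (by positivity)
        have i4 : L.ε ^ 8 ≤ 1 / 2 := by
          have : L.ε ^ 8 ≤ L.ε := pow_le_of_le_one hε.le (by linarith [h.ε_le']) (by norm_num)
          linarith [h.ε_le']
        have i5 : 2 ≤ (L.ε ^ 8)⁻¹ := by
          rw [le_inv_comm₀ (by norm_num) hε8]; linarith
        have i6 : (L.ε ^ 8)⁻¹ / 2 ≤ exp (fastR k L.ε * L.t₂ k a) - exp (lamL k L.ε * L.t₂ k a) := by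
          rw [i2]
          set E := exp ((fastR k L.ε - lamL k L.ε) * L.t₂ k a)
          have : 1 * (E - 1) ≤ exp (lamL k L.ε * L.t₂ k a) * (E - 1) := by
            gcongr; linarith
          linarith
        calc 1 / (2 * M * L.ε ^ 8) = (L.ε ^ 8)⁻¹ / 2 / M := by field_simp
          _ ≤ (L.ε ^ 8)⁻¹ / 2 / (fastR k L.ε - lamL k L.ε) := by gcongr <;> linarith
          _ ≤ _ := by gcongr
      have g4 : 1 / M ≤ k := by rw [div_le_iff₀ (by positivity), mul_comm]; exact h.k_ge k hk
      have g5 := h.pow_mul_ε_le (n := 3) (by norm_num)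
      have g6 := nodeS_pos hlt.ne (h.leg_p hk ha').pos
      calc (4000 : ℝ) < 1 / (120000 * (M ^ 3 * L.ε)) := by
            rw [lt_div_iff₀ (by positivity)]; linarith
        _ ≤ 1 / (120000 * (M ^ 3 * L.ε)) * (1 / L.ε ^ 5) := by
          refine le_mul_of_one_le_right (by positivity) ?_
          rw [le_div_iff₀ (pow_pos hε 5), one_mul]
          exact pow_le_one₀ hε.le hε1
        _ = 1 / M * (1 / (2 * M * L.ε ^ 8)) * (L.ε ^ 2 / 20) / M * (1 / 3000) := by
          field_simp; norm_num
        _ ≤ _ := by gcongr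
    unfold nextB
    have y1 : ∀ {x y z e : ℝ}, 0 < x → 0 < y → 0 < z → 0 < e → 0 < x / y * (z / e) := by
      intro x y z e hx hy hz he; positivity
    have z1 : 0 < 1 * (S (T + T') / L.q₀ a) * (-L.w k a / -L.p₀ a *
        exp (-(L.s * √L.ε * L.T₃ k a + -k * L.t₂ k a))) := by
      rw [neg_div_neg_eq]; positivity
    have z2 : 0 < k * (nodeS (lamL k L.ε) (fastR k L.ε) (L.t₁ k a) / L.q k a) * (L.w k a / L.q₀ a *
        exp (-(L.s * √L.ε * L.T₃ k a + -k * L.t₂ k a + 1 * (T + T')))) := by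
      positivity
    have z3 : (L.s * √L.ε * focS (L.s * √L.ε) (omg * √L.ε) (L.T₃ k a) -
        k * nodeS (lamL k L.ε) (fastR k L.ε) (L.t₂ k a) * L.w k a / L.p₀ a *
        exp (-(L.s * √L.ε * L.T₃ k a))) / L.p k a < 0 :=
      div_neg_of_neg_of_pos (by linarith [le_abs_self (L.s * √L.ε *
        focS (L.s * √L.ε) (omg * √L.ε) (L.T₃ k a))]) hp
    rw [neg_zero, Real.exp_zero, div_self (neg_ne_zero.2 hw.ne')]
    have z4 : (0 - L.s * √L.ε * (focS (L.s * √L.ε) (omg * √L.ε) (L.T₃ k a) / -L.p k a) * (1 * 1)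
        - -k * (nodeS (lamL k L.ε) (fastR k L.ε) (L.t₂ k a) / -L.p₀ a) *
          (-L.w k a / -L.p k a * exp (-(L.s * √L.ε * L.T₃ k a)))) =
        (L.s * √L.ε * focS (L.s * √L.ε) (omg * √L.ε) (L.T₃ k a) -
        k * nodeS (lamL k L.ε) (fastR k L.ε) (L.t₂ k a) * L.w k a / L.p₀ a *
        exp (-(L.s * √L.ε * L.T₃ k a))) / L.p k a := by
      field_simp; ring
    rw [z4]
    have z5 : -k * (nodeS (lamL k L.ε) (fastR k L.ε) (L.t₁ k a) / L.q k a) * (-L.w k a / L.q₀ a *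
        exp (-(L.s * √L.ε * L.T₃ k a + -k * L.t₂ k a + 1 * (T + T')))) =
        k * (nodeS (lamL k L.ε) (fastR k L.ε) (L.t₁ k a) / L.q k a) * (L.w k a / L.q₀ a *
        exp (-(L.s * √L.ε * L.T₃ k a + -k * L.t₂ k a + 1 * (T + T')))) := by ring
    rw [z5]
    linarith

end LeftData.Tame

end PWLCanard

/-! ### Asymptotics and sign of the integral of `f'`. -/

namespace PWLCanard

theorem abs_log_le {x M : ℝ} (hx : 0 < x) (h1 : x ≤ M) (h2 : 1 ≤ M * x) : |log x| ≤ M := by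
  rw [abs_le]
  constructor
  · have := Real.log_le_sub_one_of_pos (inv_pos.2 hx)
    rw [Real.log_inv] at this
    have h3 : x⁻¹ ≤ M := by rw [inv_le_iff_one_le_mul₀ hx]; exact h2
    linarith
  · linarith [Real.log_le_sub_one_of_pos hx]

namespace LeftData

/-- The logarithm of the ratio of the half-widths of the lower arc in the central zone. -/
noncomputable def logQ (s : ℝ) : ℝ := -(s / 2 * (π / omg))

theorem logQ_bounds {s : ℝ} (hs : s ^ 2 = 1) : 1.8 ≤ |logQ s| ∧ |logQ s| ≤ 1.85 := by
  have h1 := pi_div_omg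
  have h2 : |s| = 1 := by
    rw [← sq_abs] at hs
    nlinarith [abs_nonneg s]
  have h3 : |logQ s| = π / omg / 2 := by
    unfold logQ
    have : 0 < π / omg := by linarith
    rw [abs_neg, abs_mul, abs_div, h2, abs_of_pos this]
    norm_num; ring
  rw [h3]
  constructor <;> linarith

namespace Tame

variable {L : LeftData} {M : ℝ} {K : Set ℝ} {k a : ℝ} (h : L.Tame M K) (hk : k ∈ K)
  (ha : |a| ≤ 9 / 10 * √L.ε)
include h hk ha

/-- On `D = 0` the ratio of the half-widths is the ratio of the two values of `gf`, and the slopes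
`r₁`, `r₂` are `O(M √ε)`, so that they may be replaced by zero. -/
theorem log_d_sub_log_c (hD : L.D k a = 0) :
    |log (√L.ε + a) - log (√L.ε - a) - logQ L.s| ≤ 5 * M * √L.ε := by
  have ha' := h.lt_of_le ha
  have hs := h.s_sq
  have hs' : (-L.s) ^ 2 = 1 := by rw [neg_sq, hs]
  obtain ⟨r1, r2⟩ := h.r_le hk ha'
  have g1 := abs_log_gf_sub_le hs (h.r₁_pos hk ha').le r1
  have g2 := abs_log_gf_sub_le hs' (h.r₂_pos hk ha').le r2
  have e1 := congrArg log (gf_zero_div L.s)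
  rw [Real.log_div (gf_pos _ _).ne' (gf_pos _ _).ne', Real.log_exp] at e1
  unfold D at hD
  have e2 := congrArg log (sub_eq_zero.1 hD)
  rw [Real.log_mul (Valid.c_pos ha').ne' (gf_pos _ _).ne',
    Real.log_mul (Valid.d_pos ha').ne' (gf_pos _ _).ne'] at e2
  have b1 := h.r₁_lt hk ha'
  have b2 := h.r₂_lt hk ha'
  have hM := h.one_le
  have hσ : √L.ε ≤ M * √L.ε := le_mul_of_one_le_left h.sqrt_pos.le hM
  unfold logQ
  rw [abs_le] at *
  constructor <;> linarith

omit hk in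
theorem abs_log_c : |log (√L.ε - a) - log √L.ε| ≤ 3 := by
  have ha' := h.lt_of_le ha
  obtain ⟨c1, c2⟩ := h.c_bounds ha
  have hσ := h.sqrt_pos
  have hc := Valid.c_pos ha'
  have l1 := Real.log_le_log hσ c1
  have l2 := Real.log_le_log hc c2
  rw [Real.log_mul (by norm_num) hc.ne'] at l1
  rw [Real.log_mul (by norm_num) hσ.ne'] at l2
  have l3 : log 10 ≤ 3 := by
    rw [Real.log_le_iff_le_exp (by norm_num)]
    have : exp 3 = exp 1 ^ 3 := by rw [← Real.exp_nat_mul]; norm_num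
    rw [this]
    calc (10 : ℝ) ≤ 2.7 ^ 3 := by norm_num
      _ ≤ _ := by gcongr; linarith [Real.exp_one_gt_d9]
  have l4 : log 2 ≤ 1 := by linarith [Real.log_le_sub_one_of_pos (show (0 : ℝ) < 2 by norm_num)]
  rw [abs_le]; constructor <;> linarith

/-- The slow integral gives `lamL T₂` exactly as a logarithm, approximately `log (q / c)`. Since `ε
= lamL - lamL²`, replacing `lamL` by `ε` costs `lamL * (lamL T₂)`. -/
theorem ε_T₂_approx : |L.ε * L.T₂ k a - (log (L.q k a) - log (√L.ε - a))| ≤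
    700 * M ^ 2 * √L.ε := by
  have ha' := h.lt_of_le ha
  obtain ⟨l1, l2, l3, l4⟩ := h.lamL_one_bounds
  have ws := h.w_slow hk ha'
  obtain ⟨r1, r2⟩ := h.log_right hk ha
  have v2 := (h.log_v hk ha).2
  have hv := (h.leg_v hk ha').exit_pos
  have hc := Valid.c_pos ha'
  have hvc : 0 < L.v k a + fastR 1 L.ε * (√L.ε - a) := by positivity
  have hε := h.ε_pos
  have hσ := h.sqrt_pos
  have hM := h.one_le
  have hT := (h.turn_w hk ha').pos
  have e1 : lamL 1 L.ε * L.T₂ k a = log (L.v k a + fastR 1 L.ε * (√L.ε - a)) -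
      log (fastR 1 L.ε * (√L.ε - a) - L.w k a) := by
    rw [ws, Real.log_mul hvc.ne' (exp_pos _).ne', Real.log_exp]; ring
  have e2 : L.ε * L.T₂ k a = lamL 1 L.ε * L.T₂ k a - lamL 1 L.ε * (lamL 1 L.ε * L.T₂ k a) := by
    have s1 := lamL_add_fastR 1 L.ε
    have s2 := lamL_mul_fastR (k := 1) (ε := L.ε) (by linarith [h.ε_lt])
    linear_combination (-L.T₂ k a) * s2 + lamL 1 L.ε * L.T₂ k a * s1
  set Λ := lamL 1 L.ε * L.T₂ k a with hΛ
  have hΛ0 : 0 < Λ := mul_pos (hε.trans l1) hT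
  have b1 : Λ * √L.ε ≤ 320 * M := by
    -- The exponential of `Λ` is a quotient with denominator of order `√ε`, so the crude bound `Λ =
    -- O(M / √ε)` suffices.
    have i1 : Λ ≤ exp Λ := by linarith [Real.add_one_le_exp Λ]
    have i2 : (fastR 1 L.ε * (√L.ε - a) - L.w k a) * exp Λ =
        L.v k a + fastR 1 L.ε * (√L.ε - a) := by
      rw [ws, mul_assoc, ← Real.exp_add, neg_add_cancel, Real.exp_zero, mul_one]
    have i3 : (√L.ε - a) / 4 ≤ fastR 1 L.ε * (√L.ε - a) - L.w k a := by
      have := (h.w_ge hk ha).2.1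
      have := mul_le_mul_of_nonneg_right l3.le hc.le
      have := mul_le_mul_of_nonneg_right h.ε_le' hc.le
      linarith
    have i4 : L.v k a + fastR 1 L.ε * (√L.ε - a) ≤ 8 * M := by
      have : fastR 1 L.ε * (√L.ε - a) ≤ 1 * 1 := by
        gcongr
        linarith [(h.c_bounds ha).2, h.sqrt_le]
      linarith [(h.v_bounds hk ha').2.1]
    have i5 : √L.ε / 40 ≤ fastR 1 L.ε * (√L.ε - a) - L.w k a := by
      linarith [(h.c_bounds ha).1]
    have i6 : √L.ε / 40 * Λ ≤ (fastR 1 L.ε * (√L.ε - a) - L.w k a) * exp Λ := by gcongr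
    linarith
  have b2 : lamL 1 L.ε * Λ ≤ 640 * M ^ 2 * √L.ε := by
    calc _ ≤ 2 * L.ε * Λ := by gcongr
      _ = 2 * √L.ε * (Λ * √L.ε) := by linear_combination (-2 * Λ) * h.sq_sqrt
      _ ≤ 2 * √L.ε * (320 * M) := by gcongr
      _ = 640 * (M * √L.ε) := by ring
      _ ≤ 640 * (M ^ 2 * √L.ε) := by gcongr; exact le_self_pow₀ hM (by norm_num)
      _ = _ := by ring
  have b3 : 0 ≤ lamL 1 L.ε * Λ := by have := hε.trans l1; positivity
  have hM2 : √L.ε ≤ M ^ 2 * √L.ε := le_mul_of_one_le_left hσ.le (one_le_pow₀ hM)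
  rw [e2, e1]
  rw [e1] at b2 b3
  rw [abs_le] at *
  constructor <;> linarith

/-- As in the right zone, but with slow rate close to `ε / k`. This is the origin of the factor
`k²`, on which the balance between expansion and contraction depends. -/
theorem ε_k_t₂_approx : |L.ε * (k * L.t₂ k a) - k ^ 2 * (log (fastR k L.ε * (a - L.ℓ) - L.p₀ a) -
    log k - log (√L.ε + a))| ≤ 100 * M ^ 4 * √L.ε := by
  have ha' := h.lt_of_le ha
  obtain ⟨l1, l2, l3, l4, l5⟩ := h.lamL_bounds hk
  have ps := h.p_slow hk ha'
  obtain ⟨r1, r2⟩ := h.log_left hk ha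
  have hpos : 0 < fastR k L.ε * (a - L.ℓ) - L.p₀ a := by linarith [h.p₀_lt k hk a ha']
  have hε := h.ε_pos
  have hσ := h.sqrt_pos
  have hM := h.one_le
  have hkM := h.k_le k hk
  have hT := (h.leg_p hk ha').pos
  have hd := Valid.d_pos ha'
  have e1 : lamL k L.ε * L.t₂ k a = log (fastR k L.ε * (a - L.ℓ) - L.p₀ a) -
      log (fastR k L.ε * (√L.ε + a) - L.p k a) := by
    rw [ps, Real.log_mul hpos.ne' (exp_pos _).ne', Real.log_exp]; ring
  have e2 : L.ε * (k * L.t₂ k a) = k ^ 2 * (lamL k L.ε * L.t₂ k a) -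
      k * lamL k L.ε * (lamL k L.ε * L.t₂ k a) := by
    have s1 := lamL_add_fastR k L.ε
    have s2 := lamL_mul_fastR (h.lt_k k hk)
    linear_combination (-k * L.t₂ k a) * s2 + k * lamL k L.ε * L.t₂ k a * s1
  set Λ := lamL k L.ε * L.t₂ k a with hΛ
  have hΛ0 : 0 < Λ := mul_pos l1 hT
  have b1 : Λ * √L.ε ≤ 40 * M ^ 2 := by
    have i1 : Λ ≤ exp Λ := by linarith [Real.add_one_le_exp Λ]
    have i2 : (fastR k L.ε * (√L.ε + a) - L.p k a) * exp Λ =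
        fastR k L.ε * (a - L.ℓ) - L.p₀ a := by
      rw [ps, mul_assoc, ← Real.exp_add, neg_add_cancel, Real.exp_zero, mul_one]
    have i3 : k * (√L.ε + a) / 2 ≤ fastR k L.ε * (√L.ε + a) - L.p k a := by
      have i4 := (abs_le.1 r1).1
      rw [← Real.log_mul l5.ne' hd.ne'] at i4
      have i5 : log (k * (√L.ε + a)) - √L.ε ≤ log (fastR k L.ε * (√L.ε + a) - L.p k a) := by
        linarith
      have i6 := exp_le_exp.2 i5
      rw [Real.exp_sub, Real.exp_log r2, Real.exp_log (by positivity)] at i6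
      refine le_trans ?_ i6
      gcongr
      have := Real.exp_bound_div_one_sub_of_interval hσ.le (by linarith [h.sqrt_le])
      refine this.trans ?_
      rw [div_le_iff₀ (by linarith [h.sqrt_le])]
      linarith [h.sqrt_le]
    have i4 : fastR k L.ε * (a - L.ℓ) - L.p₀ a ≤ 2 * M := by
      obtain ⟨-, j2, j3⟩ := h.h_bounds ha'
      have : fastR k L.ε * (a - L.ℓ) ≤ M * 2 := by gcongr; linarith
      linarith [h.p₀_nonneg a ha']
    have i5 : √L.ε ≤ 20 * M * (fastR k L.ε * (√L.ε + a) - L.p k a) := by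
      have j1 := (h.d_bounds ha).1
      have j2 : √L.ε + a ≤ M * k * (√L.ε + a) := le_mul_of_one_le_left hd.le (h.k_ge k hk)
      have j3 := mul_le_mul_of_nonneg_left i3 h.M_pos.le
      linarith
    have hM0 := h.M_pos
    calc Λ * √L.ε ≤ exp Λ * (20 * M * (fastR k L.ε * (√L.ε + a) - L.p k a)) := by gcongr
      _ = 20 * M * ((fastR k L.ε * (√L.ε + a) - L.p k a) * exp Λ) := by ring
      _ ≤ 20 * M * (2 * M) := by rw [i2]; gcongr
      _ = _ := by ring
  have b2 : k * lamL k L.ε * Λ ≤ 80 * M ^ 4 * √L.ε := by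
    calc _ ≤ M * (2 * M * L.ε) * Λ := by gcongr
      _ = 2 * M ^ 2 * √L.ε * (Λ * √L.ε) := by linear_combination (-2 * M ^ 2 * Λ) * h.sq_sqrt
      _ ≤ 2 * M ^ 2 * √L.ε * (40 * M ^ 2) := by gcongr
      _ = _ := by ring
  have b3 : 0 ≤ k * lamL k L.ε * Λ := by positivity
  have b4 : |k ^ 2 * (log (fastR k L.ε * (√L.ε + a) - L.p k a) - (log k + log (√L.ε + a)))| ≤
      M ^ 4 * √L.ε := by
    rw [abs_mul, abs_of_pos (pow_pos l5 2)]
    have : k ^ 2 ≤ M ^ 4 := by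
      calc k ^ 2 ≤ M ^ 2 := by gcongr
        _ ≤ M ^ 4 := pow_le_pow_right₀ hM (by norm_num)
    gcongr
  have hM2 : 0 < M ^ 4 * √L.ε := by have := h.M_pos; positivity
  rw [e2, e1]
  rw [e1] at b2 b3
  rw [abs_le] at *
  constructor <;> linarith

/-- The integral of `f'` along the closed orbit. -/
theorem ε_J_approx (hD : L.D k a = 0) : |L.ε * L.J k a - (log (L.q k a) - log (√L.ε - a) -
    k ^ 2 * (log (fastR k L.ε * (a - L.ℓ) - L.p₀ a) - log k - log (√L.ε - a) - logQ L.s) +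
      L.ε * L.J₀ a)| ≤ 1000 * M ^ 4 * √L.ε := by
  have ha' := h.lt_of_le ha
  obtain ⟨l1, l2, l3, l4, l5⟩ := h.lamL_bounds hk
  have h1 := h.ε_T₂_approx hk ha
  have h2 := h.ε_k_t₂_approx hk ha
  have h3 := h.log_d_sub_log_c hk ha hD
  have h4 := h.abs_mT₁_le hk ha
  have h5 := (h.abs_mT₃_le ha (k := k)).1
  have hε := h.ε_pos
  have hσ := h.sqrt_pos
  have hM := h.one_le
  have hM0 := h.M_pos
  have hkM := h.k_le k hk
  have t1 := (h.leg_q hk ha').pos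
  -- The forward middle passage does not enter the leading terms, because it lasts only a time of
  -- order `1 / √ε`.
  have b1 : L.ε * (k * L.t₁ k a) ≤ 8 * M ^ 3 * √L.ε := by
    have s2 := lamL_mul_fastR (h.lt_k k hk)
    have := h.lamL_t₁_le hk ha'
    calc _ = k * fastR k L.ε * (lamL k L.ε * L.t₁ k a) := by
          linear_combination (-k * L.t₁ k a) * s2
      _ ≤ M * M * (8 * M * √L.ε) := by
          have hμM : fastR k L.ε ≤ M := by linarith
          have hμ0 : 0 ≤ fastR k L.ε := by linarith
          gcongr
      _ = _ := by ring
  have b2 : 0 ≤ L.ε * (k * L.t₁ k a) := by positivity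
  have b3 : |L.ε * (L.s * √L.ε * L.T₁ k a)| ≤ √L.ε := by
    rw [abs_mul, abs_of_pos hε]
    calc _ ≤ 1 * √L.ε := by gcongr; linarith [h.ε_le']
      _ = _ := one_mul _
  have b4 : |L.ε * (L.s * √L.ε * L.T₃ k a)| ≤ √L.ε := by
    rw [abs_mul, abs_of_pos hε]
    calc _ ≤ L.ε * 8 := by gcongr
      _ ≤ _ := by linarith [h.ε_le]
  have b5 : |k ^ 2 * (log (√L.ε + a) - log (√L.ε - a) - logQ L.s)| ≤ 5 * M ^ 3 * √L.ε := by
    rw [abs_mul, abs_of_pos (pow_pos l5 2)]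
    calc _ ≤ M ^ 2 * (5 * M * √L.ε) := by gcongr
      _ = _ := by ring
  have i1 : M ^ 2 * √L.ε ≤ M ^ 4 * √L.ε := by gcongr <;> first | exact hM | norm_num
  have i2 : M ^ 3 * √L.ε ≤ M ^ 4 * √L.ε := by gcongr <;> first | exact hM | norm_num
  have i3 : √L.ε ≤ M ^ 4 * √L.ε := le_mul_of_one_le_left hσ.le (one_le_pow₀ hM)
  unfold J
  rw [abs_le] at *
  constructor <;> linarith

omit hk ha in
theorem error_le : 1000 * M ^ 4 * √L.ε ≤ 1 / 1000 := by
  have := h.pow_mul_le (n := 4) (by norm_num)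
  linarith

/-- Here `log q ≈ log k + log h` with `h = a - ℓ`, so `log h` and `log c` occur in `ε J` only with
the factor `k² - 1 ≈ 2 log k = κ / Λ`. With `log c ≈ -Λ` this produces `-κ`, the term `k² logQ`
tends to `logQ`, and the rest is `O(M / Λ)`. -/
theorem J_headless (hq0 : L.q₀ a = 0) (hp0 : L.p₀ a = 0) (hJ0 : L.J₀ a = 0) (hD : L.D k a = 0)
    {κ : ℝ} (hκ : |κ| ≤ 3) (hkκ : 2 * log k * -log √L.ε = κ) (hΛ : 200 * M ≤ -log √L.ε) :
    |L.ε * L.J k a - (logQ L.s - κ)| ≤ 1 / 2 := by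
  have ha' := h.lt_of_le ha
  obtain ⟨l1, l2, l3, l4, l5⟩ := h.lamL_bounds hk
  have hJ := h.ε_J_approx hk ha hD
  have hle := h.error_le
  have hM := h.one_le
  obtain ⟨h3, h4, h5⟩ := h.h_bounds ha'
  have hμ : 0 < fastR k L.ε := by linarith
  obtain ⟨-, f2, -⟩ := h.log_fastR_sub hk
  have hσ := h.sqrt_pos
  have hq : |log (L.q k a) - log k - log (a - L.ℓ)| ≤ 1 / 1000 := by
    have g3 := h.log_q hk ha
    have q1 := h.q_slow hk ha'
    rw [hq0, zero_add] at q1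
    rw [q1, Real.log_mul (by positivity) (exp_pos _).ne', Real.log_exp,
      Real.log_mul hμ.ne' h5.ne'] at g3
    have g4 := h.lamL_t₁_le hk ha'
    have g5 : 0 ≤ lamL k L.ε * L.t₁ k a := by have := (h.leg_q hk ha').pos; positivity
    have g6 := h.pow_mul_le (n := 3) (by norm_num)
    have g7 := h.mul_sqrt_le
    have g8 := h.sqrt_le
    rw [abs_le] at *
    constructor <;> linarith
  have hlogh : |log (a - L.ℓ)| ≤ 2 * M :=
    abs_log_le h5 (by linarith) (by linarith)
  have hc := h.abs_log_c ha
  have hq8 := (logQ_bounds h.s_sq).2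
  rw [hp0, sub_zero, Real.log_mul hμ.ne' h5.ne', hJ0, mul_zero, add_zero] at hJ
  set Λ := -log √L.ε with hΛdef
  have hΛ0 : 0 < Λ := by linarith
  set x := 2 * log k with hx
  have hxΛ : |x| * Λ ≤ 3 := by
    rw [← abs_of_pos hΛ0, ← abs_mul, hkκ]; exact hκ
  have hx1 : |x| ≤ 1 / 50 := by
    have : |x| * 200 ≤ |x| * Λ := by gcongr; linarith
    linarith
  have hk2 : k ^ 2 = exp x := by
    rw [hx, two_mul, Real.exp_add, Real.exp_log l5]; ring
  have e1 : |k ^ 2 - 1 - x| ≤ x ^ 2 := by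
    rw [hk2]
    have := Real.abs_exp_sub_one_sub_id_le (x := x) (by linarith)
    exact this
  have e2 : |k ^ 2 - 1| ≤ 2 * |x| := by
    have i1 : x ^ 2 ≤ |x| := by
      rw [← sq_abs]
      nlinarith [abs_nonneg x]
    have := abs_add_le (k ^ 2 - 1 - x) x
    rw [sub_add_cancel] at this
    linarith
  have e3 : |(k ^ 2 - 1) * log (a - L.ℓ)| ≤ 6 / 100 := by
    rw [abs_mul]
    calc _ ≤ 2 * |x| * (2 * M) := by gcongr
      _ = |x| * (200 * M) / 50 := by ring
      _ ≤ |x| * Λ / 50 := by gcongr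
      _ ≤ _ := by linarith
  have e4 : |(k ^ 2 - 1) * (log (√L.ε - a) + Λ)| ≤ 6 / 50 := by
    rw [abs_mul]
    have : |log (√L.ε - a) + Λ| ≤ 3 := by rw [hΛdef]; exact hc
    calc _ ≤ 2 * |x| * 3 := by gcongr
      _ ≤ _ := by linarith
  have e5 : |(k ^ 2 - 1 - x) * Λ| ≤ 3 / 50 := by
    rw [abs_mul, abs_of_pos hΛ0]
    calc _ ≤ x ^ 2 * Λ := by gcongr
      _ = |x| * (|x| * Λ) := by rw [← sq_abs]; ring
      _ ≤ 1 / 50 * 3 := by gcongr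
      _ = _ := by ring
  have e6 : |(k ^ 2 - 1) * logQ L.s| ≤ 4 / 50 := by
    rw [abs_mul]
    calc _ ≤ 2 * |x| * 2 := by gcongr; linarith
      _ ≤ _ := by linarith
  have e7 : |k ^ 2 * (log (fastR k L.ε) - log k)| ≤ 1 / 1000 := by
    rw [abs_mul, abs_of_pos (pow_pos l5 2)]
    have hk1 : k ^ 2 ≤ 2 := by have := (abs_le.1 e2).2; linarith
    calc _ ≤ 2 * (1 / 10 ^ 6) := mul_le_mul hk1 (f2.trans h.sqrt_le) (abs_nonneg _) (by norm_num)
      _ ≤ _ := by norm_num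
  have e8 : log k = x / 2 := by rw [hx]; ring
  have e9 : (k ^ 2 - 1) * log (√L.ε - a) = (k ^ 2 - 1) * (log (√L.ε - a) + Λ) -
      (k ^ 2 - 1 - x) * Λ - κ := by rw [← hkκ]; ring
  rw [abs_le] at *
  constructor <;> linarith

/-- Quantities that stay bounded in the expansion of the integral of `f'`. -/
theorem bounded_terms : |log (L.q k a)| ≤ 6 * M ^ 3 ∧ |k ^ 2 * log k| ≤ M ^ 3 ∧
    |k ^ 2 * logQ L.s| ≤ 2 * M ^ 3 ∧ |(k ^ 2 - 1) * (log (√L.ε - a) - log √L.ε)| ≤ 6 * M ^ 3 := by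
  have ha' := h.lt_of_le ha
  have hk0 := h.k_pos k hk
  have hkM := h.k_le k hk
  have hM := h.one_le
  have hM0 := h.M_pos
  have hq := h.q_pos hk ha'
  have m1 : M ≤ M ^ 3 := le_self_pow₀ hM (by norm_num)
  have m2 : M ^ 2 ≤ M ^ 3 := pow_le_pow_right₀ hM (by norm_num)
  have m3 : 1 ≤ M ^ 3 := one_le_pow₀ hM
  have hk2 : k ^ 2 ≤ M ^ 2 := by gcongr
  refine ⟨abs_log_le hq (by linarith [h.q_le hk ha']) ?_, ?_, ?_, ?_⟩
  · have := h.q_ge hk ha'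
    have : 4 * M ^ 2 * L.q k a ≤ 6 * M ^ 3 * L.q k a := by gcongr; linarith
    linarith
  · rw [abs_mul, abs_of_pos (pow_pos hk0 2)]
    calc _ ≤ M ^ 2 * M := by gcongr; exact abs_log_le hk0 hkM (h.k_ge k hk)
      _ = _ := by ring
  · rw [abs_mul, abs_of_pos (pow_pos hk0 2)]
    calc _ ≤ M ^ 2 * 2 := by gcongr; linarith [(logQ_bounds h.s_sq).2]
      _ ≤ _ := by linarith
  · rw [abs_mul]
    have hc := h.abs_log_c ha
    have : |k ^ 2 - 1| ≤ 2 * M ^ 2 := by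
      have := one_le_pow₀ (n := 2) hM
      rw [abs_le]; constructor <;> nlinarith
    calc _ ≤ 2 * M ^ 2 * 3 := by gcongr
      _ ≤ _ := by linarith

/-- All terms of the expansion are `O(M³)` except `(k² - 1) log √ε`, which is at most `-600 M³`. -/
theorem J_neg_of_two_le (hJ0 : L.ε * L.J₀ a ≤ M) (hD : L.D k a = 0)
    (hΛ : 200 * M ^ 3 ≤ -log √L.ε) (hk2 : 2 ≤ k)
    (hg : 1 ≤ M * (fastR k L.ε * (a - L.ℓ) - L.p₀ a)) : L.J k a < 0 := by
  have ha' := h.lt_of_le ha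
  obtain ⟨b1, b2, b3, b4⟩ := h.bounded_terms hk ha
  have hJ := h.ε_J_approx hk ha hD
  have hle := h.error_le
  have hM := h.one_le
  have hM0 := h.M_pos
  have hk0 := h.k_pos k hk
  have hkM := h.k_le k hk
  have m1 : M ≤ M ^ 3 := le_self_pow₀ hM (by norm_num)
  have m3 : 1 ≤ M ^ 3 := one_le_pow₀ hM
  have hpos : 0 < fastR k L.ε * (a - L.ℓ) - L.p₀ a := by linarith [h.p₀_lt k hk a ha']
  have hlog : -M ≤ log (fastR k L.ε * (a - L.ℓ) - L.p₀ a) := by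
    have := Real.log_le_log (by positivity : 0 < M⁻¹)
      (by rw [inv_le_iff_one_le_mul₀' hM0]; exact hg :
        M⁻¹ ≤ fastR k L.ε * (a - L.ℓ) - L.p₀ a)
    rw [Real.log_inv] at this
    linarith [Real.log_le_self hM0.le]
  have e1 : -(k ^ 2 * log (fastR k L.ε * (a - L.ℓ) - L.p₀ a)) ≤ M ^ 3 := by
    calc _ = k ^ 2 * -log (fastR k L.ε * (a - L.ℓ) - L.p₀ a) := by ring
      _ ≤ k ^ 2 * M := by gcongr; linarith
      _ ≤ M ^ 2 * M := by gcongr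
      _ = _ := by ring
  have e2 : (k ^ 2 - 1) * log √L.ε ≤ -(3 * (200 * M ^ 3)) := by
    have h3 : 3 ≤ k ^ 2 - 1 := by nlinarith
    have : 3 * (200 * M ^ 3) ≤ (k ^ 2 - 1) * -log √L.ε :=
      mul_le_mul h3 hΛ (by positivity) (by linarith)
    linarith
  have : L.ε * L.J k a < 0 := by
    rw [abs_le] at *
    linarith
  exact neg_of_mul_neg_right this h.ε_pos.le

/-- A gap of size `√ε ^ θ` adds `-k² θ log √ε` to the expansion. The total coefficient of `-log √ε`
is then `1 - k² (1 - θ)`, which is at least `1 / 4`. -/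
theorem J_pos_of_close {θ : ℝ} (hJ0 : 0 ≤ L.ε * L.J₀ a) (hD : L.D k a = 0)
    (hΛ : 200 * M ^ 3 ≤ -log √L.ε) (hθ : k ^ 2 * (1 - θ) ≤ 3 / 4)
    (hg : fastR k L.ε * (a - L.ℓ) - L.p₀ a ≤ M * √L.ε ^ θ) : 0 < L.J k a := by
  have ha' := h.lt_of_le ha
  obtain ⟨b1, b2, b3, b4⟩ := h.bounded_terms hk ha
  have hJ := h.ε_J_approx hk ha hD
  have hle := h.error_le
  have hM := h.one_le
  have hM0 := h.M_pos
  have hk0 := h.k_pos k hk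
  have hkM := h.k_le k hk
  have hσ := h.sqrt_pos
  have m3 : 1 ≤ M ^ 3 := one_le_pow₀ hM
  have hpos : 0 < fastR k L.ε * (a - L.ℓ) - L.p₀ a := by linarith [h.p₀_lt k hk a ha']
  have hlog : log (fastR k L.ε * (a - L.ℓ) - L.p₀ a) ≤ M + θ * log √L.ε := by
    refine (Real.log_le_log hpos hg).trans ?_
    rw [Real.log_mul hM0.ne' (Real.rpow_pos_of_pos hσ θ).ne', Real.log_rpow hσ]
    linarith [Real.log_le_self hM0.le]
  have e1 : k ^ 2 * log (fastR k L.ε * (a - L.ℓ) - L.p₀ a) ≤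
      M ^ 3 + k ^ 2 * θ * log √L.ε := by
    calc _ ≤ k ^ 2 * (M + θ * log √L.ε) := by gcongr
      _ = k ^ 2 * M + k ^ 2 * θ * log √L.ε := by ring
      _ ≤ M ^ 2 * M + k ^ 2 * θ * log √L.ε := by gcongr
      _ = _ := by ring
  have e2 : 1 / 4 * (200 * M ^ 3) ≤ (1 - k ^ 2 * (1 - θ)) * -log √L.ε :=
    mul_le_mul (by linarith) hΛ (by positivity) (by linarith)
  have : 0 < L.ε * L.J k a := by
    rw [abs_le] at *
    linarith
  exact pos_of_mul_pos_right this h.ε_pos.le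

end Tame

end LeftData

end PWLCanard

/-! ### Saddle-node canard cycles from common zeros, and the smallness of `ε`. -/

namespace PWLCanard

namespace LeftData.Tame

variable {L : LeftData} {M : ℝ} {K : Set ℝ} {k a : ℝ} (h : L.Tame M K)
include h

/-- A common zero of the closing defect and of `∫ f'` is a saddle-node canard cycle. -/
theorem saddleNode_of_zero (hk : k ∈ K) (ha : |a| ≤ 9 / 10 * √L.ε) (hx : L.x₀ < -√L.ε)
    (hxr : ∀ b, |b| < √L.ε → L.x₀ ∈ Ioo (xr b k L.ε) (xs b k L.ε)) (hD : L.D k a = 0)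
    (hst : ∃ A B, A ≠ 0 ∧ B ≠ 0 ∧
      Stage k (L.s * √L.ε) L.ε a (-L.w k a) √L.ε (-L.w k a) 0 A B) :
    IsHatA k L.ε L.x₀ (L.s * √L.ε) a ∧
      ∃ Γ, IsCanardCycle a k (L.s * √L.ε) L.ε L.x₀ Γ ∧ IsSaddleNode a k (L.s * √L.ε) L.ε Γ := by
  have hε := h.ε_pos
  have hε1 : L.ε ≤ 1 := by linarith [h.ε_lt]
  have ha' := h.lt_of_le ha
  have hxa : L.x₀ < a := by linarith [(abs_lt.1 ha').1]
  have hw := (h.turn_w hk ha').w_pos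
  obtain ⟨ts, Tf, Tb, hs⟩ := h.shoot hk ha'
  have hV : (√L.ε - a) * √L.ε * gf L.s (L.r₁ k a) =
      (√L.ε + a) * √L.ε * gf (-L.s) (L.r₂ k a) := by
    unfold D at hD
    linear_combination √L.ε * hD
  rw [← hV] at hs
  obtain ⟨γ, T, hγ, hγ0, hT, hperT, hper, hwid, hnull, hsec⟩ :=
    hs.exists_orbit hε1 hxa (abs_lt.1 ha').2
  obtain ⟨A, B, hA, hB, hstage⟩ := hst
  obtain ⟨P, hP, hP2, hP0, hP1, hPn, hPa⟩ := hstage.saddleNode hε hε1 (by linarith) hA hB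
  have hlim := hs.isLimitCycle hε hε1 hxa hγ hγ0 hper hnull hsec
    (y₀ := L.s * √L.ε * (√L.ε - a) + -L.w k a) (by rw [f_sqrt hε]; ring) hP
    (hP2.comp (L.s * √L.ε * (√L.ε - a) + -L.w k a) (f := fun y : ℝ => (y, a))
      (contDiffAt_id.prodMk contDiffAt_const)) hP0 hP1 hPn
  have hcan : IsCanardCycle a k (L.s * √L.ε) L.ε L.x₀ (range γ) := ⟨hlim, hwid, hxr a ha'⟩
  have hmem : (√L.ε, L.s * √L.ε * (√L.ε - a) + -L.w k a) ∈ range γ :=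
    ⟨ts, by rw [hs.section_eq γ hγ hγ0, pt, f_sqrt hε]⟩
  refine ⟨⟨⟨ha', _, hcan⟩, fun a' ha'' ⟨Γ, hΓ⟩ => ?_⟩, _, hcan,
    ⟨_, P, hmem, hP, hP2, hP0, hP1, hPn, hPa⟩⟩
  obtain ⟨ts', Tf', Tb', hs'⟩ := h.shoot hk ha''
  have h1 := hs'.closes hε1 hΓ.1.1 hΓ.2.1
  refine h.D_zero_unique hk ha'' ha' ?_ hD
  have h2 : √L.ε * L.D k a' = 0 := by unfold D; linear_combination h1
  exact (mul_eq_zero.1 h2).resolve_left h.sqrt_pos.ne'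

theorem exists_saddleNode {k₁ k₂ : ℝ} (hle : k₁ ≤ k₂) (hK : Icc k₁ k₂ ⊆ K)
    (hx : L.x₀ < -√L.ε)
    (hxr : ∀ k ∈ K, ∀ b, |b| < √L.ε → L.x₀ ∈ Ioo (xr b k L.ε) (xs b k L.ε))
    (h₁ : ∀ a, |a| ≤ 9 / 10 * √L.ε → L.D k₁ a = 0 → 0 < L.J k₁ a)
    (h₂ : ∀ a, |a| ≤ 9 / 10 * √L.ε → L.D k₂ a = 0 → L.J k₂ a < 0)
    (hst : ∀ k ∈ Icc k₁ k₂, ∀ a, |a| ≤ 9 / 10 * √L.ε → L.D k a = 0 → L.J k a = 0 →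
      ∃ A B, A ≠ 0 ∧ B ≠ 0 ∧
        Stage k (L.s * √L.ε) L.ε a (-L.w k a) √L.ε (-L.w k a) 0 A B) :
    ∃ k ∈ K, ∃ a, |a| < √L.ε ∧ IsHatA k L.ε L.x₀ (L.s * √L.ε) a ∧
      ∃ Γ, IsCanardCycle a k (L.s * √L.ε) L.ε L.x₀ Γ ∧ IsSaddleNode a k (L.s * √L.ε) L.ε Γ := by
  have hσ := h.sqrt_pos
  have hmem : ∀ {a}, a ∈ Icc (-(9 / 10 * √L.ε)) (9 / 10 * √L.ε) → |a| < √L.ε :=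
    fun ha => h.lt_of_le (abs_le.2 ha)
  obtain ⟨k, hk, a, ha, hD, hJ⟩ := exists_common_zero hle (by positivity : 0 ≤ 9 / 10 * √L.ε)
    (fun k hk a ha => h.continuousAt_D (hK hk) (hmem ha))
    (fun k hk a ha => h.continuousAt_J (hK hk) (hmem ha))
    (fun k hk => h.strictAntiOn_D (hK hk))
    (fun k hk => h.D_pos (hK hk) (hmem ⟨le_rfl, by linarith⟩) le_rfl)
    (fun k hk => h.D_neg (hK hk) (hmem ⟨by linarith, le_rfl⟩) le_rfl)
    (fun a ha => h₁ a (abs_le.2 ha)) (fun a ha => h₂ a (abs_le.2 ha))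
  have ha' := abs_le.2 ha
  exact ⟨k, hK hk, a, hmem ha, h.saddleNode_of_zero (hK hk) ha' hx (hxr k (hK hk)) hD
    (hst k hk a ha' hD hJ)⟩

end LeftData.Tame

/-- Smallness of `ε` relative to a bound `M`. -/
theorem eventually_small (M : ℝ) (hM : 1 ≤ M) : ∀ᶠ ε : ℝ in 𝓝[>] 0,
    0 < ε ∧ ε < 1 / 4 ∧ 10 ^ 6 * M ^ 10 * √ε ≤ 1 ∧ exp (-(1 / (16 * M ^ 2 * ε))) ≤ ε ^ 8 ∧
      200 * M ^ 3 ≤ -log √ε := by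
  have hσ : Tendsto (fun ε : ℝ => √ε) (𝓝[>] 0) (𝓝[>] 0) := by
    refine tendsto_nhdsWithin_iff.2 ⟨?_, eventually_mem_nhdsWithin.mono fun ε hε => Real.sqrt_pos.2 hε⟩
    have := Real.continuous_sqrt.tendsto 0
    rw [Real.sqrt_zero] at this
    exact this.mono_left nhdsWithin_le_nhds
  have e1 : ∀ᶠ ε : ℝ in 𝓝[>] 0, √ε < 1 / (10 ^ 6 * M ^ 10) :=
    hσ.eventually (mem_nhdsWithin_of_mem_nhds (Iio_mem_nhds (by positivity)))
  have e2 : ∀ᶠ ε : ℝ in 𝓝[>] 0, log √ε ≤ -(200 * M ^ 3) :=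
    hσ.eventually (Real.tendsto_log_nhdsGT_zero.eventually_le_atBot _)
  have e3 : ∀ᶠ ε : ℝ in 𝓝[>] 0, ε < 1 / 4 :=
    mem_nhdsWithin_of_mem_nhds (Iio_mem_nhds (by norm_num))
  have hx : Tendsto (fun ε : ℝ => 1 / (16 * M ^ 2) * ε⁻¹) (𝓝[>] 0) atTop :=
    tendsto_inv_nhdsGT_zero.const_mul_atTop (by positivity)
  -- This is `y ^ 8 * exp (-y) → 0` at `y = 1 / (16 M² ε)`. The threshold `(1 / (16 M²)) ^ 8` is
  -- what turns `y ^ (-8)` into `ε ^ 8`.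
  have e4 := hx.eventually ((tendsto_pow_mul_exp_neg_atTop_nhds_zero 8).eventually_lt_const
    (by positivity : (0 : ℝ) < (1 / (16 * M ^ 2)) ^ 8))
  filter_upwards [e1, e2, e3, e4, self_mem_nhdsWithin] with ε h1 h2 h3 h4 (h0 : 0 < ε)
  refine ⟨h0, h3, ?_, ?_, by linarith⟩
  · rw [lt_div_iff₀ (by positivity)] at h1
    linarith
  · have h5 : 1 / (16 * M ^ 2) * ε⁻¹ = 1 / (16 * M ^ 2 * ε) := by field_simp
    rw [mul_pow, mul_assoc, h5, inv_pow] at h4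
    have h6 := lt_of_mul_lt_mul_left (h4.trans_eq (mul_one _).symm) (by positivity)
    rw [inv_mul_lt_iff₀ (by positivity), mul_one] at h6
    exact h6.le

end PWLCanard

/-! ### Cycles without head. -/

namespace PWLCanard

section Bounds

variable {k ε : ℝ} (hε : 0 < ε) (hk0 : 0 < k) (hk : 4 * ε < k ^ 2)
include hε hk0 hk

theorem fastR_bounds : k / 2 < fastR k ε ∧ fastR k ε < k ∧ lamL k ε * k < 2 * ε := by
  have h1 := lamL_pos hε hk0
  have h2 := lamL_lt_fastR hk
  have h3 := lamL_add_fastR k ε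
  have h4 := lamL_mul_fastR hk
  refine ⟨by linarith, by linarith, by nlinarith⟩

/-- In the slow first integral the exponential is at least one, and the initial speed is
nonnegative. Dropping both leaves the stated bound. -/
theorem expV_ge {h v d : ℝ} (hd : d < h) (hd0 : 0 < d) (hv : 0 ≤ v) :
    fastR k ε * (h - d) ≤ expV ε k h v d := by
  have h1 := expand_slow hε hk0 hk hd hd0 hv
  have h2 := (leg_expand hε hk0 hk hd hd0 hv).pos
  have h3 : 1 ≤ exp (lamL k ε * expT ε k h v d) :=
    Real.one_le_exp (mul_pos (lamL_pos hε hk0) h2).le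
  have h4 : 0 < fastR k ε * h :=
    mul_pos (by linarith [fastR_bounds hε hk0 hk]) (hd0.trans hd)
  have h5 := le_mul_of_one_le_right (by linarith : 0 ≤ v + fastR k ε * h) h3
  linarith

end Bounds

/-- The orbit starts in the middle zone, at the line `x = x₀` itself. -/
noncomputable def headlessData (s x₀ ε : ℝ) : LeftData := ⟨s, ε, x₀, x₀, 0, 0, 0⟩

theorem headless_tame {s x₀ ε M : ℝ} (hs : s ^ 2 = 1) (hx : x₀ ∈ Ioo (-1) 0)
    (hM2 : 2 ≤ M) (hM : 2 ≤ M * -x₀) (hε : 0 < ε) (hε1 : ε < 1 / 4)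
    (hsmall : 10 ^ 6 * M ^ 10 * √ε ≤ 1) (htiny : exp (-(1 / (16 * M ^ 2 * ε))) ≤ ε ^ 8) :
    (headlessData s x₀ ε).Tame M (Ioo (1 / 2) 2) ∧ 10 ^ 6 * √ε ≤ -x₀ ∧ ε ≤ 1 / 10 ^ 6 * √ε ∧
      √ε ≤ 1 / 10 ^ 6 := by
  have hσ := Real.sqrt_pos.2 hε
  have hx0 : 0 < -x₀ := by linarith [hx.2]
  have hMσ : 10 ^ 6 * (M * √ε) ≤ 1 := by
    refine le_trans ?_ hsmall
    have : M ≤ M ^ 10 := le_self_pow₀ (by linarith) (by norm_num)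
    rw [mul_assoc]
    gcongr
  have hσ1 : √ε ≤ 1 / 10 ^ 6 := by nlinarith
  have hσx : 10 ^ 6 * √ε ≤ -x₀ := by
    have : M * (10 ^ 6 * √ε) ≤ M * -x₀ := by linarith
    exact le_of_mul_le_mul_left this (by linarith)
  have hεσ : ε ≤ 1 / 10 ^ 6 * √ε := by
    have := Real.mul_self_sqrt hε.le
    nlinarith
  have hkk : ∀ k ∈ Ioo (1 / 2 : ℝ) 2, 0 < k ∧ 4 * ε < k ^ 2 := fun k hk =>
    ⟨by linarith [hk.1], by nlinarith [hk.1]⟩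
  have hμ : ∀ k ∈ Ioo (1 / 2 : ℝ) 2, 1 / 4 < fastR k ε := fun k hk => by
    have := (fastR_bounds hε (hkk k hk).1 (hkk k hk).2).1
    linarith [hk.1]
  have hh : ∀ a, |a| < √ε → 4 * √ε ≤ a - x₀ := fun a ha => by linarith [(abs_lt.1 ha).1]
  refine ⟨?_, hσx, hεσ, hσ1⟩
  constructor
  · constructor
    · exact isOpen_Ioo
    · exact hs
    · exact hε
    · change 4 * ε < 1
      linarith
    · exact fun k hk => (hkk k hk).1
    · exact fun k hk => (hkk k hk).2
    · change x₀ < -√ε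
      linarith
    · exact hx.1.le
    · exact fun _ _ => le_rfl
    · exact fun _ _ => le_rfl
    · intro k hk a ha
      have := hh a ha
      change 0 < fastR k ε * (a - x₀)
      exact mul_pos (by linarith [hμ k hk]) (by linarith)
    · intro k hk a ha
      have h1 := hh a ha
      obtain ⟨h2, h3⟩ := abs_lt.1 ha
      change -√ε < a at h2
      have h4 := expV_ge hε (hkk k hk).1 (hkk k hk).2 (by linarith : √ε + a < a - x₀)
        (by linarith) le_rfl
      have h5 : 1 / 4 * (a - x₀ - (√ε + a)) ≤ fastR k ε * (a - x₀ - (√ε + a)) :=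
        mul_le_mul_of_nonneg_right (hμ k hk).le (by linarith)
      change 16 * ε < expV ε k (a - x₀) 0 (√ε + a)
      linarith
    · exact fun _ _ => contDiffAt_const
    · exact fun _ _ => contDiffAt_const
    · exact fun _ _ => contDiffAt_const
    · exact fun _ _ _ _ => ⟨0, upTo_refl⟩
    · exact fun _ _ _ _ => ⟨0, downTo_refl⟩
  · linarith
  · exact hsmall
  · exact htiny
  · intro k hk
    nlinarith [hk.1]
  · intro k hk
    linarith [hk.2]
  · exact hM
  · exact fun _ _ => zero_le_one
  · exact fun _ _ => by change (0 : ℝ) ≤ M; linarith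
  · intro a _
    change |(0 : ℝ) * _| ≤ M
    rw [zero_mul, abs_zero]; linarith
  · intro a _
    change |(0 : ℝ) * _| ≤ M
    rw [zero_mul, abs_zero]; linarith
  · intro k hk a ha
    have h1 := hh a ha
    change 4 * fastR k ε * √ε ≤ fastR k ε * (a - x₀) - 0
    have : fastR k ε * (4 * √ε) ≤ fastR k ε * (a - x₀) :=
      mul_le_mul_of_nonneg_left h1 (by linarith [hμ k hk])
    linarith

/-- The logarithm costs only a square root: `σ (-log σ) ≤ 2 √σ`. So the threshold for `2 log k` in
the nondegeneracy argument, of order `√ε`, is far below its actual size, of order `1 / Λ`. -/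
theorem sqrt_mul_neg_log_le {M ε : ℝ} (hM : 1 ≤ M) (hε : 0 < ε) (hsmall : 10 ^ 6 * M ^ 10 * √ε ≤ 1) :
    10 ^ 3 * M ^ 3 * (√ε * -log √ε) ≤ 2 / M ^ 2 := by
  have hσ := Real.sqrt_pos.2 hε
  have hτ := Real.sqrt_pos.2 hσ
  have h1 : √(√ε) ^ 2 = √ε := Real.sq_sqrt hσ.le
  have h2 : 10 ^ 3 * M ^ 5 * √(√ε) ≤ 1 := by
    have : (10 ^ 3 * M ^ 5 * √(√ε)) ^ 2 ≤ 1 := by rw [mul_pow, h1]; linarith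
    exact (sq_le_one_iff₀ (by positivity)).1 this
  have h3 : √ε * -log √ε ≤ 2 * √(√ε) := by
    have h4 := Real.log_le_self (x := (√(√ε))⁻¹) (by positivity)
    rw [Real.log_inv] at h4
    have h5 : log √ε = 2 * log √(√ε) := by
      nth_rewrite 1 [← h1]; rw [Real.log_pow]; norm_num
    rw [h5]
    calc √ε * -(2 * log √(√ε)) = 2 * √ε * -log √(√ε) := by ring
      _ ≤ 2 * √ε * (√(√ε))⁻¹ := by gcongr
      _ = 2 * √(√ε) := by nth_rewrite 1 [← h1]; field_simp
  rw [le_div_iff₀ (by positivity)]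
  calc _ ≤ 10 ^ 3 * M ^ 3 * (2 * √(√ε)) * M ^ 2 := by gcongr
    _ = 2 * (10 ^ 3 * M ^ 5 * √(√ε)) := by ring
    _ ≤ 2 := by linarith

/-- The search runs over `k = exp (κ / (2Λ))` with `κ` between `Q - 1` and `Q + 1`. By `J_headless`
the sign of `J` changes there, as the error is at most `1 / 2`. Since `|Q| ≥ 1.8`, the value `κ =
0`, where `k = 1` and the second derivative could vanish, is excluded. -/
theorem eventually_headless {s x₀ : ℝ} (hs : s ^ 2 = 1) (hx : x₀ ∈ Ioo (-1) 0) :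
    ∀ᶠ ε : ℝ in 𝓝[>] 0, ∃ k, 0 < k ∧ 4 * ε < k ^ 2 ∧ ∃ a, IsHatA k ε x₀ (s * √ε) a ∧
      (x₀ ∈ Ioo (xr a k ε) (xu a ε) ∪ Ioo (-1) (xs a k ε)) ∧
      ∃ Γ, IsCanardCycle a k (s * √ε) ε x₀ Γ ∧ IsSaddleNode a k (s * √ε) ε Γ := by
  have hx0 : 0 < -x₀ := by linarith [hx.2]
  have hM0 : 0 < 2 / -x₀ := by positivity
  set M := 3 + 2 / -x₀ with hMdef
  have hM3 : 3 ≤ M := by linarith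
  have hM : 2 ≤ M * -x₀ := by
    have : 2 / -x₀ * -x₀ = 2 := div_mul_cancel₀ _ hx0.ne'
    rw [hMdef, add_mul, this]; linarith
  filter_upwards [eventually_small M (by linarith)] with ε hε
  obtain ⟨hε, hε1, hsmall, htiny, hΛ⟩ := hε
  obtain ⟨h, hσx, hεσ, hσ1⟩ := headless_tame hs hx (by linarith) hM hε hε1 hsmall htiny
  have hσ := Real.sqrt_pos.2 hε
  have hσΛ := sqrt_mul_neg_log_le (by linarith) hε hsmall
  have hΛM : 200 * M ≤ -log √ε := by
    have : M ≤ M ^ 3 := le_self_pow₀ (by linarith) (by norm_num)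
    linarith
  set Λ := -log √ε with hΛdef
  have hΛ0 : 0 < Λ := by linarith
  obtain ⟨hQ1, hQ2⟩ := LeftData.logQ_bounds hs
  set Q := LeftData.logQ s with hQ
  -- This `k` is the solution of `2 log k * Λ = κ`. The size of `Λ` keeps it in the interval where
  -- the data are tame.
  have hexp : ∀ κ : ℝ, |κ| ≤ 3 → exp (κ / (2 * Λ)) ∈ Ioo (1 / 2 : ℝ) 2 ∧
      2 * log (exp (κ / (2 * Λ))) * Λ = κ := fun κ hκ => by
    have h1 : |κ / (2 * Λ)| ≤ 1 / 100 := by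
      rw [abs_div, abs_of_pos (by linarith : 0 < 2 * Λ), div_le_iff₀ (by linarith)]
      linarith
    obtain ⟨h2, h3⟩ := abs_le.1 h1
    refine ⟨⟨by linarith [Real.add_one_le_exp (κ / (2 * Λ))], ?_⟩, ?_⟩
    · have h4 := Real.add_one_le_exp (-(κ / (2 * Λ)))
      rw [Real.exp_neg] at h4
      have h5 : (1 / 2 : ℝ) < (exp (κ / (2 * Λ)))⁻¹ := by linarith
      rw [lt_inv_comm₀ (by norm_num) (exp_pos _)] at h5
      linarith
    · rw [Real.log_exp]; field_simp
  have hQ3 := abs_le.1 hQ2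
  have hκ1 : |Q - 1| ≤ 3 := by rw [abs_le]; constructor <;> linarith [hQ3.1, hQ3.2]
  have hκ2 : |Q + 1| ≤ 3 := by rw [abs_le]; constructor <;> linarith [hQ3.1, hQ3.2]
  obtain ⟨m1, l1⟩ := hexp _ hκ1
  obtain ⟨m2, l2⟩ := hexp _ hκ2
  have hle : exp ((Q - 1) / (2 * Λ)) ≤ exp ((Q + 1) / (2 * Λ)) := by gcongr; linarith
  have hK : ∀ k ∈ Ioo (1 / 2 : ℝ) 2, 0 < k ∧ 4 * ε < k ^ 2 := fun k hk =>
    ⟨h.k_pos k hk, h.lt_k k hk⟩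
  obtain ⟨k, hk, a, ha, hhat, hcyc⟩ := h.exists_saddleNode (k₁ := exp ((Q - 1) / (2 * Λ)))
    (k₂ := exp ((Q + 1) / (2 * Λ))) hle (fun k hk => ⟨m1.1.trans_le hk.1, hk.2.trans_lt m2.2⟩)
    h.ℓ_lt
    (fun k hk b hb => by
      obtain ⟨hk0, hk4⟩ := hK k hk
      obtain ⟨b1, b2⟩ := abs_lt.1 hb
      change -√ε < b at b1
      change b < √ε at b2
      obtain ⟨-, -, h3⟩ := fastR_bounds hε hk0 hk4
      have h4 := lamL_pos hε hk0
      have h5 : lamL k ε ≤ 4 * ε := by nlinarith [hk.1]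
      have h6 : lamL k ε * (√ε + b) ≤ 1 * (√ε + b) := by
        gcongr
        · linarith
        · linarith
      have h7 : 0 < lamL k ε * (√ε + b) := mul_pos h4 (by linarith)
      constructor
      · change -(1 + k) + k * √ε - lamL k ε * (√ε + b) < x₀
        have : k * √ε ≤ k * 1 := by gcongr; linarith
        linarith [hx.1]
      · change x₀ < -√ε - lamL k ε * (√ε + b)
        linarith)
    (fun a ha hD => by
      have := (abs_le.1 (h.J_headless m1 ha rfl rfl rfl hD hκ1 l1 hΛM)).1
      have : 0 < ε * (headlessData s x₀ ε).J (exp ((Q - 1) / (2 * Λ))) a := by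
        change -(1 / 2) ≤ ε * _ - (Q - (Q - 1)) at this
        linarith
      exact pos_of_mul_pos_right this hε.le)
    (fun a ha hD => by
      have := (abs_le.1 (h.J_headless m2 ha rfl rfl rfl hD hκ2 l2 hΛM)).2
      have : ε * (headlessData s x₀ ε).J (exp ((Q + 1) / (2 * Λ))) a < 0 := by
        change ε * _ - (Q - (Q + 1)) ≤ 1 / 2 at this
        linarith
      exact neg_of_mul_neg_right this hε.le)
    (fun k hk a ha hD hJ => by
      have hkK : k ∈ Ioo (1 / 2 : ℝ) 2 := ⟨m1.1.trans_le hk.1, hk.2.trans_lt m2.2⟩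
      refine h.saddleNode_of_headless hkK ha hx.1 rfl rfl rfl hD hJ ?_
      change 10 ^ 3 * M ^ 3 * √ε ≤ |2 * log k|
      have hk0 := h.k_pos k hkK
      have g1 := mul_le_mul_of_nonneg_right (Real.log_le_log (exp_pos _) hk.1) hΛ0.le
      have g2 := mul_le_mul_of_nonneg_right (Real.log_le_log hk0 hk.2) hΛ0.le
      -- The number `2 log k * Λ` lies between `Q - 1` and `Q + 1`, hence at distance at least `0.8`
      -- from zero.
      have g3 : 0.8 ≤ |2 * log k| * Λ := by
        have : 0.8 ≤ |2 * log k * Λ| := by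
          rcases le_total 0 Q with hQ0 | hQ0
          · rw [abs_of_nonneg hQ0] at hQ1
            exact le_trans (by linarith) (le_abs_self _)
          · rw [abs_of_nonpos hQ0] at hQ1
            exact le_trans (by linarith) (neg_le_abs _)
        rwa [abs_mul, abs_of_pos hΛ0] at this
      have g4 : 2 / M ^ 2 ≤ 0.8 := by
        rw [div_le_iff₀ (by positivity)]; nlinarith
      have g5 : 10 ^ 3 * M ^ 3 * √ε * Λ ≤ |2 * log k| * Λ := by linarith
      exact le_of_mul_le_mul_right g5 hΛ0)
  have hk' := hK k hk
  refine ⟨k, hk'.1, hk'.2, a, hhat, Or.inr ⟨hx.1, ?_⟩, hcyc⟩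
  obtain ⟨Γ, hΓ, -⟩ := hcyc
  exact hΓ.2.2.2

end PWLCanard

/-! ### The orbit in the far left zone. -/

namespace PWLCanard

/-- The velocity at `x = -1` of the forward orbit through the point of the nullcline over `x₀`. -/
noncomputable def farQ (x₀ ε a : ℝ) : ℝ := conV ε 1 (a - x₀) 0 (1 + a)

/-- The time after which the orbit of `farQ` reaches `x = -1`. -/
noncomputable def farTq (x₀ ε a : ℝ) : ℝ := conT ε 1 (a - x₀) 0 (1 + a)

/-- The speed at `x = -1` of the backward orbit through the point of the nullcline over `x₀`. -/
noncomputable def farP (x₀ ε a : ℝ) : ℝ := expV ε 1 (a - x₀) 0 (1 + a)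

/-- The time after which the backward orbit of `farP` reaches `x = -1`. -/
noncomputable def farTp (x₀ ε a : ℝ) : ℝ := expT ε 1 (a - x₀) 0 (1 + a)

section Far

variable {x₀ ε a : ℝ} (hε : 0 < ε) (hx : x₀ < -1) (hσ : √ε ≤ 1 / 10 ^ 6)

include hε hσ in
theorem le_of_sqrt_le : ε ≤ 1 / 10 ^ 6 * √ε ∧ 4 * ε < 1 ^ 2 := by
  have := Real.mul_self_sqrt hε.le
  have := Real.sqrt_pos.2 hε
  constructor <;> nlinarith

variable (ha : |a| < √ε)
include hε hx hσ ha

omit hε in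
theorem far_lt : 1 + a < a - x₀ ∧ 0 < 1 + a := by
  obtain ⟨h1, h2⟩ := abs_lt.1 ha
  constructor <;> linarith

theorem leg_farQ : Leg 1 ε (nodeC (-lamL 1 ε) (-fastR 1 ε)) (nodeS (-lamL 1 ε) (-fastR 1 ε))
    (x₀ - a) 0 (-1 - a) (farQ x₀ ε a) (farTq x₀ ε a) := by
  obtain ⟨h1, h2⟩ := far_lt hx hσ ha
  have hk := (le_of_sqrt_le hε hσ).2
  have := leg_contract hε one_pos hk h1 h2 le_rfl
    (mul_pos (by linarith [fastR_bounds hε one_pos hk]) (h2.trans h1))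
  rwa [neg_sub, neg_add'] at this

theorem leg_farP : Leg (-1) ε (nodeC (lamL 1 ε) (fastR 1 ε)) (nodeS (lamL 1 ε) (fastR 1 ε))
    (x₀ - a) 0 (-1 - a) (farP x₀ ε a) (farTp x₀ ε a) := by
  obtain ⟨h1, h2⟩ := far_lt hx hσ ha
  have := leg_expand hε one_pos (le_of_sqrt_le hε hσ).2 h1 h2 le_rfl
  rwa [neg_sub, neg_add'] at this

theorem smooth_far : ContDiffAt ℝ 1 (farQ x₀ ε) a ∧ ContDiffAt ℝ 1 (farTq x₀ ε) a ∧
    ContDiffAt ℝ 1 (farP x₀ ε) a ∧ ContDiffAt ℝ 1 (farTp x₀ ε) a := by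
  have hk := (le_of_sqrt_le hε hσ).2
  have hev : ∀ᶠ b in 𝓝 a, |b| < √ε := continuous_abs.continuousAt.eventually_lt_const ha
  have e1 := hev.mono fun b hb => show (0 : ℝ) < 1 ∧ 4 * ε < 1 ^ 2 ∧ 1 + b < b - x₀ ∧ 0 < 1 + b ∧
    (0 : ℝ) ≤ 0 from ⟨one_pos, hk, (far_lt hx hσ hb).1, (far_lt hx hσ hb).2, le_rfl⟩
  have e2 := e1.mono fun b hb => show (0 : ℝ) < 1 ∧ 4 * ε < 1 ^ 2 ∧ 1 + b < b - x₀ ∧ 0 < 1 + b ∧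
    (0 : ℝ) ≤ 0 ∧ 0 < fastR 1 ε * (b - x₀) from ⟨hb.1, hb.2.1, hb.2.2.1, hb.2.2.2.1, hb.2.2.2.2,
      mul_pos (by linarith [fastR_bounds hε one_pos hk]) (hb.2.2.2.1.trans hb.2.2.1)⟩
  have h1 : ContDiffAt ℝ 1 (fun b : ℝ => b - x₀) a := contDiffAt_id.sub contDiffAt_const
  have h2 : ContDiffAt ℝ 1 (fun b : ℝ => 1 + b) a := contDiffAt_const.add contDiffAt_id
  exact ⟨contDiffAt_conV hε contDiffAt_const h1 contDiffAt_const h2 e2,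
    contDiffAt_conT hε contDiffAt_const h1 contDiffAt_const h2 e2,
    contDiffAt_expV hε contDiffAt_const h1 contDiffAt_const h2 e1,
    contDiffAt_expT hε contDiffAt_const h1 contDiffAt_const h2 e1⟩

theorem deriv_farQ : farQ x₀ ε a * deriv (farQ x₀ ε) a =
    exp (-farTq x₀ ε a) * (ε * (a - x₀)) + farQ x₀ ε a - ε * (1 + a) := by
  obtain ⟨s1, s2, -, -⟩ := smooth_far hε hx hσ ha
  have hl := leg_farQ hε hx hσ ha
  have hev : ∀ᶠ b in 𝓝 a, |b| < √ε := continuous_abs.continuousAt.eventually_lt_const ha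
  have e : farQ x₀ ε = fun b => linV 1 ε (nodeC (-lamL 1 ε) (-fastR 1 ε))
      (nodeS (-lamL 1 ε) (-fastR 1 ε)) (x₀ - b) 0 (farTq x₀ ε b) := by
    funext b; rw [← neg_sub]; rfl
  have := (hl.fund.hasDerivAt_transit (ℓ₁ := -1)
    (s2.differentiableAt (by norm_num)).hasDerivAt (hasDerivAt_const a (0 : ℝ)) (hasDerivAt_id' a)
    (hev.mono fun b hb => (leg_farQ hε hx hσ hb).linX_eq) hl.linV_eq hl.exit_pos.ne').2
  rw [← e] at this
  rw [this.deriv, one_mul]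
  field_simp [hl.exit_pos.ne']
  ring

theorem deriv_farP : farP x₀ ε a * deriv (farP x₀ ε) a =
    exp (farTp x₀ ε a) * (ε * (a - x₀)) - farP x₀ ε a - ε * (1 + a) := by
  obtain ⟨-, -, s1, s2⟩ := smooth_far hε hx hσ ha
  have hl := leg_farP hε hx hσ ha
  have hev : ∀ᶠ b in 𝓝 a, |b| < √ε := continuous_abs.continuousAt.eventually_lt_const ha
  have e : farP x₀ ε = fun b => linV (-1) ε (nodeC (lamL 1 ε) (fastR 1 ε))
      (nodeS (lamL 1 ε) (fastR 1 ε)) (x₀ - b) 0 (farTp x₀ ε b) := by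
    funext b; rw [← neg_sub]; rfl
  have := (hl.fund.hasDerivAt_transit (ℓ₁ := -1)
    (s2.differentiableAt (by norm_num)).hasDerivAt (hasDerivAt_const a (0 : ℝ)) (hasDerivAt_id' a)
    (hev.mono fun b hb => (leg_farP hε hx hσ hb).linX_eq) hl.linV_eq hl.exit_pos.ne').2
  rw [← e] at this
  rw [this.deriv, neg_mul, neg_neg, one_mul]
  field_simp [hl.exit_pos.ne']
  ring

/-- Forwards the orbit comes down along the slow direction: it reaches `x = -1` with speed `O(ε)`.
The slow integral bounds `ε` times the duration by a constant depending on `x₀`, which is why this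
time appears in the expansion of `ε J`. -/
theorem farQ_bounds : farQ x₀ ε a ≤ 4 * ε ∧ |farQ x₀ ε a * deriv (farQ x₀ ε) a| ≤ -x₀ + 10 ∧
    ε * farTq x₀ ε a ≤ 8 * (1 - x₀) := by
  obtain ⟨h1, h2⟩ := far_lt hx hσ ha
  obtain ⟨hε1, hk⟩ := le_of_sqrt_le hε hσ
  obtain ⟨m1, m2, m3⟩ := fastR_bounds hε one_pos hk
  have m4 := lamL_pos hε one_pos
  have m5 := lamL_mul_fastR hk
  have hl := leg_farQ hε hx hσ ha
  have hv : 0 < fastR 1 ε * (a - x₀) := mul_pos (by linarith) (h2.trans h1)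
  have c1 := contract_slow hε one_pos hk h1 h2 le_rfl hv
  have c2 := contract_fast hε one_pos hk h1 h2 le_rfl hv
  change _ - farQ x₀ ε a = (_ - 0) * exp (-(_ * farTq x₀ ε a)) at c1 c2
  obtain ⟨b1, b2⟩ := abs_lt.1 ha
  have hq : farQ x₀ ε a ≤ lamL 1 ε * (1 + a) := by
    have : 0 < (lamL 1 ε * (a - x₀) - 0) * exp (-(fastR 1 ε * farTq x₀ ε a)) := by
      rw [sub_zero]
      exact mul_pos (mul_pos m4 (h2.trans h1)) (exp_pos _)
    linarith
  have hq2 : farQ x₀ ε a ≤ 4 * ε := by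
    have : lamL 1 ε * (1 + a) ≤ (2 * ε) * 2 := by
      apply mul_le_mul <;> linarith
    linarith
  have hq0 := hl.exit_pos
  have ht := hl.pos
  have hW := h2.trans h1
  refine ⟨hq2, ?_, ?_⟩
  · rw [deriv_farQ hε hx hσ ha]
    have e1 : exp (-farTq x₀ ε a) ≤ 1 := Real.exp_le_one_iff.2 (by linarith)
    have e2 : exp (-farTq x₀ ε a) * (ε * (a - x₀)) ≤ 1 * (1 * (a - x₀)) := by
      have := hW.le
      gcongr
      linarith
    have e3 : 0 ≤ exp (-farTq x₀ ε a) * (ε * (a - x₀)) :=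
      mul_nonneg (exp_pos _).le (mul_pos hε (h2.trans h1)).le
    have e4 : ε * (1 + a) ≤ 1 * 2 := by apply mul_le_mul <;> linarith
    have e5 : 0 < ε * (1 + a) := mul_pos hε h2
    rw [abs_le]
    constructor <;> linarith
  · have e1 : 1 / 8 ≤ fastR 1 ε * (1 + a) - farQ x₀ ε a := by
      have : (1 / 2 : ℝ) * (1 / 2) ≤ fastR 1 ε * (1 + a) := by
        apply mul_le_mul <;> linarith
      linarith
    have e2 : (fastR 1 ε * (1 + a) - farQ x₀ ε a) * exp (lamL 1 ε * farTq x₀ ε a) =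
        fastR 1 ε * (a - x₀) := by
      rw [c1, sub_zero, mul_assoc, ← Real.exp_add, neg_add_cancel, Real.exp_zero, mul_one]
    have e3 := mul_le_mul_of_nonneg_right e1 (exp_pos (lamL 1 ε * farTq x₀ ε a)).le
    have e4 : fastR 1 ε * (a - x₀) ≤ 1 * (1 - x₀) := by
      apply mul_le_mul <;> linarith
    have e5 := Real.add_one_le_exp (lamL 1 ε * farTq x₀ ε a)
    have e6 : ε * farTq x₀ ε a ≤ lamL 1 ε * farTq x₀ ε a := by
      gcongr
      nlinarith
    linarith

/-- Backwards the orbit leaves along the fast direction. The slow factor over the duration is `1 +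
O(√ε)`, so the slow integral gives an arrival speed close to `-1 - x₀`. The product of both
integrals controls `exp (farTp)`, and through it the derivative. -/
theorem farP_bounds : (1 - 2 * ε) * (-1 - x₀) ≤ farP x₀ ε a ∧
    farP x₀ ε a ≤ -1 - x₀ + 32 * √ε * (1 - x₀) ∧
    |farP x₀ ε a * deriv (farP x₀ ε) a| ≤ 8 * (2 - x₀) ^ 2 ∧ ε * farTp x₀ ε a ≤ 1 := by
  obtain ⟨h1, h2⟩ := far_lt hx hσ ha
  obtain ⟨hε1, hk⟩ := le_of_sqrt_le hε hσ
  obtain ⟨m1, m2, m3⟩ := fastR_bounds hε one_pos hk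
  have m4 := lamL_pos hε one_pos
  have m5 := lamL_mul_fastR hk
  have m6 := lamL_add_fastR 1 ε
  have hl := leg_farP hε hx hσ ha
  have c1 := expand_slow hε one_pos hk h1 h2 le_rfl
  have c2 := expand_fast hε one_pos hk h1 h2 le_rfl
  change farP x₀ ε a + _ = (0 + _) * exp (_ * farTp x₀ ε a) at c1 c2
  rw [zero_add] at c1 c2
  obtain ⟨b1, b2⟩ := abs_lt.1 ha
  have hs := Real.sqrt_pos.2 hε
  have hW := h2.trans h1
  have ht := hl.pos
  have hp := hl.exit_pos
  have hlε : ε ≤ lamL 1 ε := by nlinarith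
  have hE : exp ((fastR 1 ε - lamL 1 ε) * farTp x₀ ε a) ≤ 1 / ε := by
    have i1 : lamL 1 ε * (1 + a) ≤ fastR 1 ε * (1 + a) := by gcongr; linarith
    have i2 : lamL 1 ε * (a - x₀) * exp (fastR 1 ε * farTp x₀ ε a) ≤
        fastR 1 ε * (a - x₀) * exp (lamL 1 ε * farTp x₀ ε a) := by linarith
    have i3 : exp (fastR 1 ε * farTp x₀ ε a) = exp ((fastR 1 ε - lamL 1 ε) * farTp x₀ ε a) *
        exp (lamL 1 ε * farTp x₀ ε a) := by rw [← Real.exp_add]; ring_nf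
    rw [i3, ← mul_assoc] at i2
    have i4 := le_of_mul_le_mul_right i2 (exp_pos _)
    have i5 : (lamL 1 ε * exp ((fastR 1 ε - lamL 1 ε) * farTp x₀ ε a)) * (a - x₀) ≤
        fastR 1 ε * (a - x₀) := by linarith
    have i6 := le_of_mul_le_mul_right i5 hW
    rw [le_div_iff₀ hε]
    have i7 : ε * exp ((fastR 1 ε - lamL 1 ε) * farTp x₀ ε a) ≤
        lamL 1 ε * exp ((fastR 1 ε - lamL 1 ε) * farTp x₀ ε a) := by gcongr
    linarith
  have hlt : lamL 1 ε * farTp x₀ ε a ≤ 16 * √ε := by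
    have i1 := (Real.le_log_iff_exp_le (by positivity)).2 hE
    have i2 : log (1 / ε) ≤ 2 * (1 / √ε) := by
      have i3 : (1 / ε) = (1 / √ε) ^ 2 := by rw [div_pow, Real.sq_sqrt hε.le, one_pow]
      rw [i3, Real.log_pow]
      have := Real.log_le_self (x := 1 / √ε) (by positivity)
      push_cast; linarith
    have i4 : (1 / 4) * farTp x₀ ε a ≤ (fastR 1 ε - lamL 1 ε) * farTp x₀ ε a := by
      gcongr; linarith
    have i5 : farTp x₀ ε a ≤ 8 * (1 / √ε) := by linarith
    calc _ ≤ (2 * ε) * (8 * (1 / √ε)) := by gcongr; linarith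
      _ = 16 * √ε := by
        nth_rewrite 1 [← Real.sq_sqrt hε.le]; field_simp; ring
  have hlt0 : 0 ≤ lamL 1 ε * farTp x₀ ε a := (mul_pos m4 ht).le
  have hexp : exp (lamL 1 ε * farTp x₀ ε a) ≤ 1 + 32 * √ε := by
    refine (Real.exp_bound_div_one_sub_of_interval hlt0 (by linarith)).trans ?_
    rw [div_le_iff₀ (by linarith)]
    nlinarith
  have hexp1 := Real.one_le_exp hlt0
  have hlow : fastR 1 ε * (a - x₀) ≤ fastR 1 ε * (a - x₀) * exp (lamL 1 ε * farTp x₀ ε a) :=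
    le_mul_of_one_le_right (mul_pos (by linarith) hW).le hexp1
  have hupp : farP x₀ ε a ≤ -1 - x₀ + 32 * √ε * (1 - x₀) := by
    have i1 : fastR 1 ε * (a - x₀) * exp (lamL 1 ε * farTp x₀ ε a) ≤
        fastR 1 ε * (a - x₀) * (1 + 32 * √ε) :=
      mul_le_mul_of_nonneg_left hexp (mul_pos (by linarith) hW).le
    have i2 : fastR 1 ε * (-1 - x₀) ≤ 1 * (-1 - x₀) :=
      mul_le_mul_of_nonneg_right m2.le (by linarith)
    have i3 : fastR 1 ε * (a - x₀) ≤ 1 * (1 - x₀) := by apply mul_le_mul <;> linarith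
    have i4 : fastR 1 ε * (a - x₀) * (32 * √ε) ≤ 1 * (1 - x₀) * (32 * √ε) := by gcongr
    linarith
  refine ⟨?_, hupp, ?_, ?_⟩
  · have : (1 - 2 * ε) * (-1 - x₀) ≤ fastR 1 ε * (-1 - x₀) :=
      mul_le_mul_of_nonneg_right (by linarith) (by linarith)
    linarith
  · rw [deriv_farP hε hx hσ ha]
    have i1 : (farP x₀ ε a + fastR 1 ε * (1 + a)) * (farP x₀ ε a + lamL 1 ε * (1 + a)) =
        exp (farTp x₀ ε a) * (ε * (a - x₀)) * (a - x₀) := by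
      have i2 : exp (farTp x₀ ε a) = exp (lamL 1 ε * farTp x₀ ε a) *
          exp (fastR 1 ε * farTp x₀ ε a) := by
        rw [← Real.exp_add, ← add_mul, m6, one_mul]
      rw [c1, c2, i2]
      linear_combination (a - x₀) ^ 2 * exp (lamL 1 ε * farTp x₀ ε a) *
        exp (fastR 1 ε * farTp x₀ ε a) * m5
    have i3 : 32 * √ε * (1 - x₀) ≤ 1 * (1 - x₀) :=
      mul_le_mul_of_nonneg_right (by linarith) (by linarith)
    have i0 : fastR 1 ε * (1 + a) ≤ 1 * 2 := by apply mul_le_mul <;> linarith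
    have i0' : lamL 1 ε * (1 + a) ≤ 1 * 2 := by apply mul_le_mul <;> linarith
    have p1 : 0 < fastR 1 ε * (1 + a) := mul_pos (by linarith) h2
    have p2 : 0 < lamL 1 ε * (1 + a) := mul_pos m4 h2
    set X := exp (farTp x₀ ε a) * (ε * (a - x₀)) with hX
    have hX0 : 0 < X := mul_pos (exp_pos _) (mul_pos hε hW)
    have i4 : X * (1 / 2) ≤ (4 - 2 * x₀) * (4 - 2 * x₀) := by
      calc X * (1 / 2) ≤ X * (a - x₀) := by gcongr; linarith
        _ ≤ _ := by
          rw [← i1]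
          apply mul_le_mul <;> linarith
    have e4 : ε * (1 + a) ≤ 1 * 2 := by apply mul_le_mul <;> linarith
    have e5 : 0 < ε * (1 + a) := mul_pos hε h2
    rw [abs_le]
    constructor <;> nlinarith
  · have : ε * farTp x₀ ε a ≤ lamL 1 ε * farTp x₀ ε a := by gcongr
    linarith

end Far

end PWLCanard

/-! ### Cycles with head. -/

namespace PWLCanard

/-- The orbit starts in the left zone and enters the middle zone through `x = -1`. -/
noncomputable def headData (s x₀ ε : ℝ) : LeftData :=
  ⟨s, ε, x₀, -1, farQ x₀ ε, farP x₀ ε, fun a => farTp x₀ ε a + farTq x₀ ε a⟩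

section Head

variable {s x₀ ε M : ℝ} (hx : x₀ < -1) (hM : 8 * (3 - x₀) ^ 2 ≤ M) (hMb : 2 ≤ M * (-1 - x₀))
  (hε : 0 < ε) (hsmall : 10 ^ 6 * M ^ 10 * √ε ≤ 1)

include hx hM in
theorem head_M_bounds : 100 ≤ M ∧ 10 * (3 - x₀) ≤ M := by
  constructor <;> nlinarith

include hx hM hε hsmall

theorem head_sqrt_bounds : √ε ≤ 1 / 10 ^ 6 ∧ 10 ^ 6 * (M * √ε) ≤ 1 ∧ M * ε ≤ 1 / 10 ^ 6 * √ε := by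
  obtain ⟨m1, m2⟩ := head_M_bounds hx hM
  have hσ := Real.sqrt_pos.2 hε
  have hMσ : 10 ^ 6 * (M * √ε) ≤ 1 := by
    refine le_trans ?_ hsmall
    have : M ≤ M ^ 10 := le_self_pow₀ (by linarith) (by norm_num)
    rw [mul_assoc]
    gcongr
  refine ⟨by nlinarith, hMσ, ?_⟩
  have := Real.mul_self_sqrt hε.le
  have h2 : 10 ^ 6 * (M * √ε) * √ε ≤ 1 * √ε := by gcongr
  have h3 : M * √ε * √ε = M * ε := by rw [mul_assoc, this]
  linarith

/-- `fastR (1 + a)` is `k + O(M √ε)`, and the arrival speed is `-1 - x₀` up to the same order. The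
distance from the fast eigenline is therefore governed by `k - (-1 - x₀)`. -/
theorem head_gap {k a : ℝ} (hk0 : 0 < k) (hk : 4 * ε < k ^ 2) (hkM : k ≤ M) (hMk : 1 ≤ M * k)
    (ha : |a| < √ε) :
    k - (-1 - x₀) - 40 * M * √ε ≤ fastR k ε * (a - -1) - farP x₀ ε a ∧
      fastR k ε * (a - -1) - farP x₀ ε a ≤ k - (-1 - x₀) + 3 * M * √ε := by
  obtain ⟨m1, m2⟩ := head_M_bounds hx hM
  obtain ⟨s1, s2, s3⟩ := head_sqrt_bounds hx hM hε hsmall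
  have hσ := Real.sqrt_pos.2 hε
  obtain ⟨p1, p2, -, -⟩ := farP_bounds hε hx s1 ha
  obtain ⟨f1, f2, f3⟩ := fastR_bounds hε hk0 hk
  have f4 := lamL_pos hε hk0
  have f5 := lamL_add_fastR k ε
  obtain ⟨a1, a2⟩ := abs_lt.1 ha
  have hl : lamL k ε ≤ 2 * M * ε := by
    calc lamL k ε ≤ lamL k ε * (M * k) := le_mul_of_one_le_right f4.le hMk
      _ = M * (lamL k ε * k) := by ring
      _ ≤ M * (2 * ε) := by gcongr
      _ = _ := by ring
  have hka : |k * a| ≤ M * √ε := by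
    rw [abs_mul, abs_of_pos hk0]; gcongr
  obtain ⟨k1, k2⟩ := abs_le.1 hka
  have hla : lamL k ε * (1 + a) ≤ 2 * M * ε * 2 := by apply mul_le_mul <;> linarith
  have hla0 : 0 < lamL k ε * (1 + a) := mul_pos f4 (by linarith)
  have e1 : fastR k ε * (a - -1) = k + k * a - lamL k ε * (1 + a) := by
    linear_combination (1 + a) * f5
  have hM0 : √ε ≤ M * √ε := le_mul_of_one_le_left hσ.le (by linarith)
  have e2 : 32 * √ε * (1 - x₀) ≤ 32 * √ε * M := by gcongr; linarith
  have e3 : ε * (-1 - x₀) ≤ ε * M := by gcongr; linarith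
  constructor <;> linarith

include hMb

theorem head_k {δ k : ℝ} (hδ : 88 * M * √ε ≤ δ) (hk : k ∈ Ioo (-1 - x₀ + δ / 2) (-1 - x₀ + 3)) :
    0 < k ∧ 4 * ε < k ^ 2 ∧ k ≤ M ∧ 1 ≤ M * k := by
  obtain ⟨m1, m2⟩ := head_M_bounds hx hM
  obtain ⟨s1, s2, s3⟩ := head_sqrt_bounds hx hM hε hsmall
  have hσ := Real.sqrt_pos.2 hε
  have hMσ : 0 < M * √ε := by positivity
  obtain ⟨k1, k2⟩ := hk
  have hk0 : 0 < k := by linarith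
  have h1 : M * (-1 - x₀) ≤ M * k := by gcongr; linarith
  refine ⟨hk0, ?_, by linarith, by linarith⟩
  have h2 : 10 ^ 6 * √ε < k := by
    have : M * (10 ^ 6 * √ε) < M * k := by linarith
    exact lt_of_mul_lt_mul_left this (by linarith)
  have h3 := Real.sq_sqrt hε.le
  nlinarith

theorem head_tame {δ : ℝ} (hs : s ^ 2 = 1)
    (htiny : exp (-(1 / (16 * M ^ 2 * ε))) ≤ ε ^ 8) (hδ : 88 * M * √ε ≤ δ) :
    (headData s x₀ ε).Tame M (Ioo (-1 - x₀ + δ / 2) (-1 - x₀ + 3)) := by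
  obtain ⟨m1, m2⟩ := head_M_bounds hx hM
  obtain ⟨s1, s2, s3⟩ := head_sqrt_bounds hx hM hε hsmall
  have hσ := Real.sqrt_pos.2 hε
  have hkk := fun {k : ℝ} => head_k hx hM hMb hε hsmall hδ (k := k)
  -- The constant `88` is used here: half of `88 M √ε` pays for the error `40 M √ε` of `head_gap`
  -- and the required gap `4 fastR √ε ≤ 4 M √ε`.
  have hgap : ∀ k ∈ Ioo (-1 - x₀ + δ / 2) (-1 - x₀ + 3), ∀ a, |a| < √ε →
      4 * fastR k ε * √ε ≤ fastR k ε * (a - -1) - farP x₀ ε a := by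
    intro k hk a ha
    obtain ⟨k1, k2, k3, k4⟩ := hkk hk
    have := (head_gap hx hM hε hsmall k1 k2 k3 k4 ha).1
    have h2 : fastR k ε * √ε ≤ M * √ε := by
      gcongr
      linarith [fastR_bounds hε k1 k2]
    linarith [hk.1]
  have hε6 : M * ε ≤ 1 / 10 ^ 12 := by linarith
  have hεM : ε ≤ M * ε := le_mul_of_one_le_left hε.le (by linarith)
  have hεle : ε ≤ 1 := by linarith
  constructor
  · constructor
    · exact isOpen_Ioo
    · exact hs
    · exact hε
    · change 4 * ε < 1
      linarith
    · exact fun k hk => (hkk hk).1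
    · exact fun k hk => (hkk hk).2.1
    · change -1 < -√ε
      linarith
    · exact le_rfl
    · exact fun a ha => (leg_farQ hε hx s1 ha).exit_pos.le
    · exact fun a ha => (leg_farP hε hx s1 ha).exit_pos.le
    · intro k hk a ha
      have h1 := hgap k hk a ha
      obtain ⟨k1, k2, k3, k4⟩ := hkk hk
      have h2 : 0 < fastR k ε * √ε := mul_pos (by linarith [fastR_bounds hε k1 k2]) hσ
      change farP x₀ ε a < fastR k ε * (a - -1)
      linarith
    · intro k hk a ha
      obtain ⟨k1, k2, k3, k4⟩ := hkk hk
      obtain ⟨h2, h3⟩ := abs_lt.1 ha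
      change -√ε < a at h2
      have h4 := expV_ge hε k1 k2 (by linarith : √ε + a < a - -1) (by linarith)
        (leg_farQ hε hx s1 ha).exit_pos.le
      have h5 := (fastR_bounds hε k1 k2).1
      have h6 : k / 2 * (1 / 2) ≤ fastR k ε * (a - -1 - (√ε + a)) := by
        apply mul_le_mul <;> linarith
      have h7 : M * (100 * ε) < M * k := by linarith
      have h8 := lt_of_mul_lt_mul_left h7 (by linarith)
      change 16 * ε < expV ε k (a - -1) (farQ x₀ ε a) (√ε + a)
      linarith
    · exact fun a ha => (smooth_far hε hx s1 ha).1
    · exact fun a ha => (smooth_far hε hx s1 ha).2.2.1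
    · exact fun a ha => (smooth_far hε hx s1 ha).2.2.2.add (smooth_far hε hx s1 ha).2.1
    · exact fun k hk a ha => ⟨_, upTo_refl.step hεle (leg_farQ hε hx s1 ha)
        (isZone_farLeft _ _ _ _) Icc_subset_Iic_self⟩
    · exact fun k hk a ha => ⟨_, downTo_refl.step hεle (leg_farP hε hx s1 ha)
        (isZone_farLeft _ _ _ _) Icc_subset_Iic_self⟩
  · linarith
  · exact hsmall
  · exact htiny
  · exact fun k hk => (hkk hk).2.2.2
  · exact fun k hk => (hkk hk).2.2.1
  · change 2 ≤ M * - -1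
    linarith
  · intro a ha
    change farQ x₀ ε a ≤ 1
    linarith [(farQ_bounds hε hx s1 ha).1]
  · intro a ha
    change farP x₀ ε a ≤ M
    have := (farP_bounds hε hx s1 ha).2.1
    have h2 : 32 * √ε * (1 - x₀) ≤ 1 * (1 - x₀) :=
      mul_le_mul_of_nonneg_right (by linarith) (by linarith)
    linarith
  · intro a ha
    change |farQ x₀ ε a * deriv (farQ x₀ ε) a| ≤ M
    linarith [(farQ_bounds hε hx s1 ha).2.1]
  · intro a ha
    change |farP x₀ ε a * deriv (farP x₀ ε) a| ≤ M
    have := (farP_bounds hε hx s1 ha).2.2.1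
    nlinarith
  · exact hgap

end Head

/-- The offset of the lower endpoint for `k` has to be much larger than the error `M σ` of the gap,
and yet close to `σ` in logarithmic scale. The exponent `1 - ρ`, with a small fixed `ρ > 0`,
achieves both once `ρ * -log σ` is large. -/
theorem rpow_bounds {b σ M : ℝ} (hσ : 0 < σ) (s1 : σ ≤ 1 / 10 ^ 6) (hM : 1 ≤ M)
    (hbM : b ^ 2 + 1 ≤ M) (hΛ : 200 * M ^ 3 ≤ -log σ) :
    88 * M * σ ≤ σ ^ (1 - 1 / (2 * (b ^ 2 + 1))) ∧ σ ^ (1 - 1 / (2 * (b ^ 2 + 1))) ≤ 1 / 4 := by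
  set ρ := 1 / (2 * (b ^ 2 + 1)) with hρ
  have hρ0 : 0 < ρ := by positivity
  have hρ1 : ρ ≤ 1 / 2 := by
    rw [hρ, div_le_div_iff₀ (by positivity) (by norm_num)]
    linarith [sq_nonneg b]
  have hρM : 1 ≤ 2 * M * ρ := by
    rw [hρ, mul_one_div, one_le_div (by positivity)]
    linarith
  set δ := σ ^ (1 - ρ) with hδdef
  have hδ0 : 0 < δ := Real.rpow_pos_of_pos hσ _
  constructor
  · have e1 : δ * σ ^ ρ = σ := by
      rw [hδdef, ← Real.rpow_add hσ, sub_add_cancel, Real.rpow_one]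
    have e3 : 88 * M ≤ ρ * -log σ := by
      calc 88 * M ≤ 100 * M ^ 2 * 1 := by
            have : M ≤ M ^ 2 := le_self_pow₀ hM (by norm_num)
            linarith
        _ ≤ 100 * M ^ 2 * (2 * M * ρ) := by gcongr
        _ = ρ * (200 * M ^ 3) := by ring
        _ ≤ ρ * -log σ := by gcongr
    have e2 : 88 * M * σ ^ ρ ≤ 1 := by
      have e4 := Real.add_one_le_exp (ρ * -log σ)
      have e5 : exp (log σ * ρ) = (exp (ρ * -log σ))⁻¹ := by
        rw [← Real.exp_neg]; congr 1; ring
      rw [Real.rpow_def_of_pos hσ, e5, ← div_eq_mul_inv, div_le_one (exp_pos _)]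
      linarith
    calc 88 * M * σ = δ * (88 * M * σ ^ ρ) := by nth_rewrite 1 [← e1]; ring
      _ ≤ δ * 1 := by gcongr
      _ = δ := mul_one _
  · refine (Real.rpow_le_rpow_of_exponent_ge hσ (by linarith)
      (by linarith : (1 / 2 : ℝ) ≤ 1 - ρ)).trans ?_
    rw [← Real.sqrt_eq_rpow, Real.sqrt_le_left (by norm_num)]
    linarith

/-- With `b = -1 - x₀`, at `k = b + δ` the gap is a power of `√ε` and `J > 0`, while at `k = b + 2`
the gap is bounded below and `J < 0`. Tameness holds on a slightly larger interval, on which the gap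
never falls below the order `√ε`. -/
theorem eventually_head {s x₀ : ℝ} (hs : s ^ 2 = 1) (hx : x₀ < -1) :
    ∀ᶠ ε : ℝ in 𝓝[>] 0, ∃ k, 0 < k ∧ 4 * ε < k ^ 2 ∧ ∃ a, IsHatA k ε x₀ (s * √ε) a ∧
      (x₀ ∈ Ioo (xr a k ε) (xu a ε) ∪ Ioo (-1) (xs a k ε)) ∧
      ∃ Γ, IsCanardCycle a k (s * √ε) ε x₀ Γ ∧ IsSaddleNode a k (s * √ε) ε Γ := by
  set b := -1 - x₀ with hb
  have hb0 : 0 < b := by linarith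
  set M := 8 * (3 - x₀) ^ 2 + 2 / b with hMdef
  have hMb0 : 0 < 2 / b := by positivity
  have hM : 8 * (3 - x₀) ^ 2 ≤ M := by linarith
  have hMb : 2 ≤ M * b := by
    have : 2 / b * b = 2 := div_mul_cancel₀ _ hb0.ne'
    rw [hMdef, add_mul, this]
    have : 0 ≤ 8 * (3 - x₀) ^ 2 * b := by positivity
    linarith
  obtain ⟨m1, m2⟩ := head_M_bounds hx hM
  filter_upwards [eventually_small M (by linarith)] with ε hε
  obtain ⟨hε, -, hsmall, htiny, hΛ⟩ := hε
  obtain ⟨s1, s2, s3⟩ := head_sqrt_bounds hx hM hε hsmall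
  have hσ := Real.sqrt_pos.2 hε
  have hMσ : 0 < M * √ε := by positivity
  have hbM : b ^ 2 + 1 ≤ M := by nlinarith
  set ρ := 1 / (2 * (b ^ 2 + 1)) with hρ
  set δ := √ε ^ (1 - ρ)
  obtain ⟨hδ, hδ4⟩ : 88 * M * √ε ≤ δ ∧ δ ≤ 1 / 4 := rpow_bounds hσ s1 (by linarith) hbM hΛ
  have hδ0 : 0 < δ := by linarith
  have h := head_tame (s := s) hx hM hMb hε hsmall hs htiny hδ
  have hkk := fun {k : ℝ} => head_k hx hM hMb hε hsmall hδ (k := k)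
  have hk₁ : b + δ ∈ Ioo (b + δ / 2) (b + 3) := ⟨by linarith, by linarith⟩
  have hk₂ : b + 2 ∈ Ioo (b + δ / 2) (b + 3) := ⟨by linarith, by linarith⟩
  have hσ' : ∀ {a}, |a| ≤ 9 / 10 * √ε → |a| < √ε := fun ha => by linarith
  have hsub : Icc (b + δ) (b + 2) ⊆ Ioo (b + δ / 2) (b + 3) :=
    fun k hk => ⟨hk₁.1.trans_le hk.1, hk.2.trans_lt hk₂.2⟩
  obtain ⟨k, hk, a, ha, hhat, hcyc⟩ := h.exists_saddleNode (k₁ := b + δ) (k₂ := b + 2)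
    (by linarith) hsub (by change x₀ < -√ε; linarith)
    (fun k hk a ha => by
      obtain ⟨k1, k2, k3, k4⟩ := hkk hk
      obtain ⟨b1, b2⟩ := abs_lt.1 ha
      change -√ε < a at b1
      change a < √ε at b2
      obtain ⟨-, -, h3⟩ := fastR_bounds hε k1 k2
      have h4 := lamL_pos hε k1
      have h5 : lamL k ε ≤ 1 := by
        have : lamL k ε * 1 ≤ lamL k ε * (M * k) := by gcongr
        have : M * (lamL k ε * k) ≤ M * (2 * ε) := by gcongr
        linarith
      have h6 : lamL k ε * (√ε + a) ≤ 1 * (√ε + a) := by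
        gcongr
        linarith
      have h7 : 0 < lamL k ε * (√ε + a) := mul_pos h4 (by linarith)
      constructor
      · change -(1 + k) + k * √ε - lamL k ε * (√ε + a) < x₀
        have : k * √ε ≤ M * √ε := by gcongr
        linarith [hk.1]
      · change x₀ < -√ε - lamL k ε * (√ε + a)
        linarith)
    (fun a ha hD => by
      obtain ⟨k1, k2, k3, k4⟩ := hkk hk₁
      have ha' := hσ' ha
      -- The choice `ρ = 1 / (2 (b² + 1))` makes `k² (1 - θ) = (b + δ)² ρ` at most `3 / 4`,
      -- uniformly in `b`.
      refine h.J_pos_of_close (θ := 1 - ρ) hk₁ ha ?_ hD hΛ ?_ ?_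
      · exact mul_nonneg hε.le (add_nonneg (leg_farP hε hx s1 ha').pos.le
          (leg_farQ hε hx s1 ha').pos.le)
      · rw [sub_sub_cancel, hρ, mul_one_div, div_le_iff₀ (by positivity)]
        have g1 : 0 ≤ δ * (b - 1) ^ 2 := by positivity
        have g2 : δ ^ 2 ≤ 1 / 4 * (1 / 4) := by rw [pow_two]; gcongr
        have g3 : δ * b ^ 2 ≤ 1 / 4 * b ^ 2 := by gcongr
        linarith [sq_nonneg b]
      · have := (head_gap hx hM hε hsmall k1 k2 k3 k4 ha').2
        change fastR (b + δ) ε * (a - -1) - farP x₀ ε a ≤ M * δ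
        have : 2 * δ ≤ M * δ := by gcongr; linarith
        linarith)
    (fun a ha hD => by
      obtain ⟨k1, k2, k3, k4⟩ := hkk hk₂
      have ha' := hσ' ha
      refine h.J_neg_of_two_le hk₂ ha ?_ hD hΛ (by linarith) ?_
      · change ε * (farTp x₀ ε a + farTq x₀ ε a) ≤ M
        linarith [(farP_bounds hε hx s1 ha').2.2.2, (farQ_bounds hε hx s1 ha').2.2]
      · have := (head_gap hx hM hε hsmall k1 k2 k3 k4 ha').1
        change 1 ≤ M * (fastR (b + 2) ε * (a - -1) - farP x₀ ε a)
        have h1 : 1 ≤ fastR (b + 2) ε * (a - -1) - farP x₀ ε a := by linarith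
        exact one_le_mul_of_one_le_of_one_le (by linarith) h1)
    (fun k hk a ha hD hJ => by
      have ha' := hσ' ha
      have l1 := leg_farP hε hx s1 ha'
      have l2 := leg_farQ hε hx s1 ha'
      have hk4 := (le_of_sqrt_le hε s1).2
      exact h.saddleNode_of_head (hsub hk) ha rfl l1 l2
        (nodeS_pos (neg_injective.ne (lamL_lt_fastR hk4).ne) (add_pos l1.pos l2.pos)) rfl hD hJ)
  obtain ⟨k1, k2, -, -⟩ := hkk hk
  refine ⟨k, k1, k2, a, hhat, Or.inl ⟨?_, ?_⟩, hcyc⟩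
  · obtain ⟨Γ, hΓ, -⟩ := hcyc
    exact hΓ.2.2.1
  · have hk4 := (le_of_sqrt_le hε s1).2
    have f1 := (fastR_bounds hε one_pos hk4).2.2
    have f2 := lamL_pos hε one_pos
    obtain ⟨b1, b2⟩ := abs_lt.1 ha
    change a < √ε at b2
    -- Thus `xu` differs from `-1` by `O(ε)`, and the fixed number `x₀ < -1` lies to its left for
    -- small `ε`.
    have e1 : lamLL ε = -lamL 1 ε := by unfold lamLL lamL; rw [one_pow]; ring
    have e2 : lamL 1 ε * (1 + a) ≤ lamL 1 ε * 2 := by gcongr; linarith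
    have e3 : 4 * ε < b := by
      have : M * (4 * ε) < M * b := by linarith
      exact lt_of_mul_lt_mul_left this (by linarith)
    change x₀ < -1 + lamLL ε * (1 + a)
    rw [e1]
    linarith

end PWLCanard

/-! ### Choice of the function `k`. -/

theorem theorem6 (s : ℝ) (hs : s = -1 ∨ s = 1) (x₀ : ℝ)
    (hx₀ : x₀ ∈ Set.Iio (-1 : ℝ) ∪ Set.Ioo (-1 : ℝ) 0) :
    ∃ ε₀ : ℝ, 0 < ε₀ ∧ ε₀ ≤ 1 / 4 ∧ ∃ k : ℝ → ℝ, ∀ ε ∈ Set.Ioo (0 : ℝ) ε₀,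
      0 < k ε ∧ 4 * ε < k ε ^ 2 ∧
      ∃ a : ℝ, PWLCanard.IsHatA (k ε) ε x₀ (s * √ε) a ∧
        x₀ ∈ Set.Ioo (PWLCanard.xr a (k ε) ε) (PWLCanard.xu a ε) ∪
          Set.Ioo (-1) (PWLCanard.xs a (k ε) ε) ∧
        ∃ Γ : Set (ℝ × ℝ), PWLCanard.IsCanardCycle a (k ε) (s * √ε) ε x₀ Γ ∧
          PWLCanard.IsSaddleNode a (k ε) (s * √ε) ε Γ := by
  have hs2 : s ^ 2 = 1 := by rcases hs with rfl | rfl <;> norm_num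
  have hev := hx₀.elim (PWLCanard.eventually_head hs2) (PWLCanard.eventually_headless hs2)
  obtain ⟨ε₁, hε₁, hsub⟩ := mem_nhdsGT_iff_exists_Ioo_subset.1 hev
  refine ⟨min ε₁ (1 / 4), lt_min hε₁ (by norm_num), min_le_right _ _, ?_⟩
  -- Outside the interval of admissible `ε` the value is irrelevant and set to `0`. The implication
  -- is built into the existence statement so that `choose` yields a total function.
  have hex : ∀ ε : ℝ, ∃ k, ε ∈ Set.Ioo 0 (min ε₁ (1 / 4)) → 0 < k ∧ 4 * ε < k ^ 2 ∧
      ∃ a : ℝ, PWLCanard.IsHatA k ε x₀ (s * √ε) a ∧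
        x₀ ∈ Set.Ioo (PWLCanard.xr a k ε) (PWLCanard.xu a ε) ∪
          Set.Ioo (-1) (PWLCanard.xs a k ε) ∧
        ∃ Γ : Set (ℝ × ℝ), PWLCanard.IsCanardCycle a k (s * √ε) ε x₀ Γ ∧
          PWLCanard.IsSaddleNode a k (s * √ε) ε Γ := by
    intro ε
    by_cases hε : ε ∈ Set.Ioo 0 (min ε₁ (1 / 4))
    · obtain ⟨k, hk⟩ := hsub ⟨hε.1, hε.2.trans_le (min_le_left _ _)⟩
      exact ⟨k, fun _ => hk⟩
    · exact ⟨0, fun h => absurd h hε⟩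
  choose k hk using hex
  exact ⟨k, fun ε hε => hk ε hε⟩
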